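/- **Conventions.** Graphs are finite and simple. For $k\ge 3$, $SC_k$ is the class of connected non-empty graphs in which every induced cycle has length $k$ (forests allowed, i.e. trees belong to every $SC_k$). For a graph $G$ and $S\subseteq V(G)$: $S$ is an *odd cycle transversal* (OCT) if $G\setminus S$ is bipartite, an *even cycle transversal* (ECT) if every induced cycle of $G\setminus S$ is odd, and a *feedback vertex set* (FVS) if $G\setminus S$ is a forest. "Minimum" means of minimum cardinality. *Pendant elements.* In a graph $H$, a *pendant vertex* is a vertex of degree $1$. A *pendant cycle* is an induced cycle $C=u_0u_1\dots u_{k-1}$ of $H$ together with attachment vertices $u=u_0$ and $v=u_q$ of degree at least $3$ in $H$, all other vertices of $C$ having degree $2$ in $H$, where $q=0$ (one attachment vertex: a 0- or 1-pendant cycle), or $q=1$ (adjacent attachment vertices: a 2-pendant cycle), or $k$ is even and $q=k/2$ (antipodal attachment vertices: a $(\frac k2+1)$-pendant cycle). Its *ear* is $\{u_{q+1},\dots,u_{k-1}\}$. *Vertex cycle orderings.* A VCO of $H$ is a sequence $\mu=(x_1,\dots,x_s)$ of vertex sets such that either $s=1$, $x_1=V(H)$ and $H$ is a single vertex or a cycle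 $C_k$; or $s\ge2$ and either $x_1=\{x\}$ for a pendant vertex $x$ of $H$ and $(x_2,\dots,x_s)$ is a VCO of $H\setminus x$, or $x_1$ is the vertex set of a pendant cycle of $H$ and $(x_2,\dots,x_s)$ is a VCO of $H$ minus the ear of this cycle. *The recursion.* For an induced subgraph $H$ of a graph in $SC_k$ let $R(H)$ be computed as follows. - $R(H)=\emptyset$ if $H$ is empty or a single vertex; $R(H)=\{w\}$ for an arbitrary vertex $w$ if $H=C_k$. - If $H$ is disconnected, $R(H)=R(H_1)\cup R(H_2)$, where $H$ is the disjoint union of the non-empty graphs $H_1,H_2$ with no edge between them. - Otherwise choose any VCO of $H$, with first element $x_1$. If $x_1=\{x\}$ is a pendant vertex, $R(H)=R(H\setminus x)$. If $x_1$ is a 0- or 1-pendant cycle with attachment vertex $u$, $R(H)=\{u\}\cup R(H\setminus x_1)$. If $x_1$ is a 2-pendant or $(\frac k2+1)$-pendant cycle with attachment vertices $u\ne v$, $R(H)$ is one of minimum cardinality among $\{u\}\cup R(H\setminus(x_1\setminus\{v\}))$ and $\{v\}\cup R(H\setminus(x_1\setminus\{u\}))$. All choices (of VCOs and components, of $w$,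 and in ties) are free. Put $OCT(G)=R(G)$ if $k$ is odd and $OCT(G)=\emptyset$ if $k$ is even; $ECT(G)=R(G)$ if $k$ is even and $ECT(G)=\emptyset$ if $k$ is odd. A *value* of $OCT(G)$ (of $ECT(G)$) is any set that can result. **Theorem.** Let $k\ge5$ and $G\in SC_k$. 1. $OCT(G)$ has a value, and every value of $OCT(G)$ is a minimum odd cycle transversal of $G$. 2. $ECT(G)$ has a value, and every value of $ECT(G)$ is a minimum even cycle transversal of $G$. 3. If $k$ is odd, a set is an FVS of $G$ if and only if it is an OCT of $G$; if $k$ is even, if and only if it is an ECT of $G$. 4. There are polynomial-time algorithms which, given $k\ge5$ and $G\in SC_k$, compute a value of $OCT(G)$, a value of $ECT(G)$, and a minimum FVS of $G$, respectively. (Time is the number of steps of a random access machine with addition and truncated subtraction, indirect addressing and zero tests at unit cost, and it is bounded by a polynomial in $|V(G)|$ not depending on $k$; the input is $|V(G)|$, $k$ and the adjacency matrix of $G$.) -/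

import Mathlib

open SimpleGraph

/-- `G` is cycle-free or all its induced cycles have length `k`. -/
def IsSC {V : Type*} (k : ℕ) (G : SimpleGraph V) : Prop :=
  ∀ m : ℕ, 3 ≤ m → Nonempty (cycleGraph m ↪g G) → m = k

/-- Odd cycle transversal: deleting `S` leaves a bipartite graph. -/
def IsOCT {V : Type*} (G : SimpleGraph V) (S : Set V) : Prop :=
  (G.induce Sᶜ).IsBipartite

/-- Even cycle transversal: deleting `S` leaves a graph all of whose induced cycles are odd. -/
def IsECT {V : Type*} (G : SimpleGraph V) (S : Set V) : Prop :=
  ∀ m : ℕ, 3 ≤ m → Nonempty (cycleGraph m ↪g G.induce Sᶜ) → Odd m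

/-- Feedback vertex set: deleting `S` leaves a forest. -/
def IsFVS {V : Type*} (G : SimpleGraph V) (S : Set V) : Prop :=
  (G.induce Sᶜ).IsAcyclic

/-- `S` has the property `P` and minimum cardinality among the sets with this property. -/
def IsMinCard {V : Type*} (P : Set V → Prop) (S : Set V) : Prop :=
  P S ∧ ∀ T : Set V, P T → S.ncard ≤ T.ncard

/-- The degree of `v` in the subgraph of `G` induced on `A` (for `v ∈ A`). -/
noncomputable def degIn {V : Type*} (G : SimpleGraph V) (A : Set V) (v : V) : ℕ :=
  {w : V | w ∈ A ∧ G.Adj v w}.ncard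

/-- `x` is a pendant vertex of the subgraph induced on `A`. -/
def IsPendantVertex {V : Type*} (G : SimpleGraph V) (A : Set V) (x : V) : Prop :=
  x ∈ A ∧ degIn G A x = 1

/-- The induced cycle `c` is a pendant cycle of the subgraph induced on `A`, attached to the rest
at `c p` and `c q`: these have degree at least three, all other vertices of `c` have degree two.
The cycle is numbered from `p = 0`. The case `q = 0` (one attachment vertex) is that of a 0- or
1-pendant cycle, `q = 1` (adjacent attachment vertices) that of a 2-pendant cycle, and `q = k / 2`,
`k` even (antipodal attachment vertices), that of a `(k / 2 + 1)`-pendant cycle. -/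
structure IsPendantCycle {V : Type*} {k : ℕ} (G : SimpleGraph V) (A : Set V)
    (c : cycleGraph k ↪g G) (p q : Fin k) : Prop where
  subset : Set.range c ⊆ A
  start : p.val = 0
  kind : q.val = 0 ∨ q.val = 1 ∨ (Even k ∧ q.val = k / 2)
  deg_left : 3 ≤ degIn G A (c p)
  deg_right : 3 ≤ degIn G A (c q)
  deg_other : ∀ i : Fin k, i ≠ p → i ≠ q → degIn G A (c i) = 2

/-- `IsVCO k G A μ`: the list `μ` of labels is a vertex cycle ordering of the subgraph of `G`
induced on `A`. It ends with a single vertex or a `k`-cycle; every earlier label is a pendant vertex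
or (the vertex set of) a pendant cycle of the current graph, and going on to the next label removes
the pendant vertex, or the ear formed by the vertices of the cycle numbered above `q`
(the rest of the cycle, i.e. the path from `c 0` to `c q` along which it is glued, stays). -/
inductive IsVCO {V : Type*} (k : ℕ) (G : SimpleGraph V) : Set V → List (Set V) → Prop
  | single (x : V) : IsVCO k G {x} [{x}]
  | cycle (c : cycleGraph k ↪g G) : IsVCO k G (Set.range c) [Set.range c]
  | pendantVertex {A : Set V} {x : V} {μ : List (Set V)} (hx : IsPendantVertex G A x)
      (h : IsVCO k G (A \ {x}) μ) : IsVCO k G A ({x} :: μ)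
  | pendantCycle {A : Set V} {c : cycleGraph k ↪g G} {p q : Fin k} {μ : List (Set V)}
      (hc : IsPendantCycle G A c p q)
      (h : IsVCO k G (A \ c '' {i | q < i}) μ) : IsVCO k G A (Set.range c :: μ)

/-- The recursion for cycle transversals along vertex cycle orderings: `CycleHitRec k G A S` says
that `S` is a value of the recursion on the subgraph of `G` induced on `A`. At every stage any
vertex cycle ordering of the current graph may be used, and ties in `min` may be broken either way.
The label of the first element is deleted, except that, when there are two attachment vertices, the
one that is not picked stays, being part of the rest of the graph. A disconnected graph, which such
a deletion may produce, is treated componentwise. -/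
inductive CycleHitRec {V : Type*} (k : ℕ) (G : SimpleGraph V) : Set V → Set V → Prop
  | empty : CycleHitRec k G ∅ ∅
  | single (x : V) : CycleHitRec k G {x} ∅
  | cycle (c : cycleGraph k ↪g G) (i : Fin k) : CycleHitRec k G (Set.range c) {c i}
  | components {A B S T : Set V} (hA : A.Nonempty) (hB : B.Nonempty) (hAB : Disjoint A B)
      (hadj : ∀ a ∈ A, ∀ b ∈ B, ¬ G.Adj a b)
      (hS : CycleHitRec k G A S) (hT : CycleHitRec k G B T) : CycleHitRec k G (A ∪ B) (S ∪ T)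
  | pendantVertex {A S : Set V} {x : V} {μ : List (Set V)}
      (hμ : IsVCO k G A ({x} :: μ)) (hx : IsPendantVertex G A x)
      (hS : CycleHitRec k G (A \ {x}) S) : CycleHitRec k G A S
  | oneAttachment {A S : Set V} {c : cycleGraph k ↪g G} {p : Fin k} {μ : List (Set V)}
      (hμ : IsVCO k G A (Set.range c :: μ)) (hc : IsPendantCycle G A c p p)
      (hS : CycleHitRec k G (A \ Set.range c) S) : CycleHitRec k G A ({c p} ∪ S)
  | twoAttachmentsLeft {A S T : Set V} {c : cycleGraph k ↪g G} {p q : Fin k} {μ : List (Set V)}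
      (hμ : IsVCO k G A (Set.range c :: μ)) (hpq : p ≠ q) (hc : IsPendantCycle G A c p q)
      (hS : CycleHitRec k G (A \ (Set.range c \ {c q})) S)
      (hT : CycleHitRec k G (A \ (Set.range c \ {c p})) T)
      (hle : ({c p} ∪ S).ncard ≤ ({c q} ∪ T).ncard) : CycleHitRec k G A ({c p} ∪ S)
  | twoAttachmentsRight {A S T : Set V} {c : cycleGraph k ↪g G} {p q : Fin k} {μ : List (Set V)}
      (hμ : IsVCO k G A (Set.range c :: μ)) (hpq : p ≠ q) (hc : IsPendantCycle G A c p q)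
      (hS : CycleHitRec k G (A \ (Set.range c \ {c q})) S)
      (hT : CycleHitRec k G (A \ (Set.range c \ {c p})) T)
      (hle : ({c q} ∪ T).ncard ≤ ({c p} ∪ S).ncard) : CycleHitRec k G A ({c q} ∪ T)

/-- `S` is a value of `OCT(G)`: empty for even `k`, given by the recursion for odd `k` (where there
are no `(k / 2 + 1)`-pendant cycles). -/
def OCTValue {V : Type*} (k : ℕ) (G : SimpleGraph V) (S : Set V) : Prop :=
  (Odd k ∧ CycleHitRec k G Set.univ S) ∨ (Even k ∧ S = ∅)

/-- `S` is a value of `ECT(G)`: empty for odd `k`, given by the recursion for even `k`. -/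
def ECTValue {V : Type*} (k : ℕ) (G : SimpleGraph V) (S : Set V) : Prop :=
  (Even k ∧ CycleHitRec k G Set.univ S) ∨ (Odd k ∧ S = ∅)

/-- The state of a random access machine: registers and memory cells holding natural numbers. -/
structure RAMState where
  reg : ℕ → ℕ
  mem : ℕ → ℕ

/-- Write `x` to register `r`. -/
def RAMState.setReg (σ : RAMState) (r x : ℕ) : RAMState :=
  { σ with reg := Function.update σ.reg r x }

/-- Write `x` to memory cell `a`. -/
def RAMState.setMem (σ : RAMState) (a x : ℕ) : RAMState :=
  { σ with mem := Function.update σ.mem a x }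

/-- Programs of a random access machine with addition and truncated subtraction, in structured
form. The arguments of the instructions are constants and numbers of registers. -/
inductive RAMProg where
  | const (r x : ℕ)
  | add (r a b : ℕ)
  | sub (r a b : ℕ)
  | load (r a : ℕ)
  | store (a r : ℕ)
  | seq (P Q : RAMProg)
  | ite (r : ℕ) (P Q : RAMProg)
  | loop (r : ℕ) (P : RAMProg)

/-- `P.Runs σ τ t`: the program `P`, started in the state `σ`, halts in the state `τ` after `t`
steps. Every executed instruction and every executed test counts as one step. Multiplication is not
an instruction, so that this unit cost measure is polynomially equivalent to Turing machine time. -/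
inductive RAMProg.Runs : RAMProg → RAMState → RAMState → ℕ → Prop
  | const (σ : RAMState) (r x : ℕ) : Runs (.const r x) σ (σ.setReg r x) 1
  | add (σ : RAMState) (r a b : ℕ) : Runs (.add r a b) σ (σ.setReg r (σ.reg a + σ.reg b)) 1
  | sub (σ : RAMState) (r a b : ℕ) : Runs (.sub r a b) σ (σ.setReg r (σ.reg a - σ.reg b)) 1
  | load (σ : RAMState) (r a : ℕ) : Runs (.load r a) σ (σ.setReg r (σ.mem (σ.reg a))) 1
  | store (σ : RAMState) (a r : ℕ) : Runs (.store a r) σ (σ.setMem (σ.reg a) (σ.reg r)) 1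
  | seq {P Q : RAMProg} {σ τ υ : RAMState} {s t : ℕ} (h₁ : Runs P σ τ s) (h₂ : Runs Q τ υ t) :
      Runs (.seq P Q) σ υ (s + t)
  | iteTrue {r : ℕ} {P Q : RAMProg} {σ τ : RAMState} {t : ℕ} (hr : σ.reg r ≠ 0)
      (h : Runs P σ τ t) : Runs (.ite r P Q) σ τ (t + 1)
  | iteFalse {r : ℕ} {P Q : RAMProg} {σ τ : RAMState} {t : ℕ} (hr : σ.reg r = 0)
      (h : Runs Q σ τ t) : Runs (.ite r P Q) σ τ (t + 1)
  | loopDone {r : ℕ} {P : RAMProg} {σ : RAMState} (hr : σ.reg r = 0) : Runs (.loop r P) σ σ 1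
  | loopStep {r : ℕ} {P : RAMProg} {σ τ υ : RAMState} {s t : ℕ} (hr : σ.reg r ≠ 0)
      (h₁ : Runs P σ τ s) (h₂ : Runs (.loop r P) τ υ t) : Runs (.loop r P) σ υ (s + t + 1)

open Classical in
/-- The input for a graph `G` on `n` vertices: `n` in register 0, `k` in register 1, and the
adjacency matrix of `G` row by row in memory. -/
noncomputable def inputState (k : ℕ) {n : ℕ} (G : SimpleGraph (Fin n)) : RAMState where
  reg r := if r = 0 then n else if r = 1 then k else 0
  mem a := if ∃ i j : Fin n, a = i.val * n + j.val ∧ G.Adj i j then 1 else 0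

/-- The output: the set of those vertices `v` for which memory cell `v` is nonzero. -/
def outputSet (n : ℕ) (σ : RAMState) : Set (Fin n) :=
  {v | σ.mem v.val ≠ 0}

/-- There is one program which, for all `k ≥ 5` and all connected graphs `G` in the class `SC_k`,
finds a vertex set related to `G` by `Q`, in a number of steps polynomial in the number of vertices
of `G`. -/
def PolyTimeOnSC (Q : (k n : ℕ) → SimpleGraph (Fin n) → Set (Fin n) → Prop) : Prop :=
  ∃ (P : RAMProg) (f : Polynomial ℕ), ∀ (k n : ℕ) (G : SimpleGraph (Fin n)),
    5 ≤ k → G.Connected → IsSC k G →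
      ∃ (σ : RAMState) (t : ℕ), P.Runs (inputState k G) σ t ∧ t ≤ f.eval n ∧
        Q k n G (outputSet n σ)

/-!
Let all induced cycles of `G` have length `k ≥ 5`.

**Transversals.** A finite graph has a cycle exactly if it has a nonempty vertex set of minimum
degree two, so that `S` hits all cycles in `A` if and only if the largest such subset of `A \ S`,
its core, is empty. Everything rests on `exists_niceCyc`: a nonempty set `A` of minimum degree two
contains a `k`-cycle whose vertices have degree two in `A`, with the exception of one or two
vertices, which are equal, adjacent or antipodal. Indeed, comparing the lengths of cycles shows that
a vertex outside a `k`-cycle has at most one neighbour on it and that a connected set outside the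
cycle with two attachments has them at adjacent or antipodal positions; three attachments are
impossible (`not_three_att`). If `K` is a largest component of the complement of a cycle in `A`, over
all choices of the cycle, the attachments of `K` are among those of any other component
(`att_subset_of_maximal`). So either `K` has two attachments, and the cycle is as desired, or
`A \ K` is a smaller set to which induction applies; a root vertex is carried along, which may count
as an attachment vertex.

Pendant cycles yield vertex cycle orderings (`exists_isVCO`) and values of the recursion
(`exists_cycleHitRec`). A transversal meeting a pendant cycle elsewhere can be changed so as to meet
it at an attachment vertex, which shows that all values are smallest transversals
(`CycleHitRec.isOpt`). As all induced cycles have the same length, feedback vertex sets are the same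
as odd cycle transversals for odd `k`, and the same as even cycle transversals for even `k`.

**Polynomial time.** The recursion itself branches. To avoid this, let `τ(A)` be the smallest size of
a set hitting all cycles in `A`. At a pendant cycle of `A` some attachment vertex `u` satisfies
`τ(A \ {u}) < τ(A)`, and each such `u` may be chosen by the recursion (`NiceCyc.exists_ends_lt`,
`NiceCyc.value_insert`). The number `τ(A)` is found by dynamic programming: pendant cycles show that
the graph has treewidth at most two (`good_of_isSC`), i.e. that one can always eliminate a vertex
with at most two neighbours, which are then joined. Tables record, for each pair of vertices, the
cost of deleting none, one or both of them, and in the first case whether or not they are connected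
through the eliminated part; since the kept part has to be a forest, this information is sufficient
(`Elim.Inv.next`, `Elim.Inv.final`). Pendant cycles are found by trying all pairs `u`, `v`: one looks
for a cycle through `u` and `v` whose other vertices have degree two, and compares the distance of
`u` and `v` with `k / 2` (`CycleHitRec.of_attached`, `exists_attached`). This algorithm is written in
a small language of programs over square arrays, all of which run in polynomial time on the random
access machine (`polyTimeOnSC_of_cmd`).
-/

/-! ### Sets of minimum degree two and induced cycles -/

/-- Every vertex of `B` has at least two neighbours in `B`. The empty set has this property. -/
def MinDegTwo {V : Type*} (G : SimpleGraph V) (B : Set V) : Prop :=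
  ∀ v ∈ B, ∃ x ∈ B, ∃ y ∈ B, x ≠ y ∧ G.Adj v x ∧ G.Adj v y

/-- The first `L` values of `f` run once around an induced cycle of length `L`. -/
def IndCyc {V : Type*} (G : SimpleGraph V) (L : ℕ) (f : ℕ → V) : Prop :=
  ∀ i j, i < j → j < L → f i ≠ f j ∧ (G.Adj (f i) (f j) ↔ j = i + 1 ∨ (i = 0 ∧ j + 1 = L))

/-- The vertex set of the cycle given by `f`. -/
def cyc {V : Type*} (k : ℕ) (f : ℕ → V) : Set V := f '' {i | i < k}

/-- The closed sequence `f` of length `k`, started at position `r`. -/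
def rot {V : Type*} (k : ℕ) (f : ℕ → V) (r : ℕ) : ℕ → V :=
  fun i => if i + r < k then f (i + r) else f (i + r - k)

section Basics

variable {V : Type*} {G : SimpleGraph V}

lemma mem_cyc {k : ℕ} {f : ℕ → V} {x : V} : x ∈ cyc k f ↔ ∃ i < k, f i = x := by
  simp [cyc]

lemma MinDegTwo.sUnion {𝒮 : Set (Set V)} (h : ∀ B ∈ 𝒮, MinDegTwo G B) : MinDegTwo G (⋃₀ 𝒮) := by
  rintro v ⟨B, hB, hv⟩
  obtain ⟨x, hx, y, hy, h'⟩ := h B hB v hv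
  exact ⟨x, ⟨B, hB, hx⟩, y, ⟨B, hB, hy⟩, h'⟩

lemma IndCyc.inj {L : ℕ} {f : ℕ → V} (h : IndCyc G L f) {i j : ℕ} (hi : i < L) (hj : j < L)
    (hij : f i = f j) : i = j := by
  rcases lt_trichotomy i j with h1 | h1 | h1
  · exact absurd hij (h i j h1 hj).1
  · exact h1
  · exact absurd hij.symm (h j i h1 hi).1

lemma IndCyc.adj_iff {L : ℕ} {f : ℕ → V} (h : IndCyc G L f) {i j : ℕ} (hi : i < L) (hj : j < L) :
    G.Adj (f i) (f j) ↔ i ≠ j ∧ (j = i + 1 ∨ i = j + 1 ∨ (i = 0 ∧ j + 1 = L) ∨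
      (j = 0 ∧ i + 1 = L)) := by
  rcases lt_trichotomy i j with h1 | h1 | h1
  · rw [(h i j h1 hj).2]; omega
  · subst h1; simp
  · rw [G.adj_comm, (h j i h1 hi).2]; omega

lemma IndCyc.rotate {L : ℕ} {f : ℕ → V} (h : IndCyc G L f) {r : ℕ} (hr : r < L) :
    IndCyc G L (rot L f r) := by
  intro i j hij hj
  unfold rot
  have key : ∀ a b, a < L → b < L → a ≠ b → f a ≠ f b ∧ (G.Adj (f a) (f b) ↔ a ≠ b ∧
      (b = a + 1 ∨ a = b + 1 ∨ (a = 0 ∧ b + 1 = L) ∨ (b = 0 ∧ a + 1 = L))) :=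
    fun a b ha hb hab => ⟨fun e => hab (h.inj ha hb e), h.adj_iff ha hb⟩
  split_ifs with h1 h2 h2
  · have := key (i + r) (j + r) (by omega) (by omega) (by omega)
    refine ⟨this.1, this.2.trans (by omega)⟩
  · have := key (i + r) (j + r - L) (by omega) (by omega) (by omega)
    refine ⟨this.1, this.2.trans (by omega)⟩
  · omega
  · have := key (i + r - L) (j + r - L) (by omega) (by omega) (by omega)
    refine ⟨this.1, this.2.trans (by omega)⟩

lemma cyc_rotate {L : ℕ} (f : ℕ → V) {r : ℕ} (hr : r < L) :
    cyc L (rot L f r) = cyc L f := by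
  ext x
  simp only [mem_cyc, rot]
  constructor
  · rintro ⟨i, hi, rfl⟩
    split_ifs with h
    · exact ⟨_, h, rfl⟩
    · exact ⟨i + r - L, by omega, rfl⟩
  · rintro ⟨i, hi, rfl⟩
    by_cases h : r ≤ i
    · exact ⟨i - r, by omega, by rw [if_pos (by omega)]; congr 1; omega⟩
    · exact ⟨i + L - r, by omega, by rw [if_neg (by omega)]; congr 1; omega⟩

/-- Every vertex of an induced cycle has exactly the two cyclic neighbours on it. -/
lemma IndCyc.exists_nbrs {L : ℕ} {f : ℕ → V} (hL : 3 ≤ L) (h : IndCyc G L f) {i : ℕ} (hi : i < L) :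
    ∃ a < L, ∃ b < L, a ≠ b ∧ G.Adj (f i) (f a) ∧ G.Adj (f i) (f b) ∧
      ∀ j < L, G.Adj (f i) (f j) → j = a ∨ j = b := by
  refine ⟨if i = 0 then L - 1 else i - 1, by split_ifs <;> omega,
    if i + 1 = L then 0 else i + 1, by split_ifs <;> omega, by split_ifs <;> omega, ?_, ?_, ?_⟩
  · rw [h.adj_iff hi (by split_ifs <;> omega)]; split_ifs <;> omega
  · rw [h.adj_iff hi (by split_ifs <;> omega)]; split_ifs <;> omega
  · intro j hj hadj
    rw [h.adj_iff hi hj] at hadj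
    split_ifs <;> omega

lemma IndCyc.minDegTwo {L : ℕ} {f : ℕ → V} (hL : 3 ≤ L) (h : IndCyc G L f) :
    MinDegTwo G (cyc L f) := by
  intro v hv
  obtain ⟨i, hi, rfl⟩ := mem_cyc.1 hv
  obtain ⟨a, ha, b, hb, hab, h1, h2, -⟩ := h.exists_nbrs hL hi
  exact ⟨_, mem_cyc.2 ⟨a, ha, rfl⟩, _, mem_cyc.2 ⟨b, hb, rfl⟩, fun e => hab (h.inj ha hb e), h1, h2⟩

lemma cyc_ncard {L : ℕ} {f : ℕ → V} (h : IndCyc G L f) : (cyc L f).ncard = L := by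
  unfold cyc
  have hinj : Set.InjOn f {i | i < L} := fun i hi j hj e => h.inj hi hj e
  rw [hinj.ncard_image]
  have : {i | i < L} = (Finset.range L : Set ℕ) := by ext; simp
  rw [this, Set.ncard_coe_finset, Finset.card_range]

/-- A finite nonempty set of minimum degree two contains an induced cycle: on a walk that never
turns back, a closest pair of adjacent vertices at distance at least two along the walk closes
one. -/
lemma MinDegTwo.exists_indCyc [Finite V] {B : Set V} (hB : MinDegTwo G B) (hne : B.Nonempty) :
    ∃ L f, 3 ≤ L ∧ IndCyc G L f ∧ ∀ i < L, f i ∈ B := by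
  classical
  have step : ∀ p q : V, q ∈ B → ∃ z ∈ B, G.Adj q z ∧ z ≠ p := by
    intro p q hq
    obtain ⟨x, hx, y, hy, hxy, h1, h2⟩ := hB q hq
    by_cases h : x = p
    · exact ⟨y, hy, h2, fun e => hxy (h.trans e.symm)⟩
    · exact ⟨x, hx, h1, h⟩
  choose! nx hnB hnA hnP using step
  obtain ⟨v0, hv0⟩ := hne
  let s : ℕ → V × V := fun n => Nat.rec (v0, nx v0 v0) (fun _ p => (p.2, nx p.1 p.2)) n
  have hs0 : s 0 = (v0, nx v0 v0) := rfl
  have hs : ∀ n, s (n + 1) = ((s n).2, nx (s n).1 (s n).2) := fun n => rfl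
  have hsB : ∀ n, (s n).1 ∈ B ∧ (s n).2 ∈ B := by
    intro n
    induction n with
    | zero => exact ⟨hv0, hnB _ _ hv0⟩
    | succ n ih => rw [hs]; exact ⟨ih.2, hnB _ _ ih.2⟩
  set x : ℕ → V := fun n => (s n).1 with hx
  have hxB : ∀ n, x n ∈ B := fun n => (hsB n).1
  have hx1 : ∀ n, x (n + 1) = (s n).2 := fun n => rfl
  have hx2 : ∀ n, x (n + 2) = nx (x n) (x (n + 1)) := fun n => rfl
  have hadj : ∀ n, G.Adj (x n) (x (n + 1)) := by
    intro n
    cases n with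
    | zero => exact hnA v0 v0 hv0
    | succ n => rw [hx2]; exact hnA (x n) (x (n + 1)) (hxB (n + 1))
  have hback : ∀ n, x (n + 2) ≠ x n := fun n => by rw [hx2]; exact hnP (x n) (x (n + 1)) (hxB
      (n + 1))
  -- a repeated vertex yields a chord that ends one step earlier
  have hrep : ∀ i j, i < j → x i = x j → i + 3 ≤ j ∧ G.Adj (x i) (x (j - 1)) := by
    intro i j hij he
    have h1 : j ≠ i + 1 := fun e => (hadj i).ne (e ▸ he)
    have h2 : j ≠ i + 2 := fun e => hback i (e ▸ he).symm
    refine ⟨by omega, ?_⟩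
    have := hadj (j - 1)
    rw [show j - 1 + 1 = j by omega, ← he] at this
    exact this.symm
  have hex : ∃ d, 2 ≤ d ∧ ∃ i, G.Adj (x i) (x (i + d)) := by
    obtain ⟨i, j, hij, he⟩ := Finite.exists_ne_map_eq_of_infinite x
    wlog hlt : i < j generalizing i j
    · exact this j i hij.symm he.symm (by omega)
    obtain ⟨h1, h2⟩ := hrep i j hlt he
    exact ⟨j - 1 - i, by omega, i, by rwa [show i + (j - 1 - i) = j - 1 by omega]⟩
  obtain ⟨hd2, i, hi⟩ := Nat.find_spec hex
  set d := Nat.find hex with hd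
  have hmin : ∀ a b, a + 2 ≤ b → G.Adj (x a) (x b) → d ≤ b - a := fun a b hab h =>
    Nat.find_min' hex ⟨by omega, a, by rwa [show a + (b - a) = b by omega]⟩
  refine ⟨d + 1, fun l => x (i + l), by omega, ?_, fun l _ => hxB _⟩
  intro a b hab hb
  refine ⟨?_, ?_⟩
  · intro he
    obtain ⟨h1, h2⟩ := hrep (i + a) (i + b) (by omega) he
    have := hmin _ _ (by omega) h2
    omega
  · constructor
    · intro h
      by_cases hb1 : b = a + 1
      · exact .inl hb1
      · have := hmin (i + a) (i + b) (by omega) h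
        omega
    · rintro (rfl | ⟨rfl, hb⟩)
      · exact hadj (i + a)
      · rw [show b = d by omega]; exact hi

lemma cycleGraph_adj_of_lt {k : ℕ} {a b : Fin k} (hab : a < b) :
    (cycleGraph k).Adj a b ↔ b.val = a.val + 1 ∨ (a.val = 0 ∧ b.val + 1 = k) := by
  have ha := a.2
  have hb := b.2
  rw [Fin.lt_def] at hab
  rw [cycleGraph_adj', Fin.coe_sub_iff_lt.2 (Fin.lt_def.2 hab),
    Fin.sub_val_of_le (Fin.le_def.2 hab.le)]
  omega

/-- Induced cycles in the sense of graph embeddings. -/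
lemma IndCyc.exists_embedding {L : ℕ} {f : ℕ → V} (h : IndCyc G L f) :
    ∃ c : cycleGraph L ↪g G, ∀ i : Fin L, c i = f i := by
  refine ⟨⟨⟨fun i : Fin L => f i, fun i j e => Fin.ext (h.inj i.2 j.2 e)⟩, ?_⟩, fun i => rfl⟩
  intro a b
  change G.Adj (f a) (f b) ↔ _
  rcases lt_trichotomy a b with hab | hab | hab
  · rw [(h a b hab b.2).2, cycleGraph_adj_of_lt hab]
  · subst hab; simp
  · rw [G.adj_comm, (h b a hab a.2).2, SimpleGraph.adj_comm, cycleGraph_adj_of_lt hab]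

lemma exists_indCyc_of_embedding {k : ℕ} (hk : 0 < k) (c : cycleGraph k ↪g G) :
    ∃ f, IndCyc G k f ∧ ∀ i : Fin k, f i = c i := by
  refine ⟨fun i => if h : i < k then c ⟨i, h⟩ else c ⟨0, hk⟩, ?_, fun i => by simp⟩
  intro i j hij hj
  have hi : i < k := by omega
  simp only [hi, hj, dif_pos]
  refine ⟨fun e => ?_, ?_⟩
  · have := congrArg Fin.val (c.injective e); simp at this; omega
  · rw [c.map_adj_iff, cycleGraph_adj_of_lt (by exact hij)]

lemma range_eq_cyc {k : ℕ} {c : cycleGraph k ↪g G} {f : ℕ → V} (h : ∀ i : Fin k, f i = c i) :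
    Set.range c = cyc k f := by
  ext x
  rw [mem_cyc]
  constructor
  · rintro ⟨i, rfl⟩; exact ⟨i, i.2, h i⟩
  · rintro ⟨i, hi, rfl⟩; exact ⟨⟨i, hi⟩, (h ⟨i, hi⟩).symm⟩

lemma IsSC.length_eq {k L : ℕ} {f : ℕ → V} (hG : IsSC k G) (hL : 3 ≤ L) (h : IndCyc G L f) :
    L = k := by
  obtain ⟨c, -⟩ := h.exists_embedding
  exact hG L hL ⟨c⟩

/-- An induced cycle inside a set is an induced cycle of the subgraph on this set. -/
lemma IndCyc.nonempty_embedding_induce {L : ℕ} {f : ℕ → V} {A : Set V} (h : IndCyc G L f)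
    (hA : ∀ i < L, f i ∈ A) : Nonempty (cycleGraph L ↪g G.induce A) := by
  obtain ⟨c, hc⟩ := h.exists_embedding
  refine ⟨⟨⟨fun i => ⟨c i, by rw [hc]; exact hA i i.2⟩, fun i j e => ?_⟩, ?_⟩⟩
  · exact c.injective (congrArg Subtype.val e)
  · intro a b
    change G.Adj (c a) (c b) ↔ _
    exact c.map_adj_iff

lemma IsSC.induce {k : ℕ} (hG : IsSC k G) (A : Set V) : IsSC k (G.induce A) := by
  rintro m hm ⟨c⟩
  exact hG m hm ⟨c.trans (Embedding.induce A)⟩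

lemma not_isAcyclic_of_embedding {L : ℕ} (hL : 3 ≤ L) (c : cycleGraph L ↪g G) :
    ¬ G.IsAcyclic := by
  intro h
  obtain ⟨n, rfl⟩ : ∃ n, L = n + 3 := ⟨L - 3, by omega⟩
  exact IsAcyclic.embedding c h _ cycleGraph.isCycle_cycle

lemma isAcyclic_induce_iff [Finite V] (A : Set V) :
    (G.induce A).IsAcyclic ↔ ∀ B ⊆ A, MinDegTwo G B → B = ∅ := by
  constructor
  · intro h B hBA hB
    by_contra hne
    obtain ⟨L, f, hL, hf, hfB⟩ := hB.exists_indCyc (Set.nonempty_iff_ne_empty.2 hne)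
    obtain ⟨c⟩ := hf.nonempty_embedding_induce fun i hi => hBA (hfB i hi)
    exact not_isAcyclic_of_embedding hL c h
  · intro h v p hp
    have := h (Subtype.val '' {w | w ∈ p.support}) (by rintro _ ⟨w, -, rfl⟩; exact w.2) ?_
    · have h0 : (v : V) ∈ Subtype.val '' {w | w ∈ p.support} := ⟨v, p.start_mem_support, rfl⟩
      rw [this] at h0
      exact h0
    · rintro _ ⟨w, hw, rfl⟩
      have h2 := hp.ncard_neighborSet_toSubgraph_eq_two hw
      obtain ⟨x, y, hxy, he⟩ := Set.ncard_eq_two.1 h2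
      have hx : p.toSubgraph.Adj w x := by
        rw [← Subgraph.mem_neighborSet, he]; simp
      have hy : p.toSubgraph.Adj w y := by
        rw [← Subgraph.mem_neighborSet, he]; simp
      refine ⟨x, ⟨x, p.mem_verts_toSubgraph.1 hx.snd_mem, rfl⟩, y,
        ⟨y, p.mem_verts_toSubgraph.1 hy.snd_mem, rfl⟩, fun e => hxy (Subtype.ext e), ?_, ?_⟩
      · exact hx.adj_sub
      · exact hy.adj_sub

/-! Degrees inside a set. -/

lemma two_le_degIn_iff [Finite V] {A : Set V} {v : V} :
    2 ≤ degIn G A v ↔ ∃ x ∈ A, ∃ y ∈ A, x ≠ y ∧ G.Adj v x ∧ G.Adj v y := by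
  unfold degIn
  rw [Nat.succ_le_iff, Set.one_lt_ncard (Set.toFinite _)]
  constructor
  · rintro ⟨x, hx, y, hy, hxy⟩
    exact ⟨x, hx.1, y, hy.1, hxy, hx.2, hy.2⟩
  · rintro ⟨x, hx, y, hy, hxy, h1, h2⟩
    exact ⟨x, ⟨hx, h1⟩, y, ⟨hy, h2⟩, hxy⟩

lemma minDegTwo_iff_degIn [Finite V] {A : Set V} :
    MinDegTwo G A ↔ ∀ v ∈ A, 2 ≤ degIn G A v := by
  simp only [two_le_degIn_iff]; rfl

lemma degIn_mono [Finite V] {A B : Set V} (h : A ⊆ B) (v : V) : degIn G A v ≤ degIn G B v :=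
  Set.ncard_le_ncard (fun _ hw => ⟨h hw.1, hw.2⟩) (Set.toFinite _)

lemma degIn_congr {A B : Set V} {v : V} (h : ∀ w, G.Adj v w → (w ∈ A ↔ w ∈ B)) :
    degIn G A v = degIn G B v := by
  unfold degIn
  congr 1
  ext w
  simp only [Set.mem_ofPred_eq]
  constructor
  · rintro ⟨h1, h2⟩; exact ⟨(h w h2).1 h1, h2⟩
  · rintro ⟨h1, h2⟩; exact ⟨(h w h2).2 h1, h2⟩

/-- In a set where `v` has degree at most two, two given neighbours of `v` are all of them. -/
lemma eq_or_eq_of_degIn_le_two [Finite V] {A : Set V} {v a b w : V} (h : degIn G A v ≤ 2)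
    (ha : a ∈ A) (hb : b ∈ A) (hab : a ≠ b) (hva : G.Adj v a) (hvb : G.Adj v b) (hw : w ∈ A)
    (hvw : G.Adj v w) : w = a ∨ w = b := by
  by_contra! hne
  have : ({a, b, w} : Set V) ⊆ {w : V | w ∈ A ∧ G.Adj v w} := by
    rintro x (rfl | rfl | rfl)
    · exact ⟨ha, hva⟩
    · exact ⟨hb, hvb⟩
    · exact ⟨hw, hvw⟩
  have h3 := Set.ncard_le_ncard this (Set.toFinite _)
  rw [Set.ncard_eq_three.2 ⟨a, b, w, hab, hne.1.symm, hne.2.symm, rfl⟩] at h3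
  unfold degIn at h
  omega

/-- On an induced cycle, a vertex of degree two in `A` has all its neighbours in `A` on the
cycle. -/
lemma IndCyc.mem_of_adj [Finite V] {L : ℕ} {f : ℕ → V} {A : Set V} (hL : 3 ≤ L)
    (h : IndCyc G L f) (hA : cyc L f ⊆ A) {i : ℕ} (hi : i < L) (hd : degIn G A (f i) ≤ 2) {w : V}
    (hw : w ∈ A) (hadj : G.Adj (f i) w) : w ∈ cyc L f := by
  obtain ⟨a, ha, b, hb, hab, h1, h2, -⟩ := h.exists_nbrs hL hi
  rcases eq_or_eq_of_degIn_le_two hd (hA (mem_cyc.2 ⟨a, ha, rfl⟩)) (hA (mem_cyc.2 ⟨b, hb, rfl⟩))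
    (fun e => hab (h.inj ha hb e)) h1 h2 hw hadj with rfl | rfl
  · exact mem_cyc.2 ⟨a, ha, rfl⟩
  · exact mem_cyc.2 ⟨b, hb, rfl⟩

/-- The largest subset of `A` of minimum degree two. -/
def core (G : SimpleGraph V) (A : Set V) : Set V := ⋃₀ {B | B ⊆ A ∧ MinDegTwo G B}

lemma core_subset (A : Set V) : core G A ⊆ A := Set.sUnion_subset fun _ hB => hB.1

lemma minDegTwo_core (A : Set V) : MinDegTwo G (core G A) := MinDegTwo.sUnion fun _ hB => hB.2

lemma MinDegTwo.subset_core {A B : Set V} (hB : MinDegTwo G B) (h : B ⊆ A) : B ⊆ core G A :=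
  Set.subset_sUnion_of_mem ⟨h, hB⟩

lemma core_mono {A B : Set V} (h : A ⊆ B) : core G A ⊆ core G B :=
  (minDegTwo_core A).subset_core ((core_subset A).trans h)

lemma MinDegTwo.core_eq {A : Set V} (h : MinDegTwo G A) : core G A = A :=
  (core_subset A).antisymm (h.subset_core subset_rfl)

lemma core_eq_empty_iff {A : Set V} : core G A = ∅ ↔ ∀ B ⊆ A, MinDegTwo G B → B = ∅ := by
  constructor
  · intro h B hBA hB
    exact Set.subset_empty_iff.1 (h ▸ hB.subset_core hBA)
  · intro h
    exact h _ (core_subset A) (minDegTwo_core A)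

lemma isFVS_iff [Finite V] (S : Set V) : IsFVS G S ↔ core G Sᶜ = ∅ := by
  rw [IsFVS, isAcyclic_induce_iff, core_eq_empty_iff]

end Basics

/-! ### Connected sets and shortest paths -/

/-- `H` is a union of connected components of the subgraph induced on `A`. -/
def ClosedIn {V : Type*} (G : SimpleGraph V) (A H : Set V) : Prop :=
  H ⊆ A ∧ ∀ a ∈ H, ∀ b ∈ A, G.Adj a b → b ∈ H

/-- The subgraph induced on `A` is connected and nonempty: it is not a union of fewer components. -/
def Conn {V : Type*} (G : SimpleGraph V) (A : Set V) : Prop :=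
  A.Nonempty ∧ ∀ H, ClosedIn G A H → H.Nonempty → H = A

/-- `K` is a connected component of the subgraph induced on `A`. -/
def IsComp {V : Type*} (G : SimpleGraph V) (A K : Set V) : Prop :=
  Conn G K ∧ ClosedIn G A K

/-- The first `n` values of `y` form an induced path. -/
def IndPath {V : Type*} (G : SimpleGraph V) (n : ℕ) (y : ℕ → V) : Prop :=
  ∀ i j, i < j → j < n → y i ≠ y j ∧ (G.Adj (y i) (y j) ↔ j = i + 1)

section Structure

variable {V : Type*} {G : SimpleGraph V}

lemma conn_singleton (x : V) : Conn G {x} := by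
  refine ⟨⟨x, rfl⟩, fun H hH hne => ?_⟩
  rcases Set.subset_singleton_iff_eq.1 hH.1 with h | h
  · exact absurd h hne.ne_empty
  · exact h

lemma Conn.subset_of_closedIn {A X H : Set V} (hX : Conn G X) (hXA : X ⊆ A) (hH : ClosedIn G A H)
    (hne : (X ∩ H).Nonempty) : X ⊆ H := by
  have := hX.2 (X ∩ H) ⟨Set.inter_subset_left, fun a ha b hb hab =>
    ⟨hb, hH.2 a ha.2 b (hXA hb) hab⟩⟩ hne
  exact Set.inter_eq_left.1 this

lemma Conn.insert_of_adj {Y : Set V} (hY : Conn G Y) {x y : V} (hy : y ∈ Y) (hxy : G.Adj x y) :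
    Conn G (insert x Y) := by
  refine ⟨⟨x, by simp⟩, fun H hH hne => ?_⟩
  have hYH : (Y ∩ H).Nonempty → insert x Y ⊆ H := by
    intro h
    have h1 := hY.subset_of_closedIn (Set.subset_insert x Y) hH h
    exact Set.insert_subset (hH.2 y (h1 hy) x (by simp) hxy.symm) h1
  apply hH.1.antisymm
  obtain ⟨z, hz⟩ := hne
  rcases hH.1 hz with rfl | h
  · exact hYH ⟨y, hy, hH.2 z hz y (by simp [hy]) hxy⟩
  · exact hYH ⟨z, h, hz⟩

lemma Conn.sUnion {𝒮 : Set (Set V)} {x : V} (h : ∀ X ∈ 𝒮, Conn G X ∧ x ∈ X) (hne : 𝒮.Nonempty) :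
    Conn G (⋃₀ 𝒮) := by
  obtain ⟨X0, hX0⟩ := hne
  refine ⟨⟨x, X0, hX0, (h X0 hX0).2⟩, fun H hH hHne => ?_⟩
  obtain ⟨z, hz⟩ := hHne
  obtain ⟨X, hX, hzX⟩ := hH.1 hz
  have hxH : x ∈ H := (h X hX).1.subset_of_closedIn (Set.subset_sUnion_of_mem hX) hH
    ⟨z, hzX, hz⟩ (h X hX).2
  refine hH.1.antisymm (Set.sUnion_subset fun Y hY => ?_)
  exact (h Y hY).1.subset_of_closedIn (Set.subset_sUnion_of_mem hY) hH ⟨x, (h Y hY).2, hxH⟩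

lemma exists_isComp {A : Set V} {x : V} (hx : x ∈ A) : ∃ K, IsComp G A K ∧ x ∈ K := by
  let 𝒮 : Set (Set V) := {X | X ⊆ A ∧ Conn G X ∧ x ∈ X}
  have h0 : {x} ∈ 𝒮 := ⟨by simpa using hx, conn_singleton x, rfl⟩
  have hc : Conn G (⋃₀ 𝒮) := Conn.sUnion (fun X hX => hX.2) ⟨_, h0⟩
  have hxm : x ∈ ⋃₀ 𝒮 := ⟨_, h0, rfl⟩
  have hsub : ⋃₀ 𝒮 ⊆ A := Set.sUnion_subset fun X hX => hX.1
  refine ⟨⋃₀ 𝒮, ⟨hc, hsub, fun a ha b hb hab => ?_⟩, hxm⟩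
  exact ⟨insert b (⋃₀ 𝒮), ⟨Set.insert_subset hb hsub, hc.insert_of_adj ha hab.symm, by simp [hxm]⟩,
    by simp⟩

lemma IsComp.disjoint {A K K' : Set V} (hK : IsComp G A K) (hK' : IsComp G A K') (h : K ≠ K') :
    Disjoint K K' := by
  rw [Set.disjoint_iff_inter_eq_empty]
  by_contra hne
  have hne := Set.nonempty_iff_ne_empty.2 hne
  exact h ((hK.1.subset_of_closedIn hK.2.1 hK'.2 hne).antisymm
    (hK'.1.subset_of_closedIn hK'.2.1 hK.2 (by rwa [Set.inter_comm])))

lemma ClosedIn.diff {A H : Set V} (h : ClosedIn G A H) : ClosedIn G A (A \ H) :=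
  ⟨Set.sdiff_subset, fun _ ha _ hb hab => ⟨hb, fun hbH => ha.2 (h.2 _ hbH _ ha.1 hab.symm)⟩⟩

/-- A shortest path in the connected set `X` from `U` to `W`. -/
lemma Conn.exists_indPath {X U W : Set V} (hX : Conn G X) (hU : (X ∩ U).Nonempty)
    (hW : (X ∩ W).Nonempty) :
    ∃ t y, IndPath G (t + 1) y ∧ (∀ i ≤ t, y i ∈ X) ∧ (∀ i ≤ t, y i ∈ U ↔ i = 0) ∧
      (∀ i ≤ t, y i ∈ W ↔ i = t) := by
  classical
  let P : ℕ → (ℕ → V) → Prop := fun t y =>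
    (∀ i ≤ t, y i ∈ X) ∧ (∀ i < t, G.Adj (y i) (y (i + 1))) ∧ y 0 ∈ U ∧ y t ∈ W
  have hex : ∃ t y, P t y := by
    let R : Set V := {x | x ∈ X ∧ ∃ (t : ℕ) (y : ℕ → V), (∀ i ≤ t, y i ∈ X) ∧ (∀ i < t, G.Adj
        (y i) (y (i + 1))) ∧
      y 0 ∈ U ∧ y t = x}
    have hR : R = X := by
      refine hX.2 R ⟨fun x hx => hx.1, ?_⟩ ?_
      · rintro a ⟨ha, t, y, h1, h2, h3, rfl⟩ b hb hab
        refine ⟨hb, t + 1, fun i => if i ≤ t then y i else b, ?_, ?_, ?_, ?_⟩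
        · intro i hi
          dsimp only; split_ifs with h
          · exact h1 i h
          · exact hb
        · intro i hi
          by_cases h : i = t
          · subst h; simpa using hab
          · simp only [show i ≤ t by omega, show i + 1 ≤ t by omega, if_true]
            exact h2 i (by omega)
        · simpa using h3
        · simp
      · obtain ⟨x, hx, hxU⟩ := hU
        exact ⟨x, hx, 0, fun _ => x, fun _ _ => hx, fun i hi => by omega, hxU, rfl⟩
    obtain ⟨w, hw, hwW⟩ := hW
    rw [← hR] at hw
    obtain ⟨-, t, y, h1, h2, h3, rfl⟩ := hw
    exact ⟨t, y, h1, h2, h3, hwW⟩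
  obtain ⟨y, hy1, hy2, hy3, hy4⟩ := Nat.find_spec hex
  set t := Nat.find hex with ht
  have hmin : ∀ s z, P s z → t ≤ s := fun s z h => Nat.find_min' hex ⟨z, h⟩
  have hUiff : ∀ i ≤ t, y i ∈ U ↔ i = 0 := by
    refine fun i hi => ⟨fun h => ?_, fun h => h ▸ hy3⟩
    have := hmin (t - i) (fun l => y (l + i)) ⟨fun l hl => hy1 _ (by omega), fun l hl => by
      have := hy2 (l + i) (by omega)
      rwa [show l + i + 1 = l + 1 + i by omega] at this, by simpa using h, by
      dsimp only; rwa [show t - i + i = t by omega]⟩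
    omega
  have hWiff : ∀ i ≤ t, y i ∈ W ↔ i = t := by
    refine fun i hi => ⟨fun h => ?_, fun h => h ▸ hy4⟩
    have := hmin i y ⟨fun l hl => hy1 _ (by omega), fun l hl => hy2 _ (by omega), hy3, h⟩
    omega
  -- a chord, or a repeated vertex, gives a shortcut
  have hshort : ∀ i j, i < j → j ≤ t → G.Adj (y i) (y j) → j = i + 1 := by
    intro i j hij hj hadj
    have := hmin (t - (j - i - 1)) (fun l => if l ≤ i then y l else y (l + (j - i - 1))) ⟨?_, ?_,
        ?_,
      ?_⟩
    · omega
    · intro l hl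
      dsimp only; split_ifs
      · exact hy1 _ (by omega)
      · exact hy1 _ (by omega)
    · intro l hl
      rcases lt_trichotomy l i with h | h | h
      · simp only [show l ≤ i by omega, show l + 1 ≤ i by omega, if_true]
        exact hy2 _ (by omega)
      · subst h
        simp only [le_refl, if_true, show ¬ (l + 1 ≤ l) by omega, if_false]
        rwa [show l + 1 + (j - l - 1) = j by omega]
      · simp only [show ¬ l ≤ i by omega, show ¬ (l + 1 ≤ i) by omega, if_false]
        have := hy2 (l + (j - i - 1)) (by omega)
        rwa [show l + (j - i - 1) + 1 = l + 1 + (j - i - 1) by omega] at this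
    · simpa using hy3
    · dsimp only
      rw [if_neg (by omega), show t - (j - i - 1) + (j - i - 1) = t by omega]
      exact hy4
  refine ⟨t, y, fun i j hij hj => ⟨fun he => ?_, hshort i j hij (by omega), ?_⟩, hy1, hUiff, hWiff⟩
  · by_cases hjt : j = t
    · have := (hWiff i (by omega)).1 (by rw [he, hjt]; exact hy4)
      omega
    · have := hy2 j (by omega)
      rw [← he] at this
      have := hshort i (j + 1) (by omega) (by omega) this
      omega
  · rintro rfl
    exact hy2 i (by omega)

lemma IndPath.reverse {n : ℕ} {y : ℕ → V} (h : IndPath G n y) :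
    IndPath G n (fun i => y (n - 1 - i)) := by
  intro i j hij hj
  have := h (n - 1 - j) (n - 1 - i) (by omega) (by omega)
  exact ⟨this.1.symm, by rw [G.adj_comm, this.2]; omega⟩

lemma IndPath.mono {m n : ℕ} {y : ℕ → V} (h : IndPath G n y) (hm : m ≤ n) : IndPath G m y :=
  fun i j hij hj => h i j hij (by omega)

lemma IndPath.conn {n : ℕ} {y : ℕ → V} (h : IndPath G (n + 1) y) : Conn G (cyc (n + 1) y) := by
  induction n with
  | zero =>
    convert conn_singleton (G := G) (y 0)
    ext x
    simp only [mem_cyc, Set.mem_singleton_iff]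
    constructor
    · rintro ⟨i, hi, rfl⟩; congr 1; omega
    · rintro rfl; exact ⟨0, by omega, rfl⟩
  | succ n ih =>
    have : cyc (n + 1 + 1) y = insert (y (n + 1)) (cyc (n + 1) y) := by
      ext x
      simp only [mem_cyc, Set.mem_insert_iff]
      constructor
      · rintro ⟨i, hi, rfl⟩
        by_cases he : i = n + 1
        · exact .inl (by rw [he])
        · exact .inr ⟨i, by omega, rfl⟩
      · rintro (rfl | ⟨i, hi, rfl⟩)
        · exact ⟨n + 1, by omega, rfl⟩
        · exact ⟨i, by omega, rfl⟩
    rw [this]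
    exact (ih (h.mono (by omega))).insert_of_adj (mem_cyc.2 ⟨n, by omega, rfl⟩)
      ((h n (n + 1) (by omega) (by omega)).2.2 rfl).symm

/-- The last `n - 1` vertices of an induced path. -/
lemma IndPath.tail {n : ℕ} {y : ℕ → V} (h : IndPath G (n + 1) y) :
    IndPath G n (fun i => y (i + 1)) := by
  intro i j hij hj
  have := h (i + 1) (j + 1) (by omega) (by omega)
  exact ⟨this.1, this.2.trans (by omega)⟩

/-- Two induced paths joined at their ends form an induced cycle. -/
lemma IndPath.glue {n m : ℕ} {y z : ℕ → V} (hy : IndPath G n y) (hz : IndPath G m z) (hn : 1 ≤ n)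
    (hm : 2 ≤ m)
    (hyz : ∀ i < n, ∀ j < m, y i ≠ z j ∧
      (G.Adj (y i) (z j) ↔ (i + 1 = n ∧ j = 0) ∨ (i = 0 ∧ j + 1 = m))) :
    IndCyc G (n + m) (fun i => if i < n then y i else z (i - n)) := by
  intro i j hij hj
  dsimp only
  split_ifs with h1 h2 h2
  · have := hy i j hij h2
    exact ⟨this.1, this.2.trans (by omega)⟩
  · have := hyz i h1 (j - n) (by omega)
    exact ⟨this.1, this.2.trans (by omega)⟩
  · omega
  · have := hz (i - n) (j - n) (by omega) (by omega)
    exact ⟨this.1, this.2.trans (by omega)⟩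

lemma IndCyc.indPath {k m : ℕ} {f : ℕ → V} (h : IndCyc G k f) (hm : m < k) : IndPath G m f := by
  intro i j hij hj
  have := h i j hij (by omega)
  exact ⟨this.1, this.2.trans (by omega)⟩

/-! ### How a connected set attaches to an induced cycle -/

/-- Positions `p ≠ q` on a `k`-cycle are adjacent or antipodal. -/
def GoodPos (k p q : ℕ) : Prop :=
  q = p + 1 ∨ p = q + 1 ∨ (p = 0 ∧ q + 1 = k) ∨ (q = 0 ∧ p + 1 = k) ∨
    2 * p + k = 2 * q ∨ 2 * q + k = 2 * p

lemma GoodPos.symm {k p q : ℕ} (h : GoodPos k p q) : GoodPos k q p := by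
  unfold GoodPos at *; omega

/-- Three positions of a cycle of length at least five are not pairwise adjacent or antipodal. -/
lemma GoodPos.not_triangle {k a b c : ℕ} (hk : 5 ≤ k) (ha : a < k) (hb : b < k) (hc : c < k)
    (hab : GoodPos k a b) (hbc : GoodPos k b c) (hac : GoodPos k a c) (h1 : a ≠ b) (h2 : b ≠ c)
    (h3 : a ≠ c) : False := by
  unfold GoodPos at *
  rcases hab with h | h | h | h | h | h <;> rcases hbc with h' | h' | h' | h' | h' | h' <;> omega

/-- A path outside an induced cycle that joins the two ends of an arc with `δ` edges, and is not
attached to this arc elsewhere, has `k - δ - 1` vertices. -/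
lemma link_length {k n p q δ : ℕ} {f y : ℕ → V} (hG : IsSC k G) (hf : IndCyc G k f)
    (hy : IndPath G n y) (hn : 1 ≤ n) (hd : ∀ i < n, y i ∉ cyc k f) (hp : p < k) (hq : q < k)
    (hδ : q = p + δ ∨ q + k = p + δ) (hδ1 : 1 ≤ δ) (hδ2 : δ + 2 ≤ k)
    (hadj : ∀ i < n, ∀ j ≤ δ, ∀ l < k, (l = p + j ∨ l + k = p + j) →
      (G.Adj (y i) (f l) ↔ (i + 1 = n ∧ l = p) ∨ (i = 0 ∧ l = q))) : n + δ + 1 = k := by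
  have hz : IndPath G (δ + 1) (rot k f p) := (hf.rotate hp).indPath (by omega)
  have := hy.glue hz hn (by omega) ?_
  · exact hG.length_eq (by omega) this
  intro i hi j hj
  unfold rot
  split_ifs with h
  · refine ⟨fun e => hd i hi (mem_cyc.2 ⟨_, h, e.symm⟩), ?_⟩
    rw [hadj i hi j (by omega) (j + p) h (by omega)]
    omega
  · refine ⟨fun e => hd i hi (mem_cyc.2 ⟨_, by omega, e.symm⟩), ?_⟩
    rw [hadj i hi j (by omega) (j + p - k) (by omega) (by omega)]
    omega

/-- A vertex outside an induced cycle has at most one neighbour on it. -/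
lemma nbr_unique {k : ℕ} {f : ℕ → V} (hk : 5 ≤ k) (hG : IsSC k G) (hf : IndCyc G k f) {x : V}
    (hx : x ∉ cyc k f) {a b : ℕ} (ha : a < k) (hb : b < k) (hxa : G.Adj x (f a))
    (hxb : G.Adj x (f b)) : a = b := by
  classical
  -- the next neighbour after a given one is `k - 2` steps further
  have key : ∀ g, IndCyc G k g → x ∉ cyc k g → G.Adj x (g 0) → ∀ b, 0 < b → b < k →
      G.Adj x (g b) → k ≤ b + 2 := by
    intro g hg hxg h0 b hb0 hbk hxb
    have hex : ∃ d, 0 < d ∧ G.Adj x (g d) := ⟨b, hb0, hxb⟩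
    obtain ⟨hd0, hxd⟩ := Nat.find_spec hex
    have hmin : ∀ j, 0 < j → G.Adj x (g j) → Nat.find hex ≤ j := fun j h1 h2 =>
      Nat.find_min' hex ⟨h1, h2⟩
    have hdb := hmin b hb0 hxb
    set d := Nat.find hex with hd
    by_contra hlt
    have := link_length (n := 1) (p := 0) (q := d) (δ := d) (y := fun _ => x) hG hg
      (fun i j hij hj => by omega) le_rfl (fun _ _ => hxg) (by omega) (by omega) (by omega) hd0
      (by omega) ?_
    · omega
    · intro i hi j hj l hl hlj
      constructor
      · intro h
        by_cases hl0 : l = 0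
        · omega
        · have := hmin l (by omega) h
          omega
      · rintro (⟨-, rfl⟩ | ⟨-, rfl⟩)
        · exact h0
        · exact hxd
  by_contra hab
  wlog hlt : a < b generalizing a b
  · exact this hb ha hxb hxa (Ne.symm hab) (by omega)
  have e0 : ∀ r < k, rot k f r 0 = f r := fun r hr => by simp [rot, hr]
  have h1 := key (rot k f a) (hf.rotate ha) (by rwa [cyc_rotate f ha]) (by rwa [e0 a ha]) (b - a)
    (by omega) (by omega) (by
      rw [rot, if_pos (by omega), show b - a + a = b by omega]; exact hxb)
  have h2 := key (rot k f b) (hf.rotate hb) (by rwa [cyc_rotate f hb]) (by rwa [e0 b hb])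
    (a + k - b) (by omega) (by omega) (by
      rw [rot, if_neg (by omega), show a + k - b + b - k = a by omega]; exact hxa)
  omega

/-- The positions at which the set `X` is attached to the cycle given by `f`. -/
def Att (G : SimpleGraph V) (k : ℕ) (f : ℕ → V) (X : Set V) : Set ℕ :=
  {i | i < k ∧ ∃ x ∈ X, G.Adj x (f i)}

/-- A connected set attached to an induced cycle at exactly two positions. -/
lemma goodPos_of_att_eq_pair {k p q : ℕ} {f : ℕ → V} {X : Set V} (hk : 5 ≤ k) (hG : IsSC k G)
    (hf : IndCyc G k f) (hX : Conn G X) (hd : Disjoint X (cyc k f)) (hpq : p ≠ q)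
    (hatt : Att G k f X = {p, q}) : GoodPos k p q := by
  wlog hlt : p < q generalizing p q
  · exact (this hpq.symm (by rw [hatt, Set.pair_comm]) (by omega)).symm
  have hp : p ∈ Att G k f X := by rw [hatt]; simp
  have hq : q ∈ Att G k f X := by rw [hatt]; simp
  have hpk := hp.1
  have hqk := hq.1
  obtain ⟨t, y, hy, hyX, hyp, hyq⟩ := hX.exists_indPath (U := {x | G.Adj x (f p)})
    (W := {x | G.Adj x (f q)}) hp.2 hq.2
  have hyc : ∀ i < t + 1, y i ∉ cyc k f := fun i hi h =>
    Set.disjoint_left.1 hd (hyX i (by omega)) h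
  have hadj : ∀ i ≤ t, ∀ l < k, (G.Adj (y i) (f l) ↔ (l = p ∧ i = 0) ∨ (l = q ∧ i = t)) := by
    intro i hi l hl
    constructor
    · intro h
      have : l ∈ Att G k f X := ⟨hl, y i, hyX i hi, h⟩
      rw [hatt] at this
      rcases this with rfl | rfl
      · exact .inl ⟨rfl, (hyp i hi).1 h⟩
      · exact .inr ⟨rfl, (hyq i hi).1 h⟩
    · rintro (⟨rfl, h⟩ | ⟨rfl, h⟩)
      · exact (hyp i hi).2 h
      · exact (hyq i hi).2 h
  unfold GoodPos
  by_cases h1 : q + 2 ≤ p + k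
  · by_cases h2 : p + 2 ≤ q
    · have e1 := link_length (p := p) (q := q) (δ := q - p) hG hf hy.reverse (by omega)
        (fun i hi => hyc _ (by omega)) hpk hqk (by omega) (by omega) (by omega) (by
          intro i hi j hj l hl hlj
          rw [hadj _ (by omega) l hl]; omega)
      have e2 := link_length (p := q) (q := p) (δ := p + k - q) hG hf hy (by omega)
        hyc hqk hpk (by omega) (by omega) (by omega) (by
          intro i hi j hj l hl hlj
          rw [hadj _ (by omega) l hl]; omega)
      omega
    · omega
  · omega

/-- The last step for three attachments: a path from `p` to `q` cannot be attached at a position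
`r` next to `p` as well. -/
lemma no_path_three {k n p q r : ℕ} {f y : ℕ → V} (hk : 5 ≤ k) (hG : IsSC k G)
    (hf : IndCyc G k f) (hy : IndPath G n y) (hn : 1 ≤ n) (hd : ∀ i < n, y i ∉ cyc k f)
    (hp : p < k) (hq : q < k) (hr : r < k) (hpq : p ≠ q) (hqr : q ≠ r)
    (hpr : r = p + 1 ∨ p = r + 1 ∨ (p = 0 ∧ r + 1 = k) ∨ (r = 0 ∧ p + 1 = k))
    (hyp : ∀ i < n, G.Adj (y i) (f p) ↔ i = 0) (hyq : ∀ i < n, G.Adj (y i) (f q) ↔ i + 1 = n)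
    (hyr : ∃ i < n, G.Adj (y i) (f r))
    (hatt : ∀ i < n, ∀ l < k, G.Adj (y i) (f l) → l = p ∨ l = q ∨ l = r) : False := by
  classical
  -- the arc from `p` to `q` that avoids `r`
  have h1 : ∃ δ, 1 ≤ δ ∧ n + δ + 1 = k := by
    by_cases hc : r = p + 1 ∨ (r = 0 ∧ p + 1 = k)
    · refine ⟨if q ≤ p then p - q else p + k - q, by split_ifs <;> omega, ?_⟩
      refine link_length (p := q) (q := p) hG hf hy hn hd hq hp (by split_ifs <;> omega)
        (by split_ifs <;> omega) (by split_ifs <;> omega) ?_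
      intro i hi j hj l hl hlj
      constructor
      · intro h
        rcases hatt i hi l hl h with rfl | rfl | rfl
        · exact .inr ⟨(hyp i hi).1 h, rfl⟩
        · exact .inl ⟨(hyq i hi).1 h, rfl⟩
        · split_ifs at hj <;> omega
      · rintro (⟨h, rfl⟩ | ⟨h, rfl⟩)
        · exact (hyq i hi).2 h
        · exact (hyp i hi).2 h
    · refine ⟨if p ≤ q then q - p else q + k - p, by split_ifs <;> omega, ?_⟩
      refine link_length (p := p) (q := q) hG hf hy.reverse hn (fun i hi => hd _ (by omega)) hp hq
        (by split_ifs <;> omega) (by split_ifs <;> omega) (by split_ifs <;> omega) ?_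
      intro i hi j hj l hl hlj
      constructor
      · intro h
        rcases hatt _ (by omega) l hl h with rfl | rfl | rfl
        · have := (hyp _ (by omega)).1 h
          exact .inl ⟨by omega, rfl⟩
        · have := (hyq _ (by omega)).1 h
          exact .inr ⟨by omega, rfl⟩
        · split_ifs at hj <;> omega
      · rintro (⟨h, rfl⟩ | ⟨h, rfl⟩)
        · exact (hyp _ (by omega)).2 (by omega)
        · exact (hyq _ (by omega)).2 (by omega)
  obtain ⟨δ, hδ, hnδ⟩ := h1
  -- the initial part of the path up to its first neighbour of `f r`, closed by the edge from `r`
  -- to `p`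
  obtain ⟨hin, hir⟩ := Nat.find_spec hyr
  have hmin : ∀ j < n, G.Adj (y j) (f r) → Nat.find hyr ≤ j := fun j h1 h2 =>
    Nat.find_min' hyr ⟨h1, h2⟩
  set i := Nat.find hyr with hi
  have h2 : i + 1 + 1 + 1 = k := by
    by_cases hc : r = p + 1 ∨ (r = 0 ∧ p + 1 = k)
    · refine link_length (p := p) (q := r) (δ := 1) hG hf (hy.mono (m := i + 1) (by omega)).reverse
        (by omega) (fun i hi => hd _ (by omega)) hp hr (by omega) le_rfl (by omega) ?_
      intro a ha j hj l hl hlj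
      constructor
      · intro h
        by_cases hlp : l = p
        · subst hlp
          have := (hyp _ (by omega)).1 h
          exact .inl ⟨by omega, rfl⟩
        · obtain rfl : l = r := by omega
          have := hmin _ (by omega) h
          exact .inr ⟨by omega, rfl⟩
      · rintro (⟨h, rfl⟩ | ⟨rfl, rfl⟩)
        · exact (hyp _ (by omega)).2 (by omega)
        · exact hir
    · refine link_length (p := r) (q := p) (δ := 1) hG hf (hy.mono (m := i + 1) (by omega))
        (by omega) (fun i hi => hd _ (by omega)) hr hp (by omega) le_rfl (by omega) ?_
      intro a ha j hj l hl hlj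
      constructor
      · intro h
        by_cases hlp : l = p
        · subst hlp
          have := (hyp _ (by omega)).1 h
          exact .inr ⟨by omega, rfl⟩
        · obtain rfl : l = r := by omega
          have := hmin _ (by omega) h
          exact .inl ⟨by omega, rfl⟩
      · rintro (⟨h, rfl⟩ | ⟨rfl, rfl⟩)
        · obtain rfl : a = i := by omega
          exact hir
        · exact (hyp _ (by omega)).2 rfl
  exact hqr (nbr_unique hk hG hf (hd i hin) hq hr ((hyq i hin).2 (by omega)) hir)

/-- A connected set outside an induced cycle is not attached at three positions. -/
lemma not_three_att [Finite V] {k : ℕ} {f : ℕ → V} (hk : 5 ≤ k) (hG : IsSC k G)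
    (hf : IndCyc G k f) {X : Set V} (hX : Conn G X) (hd : Disjoint X (cyc k f)) {a b c : ℕ}
    (ha : a ∈ Att G k f X) (hb : b ∈ Att G k f X) (hc : c ∈ Att G k f X) (hab : a ≠ b)
    (hbc : b ≠ c) (hac : a ≠ c) : False := by
  induction hn : X.ncard using Nat.strong_induction_on generalizing X a b c with
  | _ N ih =>
  subst hn
  -- a proper connected subset attached at `p` and `q` shows that this pair is good
  have hpair : ∀ p q, p ∈ Att G k f X → q ∈ Att G k f X → p ≠ q → ∀ Y ⊂ X, Conn G Y →
      p ∈ Att G k f Y → q ∈ Att G k f Y → GoodPos k p q := by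
    intro p q hp hq hpq Y hYX hY hpY hqY
    refine goodPos_of_att_eq_pair hk hG hf hY (hd.mono_left hYX.1) hpq (Set.Subset.antisymm ?_ ?_)
    · intro l hl
      by_contra hne
      simp only [Set.mem_insert_iff, Set.mem_singleton_iff, not_or] at hne
      exact ih _ (Set.ncard_lt_ncard hYX (Set.toFinite _)) hY (hd.mono_left hYX.1) hpY hqY hl hpq
        (Ne.symm hne.2) (Ne.symm hne.1) rfl
    · rintro l (rfl | rfl)
      · exact hpY
      · exact hqY
  -- the case that a shortest path between two of the positions covers `X`
  have hfull : ∀ p q r, p ∈ Att G k f X → q ∈ Att G k f X → r ∈ Att G k f X → p ≠ q → q ≠ r →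
      p ≠ r → ∀ t y, IndPath G (t + 1) y → cyc (t + 1) y = X →
      (∀ i ≤ t, G.Adj (y i) (f p) ↔ i = 0) → (∀ i ≤ t, G.Adj (y i) (f q) ↔ i = t) → False := by
    intro p q r hp hq hr hpq hqr hpr t y hy hyX hyp hyq
    have hyc : ∀ i < t + 1, y i ∉ cyc k f := fun i hi h =>
      Set.disjoint_left.1 hd (hyX ▸ mem_cyc.2 ⟨i, hi, rfl⟩) h
    have ht : t ≠ 0 := by
      rintro rfl
      exact hpq (nbr_unique hk hG hf (hyc 0 (by omega)) hp.1 hq.1 ((hyp 0 le_rfl).2 rfl)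
        ((hyq 0 le_rfl).2 rfl))
    obtain ⟨i, hi, hir⟩ : ∃ i < t + 1, G.Adj (y i) (f r) := by
      obtain ⟨-, x, hx, hxr⟩ := hr
      rw [← hyX] at hx
      obtain ⟨i, hi, rfl⟩ := mem_cyc.1 hx
      exact ⟨i, hi, hxr⟩
    have hi0 : i ≠ 0 := by
      rintro rfl
      exact hpr (nbr_unique hk hG hf (hyc 0 (by omega)) hp.1 hr.1 ((hyp 0 (by omega)).2 rfl) hir)
    have hit : i ≠ t := by
      rintro rfl
      exact hqr (nbr_unique hk hG hf (hyc i (by omega)) hq.1 hr.1 ((hyq i (by omega)).2 rfl) hir)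
    have g1 : GoodPos k p r := by
      obtain ⟨s, rfl⟩ : ∃ s, t = s + 1 := ⟨t - 1, by omega⟩
      refine hpair p r hp hr hpr (cyc (s + 1) y) ⟨?_, ?_⟩ (hy.mono (by omega)).conn
        ⟨hp.1, y 0, mem_cyc.2 ⟨0, by omega, rfl⟩, (hyp 0 (by omega)).2 rfl⟩
        ⟨hr.1, y i, mem_cyc.2 ⟨i, by omega, rfl⟩, hir⟩
      · rw [← hyX]
        intro x hx
        obtain ⟨j, hj, rfl⟩ := mem_cyc.1 hx
        exact mem_cyc.2 ⟨j, by omega, rfl⟩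
      · rw [← hyX]
        intro h
        obtain ⟨j, hj, he⟩ := mem_cyc.1 (h (mem_cyc.2 ⟨s + 1, by omega, rfl⟩))
        exact (hy j (s + 1) (by omega) (by omega)).1 he
    have g2 : GoodPos k q r := by
      obtain ⟨s, rfl⟩ : ∃ s, t = s + 1 := ⟨t - 1, by omega⟩
      refine hpair q r hq hr hqr (cyc (s + 1) (fun i => y (i + 1))) ⟨?_, ?_⟩ hy.tail.conn
        ⟨hq.1, y (s + 1), mem_cyc.2 ⟨s, by omega, rfl⟩, (hyq _ (by omega)).2 rfl⟩
        ⟨hr.1, y i, mem_cyc.2 ⟨i - 1, by omega, congrArg y (by omega)⟩, hir⟩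
      · rw [← hyX]
        intro x hx
        obtain ⟨j, hj, rfl⟩ := mem_cyc.1 hx
        exact mem_cyc.2 ⟨j + 1, by omega, rfl⟩
      · rw [← hyX]
        intro h
        obtain ⟨j, hj, he⟩ := mem_cyc.1 (h (mem_cyc.2 ⟨0, by omega, rfl⟩))
        exact (hy 0 (j + 1) (by omega) (by omega)).1 he.symm
    have hatt : ∀ i < t + 1, ∀ l < k, G.Adj (y i) (f l) → l = p ∨ l = q ∨ l = r := by
      intro j hj l hl hjl
      by_contra! hne
      -- dropping the other end of the path leaves three positions
      by_cases hj0 : j = 0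
      · exact hne.1 (nbr_unique hk hG hf (hyc j hj) hl hp.1 hjl ((hyp j (by omega)).2 hj0))
      · obtain ⟨s, rfl⟩ : ∃ s, t = s + 1 := ⟨t - 1, by omega⟩
        have hsub : cyc (s + 1) (fun i => y (i + 1)) ⊂ X := by
          refine ⟨?_, ?_⟩
          · rw [← hyX]
            intro x hx
            obtain ⟨j, hj, rfl⟩ := mem_cyc.1 hx
            exact mem_cyc.2 ⟨j + 1, by omega, rfl⟩
          · rw [← hyX]
            intro h
            obtain ⟨j, hj, he⟩ := mem_cyc.1 (h (mem_cyc.2 ⟨0, by omega, rfl⟩))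
            exact (hy 0 (j + 1) (by omega) (by omega)).1 he.symm
        refine ih _ (Set.ncard_lt_ncard hsub (Set.toFinite _)) hy.tail.conn
          (hd.mono_left hsub.1) (a := q) (b := r) (c := l)
          ⟨hq.1, y (s + 1), mem_cyc.2 ⟨s, by omega, rfl⟩, (hyq _ (by omega)).2 rfl⟩
          ⟨hr.1, y i, mem_cyc.2 ⟨i - 1, by omega, congrArg y (by omega)⟩, hir⟩
          ⟨hl, y j, mem_cyc.2 ⟨j - 1, by omega, congrArg y (by omega)⟩, hjl⟩ hqr
          (Ne.symm hne.2.2) (Ne.symm hne.2.1) rfl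
    have hp' := hp.1
    have hq' := hq.1
    have hr' := hr.1
    by_cases hadj : r = p + 1 ∨ p = r + 1 ∨ (p = 0 ∧ r + 1 = k) ∨ (r = 0 ∧ p + 1 = k)
    · exact no_path_three hk hG hf hy (by omega) hyc hp' hq' hr' hpq hqr hadj
        (fun i hi => hyp i (by omega)) (fun i hi => (hyq i (by omega)).trans (by omega))
        ⟨i, hi, hir⟩ hatt
    · refine no_path_three (p := q) (q := p) (r := r) hk hG hf hy.reverse (by omega)
        (fun i hi => hyc _ (by omega)) hq' hp' hr' hpq.symm hpr ?_
        (fun i hi => (hyq _ (by omega)).trans (by omega))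
        (fun i hi => (hyp _ (by omega)).trans (by omega))
        ⟨t - i, by omega, by rwa [show t + 1 - 1 - (t - i) = i by omega]⟩ ?_
      · unfold GoodPos at g1 g2; omega
      · intro j hj l hl h
        rcases hatt _ (by omega) l hl h with h | h | h <;> simp [h]
  have hgood : ∀ p q r, p ∈ Att G k f X → q ∈ Att G k f X → r ∈ Att G k f X → p ≠ q → q ≠ r →
      p ≠ r → GoodPos k p q := by
    intro p q r hp hq hr hpq hqr hpr
    obtain ⟨t, y, hy, hyX, hyp, hyq⟩ := hX.exists_indPath (U := {x | G.Adj x (f p)})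
      (W := {x | G.Adj x (f q)}) hp.2 hq.2
    have hsub : cyc (t + 1) y ⊆ X := by
      intro x hx
      obtain ⟨j, hj, rfl⟩ := mem_cyc.1 hx
      exact hyX j (by omega)
    by_cases he : cyc (t + 1) y = X
    · exact (hfull p q r hp hq hr hpq hqr hpr t y hy he hyp hyq).elim
    · exact hpair p q hp hq hpq _ (hsub.ssubset_of_ne he) hy.conn
        ⟨hp.1, y 0, mem_cyc.2 ⟨0, by omega, rfl⟩, (hyp 0 (by omega)).2 rfl⟩
        ⟨hq.1, y t, mem_cyc.2 ⟨t, by omega, rfl⟩, (hyq t (by omega)).2 rfl⟩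
  exact GoodPos.not_triangle hk ha.1 hb.1 hc.1 (hgood a b c ha hb hc hab hbc hac)
    (hgood b c a hb hc ha hbc hac.symm hab.symm) (hgood a c b ha hc hb hac hbc.symm hab) hab hbc hac

end Structure

/-! ### Existence of pendant cycles -/

section Pendant

variable {V : Type*} {G : SimpleGraph V}

/-- One vertex of smaller degree does not prevent a finite set from containing a nonempty set of
minimum degree two. -/
lemma exists_minDegTwo_of_almost [Finite V] {B : Set V} {a : V}
    (h : ∀ v ∈ B, v ≠ a → ∃ x ∈ B, ∃ y ∈ B, x ≠ y ∧ G.Adj v x ∧ G.Adj v y)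
    (hne : (B \ {a}).Nonempty) : ∃ C ⊆ B, C.Nonempty ∧ MinDegTwo G C := by
  induction hn : B.ncard using Nat.strong_induction_on generalizing B a with
  | _ N ih =>
  subst hn
  by_cases hB : MinDegTwo G B
  · exact ⟨B, subset_rfl, hne.mono Set.sdiff_subset, hB⟩
  have haB : a ∈ B := by
    by_contra haB
    exact hB fun v hv => h v hv (ne_of_mem_of_not_mem hv haB)
  have hlow : ∀ x ∈ B, ∀ y ∈ B, G.Adj a x → G.Adj a y → x = y := by
    intro x hx y hy hax hay
    by_contra hxy
    refine hB fun v hv => ?_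
    by_cases hva : v = a
    · exact hva ▸ ⟨x, hx, y, hy, hxy, hax, hay⟩
    · exact h v hv hva
  have hlt : (B \ {a}).ncard < B.ncard := Set.ncard_sdiff_singleton_lt_of_mem haB
  by_cases hb : ∃ b ∈ B, G.Adj a b
  · obtain ⟨b, hbB, hab⟩ := hb
    have key := ih _ hlt (B := B \ {a}) (a := b) ?_ ?_ rfl
    · obtain ⟨C, hC, hC'⟩ := key
      exact ⟨C, hC.trans Set.sdiff_subset, hC'⟩
    · rintro v ⟨hv, hva⟩ hvb
      obtain ⟨x, hx, y, hy, hxy, h1, h2⟩ := h v hv hva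
      have hav : ¬ G.Adj v a := fun hadj => hvb (hlow v hv b hbB hadj.symm hab)
      exact ⟨x, ⟨hx, fun e => hav (by rw [← Set.mem_singleton_iff.1 e]; exact h1)⟩, y,
        ⟨hy, fun e => hav (by rw [← Set.mem_singleton_iff.1 e]; exact h2)⟩, hxy, h1, h2⟩
    · obtain ⟨x, hx, y, hy, hxy, h1, h2⟩ := h b hbB hab.ne'
      by_cases hxa : x = a
      · exact ⟨y, ⟨hy, fun e => hxy (hxa.trans (Set.mem_singleton_iff.1 e).symm)⟩, h2.ne'⟩
      · exact ⟨x, ⟨hx, hxa⟩, h1.ne'⟩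
  · push Not at hb
    refine ⟨B \ {a}, Set.sdiff_subset, hne, ?_⟩
    rintro v ⟨hv, hva⟩
    obtain ⟨x, hx, y, hy, hxy, h1, h2⟩ := h v hv hva
    have hav : ¬ G.Adj v a := fun hadj => hb v hv hadj.symm
    exact ⟨x, ⟨hx, fun e => hav (by rw [← Set.mem_singleton_iff.1 e]; exact h1)⟩, y,
      ⟨hy, fun e => hav (by rw [← Set.mem_singleton_iff.1 e]; exact h2)⟩, hxy, h1, h2⟩

variable [Finite V] {k : ℕ}

lemma exists_cyc_of_minDegTwo (hG : IsSC k G) {B : Set V} (hB : MinDegTwo G B)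
    (hne : B.Nonempty) : 3 ≤ k ∧ ∃ f, IndCyc G k f ∧ cyc k f ⊆ B := by
  obtain ⟨L, f, hL, hf, hfB⟩ := hB.exists_indCyc hne
  obtain rfl := hG.length_eq hL hf
  refine ⟨hL, f, hf, fun x hx => ?_⟩
  obtain ⟨i, hi, rfl⟩ := mem_cyc.1 hx
  exact hfB i hi

/-- A component `K` of the complement of an induced cycle, together with an arc of the cycle
spanned by its attachments, contains an induced cycle; the arc can avoid any prescribed position
that is not an attachment. -/
lemma exists_cyc_avoiding (hk : 3 ≤ k) (hG : IsSC k G) {A K : Set V} (hA : MinDegTwo G A)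
    {f : ℕ → V} (hf : IndCyc G k f) (hfA : cyc k f ⊆ A) (hK : IsComp G (A \ cyc k f) K) {r : ℕ}
    (hr : r < k) (hrK : r ∉ Att G k f K) :
    ∃ g, IndCyc G k g ∧ cyc k g ⊆ K ∪ (cyc k f \ {f r}) := by
  -- start the cycle at `r`
  wlog hr0 : r = 0 generalizing f r
  · have e0 : rot k f r 0 = f r := by simp [rot, hr]
    have key := this (f := rot k f r) (hf.rotate hr) (by rwa [cyc_rotate f hr])
      (by rwa [cyc_rotate f hr]) (by omega : 0 < k) ?_ rfl
    · obtain ⟨g, hg, hgs⟩ := key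
      rw [cyc_rotate f hr, e0] at hgs
      exact ⟨g, hg, hgs⟩
    · rintro ⟨-, h⟩
      rw [e0] at h
      exact hrK ⟨hr, h⟩
  subst hr0
  suffices h : ∃ B ⊆ K ∪ (cyc k f \ {f 0}), B.Nonempty ∧ MinDegTwo G B by
    obtain ⟨B, hB, hne, hBm⟩ := h
    obtain ⟨-, g, hg, hgB⟩ := exists_cyc_of_minDegTwo hG hBm hne
    exact ⟨g, hg, hgB.trans hB⟩
  have hKA : ∀ v ∈ K, v ∈ A := fun v hv => (hK.2.1 hv).1
  have hnbr : ∀ v ∈ K, ∀ w ∈ A, G.Adj v w → w ∈ K ∨ ∃ i ∈ Att G k f K, f i = w := by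
    intro v hv w hw hvw
    by_cases hc : w ∈ cyc k f
    · obtain ⟨i, hi, rfl⟩ := mem_cyc.1 hc
      exact .inr ⟨i, ⟨hi, v, hv, hvw⟩, rfl⟩
    · exact .inl (hK.2.2 v hv w ⟨hw, hc⟩ hvw)
  have hpos : ∀ i ∈ Att G k f K, 0 < i := fun i hi =>
    Nat.pos_of_ne_zero fun h0 => hrK (h0 ▸ hi)
  have hmem : ∀ i, 0 < i → i < k → f i ∈ cyc k f \ {f 0} := fun i hi hik =>
    ⟨mem_cyc.2 ⟨i, hik, rfl⟩, fun e => hi.ne' (hf.inj hik (by omega) e)⟩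
  by_cases hatt : (Att G k f K).Nonempty
  · have hfin : (Att G k f K).Finite := (Set.finite_lt_nat k).subset fun i hi => hi.1
    obtain ⟨a, ha, hamin⟩ := Set.exists_min_image _ id hfin hatt
    obtain ⟨b, hb, hbmax⟩ := Set.exists_max_image _ id hfin hatt
    simp only [id] at hamin hbmax
    have hB : K ∪ f '' Set.Icc a b ⊆ K ∪ (cyc k f \ {f 0}) := by
      refine Set.union_subset_union_right _ ?_
      rintro _ ⟨i, hi, rfl⟩
      exact hmem i (by have := hpos a ha; have := hi.1; omega)
          (by have := hb.1; have := hi.2; omega)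
    have hKdeg : ∀ v ∈ K, ∃ x ∈ K ∪ f '' Set.Icc a b, ∃ y ∈ K ∪ f '' Set.Icc a b,
        x ≠ y ∧ G.Adj v x ∧ G.Adj v y := by
      intro v hv
      obtain ⟨x, hx, y, hy, hxy, h1, h2⟩ := hA v (hKA v hv)
      have hin : ∀ w ∈ A, G.Adj v w → w ∈ K ∪ f '' Set.Icc a b := by
        intro w hw hvw
        rcases hnbr v hv w hw hvw with h | ⟨i, hi, rfl⟩
        · exact .inl h
        · exact .inr ⟨i, ⟨hamin i hi, hbmax i hi⟩, rfl⟩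
      exact ⟨x, hin x hx h1, y, hin y hy h2, hxy, h1, h2⟩
    rcases eq_or_lt_of_le (hamin b hb) with hab | hab
    · have key := exists_minDegTwo_of_almost (G := G) (B := K ∪ f '' Set.Icc a b)
        (a := f a) ?_ ?_
      · obtain ⟨C, hC, hC'⟩ := key
        exact ⟨C, hC.trans hB, hC'⟩
      · rintro v (hv | ⟨i, hi, rfl⟩) hva
        · exact hKdeg v hv
        · exact absurd (congrArg f (show i = a by have := hi.1; have := hi.2; omega)) hva
      · obtain ⟨x, hx⟩ := hK.1.1
        exact ⟨x, .inl hx, fun e => (hK.2.1 hx).2 (mem_cyc.2 ⟨a, ha.1, e.symm⟩)⟩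
    · refine ⟨_, hB, hK.1.1.mono Set.subset_union_left, ?_⟩
      have hbk := hb.1
      have hsucc : ∀ i, i + 1 < k → G.Adj (f i) (f (i + 1)) := fun i hi =>
        (hf i (i + 1) (by omega) hi).2.2 (.inl rfl)
      rintro v (hv | ⟨i, hi, rfl⟩)
      · exact hKdeg v hv
      have hi1 := hi.1
      have hi2 := hi.2
      by_cases hia : i = a
      · subst hia
        obtain ⟨-, x, hx, hxa⟩ := ha
        refine ⟨x, .inl hx, f (i + 1), .inr ⟨i + 1, ⟨by omega, by omega⟩, rfl⟩, ?_, hxa.symm,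
          hsucc i (by omega)⟩
        exact fun e => (hK.2.1 hx).2 (mem_cyc.2 ⟨i + 1, by omega, e.symm⟩)
      obtain ⟨j, rfl⟩ : ∃ j, i = j + 1 := ⟨i - 1, by omega⟩
      by_cases hib : j + 1 = b
      · obtain ⟨-, x, hx, hxb⟩ := hb
        rw [← hib] at hxb
        refine ⟨x, .inl hx, f j, .inr ⟨j, ⟨by omega, by omega⟩, rfl⟩, ?_, hxb.symm,
          (hsucc j (by omega)).symm⟩
        exact fun e => (hK.2.1 hx).2 (mem_cyc.2 ⟨j, by omega, e.symm⟩)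
      · refine ⟨f j, .inr ⟨j, ⟨by omega, by omega⟩, rfl⟩, f (j + 1 + 1),
          .inr ⟨j + 1 + 1, ⟨by omega, by omega⟩, rfl⟩, (hf j (j + 1 + 1) (by omega) (by omega)).1,
          (hsucc j (by omega)).symm, hsucc _ (by omega)⟩
  · refine ⟨K, Set.subset_union_left, hK.1.1, fun v hv => ?_⟩
    obtain ⟨x, hx, y, hy, hxy, h1, h2⟩ := hA v (hKA v hv)
    have hin : ∀ w ∈ A, G.Adj v w → w ∈ K := by
      intro w hw hvw
      rcases hnbr v hv w hw hvw with h | ⟨i, hi, -⟩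
      · exact h
      · exact absurd ⟨i, hi⟩ hatt
    exact ⟨x, hin x hx h1, y, hin y hy h2, hxy, h1, h2⟩

/-- If `K` is maximal among the components left by cycles of a certain kind, its attachments are
attachments of every other component. -/
lemma att_subset_of_maximal (hk : 3 ≤ k) (hG : IsSC k G) {A K : Set V} (hA : MinDegTwo G A)
    {f : ℕ → V} (hf : IndCyc G k f) (hfA : cyc k f ⊆ A) (hK : IsComp G (A \ cyc k f) K)
    (hmax : ∀ g, IndCyc G k g → cyc k g ⊆ A → ∀ K', IsComp G (A \ cyc k g) K' → ¬ K ⊂ K')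
    {K' : Set V} (hK' : IsComp G (A \ cyc k f) K') (hne : K ≠ K') :
    Att G k f K ⊆ Att G k f K' := by
  intro r hr
  by_contra hrK'
  obtain ⟨g, hg, hgs⟩ := exists_cyc_avoiding hk hG hA hf hfA hK' hr.1 hrK'
  have hdisj := hK.disjoint hK' hne
  have hgA : cyc k g ⊆ A := hgs.trans (Set.union_subset (fun x hx => (hK'.2.1 hx).1)
    (fun x hx => hfA hx.1))
  obtain ⟨hrk, x, hx, hxr⟩ := hr
  have hsub : insert (f r) K ⊆ A \ cyc k g := by
    rintro v (rfl | hv)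
    · refine ⟨hfA (mem_cyc.2 ⟨r, hrk, rfl⟩), fun h => ?_⟩
      rcases hgs h with h | h
      · exact (hK'.2.1 h).2 (mem_cyc.2 ⟨r, hrk, rfl⟩)
      · exact h.2 rfl
    · refine ⟨(hK.2.1 hv).1, fun h => ?_⟩
      rcases hgs h with h | h
      · exact Set.disjoint_left.1 hdisj hv h
      · exact (hK.2.1 hv).2 h.1
  have hconn := hK.1.insert_of_adj hx hxr.symm
  obtain ⟨K2, hK2, hmem⟩ := exists_isComp (G := G) (hsub (Set.mem_insert _ _))
  have hK2sub := hconn.subset_of_closedIn hsub hK2.2 ⟨f r, Set.mem_insert _ _, hmem⟩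
  refine hmax g hg hgA K2 hK2 ⟨(Set.subset_insert _ _).trans hK2sub, fun h => ?_⟩
  exact (hK.2.1 (h hmem)).2 (mem_cyc.2 ⟨r, hrk, rfl⟩)

/-- The vertices of degree at least three of the cycle `f`, and the vertex `r` if it is on the
cycle, are at one position, or at two positions that are adjacent or antipodal. -/
def PendantAt (G : SimpleGraph V) (k : ℕ) (A : Set V) (r : V) (f : ℕ → V) : Prop :=
  IndCyc G k f ∧ cyc k f ⊆ A ∧ ∃ p < k, ∃ q < k, (p = q ∨ GoodPos k p q) ∧
    ∀ i < k, 3 ≤ degIn G A (f i) ∨ f i = r → i = p ∨ i = q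

omit [Finite V] in
/-- If a component `K` of the complement of a cycle is attached at no position, or only at one, one
may pass to the rest, with the attachment as the new root. -/
lemma exists_pendantAt_of_att_subsingleton (hk : 3 ≤ k) {A K : Set V} (hA : MinDegTwo G A)
    {f : ℕ → V} (hf : IndCyc G k f) (hfA : cyc k f ⊆ A) (hK : IsComp G (A \ cyc k f) K) {a : ℕ}
    (ha : a < k) (hatt : ∀ i ∈ Att G k f K, i = a)
    (ih : ∀ A' ⊂ A, MinDegTwo G A' → A'.Nonempty → ∀ r, ∃ g, PendantAt G k A' r g) {r : V}
    (hr : r ∈ K ∨ r = f a) : ∃ g, PendantAt G k A r g := by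
  have hcK : ∀ i < k, f i ∉ K := fun i hi h => (hK.2.1 h).2 (mem_cyc.2 ⟨i, hi, rfl⟩)
  have hnb : ∀ v ∈ A \ K, v ≠ f a → ∀ w ∈ A, G.Adj v w → w ∈ A \ K := by
    intro v hv hva w hw hvw
    refine ⟨hw, fun hwK => ?_⟩
    by_cases hc : v ∈ cyc k f
    · obtain ⟨i, hi, rfl⟩ := mem_cyc.1 hc
      exact hva (by rw [hatt i ⟨hi, w, hwK, hvw.symm⟩])
    · exact hv.2 (hK.2.2 w hwK v ⟨hv.1, hc⟩ hvw.symm)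
  have hss : A \ K ⊂ A := by
    refine ⟨Set.sdiff_subset, fun h => ?_⟩
    obtain ⟨x, hx⟩ := hK.1.1
    exact (h (hK.2.1 hx).1).2 hx
  have hfsub : cyc k f ⊆ A \ K := by
    intro x hx
    obtain ⟨i, hi, rfl⟩ := mem_cyc.1 hx
    exact ⟨hfA hx, hcK i hi⟩
  have key := ih (A \ K) hss ?_ ⟨f a, hfsub (mem_cyc.2 ⟨a, ha, rfl⟩)⟩ (f a)
  · obtain ⟨g, hg, hgs, p, hp, q, hq, hpq, hT⟩ := key
    refine ⟨g, hg, hgs.trans hss.1, p, hp, q, hq, hpq, fun i hi h => hT i hi ?_⟩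
    have hgi : g i ∈ A \ K := hgs (mem_cyc.2 ⟨i, hi, rfl⟩)
    by_cases hga : g i = f a
    · exact .inr hga
    rcases h with h | h
    · left
      rwa [degIn_congr (B := A)]
      exact fun w hw => ⟨fun h => h.1, fun h => hnb _ hgi hga w h hw⟩
    · rcases hr with hr | hr
      · exact absurd (h ▸ hr) hgi.2
      · exact absurd (h.trans hr) hga
  · intro v hv
    by_cases hva : v = f a
    · subst hva
      obtain ⟨x, hx, y, hy, h⟩ := hf.minDegTwo hk (f a) (mem_cyc.2 ⟨a, ha, rfl⟩)
      exact ⟨x, hfsub hx, y, hfsub hy, h⟩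
    · obtain ⟨x, hx, y, hy, hxy, h1, h2⟩ := hA v hv.1
      exact ⟨x, hnb v hv hva x hx h1, y, hnb v hv hva y hy h2, hxy, h1, h2⟩

/-- A set of minimum degree two contains a cycle whose vertices of degree at least three, together
with a prescribed root, are at adjacent or antipodal positions. The cycle is chosen such that a
component of its complement (containing the root, if some cycle avoids the root) is as large as
possible. -/
theorem exists_pendantAt (hk : 5 ≤ k) (hG : IsSC k G) {A : Set V} (hA : MinDegTwo G A)
    (hne : A.Nonempty) (r : V) : ∃ f, PendantAt G k A r f := by
  induction hn : A.ncard using Nat.strong_induction_on generalizing A r with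
  | _ N ih =>
  subst hn
  have ih' : ∀ A' ⊂ A, MinDegTwo G A' → A'.Nonempty → ∀ r, ∃ g, PendantAt G k A' r g :=
    fun A' h hA' hne' r => ih _ (Set.ncard_lt_ncard h (Set.toFinite _)) hA' hne' r rfl
  wlog hr : r ∈ A generalizing r
  · obtain ⟨r', hr'⟩ := hne
    obtain ⟨f, hf, hfA, p, hp, q, hq, hpq, hT⟩ := this r' hr'
    refine ⟨f, hf, hfA, p, hp, q, hq, hpq, fun i hi h => hT i hi (h.imp_right fun e => ?_)⟩
    exact absurd (e ▸ hfA (mem_cyc.2 ⟨i, hi, rfl⟩)) hr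
  have hk3 : 3 ≤ k := by omega
  -- the vertices of degree at least three have neighbours outside the cycle
  have hout : ∀ f, IndCyc G k f → cyc k f ⊆ A → ∀ i < k, 3 ≤ degIn G A (f i) →
      ∃ K, IsComp G (A \ cyc k f) K ∧ i ∈ Att G k f K := by
    intro f hf hfA i hi hdeg
    obtain ⟨a, ha, b, hb, hab, h1, h2, hall⟩ := hf.exists_nbrs hk3 hi
    have : ∃ w ∈ A \ cyc k f, G.Adj (f i) w := by
      by_contra! hno
      have hsub : {w : V | w ∈ A ∧ G.Adj (f i) w} ⊆ {f a, f b} := by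
        rintro w ⟨hwA, hw⟩
        by_cases hc : w ∈ cyc k f
        · obtain ⟨j, hj, rfl⟩ := mem_cyc.1 hc
          rcases hall j hj hw with rfl | rfl <;> simp
        · exact absurd hw (hno w ⟨hwA, hc⟩)
      have h3 := Set.ncard_le_ncard hsub (Set.toFinite _)
      have h4 := Set.ncard_pair (fun e => hab (hf.inj ha hb e) : f a ≠ f b)
      unfold degIn at hdeg
      omega
    obtain ⟨w, hw, hadj⟩ := this
    obtain ⟨K, hK, hwK⟩ := exists_isComp (G := G) hw
    exact ⟨K, hK, hi, w, hwK, hadj.symm⟩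
  have hdisj : ∀ {f : ℕ → V} {K : Set V}, IsComp G (A \ cyc k f) K → Disjoint K (cyc k f) :=
    fun hK => Set.disjoint_left.2 fun x hx => (hK.2.1 hx).2
  -- the cycle with a component attached at two positions and contained in all other attachments
  have hfinal : ∀ f K, IndCyc G k f → cyc k f ⊆ A → IsComp G (A \ cyc k f) K →
      (∀ K', IsComp G (A \ cyc k f) K' → K ≠ K' → Att G k f K ⊆ Att G k f K') →
      ∀ a b, a ∈ Att G k f K → b ∈ Att G k f K → a ≠ b →
      (∀ i < k, f i = r → i = a ∨ i = b) → PendantAt G k A r f := by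
    intro f K hf hfA hK hsub a b ha hb hab hroot
    have htwo : ∀ K', IsComp G (A \ cyc k f) K' → Att G k f K' ⊆ {a, b} := by
      intro K' hK' c hc
      have haK' : a ∈ Att G k f K' ∧ b ∈ Att G k f K' := by
        by_cases h : K = K'
        · exact h ▸ ⟨ha, hb⟩
        · exact ⟨hsub K' hK' h ha, hsub K' hK' h hb⟩
      by_contra hcab
      simp only [Set.mem_insert_iff, Set.mem_singleton_iff, not_or] at hcab
      exact not_three_att hk hG hf hK'.1 (hdisj hK') haK'.1 haK'.2 hc hab (Ne.symm hcab.2)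
        (Ne.symm hcab.1)
    refine ⟨hf, hfA, a, ha.1, b, hb.1, .inr ?_, fun i hi h => ?_⟩
    · refine goodPos_of_att_eq_pair hk hG hf hK.1 (hdisj hK) hab ((htwo K hK).antisymm ?_)
      rintro c (rfl | rfl)
      · exact ha
      · exact hb
    · rcases h with h | h
      · obtain ⟨K', hK', hi'⟩ := hout f hf hfA i hi h
        exact htwo K' hK' hi'
      · exact hroot i hi h
  by_cases hroot : ∃ f, IndCyc G k f ∧ cyc k f ⊆ A \ {r}
  · -- a cycle avoiding the root, with largest component containing the root
    let 𝒦 : Set (Set V) := {K | r ∈ K ∧ ∃ f, IndCyc G k f ∧ cyc k f ⊆ A ∧ IsComp G (A \ cyc k f) K}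
    have hne𝒦 : 𝒦.Nonempty := by
      obtain ⟨f, hf, hfA⟩ := hroot
      obtain ⟨K, hK, hrK⟩ := exists_isComp (G := G) (A := A \ cyc k f) (x := r)
        ⟨hr, fun h => (hfA h).2 rfl⟩
      exact ⟨K, hrK, f, hf, hfA.trans Set.sdiff_subset, hK⟩
    obtain ⟨K, hKmax⟩ := (Set.toFinite 𝒦).exists_maximal hne𝒦
    obtain ⟨hrK, f, hf, hfA, hK⟩ := hKmax.prop
    have hsub : ∀ K', IsComp G (A \ cyc k f) K' → K ≠ K' → Att G k f K ⊆ Att G k f K' := by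
      intro K' hK' hKK'
      refine att_subset_of_maximal hk3 hG hA hf hfA hK ?_ hK' hKK'
      intro g hg hgA K2 hK2 hlt
      exact hKmax.not_prop_of_gt hlt ⟨hlt.1 hrK, g, hg, hgA, hK2⟩
    have hrf : ∀ i < k, f i ≠ r := fun i hi e => (hK.2.1 hrK).2 (mem_cyc.2 ⟨i, hi, e⟩)
    by_cases hss : (Att G k f K).Subsingleton
    · obtain ⟨a, ha, haK⟩ : ∃ a < k, ∀ i ∈ Att G k f K, i = a := by
        rcases hss.eq_empty_or_singleton with h | ⟨a, h⟩
        · exact ⟨0, by omega, fun i hi => by rw [h] at hi; exact hi.elim⟩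
        · exact ⟨a, (h ▸ rfl : a ∈ Att G k f K).1, fun i hi => by rw [h] at hi; exact hi⟩
      exact exists_pendantAt_of_att_subsingleton hk3 hA hf hfA hK ha haK ih' (.inl hrK)
    · obtain ⟨a, ha, b, hb, hab⟩ := Set.not_subsingleton_iff.1 hss
      exact ⟨f, hfinal f K hf hfA hK hsub a b ha hb hab fun i hi e => absurd e (hrf i hi)⟩
  · -- every cycle runs through the root
    have hthru : ∀ f, IndCyc G k f → cyc k f ⊆ A → r ∈ cyc k f := by
      intro f hf hfA
      by_contra h
      exact hroot ⟨f, hf, fun x hx => ⟨hfA hx, fun e => h ((Set.mem_singleton_iff.1 e) ▸ hx)⟩⟩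
    let 𝒦 : Set (Set V) := {K | ∃ f, IndCyc G k f ∧ cyc k f ⊆ A ∧ IsComp G (A \ cyc k f) K}
    obtain ⟨-, f0, hf0, hfA0⟩ := exists_cyc_of_minDegTwo hG hA hne
    by_cases hne𝒦 : 𝒦.Nonempty
    · obtain ⟨K, hKmax⟩ := (Set.toFinite 𝒦).exists_maximal hne𝒦
      obtain ⟨f, hf, hfA, hK⟩ := hKmax.prop
      have hsub : ∀ K', IsComp G (A \ cyc k f) K' → K ≠ K' → Att G k f K ⊆ Att G k f K' := by
        intro K' hK' hKK'
        refine att_subset_of_maximal hk3 hG hA hf hfA hK ?_ hK' hKK'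
        intro g hg hgA K2 hK2 hlt
        exact hKmax.not_prop_of_gt hlt ⟨g, hg, hgA, hK2⟩
      obtain ⟨a, ha, har⟩ := mem_cyc.1 (hthru f hf hfA)
      -- otherwise there is a cycle that avoids the root
      have haK : a ∈ Att G k f K := by
        by_contra haK
        obtain ⟨g, hg, hgs⟩ := exists_cyc_avoiding hk3 hG hA hf hfA hK ha haK
        have hgA : cyc k g ⊆ A := hgs.trans (Set.union_subset (fun x hx => (hK.2.1 hx).1)
          (fun x hx => hfA hx.1))
        rcases hgs (hthru g hg hgA) with h | h
        · exact (hK.2.1 h).2 (mem_cyc.2 ⟨a, ha, har⟩)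
        · exact h.2 har.symm
      by_cases hss : ∀ i ∈ Att G k f K, i = a
      · exact exists_pendantAt_of_att_subsingleton hk3 hA hf hfA hK ha hss ih' (.inr har.symm)
      · push Not at hss
        obtain ⟨b, hb, hba⟩ := hss
        refine ⟨f, hfinal f K hf hfA hK hsub a b haK hb hba.symm fun i hi e => .inl ?_⟩
        exact hf.inj hi ha (e.trans har.symm)
    · obtain ⟨a, ha, har⟩ := mem_cyc.1 (hthru f0 hf0 hfA0)
      refine ⟨f0, hf0, hfA0, a, ha, a, ha, .inl rfl, fun i hi h => ?_⟩
      rcases h with h | h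
      · obtain ⟨K, hK, -⟩ := hout f0 hf0 hfA0 i hi h
        exact absurd ⟨K, f0, hf0, hfA0, hK⟩ hne𝒦
      · exact .inl (hf0.inj hi ha (h.trans har.symm))

/-- Positions `0` and `q` of the cycle `f` in `A` are as in a pendant cycle, and all other
vertices of the cycle have degree two. -/
structure NiceCyc (G : SimpleGraph V) (k : ℕ) (A : Set V) (f : ℕ → V) (q : ℕ) : Prop where
  indCyc : IndCyc G k f
  subset : cyc k f ⊆ A
  lt : q < k
  kind : q = 0 ∨ q = 1 ∨ (Even k ∧ q = k / 2)
  deg : ∀ i < k, i ≠ 0 → i ≠ q → degIn G A (f i) = 2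

/-- Every nonempty set of minimum degree two contains a cycle that is a component or a pendant
cycle. -/
theorem exists_niceCyc (hk : 5 ≤ k) (hG : IsSC k G) {A : Set V} (hA : MinDegTwo G A)
    (hne : A.Nonempty) : ∃ f q, NiceCyc G k A f q ∧
      ((∀ i < k, degIn G A (f i) = 2) ∨ (3 ≤ degIn G A (f 0) ∧ 3 ≤ degIn G A (f q))) := by
  obtain ⟨r, -⟩ := id hne
  obtain ⟨f, hf, hfA, p, hp, q, hq, hpq, hT⟩ := exists_pendantAt hk hG hA hne r
  have h2 : ∀ i < k, 2 ≤ degIn G A (f i) := fun i hi =>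
    minDegTwo_iff_degIn.1 hA _ (hfA (mem_cyc.2 ⟨i, hi, rfl⟩))
  have hdeg : ∀ i < k, i ≠ p → i ≠ q → degIn G A (f i) = 2 := by
    intro i hi hip hiq
    have := h2 i hi
    by_contra h
    rcases hT i hi (.inl (by omega)) with h | h
    · exact hip h
    · exact hiq h
  have mk : ∀ a < k, ∀ d < k, (d = 0 ∨ d = 1 ∨ (Even k ∧ d = k / 2)) →
      (∀ i < k, i ≠ a → i ≠ a + d → i + k ≠ a + d → degIn G A (f i) = 2) →
      NiceCyc G k A (rot k f a) d := by
    intro a ha d hd hkind h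
    refine ⟨hf.rotate ha, by rwa [cyc_rotate f ha], hd, hkind, fun i hi h0 hid => ?_⟩
    unfold rot
    split_ifs with hlt
    · exact h _ (by omega) (by omega) (by omega) (by omega)
    · exact h _ (by omega) (by omega) (by omega) (by omega)
  have hrot : ∀ a < k, ∀ i < k, rot k f a i = f (if i + a < k then i + a else i + a - k) := by
    intro a ha i hi; unfold rot; split_ifs <;> rfl
  by_cases hall : ∀ i < k, degIn G A (f i) = 2
  · refine ⟨f, 0, ⟨hf, hfA, by omega, .inl rfl, fun i hi _ _ => hall i hi⟩, .inl hall⟩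
  -- one vertex of degree at least three
  have hone : ∀ a < k, (∀ i < k, i ≠ a → degIn G A (f i) = 2) → ∃ f q, NiceCyc G k A f q ∧
      ((∀ i < k, degIn G A (f i) = 2) ∨ (3 ≤ degIn G A (f 0) ∧ 3 ≤ degIn G A (f q))) := by
    intro a ha h
    have ha3 : 3 ≤ degIn G A (f a) := by
      have := h2 a ha
      by_contra hlt
      refine hall fun i hi => ?_
      by_cases hia : i = a
      · subst hia; omega
      · exact h i hi hia
    refine ⟨rot k f a, 0, mk a ha 0 (by omega) (.inl rfl) fun i hi h1 _ _ => h i hi h1, .inr ?_⟩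
    rw [hrot a ha 0 (by omega)]
    simpa [ha] using ha3
  by_cases hp3 : degIn G A (f p) = 2
  · exact hone q hq fun i hi hiq => by
      by_cases hip : i = p
      · rwa [hip]
      · exact hdeg i hi hip hiq
  by_cases hq3 : degIn G A (f q) = 2
  · exact hone p hp fun i hi hip => by
      by_cases hiq : i = q
      · rwa [hiq]
      · exact hdeg i hi hip hiq
  have hp3' : 3 ≤ degIn G A (f p) := by have := h2 p hp; omega
  have hq3' : 3 ≤ degIn G A (f q) := by have := h2 q hq; omega
  have htwo : ∀ a < k, ∀ b < k, ∀ d < k, (d = 0 ∨ d = 1 ∨ (Even k ∧ d = k / 2)) →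
      (a + d = b ∨ a + d = b + k) → (∀ i < k, i ≠ a → i ≠ b → degIn G A (f i) = 2) →
      3 ≤ degIn G A (f a) → 3 ≤ degIn G A (f b) → ∃ f q, NiceCyc G k A f q ∧
      ((∀ i < k, degIn G A (f i) = 2) ∨ (3 ≤ degIn G A (f 0) ∧ 3 ≤ degIn G A (f q))) := by
    intro a ha b hb d hd hkind hab h ha3 hb3
    refine ⟨rot k f a, d, mk a ha d hd hkind fun i hi h1 h2 h3 => h i hi h1 (by omega), .inr ?_⟩
    rw [hrot a ha 0 (by omega), hrot a ha d hd]
    refine ⟨by simpa [ha] using ha3, ?_⟩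
    convert hb3 using 3
    split_ifs <;> omega
  rcases hpq with rfl | hpq
  · exact htwo p hp p hp 0 (by omega) (.inl rfl) (by omega) hdeg hp3' hp3'
  · unfold GoodPos at hpq
    have hsw : ∀ i < k, i ≠ q → i ≠ p → degIn G A (f i) = 2 := fun i hi h1 h2 => hdeg i hi h2 h1
    by_cases hc1 : q = p + 1 ∨ (q = 0 ∧ p + 1 = k)
    · exact htwo p hp q hq 1 (by omega) (.inr (.inl rfl)) (by omega) hdeg hp3' hq3'
    by_cases hc2 : p = q + 1 ∨ (p = 0 ∧ q + 1 = k)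
    · exact htwo q hq p hp 1 (by omega) (.inr (.inl rfl)) (by omega) hsw hq3' hp3'
    have hev : Even k := by
      rw [Nat.even_iff]; omega
    exact htwo p hp q hq (k / 2) (by omega) (.inr (.inr ⟨hev, rfl⟩)) (by
      have := Nat.even_iff.1 hev; omega) hdeg hp3' hq3'

end Pendant

/-! ### Optimality of the values of the recursion -/

/-- Deleting `S` from the subgraph induced on `A` leaves a forest. -/
def Hits {V : Type*} (G : SimpleGraph V) (A S : Set V) : Prop := core G (A \ S) = ∅

section Recursion

variable {V : Type*} {G : SimpleGraph V} {k : ℕ}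

lemma hits_iff {A S : Set V} : Hits G A S ↔ ∀ B ⊆ A \ S, MinDegTwo G B → B = ∅ :=
  core_eq_empty_iff

lemma Hits.anti {A B S : Set V} (h : Hits G A S) (hB : B ⊆ A) : Hits G B S :=
  hits_iff.2 fun C hC => hits_iff.1 h C (hC.trans (Set.sdiff_subset_sdiff_left hB))

lemma CycleHitRec.subset {A S : Set V} (h : CycleHitRec k G A S) : S ⊆ A := by
  induction h with
  | empty => exact subset_rfl
  | single x => exact Set.empty_subset _
  | cycle c i => rintro _ rfl; exact ⟨i, rfl⟩
  | components _ _ _ _ _ _ h1 h2 => exact Set.union_subset_union h1 h2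
  | pendantVertex _ _ _ h => exact h.trans Set.sdiff_subset
  | oneAttachment _ hc _ h =>
    exact Set.union_subset (Set.singleton_subset_iff.2 (hc.subset ⟨_, rfl⟩))
      (h.trans Set.sdiff_subset)
  | twoAttachmentsLeft _ _ hc _ _ _ h1 h2 =>
    exact Set.union_subset (Set.singleton_subset_iff.2 (hc.subset ⟨_, rfl⟩))
      (h1.trans Set.sdiff_subset)
  | twoAttachmentsRight _ _ hc _ _ _ h1 h2 =>
    exact Set.union_subset (Set.singleton_subset_iff.2 (hc.subset ⟨_, rfl⟩))
      (h2.trans Set.sdiff_subset)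

section Propagate

variable [Finite V] {A B : Set V} {f : ℕ → V}

/-- A set of minimum degree two containing a vertex of degree two contains its neighbours. -/
lemma MinDegTwo.mem_of_adj (hB : MinDegTwo G B) (hBA : B ⊆ A) {v w : V} (hv : v ∈ B)
    (hd : degIn G A v ≤ 2) (hw : w ∈ A) (hvw : G.Adj v w) : w ∈ B := by
  obtain ⟨x, hx, y, hy, hxy, h1, h2⟩ := hB v hv
  rcases eq_or_eq_of_degIn_le_two hd (hBA hx) (hBA hy) hxy h1 h2 hw hvw with rfl | rfl
  · exact hx
  · exact hy

/-- A set of minimum degree two that meets a pendant cycle outside the attachment vertices contains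
these. -/
lemma NiceCyc.propagate {q : ℕ} (hf : NiceCyc G k A f q) (hB : MinDegTwo G B) (hBA : B ⊆ A)
    {w : ℕ} (hw : w < k) (hwB : f w ∈ B) (hw0 : w ≠ 0) (hwq : w ≠ q) : f 0 ∈ B ∧ f q ∈ B := by
  have hmemA : ∀ i < k, f i ∈ A := fun i hi => hf.subset (mem_cyc.2 ⟨i, hi, rfl⟩)
  have hq := hf.lt
  have down : ∀ d i, i + d < k → f (i + d) ∈ B → (∀ j, i < j → j ≤ i + d → j ≠ q) → f i ∈ B := by
    intro d
    induction d with
    | zero => intro i _ h _; exact h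
    | succ d ih =>
      intro i hi h hne
      refine ih i (by omega) ?_ fun j h1 h2 => hne j h1 (by omega)
      refine hB.mem_of_adj hBA h (hf.deg _ hi (by omega) (hne _ (by omega) le_rfl)).le
        (hmemA _ (by omega)) ?_
      exact ((hf.indCyc (i + d) (i + (d + 1)) (by omega) hi).2.2 (.inl (by omega))).symm
  have up : ∀ d i, i + d < k → f i ∈ B → (∀ j, i ≤ j → j < i + d → j ≠ q ∧ j ≠ 0) →
      f (i + d) ∈ B := by
    intro d
    induction d with
    | zero => intro i _ h _; exact h
    | succ d ih =>
      intro i hi h hne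
      have := hne (i + d) (by omega) (by omega)
      refine hB.mem_of_adj hBA (ih i (by omega) h fun j h1 h2 => hne j h1 (by omega))
        (hf.deg _ (by omega) this.2 this.1).le (hmemA _ (by omega)) ?_
      exact (hf.indCyc (i + d) (i + (d + 1)) (by omega) hi).2.2 (.inl (by omega))
  rcases lt_or_gt_of_ne hwq with h | h
  · refine ⟨down w 0 (by omega) (by simpa using hwB) fun j _ _ => by omega, ?_⟩
    have := up (q - w) w (by omega) hwB fun j _ _ => by omega
    rwa [show w + (q - w) = q by omega] at this
  · have h1 := down (w - q) q (by omega) (by rwa [show q + (w - q) = w by omega])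
      fun j _ _ => by omega
    refine ⟨?_, h1⟩
    have h2 := up (k - 1 - w) w (by omega) hwB fun j _ _ => by omega
    rw [show w + (k - 1 - w) = k - 1 by omega] at h2
    refine hB.mem_of_adj hBA h2 (hf.deg _ (by omega) (by omega) (by omega)).le
      (hmemA _ (by omega)) ?_
    exact ((hf.indCyc 0 (k - 1) (by omega) (by omega)).2.2 (.inr ⟨rfl, by omega⟩)).symm

/-- After an attachment vertex of a pendant cycle is deleted, no cycle runs through the vertices of
degree two of the pendant cycle. -/
lemma NiceCyc.disjoint_of_notMem {q : ℕ} (hf : NiceCyc G k A f q) (hB : MinDegTwo G B)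
    (hBA : B ⊆ A) (h : f 0 ∉ B ∨ f q ∉ B) {x : V} (hx : x ∈ cyc k f) (hxB : x ∈ B) :
    x = f 0 ∨ x = f q := by
  obtain ⟨w, hw, rfl⟩ := mem_cyc.1 hx
  by_contra! hne
  have := hf.propagate hB hBA hw hxB (fun e => hne.1 (by rw [e])) (fun e => hne.2 (by rw [e]))
  tauto

/-- A transversal may be assumed to contain an attachment vertex of a given pendant cycle: any
other vertex of the cycle can be exchanged for one. -/
lemma NiceCyc.exchange (hk : 3 ≤ k) {q : ℕ} (hf : NiceCyc G k A f q) {T : Set V}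
    (hT : Hits G A T) : ∃ T', Hits G A T' ∧ T'.ncard ≤ T.ncard ∧ (f 0 ∈ T' ∨ f q ∈ T') := by
  by_cases h0 : f 0 ∈ T ∨ f q ∈ T
  · exact ⟨T, hT, le_rfl, h0⟩
  push Not at h0
  obtain ⟨w, hw, hwT⟩ : ∃ w < k, f w ∈ T := by
    by_contra! hno
    have := hits_iff.1 hT (cyc k f) (fun x hx => ⟨hf.subset hx, ?_⟩) (hf.indCyc.minDegTwo hk)
    · have h0 : f 0 ∈ cyc k f := mem_cyc.2 ⟨0, by omega, rfl⟩
      rw [this] at h0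
      exact h0
    · obtain ⟨i, hi, rfl⟩ := mem_cyc.1 hx
      exact hno i hi
  refine ⟨insert (f 0) (T \ {f w}), hits_iff.2 fun B hB hBm => ?_, ?_, .inl (Set.mem_insert _ _)⟩
  · have hBA : B ⊆ A := hB.trans Set.sdiff_subset
    have h0B : f 0 ∉ B := fun h => (hB h).2 (Set.mem_insert _ _)
    refine hits_iff.1 hT B (fun x hx => ⟨hBA hx, fun hxT => ?_⟩) hBm
    by_cases hxw : x = f w
    · subst hxw
      rcases hf.disjoint_of_notMem hBm hBA (.inl h0B) (mem_cyc.2 ⟨w, hw, rfl⟩) hx with e | e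
      · exact h0.1 (e ▸ hxT)
      · exact h0.2 (e ▸ hxT)
    · exact (hB hx).2 (Set.mem_insert_of_mem _ ⟨hxT, hxw⟩)
  · have h1 := Set.ncard_insert_le (f 0) (T \ {f w})
    have h2 := Set.ncard_sdiff_singleton_lt_of_mem hwT
    omega

/-- What remains of `A` when the attachment vertex `u` of a pendant cycle is chosen, the other one
being `v`: the cycle is deleted except for `v`. -/
def branch (k : ℕ) (A : Set V) (f : ℕ → V) (u v : V) : Set V := A \ (insert u (cyc k f \ {v}))

omit [Finite V] in
lemma branch_subset {u v : V} : branch k A f u v ⊆ A \ {u} :=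
  fun _ hx => ⟨hx.1, fun e => hx.2 (.inl e)⟩

/-- The attachment vertices of a pendant cycle, in either order. -/
def Ends (f : ℕ → V) (q : ℕ) (u v : V) : Prop := (u = f 0 ∧ v = f q) ∨ (u = f q ∧ v = f 0)

omit [Finite V] in
lemma Ends.mem_cyc {q : ℕ} {u v : V} (h : Ends f q u v) (hq : q < k) :
    u ∈ cyc k f ∧ v ∈ cyc k f := by
  rcases h with ⟨rfl, rfl⟩ | ⟨rfl, rfl⟩
  · exact ⟨_root_.mem_cyc.2 ⟨0, by omega, rfl⟩, _root_.mem_cyc.2 ⟨q, hq, rfl⟩⟩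
  · exact ⟨_root_.mem_cyc.2 ⟨q, hq, rfl⟩, _root_.mem_cyc.2 ⟨0, by omega, rfl⟩⟩

lemma NiceCyc.subset_branch {q : ℕ} (hf : NiceCyc G k A f q) {u v : V} (h : Ends f q u v)
    (hB : MinDegTwo G B) (hBA : B ⊆ A \ {u}) : B ⊆ branch k A f u v := by
  intro x hx
  refine ⟨(hBA hx).1, ?_⟩
  rintro (rfl | ⟨hxc, hxv⟩)
  · exact (hBA hx).2 rfl
  · have hu : u ∉ B := fun h => (hBA h).2 rfl
    have := hf.disjoint_of_notMem hB (hBA.trans Set.sdiff_subset)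
      (by rcases h with ⟨rfl, rfl⟩ | ⟨rfl, rfl⟩ <;> simp [hu]) hxc hx
    have hxu : x ≠ u := fun e => hu (e ▸ hx)
    have hxv' : x ≠ v := hxv
    rcases h with ⟨rfl, rfl⟩ | ⟨rfl, rfl⟩ <;> tauto

lemma NiceCyc.core_branch {q : ℕ} (hf : NiceCyc G k A f q) {u v : V} (h : Ends f q u v) :
    core G (branch k A f u v) = core G (A \ {u}) :=
  (core_mono branch_subset).antisymm ((minDegTwo_core _).subset_core
    (hf.subset_branch h (minDegTwo_core _) (core_subset _)))

lemma NiceCyc.hits_insert {q : ℕ} (hf : NiceCyc G k A f q) {u v : V} (h : Ends f q u v)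
    {S : Set V} (hS : Hits G (branch k A f u v) S) : Hits G A ({u} ∪ S) := by
  refine hits_iff.2 fun B hB hBm => hits_iff.1 hS B (fun x hx => ⟨?_, fun hxS => ?_⟩) hBm
  · exact hf.subset_branch h hBm (fun y hy => ⟨(hB hy).1, fun e => (hB hy).2 (.inl e)⟩) hx
  · exact (hB hx).2 (.inr hxS)

omit [Finite V] in
lemma Hits.sdiff_singleton {T C : Set V} {u : V} (hT : Hits G A T) (hC : C ⊆ A \ {u}) :
    Hits G C (T \ {u}) := by
  refine hits_iff.2 fun B hB hBm => hits_iff.1 hT B (fun x hx => ⟨(hC (hB hx).1).1,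
      fun h => ?_⟩) hBm
  exact (hB hx).2 ⟨h, (hC (hB hx).1).2⟩

/-- `S` is a smallest transversal of the cycles of the subgraph induced on `A`. -/
def IsOpt (G : SimpleGraph V) (A S : Set V) : Prop := IsMinCard (Hits G A) S

/-- The better one of the two branches at a pendant cycle is optimal. -/
lemma NiceCyc.isOpt_insert (hk : 3 ≤ k) {q : ℕ} (hf : NiceCyc G k A f q) {u v : V}
    (h : Ends f q u v) {S T : Set V} (hS : IsOpt G (branch k A f u v) S)
    (hT : IsOpt G (branch k A f v u) T) (hle : ({u} ∪ S).ncard ≤ ({v} ∪ T).ncard) :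
    IsOpt G A ({u} ∪ S) := by
  refine ⟨hf.hits_insert h hS.1, fun T₀ hT₀ => ?_⟩
  obtain ⟨T', hT', hle', hmem⟩ := hf.exchange hk hT₀
  refine le_trans ?_ hle'
  have key : ∀ w (W C : Set V), IsOpt G C W → C ⊆ A \ {w} → w ∈ T' →
      ({w} ∪ W).ncard ≤ T'.ncard := by
    intro w W C hW hC hw
    have h1 := hW.2 _ (hT'.sdiff_singleton hC)
    have h2 := Set.ncard_sdiff_singleton_lt_of_mem hw
    have h3 := Set.ncard_insert_le w W
    rw [Set.singleton_union]
    omega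
  have hmem' : u ∈ T' ∨ v ∈ T' := by rcases h with ⟨rfl, rfl⟩ | ⟨rfl, rfl⟩ <;> tauto
  rcases hmem' with hm | hm
  · exact key u S _ hS branch_subset hm
  · exact hle.trans (key v T _ hT branch_subset hm)

end Propagate

section Optimal

variable [Finite V]

omit [Finite V] in
lemma IsPendantCycle.exists_niceCyc (hk : 3 ≤ k) {A : Set V} {c : cycleGraph k ↪g G}
    {p q : Fin k} (hc : IsPendantCycle G A c p q) :
    ∃ f, NiceCyc G k A f q ∧ (∀ i : Fin k, f i = c i) ∧ cyc k f = Set.range c ∧ f 0 = c p := by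
  obtain ⟨f, hf, hfc⟩ := exists_indCyc_of_embedding (by omega) c
  have hr := range_eq_cyc hfc
  have hp : p = ⟨0, by omega⟩ := Fin.ext hc.start
  refine ⟨f, ⟨hf, hr ▸ hc.subset, q.2, hc.kind, fun i hi h0 hq => ?_⟩, hfc, hr.symm, ?_⟩
  · have := hc.deg_other ⟨i, hi⟩ (fun e => h0 (by rw [← hc.start, ← e]))
      (fun e => hq (by rw [← e]))
    rwa [← hfc] at this
  · rw [hp, ← hfc]

omit [Finite V] in
lemma Hits.union_of_no_adj {A B S T : Set V}
    (hadj : ∀ a ∈ A, ∀ b ∈ B, ¬ G.Adj a b) (hS : Hits G A S) (hT : Hits G B T) :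
    Hits G (A ∪ B) (S ∪ T) := by
  refine hits_iff.2 fun C hC hCm => ?_
  have h1 : C ∩ A = ∅ := by
    refine hits_iff.1 hS _ (fun x hx => ⟨hx.2, fun h => (hC hx.1).2 (.inl h)⟩) ?_
    rintro v ⟨hv, hvA⟩
    obtain ⟨x, hx, y, hy, hxy, h1, h2⟩ := hCm v hv
    have : ∀ w ∈ C, G.Adj v w → w ∈ C ∩ A := fun w hw hvw =>
      ⟨hw, (hC hw).1.resolve_right fun hwB => hadj v hvA w hwB hvw⟩
    exact ⟨x, this x hx h1, y, this y hy h2, hxy, h1, h2⟩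
  have h2 : C ∩ B = ∅ := by
    refine hits_iff.1 hT _ (fun x hx => ⟨hx.2, fun h => (hC hx.1).2 (.inr h)⟩) ?_
    rintro v ⟨hv, hvB⟩
    obtain ⟨x, hx, y, hy, hxy, h1, h2⟩ := hCm v hv
    have : ∀ w ∈ C, G.Adj v w → w ∈ C ∩ B := fun w hw hvw =>
      ⟨hw, (hC hw).1.resolve_left fun hwA => hadj w hwA v hvB hvw.symm⟩
    exact ⟨x, this x hx h1, y, this y hy h2, hxy, h1, h2⟩
  have : C ⊆ A ∪ B := fun x hx => (hC hx).1
  rw [← Set.inter_eq_left.2 this, Set.inter_union_distrib_left, h1, h2, Set.union_empty]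

lemma core_sdiff_of_degIn_le_one {A : Set V} {x : V} (hx : degIn G A x ≤ 1) :
    core G (A \ {x}) = core G A := by
  refine (core_mono Set.sdiff_subset).antisymm ((minDegTwo_core A).subset_core fun y hy =>
    ⟨core_subset A hy, ?_⟩)
  rintro rfl
  have h1 := minDegTwo_iff_degIn.1 (minDegTwo_core A) _ hy
  have h2 := degIn_mono (G := G) (core_subset (G := G) A) y
  omega

/-- Every value of the recursion is a smallest transversal. -/
theorem CycleHitRec.isOpt (hk : 3 ≤ k) {A S : Set V} (h : CycleHitRec k G A S) : IsOpt G A S := by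
  have hsmall : ∀ (A : Set V), (∀ B ⊆ A, MinDegTwo G B → B = ∅) → IsOpt G A ∅ := fun A hA =>
    ⟨hits_iff.2 fun B hB => hA B (hB.trans Set.sdiff_subset), fun T _ => by simp⟩
  induction h with
  | empty => exact hsmall _ fun B hB _ => Set.subset_empty_iff.1 hB
  | single x =>
    refine hsmall _ fun B hB hBm => ?_
    by_contra hne
    obtain ⟨v, hv⟩ := Set.nonempty_iff_ne_empty.2 hne
    obtain ⟨y, hy, z, hz, hyz, -⟩ := hBm v hv
    exact hyz ((hB hy).trans (hB hz).symm)
  | cycle c i =>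
    obtain ⟨f, hf, hfc⟩ := exists_indCyc_of_embedding (by omega) c
    -- the cycle is treated as attached at the chosen vertex
    have hdeg : ∀ j < k, degIn G (Set.range c) (f j) = 2 := by
      intro j hj
      rw [range_eq_cyc hfc]
      obtain ⟨a, ha, b, hb, hab, h1, h2, hall⟩ := hf.exists_nbrs hk hj
      unfold degIn
      rw [Set.ncard_eq_two]
      refine ⟨f a, f b, fun e => hab (hf.inj ha hb e), Set.Subset.antisymm ?_ ?_⟩
      · rintro w ⟨hw, hjw⟩
        obtain ⟨l, hl, rfl⟩ := mem_cyc.1 hw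
        rcases hall l hl hjw with rfl | rfl <;> simp
      · rintro w (rfl | rfl)
        · exact ⟨mem_cyc.2 ⟨a, ha, rfl⟩, h1⟩
        · exact ⟨mem_cyc.2 ⟨b, hb, rfl⟩, h2⟩
    have hrot : rot k f i 0 = c i := by simp [rot, hfc]
    have hnice : NiceCyc G k (Set.range c) (rot k f i) 0 := by
      refine ⟨hf.rotate i.2, ?_, by omega, .inl rfl, fun j hj _ _ => ?_⟩
      · rw [cyc_rotate f i.2, range_eq_cyc hfc]
      · unfold rot; split_ifs <;> exact hdeg _ (by omega)
    have hbr : branch k (Set.range c) (rot k f i) (c i) (c i) = ∅ := by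
      unfold branch
      rw [cyc_rotate f i.2, range_eq_cyc hfc]
      ext x
      simp only [Set.mem_sdiff, Set.mem_insert_iff, Set.mem_singleton_iff, Set.mem_empty_iff_false]
      tauto
    have hS : IsOpt G (branch k (Set.range c) (rot k f i) (c i) (c i)) ∅ := by
      rw [hbr]; exact hsmall _ fun B hB _ => Set.subset_empty_iff.1 hB
    have := hnice.isOpt_insert hk (u := c i) (v := c i) (.inl ⟨hrot.symm, hrot.symm⟩) hS hS le_rfl
    simpa using this
  | @components A B S T hA hB hAB hadj hS hT ihS ihT =>
    refine ⟨ihS.1.union_of_no_adj hadj ihT.1, fun U hU => ?_⟩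
    have key : ∀ C, Hits G (A ∪ B) U → C ⊆ A ∪ B → Hits G C (U ∩ C) := by
      intro C hU hC
      refine hits_iff.2 fun D hD hDm => hits_iff.1 hU D (fun x hx => ⟨hC (hD hx).1,
          fun h => ?_⟩) hDm
      exact (hD hx).2 ⟨h, (hD hx).1⟩
    have h1 := ihS.2 _ (key A hU Set.subset_union_left)
    have h2 := ihT.2 _ (key B hU Set.subset_union_right)
    have h3 : (U ∩ A ∪ U ∩ B).ncard ≤ U.ncard :=
      Set.ncard_le_ncard (Set.union_subset Set.inter_subset_left Set.inter_subset_left)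
        (Set.toFinite _)
    rw [Set.ncard_union_eq (hAB.mono Set.inter_subset_right Set.inter_subset_right)
      (Set.toFinite _) (Set.toFinite _)] at h3
    have h4 := Set.ncard_union_le S T
    omega
  | @pendantVertex A S x μ hμ hx hS ih =>
    have hcore : ∀ T, Hits G A T ↔ Hits G (A \ {x}) T := by
      intro T
      refine ⟨fun h => h.anti Set.sdiff_subset, fun h => ?_⟩
      have hd : degIn G (A \ T) x ≤ 1 := (degIn_mono Set.sdiff_subset x).trans hx.2.le
      have := core_sdiff_of_degIn_le_one hd
      unfold Hits at *
      rw [← this, sdiff_sdiff_comm, h]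
    exact ⟨(hcore S).2 ih.1, fun T hT => ih.2 T ((hcore T).1 hT)⟩
  | @oneAttachment A S c p μ hμ hc hS ih =>
    obtain ⟨f, hf, hfc, hr, h0⟩ := hc.exists_niceCyc hk
    have hbr : branch k A f (c p) (c p) = A \ Set.range c := by
      unfold branch
      rw [hr, Set.insert_sdiff_singleton, Set.insert_eq_of_mem (Set.mem_range_self p)]
    rw [← hbr] at ih
    exact hf.isOpt_insert hk (.inl ⟨h0.symm, (hfc p).symm⟩) ih ih le_rfl
  | @twoAttachmentsLeft A S T c p q μ hμ hpq hc hS hT hle ihS ihT =>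
    obtain ⟨f, hf, hfc, hr, h0⟩ := hc.exists_niceCyc hk
    have hbr : ∀ i j : Fin k, i ≠ j →
        branch k A f (c i) (c j) = A \ (Set.range c \ {c j}) := by
      intro i j hij
      unfold branch
      rw [hr, Set.insert_eq_of_mem]
      exact ⟨⟨i, rfl⟩, fun e => hij (c.injective e)⟩
    rw [← hbr p q hpq] at ihS
    rw [← hbr q p hpq.symm] at ihT
    exact hf.isOpt_insert hk (.inl ⟨h0.symm, (hfc q).symm⟩) ihS ihT hle
  | @twoAttachmentsRight A S T c p q μ hμ hpq hc hS hT hle ihS ihT =>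
    obtain ⟨f, hf, hfc, hr, h0⟩ := hc.exists_niceCyc hk
    have hbr : ∀ i j : Fin k, i ≠ j →
        branch k A f (c i) (c j) = A \ (Set.range c \ {c j}) := by
      intro i j hij
      unfold branch
      rw [hr, Set.insert_eq_of_mem]
      exact ⟨⟨i, rfl⟩, fun e => hij (c.injective e)⟩
    rw [← hbr p q hpq] at ihS
    rw [← hbr q p hpq.symm] at ihT
    exact hf.isOpt_insert hk (.inr ⟨(hfc q).symm, h0.symm⟩) ihT ihS hle

end Optimal

end Recursion

/-! ### Existence of vertex cycle orderings -/

section Orderings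

variable {V : Type*} {G : SimpleGraph V} {k : ℕ}

lemma IndCyc.conn (hk : 3 ≤ k) {f : ℕ → V} (hf : IndCyc G k f) : Conn G (cyc k f) := by
  obtain ⟨n, rfl⟩ : ∃ n, k = n + 2 := ⟨k - 2, by omega⟩
  have h1 := (hf.indPath (m := n + 1) (by omega)).conn
  have h2 := h1.insert_of_adj (x := f (n + 1)) (mem_cyc.2 ⟨n, by omega, rfl⟩)
    ((hf n (n + 1) (by omega) (by omega)).2.2 (.inl rfl)).symm
  convert h2
  ext x
  simp only [mem_cyc, Set.mem_insert_iff]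
  constructor
  · rintro ⟨i, hi, rfl⟩
    by_cases he : i = n + 1
    · exact .inl (by rw [he])
    · exact .inr ⟨i, by omega, rfl⟩
  · rintro (rfl | ⟨i, hi, rfl⟩)
    · exact ⟨n + 1, by omega, rfl⟩
    · exact ⟨i, by omega, rfl⟩

/-- The vertices of the cycle `f` beyond position `q`. -/
def ear (k : ℕ) (f : ℕ → V) (q : ℕ) : Set V := f '' {i | q < i ∧ i < k}

lemma mem_ear {f : ℕ → V} {q : ℕ} {x : V} : x ∈ ear k f q ↔ ∃ i, q < i ∧ i < k ∧ f i = x := by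
  simp [ear, and_assoc]

lemma IndCyc.notMem_ear {f : ℕ → V} (hf : IndCyc G k f) {q i : ℕ} (hi : i < k) (hiq : i ≤ q) :
    f i ∉ ear k f q := by
  rw [mem_ear]
  rintro ⟨j, h1, h2, h3⟩
  have := hf.inj h2 hi h3
  omega

/-- Gluing an ear to a connected set. -/
lemma conn_of_sdiff_ear (hk : 3 ≤ k) {A : Set V} {f : ℕ → V} {q : ℕ} (hf : IndCyc G k f)
    (hfA : cyc k f ⊆ A) (h : Conn G (A \ ear k f q)) : Conn G A := by
  have hcyc : ∀ H, ClosedIn G A H → (cyc k f ∩ H).Nonempty → cyc k f ⊆ H := fun H hH hne =>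
    (hf.conn hk).subset_of_closedIn hfA hH hne
  have hear : ear k f q ⊆ cyc k f := fun x hx => by
    obtain ⟨i, -, hi, rfl⟩ := mem_ear.1 hx
    exact mem_cyc.2 ⟨i, hi, rfl⟩
  have h0c : f 0 ∈ cyc k f := mem_cyc.2 ⟨0, by omega, rfl⟩
  have h0 : f 0 ∈ A \ ear k f q := ⟨hfA h0c, hf.notMem_ear (by omega) (by omega)⟩
  refine ⟨h.1.mono Set.sdiff_subset, fun H hH hne => hH.1.antisymm ?_⟩
  have hmain : (A \ ear k f q ∩ H).Nonempty → A ⊆ H := by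
    intro hn
    have h1 := h.subset_of_closedIn Set.sdiff_subset hH hn
    have h2 := hcyc H hH ⟨f 0, h0c, h1 h0⟩
    intro x hx
    by_cases hxe : x ∈ ear k f q
    · exact h2 (hear hxe)
    · exact h1 ⟨hx, hxe⟩
  obtain ⟨x, hx⟩ := hne
  by_cases hxe : x ∈ ear k f q
  · exact hmain ⟨f 0, h0, hcyc H hH ⟨x, hear hxe, hx⟩ h0c⟩
  · exact hmain ⟨x, ⟨hH.1 hx, hxe⟩, hx⟩

variable [Finite V]

/-- Deleting the ear of a pendant cycle leaves a connected graph connected. -/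
lemma NiceCyc.conn_sdiff_ear (hk : 3 ≤ k) {A : Set V} {f : ℕ → V} {q : ℕ}
    (hf : NiceCyc G k A f q) (h : Conn G A) : Conn G (A \ ear k f q) := by
  have hq := hf.lt
  have hA : ∀ i < k, f i ∈ A := fun i hi => hf.subset (mem_cyc.2 ⟨i, hi, rfl⟩)
  have hrest : ∀ i ≤ q, f i ∈ A \ ear k f q := fun i hi =>
    ⟨hA i (by omega), hf.indCyc.notMem_ear (by omega) hi⟩
  -- the neighbours of the ear outside the ear are the two attachment vertices
  have hnbr : ∀ i, q < i → i < k → ∀ w ∈ A \ ear k f q, G.Adj (f i) w → w = f 0 ∨ w = f q := by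
    intro i hqi hi w hw hadj
    have hwc := hf.indCyc.mem_of_adj hk hf.subset hi (hf.deg i hi (by omega)
        (by omega)).le hw.1 hadj
    obtain ⟨j, hj, rfl⟩ := mem_cyc.1 hwc
    have hjq : j ≤ q := by
      by_contra hlt
      exact hw.2 (mem_ear.2 ⟨j, by omega, hj, rfl⟩)
    rw [hf.indCyc.adj_iff hi hj] at hadj
    by_cases h0 : j = 0
    · exact .inl (by rw [h0])
    · exact .inr (congrArg f (by omega))
  refine ⟨⟨f 0, hrest 0 (by omega)⟩, fun H hH hne => hH.1.antisymm ?_⟩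
  have hq0 : f q ∈ H → f 0 ∈ H := by
    have : ∀ d ≤ q, f q ∈ H → f (q - d) ∈ H := by
      intro d
      induction d with
      | zero => intro _ h; simpa using h
      | succ d ih =>
        intro hd h
        refine hH.2 _ (ih (by omega) h) _ (hrest _ (by omega)) ?_
        rw [hf.indCyc.adj_iff (by omega) (by omega)]; omega
    intro h
    simpa using this q le_rfl h
  by_cases h0 : f 0 ∈ H
  · have hqH : f q ∈ H := by
      have : ∀ d ≤ q, f d ∈ H := by
        intro d
        induction d with
        | zero => intro _; exact h0
        | succ d ih =>
          intro hd
          refine hH.2 _ (ih (by omega)) _ (hrest _ (by omega)) ?_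
          rw [hf.indCyc.adj_iff (by omega) (by omega)]; omega
      exact this q le_rfl
    have hcl : ClosedIn G A (H ∪ ear k f q) := by
      refine ⟨Set.union_subset (hH.1.trans Set.sdiff_subset) fun x hx => ?_, ?_⟩
      · obtain ⟨i, -, hi, rfl⟩ := mem_ear.1 hx
        exact hA i hi
      · intro a ha b hb hab
        by_cases hbe : b ∈ ear k f q
        · exact .inr hbe
        left
        rcases ha with ha | ha
        · exact hH.2 a ha b ⟨hb, hbe⟩ hab
        · obtain ⟨i, hqi, hi, rfl⟩ := mem_ear.1 ha
          rcases hnbr i hqi hi b ⟨hb, hbe⟩ hab with rfl | rfl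
          · exact h0
          · exact hqH
    have := h.2 _ hcl ⟨f 0, .inl h0⟩
    intro x hx
    exact (this ▸ hx.1 : x ∈ H ∪ ear k f q).resolve_right hx.2
  · have hcl : ClosedIn G A H := by
      refine ⟨hH.1.trans Set.sdiff_subset, fun a ha b hb hab => ?_⟩
      refine hH.2 a ha b ⟨hb, fun hbe => ?_⟩ hab
      obtain ⟨i, hqi, hi, rfl⟩ := mem_ear.1 hbe
      rcases hnbr i hqi hi a (hH.1 ha) hab.symm with rfl | rfl
      · exact h0 ha
      · exact h0 (hq0 ha)
    have := h.2 _ hcl hne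
    exact absurd (this ▸ hA 0 (by omega)) h0

omit [Finite V] in
lemma exists_adj_of_degIn_eq_one {A : Set V} {x : V} (h : degIn G A x = 1) :
    ∃ y ∈ A, G.Adj x y ∧ ∀ w ∈ A, G.Adj x w → w = y := by
  obtain ⟨y, hy⟩ := Set.ncard_eq_one.1 h
  have : y ∈ {w : V | w ∈ A ∧ G.Adj x w} := by rw [hy]; rfl
  refine ⟨y, this.1, this.2, fun w hw hxw => ?_⟩
  have hw' : w ∈ {w : V | w ∈ A ∧ G.Adj x w} := ⟨hw, hxw⟩
  rwa [hy] at hw'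

omit [Finite V] in
lemma Conn.sdiff_pendantVertex {A : Set V} (h : Conn G A) {x : V} (hx : IsPendantVertex G A x) :
    Conn G (A \ {x}) := by
  obtain ⟨y, hy, hxy, huniq⟩ := exists_adj_of_degIn_eq_one hx.2
  refine ⟨⟨y, hy, hxy.ne'⟩, fun H hH hne => hH.1.antisymm ?_⟩
  by_cases hyH : y ∈ H
  · have hcl : ClosedIn G A (insert x H) := by
      refine ⟨Set.insert_subset hx.1 (hH.1.trans Set.sdiff_subset), fun a ha b hb hab => ?_⟩
      by_cases hbx : b = x
      · exact .inl hbx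
      right
      rcases ha with rfl | ha
      · rwa [huniq b hb hab]
      · exact hH.2 a ha b ⟨hb, hbx⟩ hab
    have := h.2 _ hcl ⟨x, by simp⟩
    intro z hz
    exact (this ▸ hz.1 : z ∈ insert x H).resolve_left hz.2
  · have hcl : ClosedIn G A H := by
      refine ⟨hH.1.trans Set.sdiff_subset, fun a ha b hb hab => ?_⟩
      refine hH.2 a ha b ⟨hb, ?_⟩ hab
      rintro rfl
      exact hyH (huniq a (hH.1 ha).1 hab.symm ▸ ha)
    have := h.2 _ hcl hne
    exact absurd (this ▸ hx.1) fun h => (hH.1 h).2 rfl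

omit [Finite V] in
lemma IsVCO.conn (hk : 3 ≤ k) {A : Set V} {μ : List (Set V)} (h : IsVCO k G A μ) : Conn G A := by
  induction h with
  | single x => exact conn_singleton x
  | cycle c =>
    obtain ⟨f, hf, hfc⟩ := exists_indCyc_of_embedding (by omega) c
    rw [range_eq_cyc hfc]
    exact hf.conn hk
  | @pendantVertex A x μ hx h ih =>
    obtain ⟨y, hy, hxy, -⟩ := exists_adj_of_degIn_eq_one hx.2
    have := ih.insert_of_adj (x := x) ⟨hy, hxy.ne'⟩ hxy
    rwa [Set.insert_sdiff_singleton, Set.insert_eq_of_mem hx.1] at this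
  | @pendantCycle A c p q μ hc h ih =>
    obtain ⟨f, hf, hfc, -⟩ := hc.exists_niceCyc hk
    refine conn_of_sdiff_ear hk (q := q) hf.indCyc hf.subset ?_
    convert ih using 2
    ext x
    rw [mem_ear]
    constructor
    · rintro ⟨i, h1, h2, rfl⟩; exact ⟨⟨i, h2⟩, h1, (hfc ⟨i, h2⟩).symm⟩
    · rintro ⟨i, h1, rfl⟩; exact ⟨i, h1, i.2, hfc i⟩

omit [Finite V] in
/-- A pendant cycle in terms of sequences of vertices is one in terms of embeddings. -/
lemma NiceCyc.exists_isPendantCycle (hk : 3 ≤ k) {A : Set V} {f : ℕ → V} {q : ℕ}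
    (hf : NiceCyc G k A f q) (h0 : 3 ≤ degIn G A (f 0)) (hq : 3 ≤ degIn G A (f q)) :
    ∃ (c : cycleGraph k ↪g G) (p q' : Fin k), IsPendantCycle G A c p q' ∧ q'.val = q ∧ p.val = 0 ∧
      (∀ i : Fin k, c i = f i) ∧ Set.range c = cyc k f ∧ c '' {i | q' < i} = ear k f q := by
  obtain ⟨c, hc⟩ := hf.indCyc.exists_embedding
  have hr : Set.range c = cyc k f := range_eq_cyc fun i => (hc i).symm
  refine ⟨c, ⟨0, by omega⟩, ⟨q, hf.lt⟩, ⟨hr ▸ hf.subset, rfl, hf.kind, by rwa [hc], by rwa [hc],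
    fun i h1 h2 => ?_⟩, rfl, rfl, hc, hr, ?_⟩
  · rw [hc]
    exact hf.deg i i.2 (fun e => h1 (Fin.ext e)) (fun e => h2 (Fin.ext e))
  · ext x
    rw [mem_ear]
    constructor
    · rintro ⟨i, h1, rfl⟩; exact ⟨i, h1, i.2, (hc i).symm⟩
    · rintro ⟨i, h1, h2, rfl⟩; exact ⟨⟨i, h2⟩, h1, hc ⟨i, h2⟩⟩

lemma NiceCyc.closedIn (hk : 3 ≤ k) {A : Set V} {f : ℕ → V} {q : ℕ} (hf : NiceCyc G k A f q)
    (h : ∀ i < k, degIn G A (f i) = 2) : ClosedIn G A (cyc k f) := by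
  refine ⟨hf.subset, fun a ha b hb hab => ?_⟩
  obtain ⟨i, hi, rfl⟩ := mem_cyc.1 ha
  exact hf.indCyc.mem_of_adj hk hf.subset hi (h i hi).le hb hab

omit [Finite V] in
lemma NiceCyc.sdiff_ear_ssubset (hk : 3 ≤ k) {A : Set V} {f : ℕ → V} {q : ℕ}
    (hf : NiceCyc G k A f q) : A \ ear k f q ⊂ A := by
  refine ⟨Set.sdiff_subset, fun h => ?_⟩
  have hq : q + 1 < k := by
    rcases hf.kind with h | h | h <;> omega
  exact (h (hf.subset (mem_cyc.2 ⟨q + 1, hq, rfl⟩))).2 (mem_ear.2 ⟨q + 1, by omega, hq, rfl⟩)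

/-- Connected sets have vertex cycle orderings. -/
theorem exists_isVCO (hk : 5 ≤ k) (hG : IsSC k G) {A : Set V} (hA : Conn G A) :
    ∃ μ, IsVCO k G A μ := by
  induction hn : A.ncard using Nat.strong_induction_on generalizing A with
  | _ N ih =>
  subst hn
  have hk3 : 3 ≤ k := by omega
  by_cases h1 : ∃ x, IsPendantVertex G A x
  · obtain ⟨x, hx⟩ := h1
    obtain ⟨μ, hμ⟩ := ih _ (Set.ncard_sdiff_singleton_lt_of_mem hx.1)
        (hA.sdiff_pendantVertex hx) rfl
    exact ⟨_, .pendantVertex hx hμ⟩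
  by_cases h2 : MinDegTwo G A
  · obtain ⟨f, q, hf, hdeg⟩ := exists_niceCyc hk hG h2 hA.1
    rcases hdeg with hdeg | ⟨h0, hq⟩
    · obtain ⟨c, hc⟩ := hf.indCyc.exists_embedding
      have hr : Set.range c = cyc k f := range_eq_cyc fun i => (hc i).symm
      have := hA.2 _ (hf.closedIn hk3 hdeg) ⟨f 0, mem_cyc.2 ⟨0, by omega, rfl⟩⟩
      refine ⟨[Set.range c], ?_⟩
      rw [← this, ← hr]
      exact .cycle c
    · obtain ⟨c, p, q', hc, -, -, -, -, hear⟩ := hf.exists_isPendantCycle hk3 h0 hq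
      obtain ⟨μ, hμ⟩ := ih _ (Set.ncard_lt_ncard (hf.sdiff_ear_ssubset hk3) (Set.toFinite _))
        (hf.conn_sdiff_ear hk3 hA) rfl
      rw [← hear] at hμ
      exact ⟨_, .pendantCycle hc hμ⟩
  · -- a vertex of degree zero is the whole graph
    rw [minDegTwo_iff_degIn] at h2
    push Not at h2
    obtain ⟨x, hx, hlt⟩ := h2
    have h0 : degIn G A x = 0 := by
      by_contra hne
      exact h1 ⟨x, hx, by omega⟩
    have he : {w : V | w ∈ A ∧ G.Adj x w} = ∅ := (Set.ncard_eq_zero (Set.toFinite _)).1 h0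
    have hcl : ClosedIn G A {x} := by
      refine ⟨Set.singleton_subset_iff.2 hx, ?_⟩
      rintro a rfl b hb hab
      have : b ∈ {w : V | w ∈ A ∧ G.Adj a w} := ⟨hb, hab⟩
      rw [he] at this
      exact this.elim
    refine ⟨[{x}], ?_⟩
    rw [← hA.2 _ hcl ⟨x, rfl⟩]
    exact .single x

/-! ### Existence of values of the recursion -/

omit [Finite V] in
lemma CycleHitRec.empty_eq {S : Set V} (h : CycleHitRec k G ∅ S) : S = ∅ :=
  Set.subset_empty_iff.1 h.subset

omit [Finite V] in
lemma CycleHitRec.union {A B S T : Set V} (hAB : Disjoint A B)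
    (hadj : ∀ a ∈ A, ∀ b ∈ B, ¬ G.Adj a b) (hS : CycleHitRec k G A S) (hT : CycleHitRec k G B T) :
    CycleHitRec k G (A ∪ B) (S ∪ T) := by
  rcases A.eq_empty_or_nonempty with rfl | hA
  · rw [hS.empty_eq, Set.empty_union, Set.empty_union]; exact hT
  rcases B.eq_empty_or_nonempty with rfl | hB
  · rw [hT.empty_eq, Set.union_empty, Set.union_empty]; exact hS
  exact .components hA hB hAB hadj hS hT

omit [Finite V] in
lemma ClosedIn.union_value {A H S T : Set V} (hH : ClosedIn G A H) (hS : CycleHitRec k G H S)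
    (hT : CycleHitRec k G (A \ H) T) : CycleHitRec k G A (S ∪ T) := by
  have := CycleHitRec.union Set.disjoint_sdiff_right
    (fun a ha b hb hab => hb.2 (hH.2 a ha b hb.1 hab)) hS hT
  rwa [Set.union_sdiff_cancel hH.1] at this

omit [Finite V] in
/-- The recursion works separately on the components of the graph. -/
lemma CycleHitRec.restrict (hk : 3 ≤ k) {A S : Set V} (h : CycleHitRec k G A S) {B : Set V}
    (hB : ClosedIn G A B) : CycleHitRec k G B (S ∩ B) := by
  have hconn : ∀ {A S : Set V}, Conn G A → CycleHitRec k G A S → ∀ {B}, ClosedIn G A B →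
      CycleHitRec k G B (S ∩ B) := by
    intro A S hA h B hB
    rcases B.eq_empty_or_nonempty with rfl | hne
    · simpa using CycleHitRec.empty
    · rw [hA.2 B hB hne, Set.inter_eq_left.2 h.subset]
      exact h
  induction h generalizing B with
  | empty =>
    rw [Set.subset_empty_iff.1 hB.1, Set.empty_inter]; exact .empty
  | single x => exact hconn (conn_singleton x) (.single x) hB
  | cycle c i => exact hconn ((IsVCO.cycle c).conn hk) (.cycle c i) hB
  | @components A A' S T hA hA' hAA hadj hS hT ih1 ih2 =>
    have e1 : B = (B ∩ A) ∪ (B ∩ A') := by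
      rw [← Set.inter_union_distrib_left, Set.inter_eq_left.2 hB.1]
    have e2 : (S ∪ T) ∩ B = (S ∩ (B ∩ A)) ∪ (T ∩ (B ∩ A')) := by
      have h1 := hS.subset
      have h2 := hT.subset
      ext x
      simp only [Set.mem_inter_iff, Set.mem_union]
      constructor
      · rintro ⟨h | h, hb⟩
        · exact .inl ⟨h, hb, h1 h⟩
        · exact .inr ⟨h, hb, h2 h⟩
      · rintro (⟨h, hb, -⟩ | ⟨h, hb, -⟩)
        · exact ⟨.inl h, hb⟩
        · exact ⟨.inr h, hb⟩
    rw [e2]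
    nth_rewrite 1 [e1]
    refine CycleHitRec.union (hAA.mono Set.inter_subset_right Set.inter_subset_right)
      (fun a ha b hb => hadj a ha.2 b hb.2) (ih1 ⟨Set.inter_subset_right, ?_⟩)
      (ih2 ⟨Set.inter_subset_right, ?_⟩)
    · exact fun a ha b hb hab => ⟨hB.2 a ha.1 b (.inl hb) hab, hb⟩
    · exact fun a ha b hb hab => ⟨hB.2 a ha.1 b (.inr hb) hab, hb⟩
  | pendantVertex hμ hx hS _ => exact hconn (hμ.conn hk) (.pendantVertex hμ hx hS) hB
  | oneAttachment hμ hc hS _ => exact hconn (hμ.conn hk) (.oneAttachment hμ hc hS) hB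
  | twoAttachmentsLeft hμ hpq hc hS hT hle _ _ =>
    exact hconn (hμ.conn hk) (.twoAttachmentsLeft hμ hpq hc hS hT hle) hB
  | twoAttachmentsRight hμ hpq hc hS hT hle _ _ =>
    exact hconn (hμ.conn hk) (.twoAttachmentsRight hμ hpq hc hS hT hle) hB

/-- Vertices of degree at most one do not matter to the recursion. -/
lemma CycleHitRec.of_low (hk : 5 ≤ k) (hG : IsSC k G) {A S : Set V} {x : V} (hx : x ∈ A)
    (hd : degIn G A x ≤ 1) (h : CycleHitRec k G (A \ {x}) S) : CycleHitRec k G A S := by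
  obtain ⟨K, hK, hxK⟩ := exists_isComp (G := G) hx
  have hcl1 : ClosedIn G (A \ {x}) (K \ {x}) :=
    ⟨Set.sdiff_subset_sdiff_left hK.2.1, fun a ha b hb hab => ⟨hK.2.2 a ha.1 b hb.1 hab, hb.2⟩⟩
  have hcl2 : ClosedIn G (A \ {x}) (A \ K) := by
    refine ⟨fun y hy => ⟨hy.1, fun e => hy.2 (Set.mem_singleton_iff.1 e ▸ hxK)⟩, ?_⟩
    exact fun a ha b hb hab => hK.2.diff.2 a ha b hb.1 hab
  have h1 := h.restrict (by omega) hcl1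
  have h2 := h.restrict (by omega) hcl2
  have hKS : CycleHitRec k G K (S ∩ (K \ {x})) := by
    have hdeg : degIn G K x = degIn G A x :=
      degIn_congr fun w hw => ⟨fun h => hK.2.1 h, fun h => hK.2.2 x hxK w h hw⟩
    by_cases h0 : degIn G A x = 0
    · have he : {w : V | w ∈ A ∧ G.Adj x w} = ∅ := (Set.ncard_eq_zero (Set.toFinite _)).1 h0
      have hKx : {x} = K := by
        refine hK.1.2 {x} ⟨Set.singleton_subset_iff.2 hxK, ?_⟩ ⟨x, rfl⟩
        rintro a rfl b hb hab
        have : b ∈ {w : V | w ∈ A ∧ G.Adj a w} := ⟨hK.2.1 hb, hab⟩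
        rw [he] at this
        exact this.elim
      rw [← hKx, sdiff_self, Set.bot_eq_empty, Set.inter_empty]
      exact .single x
    · have hpx : IsPendantVertex G K x := ⟨hxK, by omega⟩
      obtain ⟨μ, hμ⟩ := exists_isVCO hk hG (hK.1.sdiff_pendantVertex hpx)
      exact .pendantVertex (.pendantVertex hpx hμ) hpx h1
  have := hK.2.union_value hKS h2
  have hS : S ∩ (K \ {x}) ∪ S ∩ (A \ K) = S := by
    have hSx := h.subset
    ext y
    simp only [Set.mem_union, Set.mem_inter_iff, Set.mem_sdiff, Set.mem_singleton_iff]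
    constructor
    · rintro (⟨h, -⟩ | ⟨h, -⟩) <;> exact h
    · intro hy
      have := hSx hy
      by_cases hyK : y ∈ K
      · exact .inl ⟨hy, hyK, this.2⟩
      · exact .inr ⟨hy, this.1, hyK⟩
  rwa [hS] at this

lemma CycleHitRec.of_core (hk : 5 ≤ k) (hG : IsSC k G) {A S : Set V}
    (h : CycleHitRec k G (core G A) S) : CycleHitRec k G A S := by
  induction hn : A.ncard using Nat.strong_induction_on generalizing A with
  | _ N ih =>
  subst hn
  by_cases hA : MinDegTwo G A
  · rwa [hA.core_eq] at h
  · rw [minDegTwo_iff_degIn] at hA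
    push Not at hA
    obtain ⟨x, hx, hlt⟩ := hA
    refine .of_low hk hG hx (by omega) (ih _ (Set.ncard_sdiff_singleton_lt_of_mem hx) ?_ rfl)
    rwa [core_sdiff_of_degIn_le_one (by omega)]

/-- A component that is a cycle contributes one vertex. -/
lemma NiceCyc.value_of_isolated (hk : 5 ≤ k) (hG : IsSC k G) {A S : Set V} {f : ℕ → V} {q : ℕ}
    (hf : NiceCyc G k A f q) (hdeg : ∀ i < k, degIn G A (f i) = 2) {i : ℕ} (hi : i < k)
    (hS : CycleHitRec k G (core G (A \ {f i})) S) : CycleHitRec k G A ({f i} ∪ S) := by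
  have hk3 : 3 ≤ k := by omega
  have hcl := hf.closedIn hk3 hdeg
  have hcore : core G (A \ {f i}) = core G (A \ cyc k f) := by
    refine Set.Subset.antisymm ((minDegTwo_core _).subset_core fun x hx => ?_)
      (core_mono fun x hx => ⟨hx.1, fun e => hx.2 (mem_cyc.2 ⟨i, hi,
          (Set.mem_singleton_iff.1 e).symm⟩)⟩)
    refine ⟨(core_subset _ hx).1, fun hxc => ?_⟩
    -- the vertices of the cycle in a set of minimum degree two are closed under adjacency
    have hB := minDegTwo_core (G := G) (A \ {f i})
    have hcl' : ClosedIn G (cyc k f) (cyc k f ∩ core G (A \ {f i})) := by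
      refine ⟨Set.inter_subset_left, fun a ha b hb hab => ⟨hb, ?_⟩⟩
      obtain ⟨j, hj, rfl⟩ := mem_cyc.1 ha.1
      exact hB.mem_of_adj ((core_subset _).trans Set.sdiff_subset) ha.2 (hdeg j hj).le
        (hf.subset hb) hab
    have h1 := (hf.indCyc.conn hk3).2 _ hcl' ⟨x, hxc, hx⟩
    have h2 : f i ∈ cyc k f ∩ core G (A \ {f i}) := by
      rw [h1]; exact mem_cyc.2 ⟨i, hi, rfl⟩
    exact (core_subset _ h2.2).2 rfl
  rw [hcore] at hS
  obtain ⟨c, hc⟩ := hf.indCyc.exists_embedding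
  have hr : Set.range c = cyc k f := range_eq_cyc fun i => (hc i).symm
  have h1 : CycleHitRec k G (cyc k f) {f i} := by
    have := CycleHitRec.cycle c ⟨i, hi⟩
    rwa [hr, hc] at this
  exact hcl.union_value h1 (hS.of_core hk hG)

/-- A step of the recursion at a pendant cycle of a graph that may be disconnected: an attachment
vertex `u` whose deletion makes the smallest transversals smaller may be picked. -/
lemma NiceCyc.value_insert (hk : 5 ≤ k) (hG : IsSC k G) {A S : Set V} {f : ℕ → V} {q : ℕ}
    (hf : NiceCyc G k A f q) (h0 : 3 ≤ degIn G A (f 0)) (hq : 3 ≤ degIn G A (f q)) {u v : V}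
    (huv : Ends f q u v) (hex : ∀ A' ⊂ A, ∃ T, CycleHitRec k G A' T)
    (hS : CycleHitRec k G (core G (A \ {u})) S) (hlt : ∀ T, Hits G A T → S.ncard < T.ncard) :
    CycleHitRec k G A ({u} ∪ S) := by
  have hk3 : 3 ≤ k := by omega
  obtain ⟨huc, hvc⟩ := huv.mem_cyc hf.lt
  obtain ⟨H, hH, h0H⟩ := exists_isComp (G := G) (hf.subset (mem_cyc.2 ⟨0, by omega, rfl⟩ : f 0 ∈ _))
  have hcH : cyc k f ⊆ H := (hf.indCyc.conn hk3).subset_of_closedIn hf.subset hH.2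
    ⟨f 0, mem_cyc.2 ⟨0, by omega, rfl⟩, h0H⟩
  have hdegH : ∀ x ∈ H, degIn G H x = degIn G A x := fun x hx =>
    degIn_congr fun w hw => ⟨fun h => hH.2.1 h, fun h => hH.2.2 x hx w h hw⟩
  have hfH : NiceCyc G k H f q := ⟨hf.indCyc, hcH, hf.lt, hf.kind, fun i hi h1 h2 => by
    rw [hdegH _ (hcH (mem_cyc.2 ⟨i, hi, rfl⟩))]; exact hf.deg i hi h1 h2⟩
  obtain ⟨c, p, q', hc, hq', hp, hcf, hr, hear⟩ := hfH.exists_isPendantCycle hk3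
    (by rwa [hdegH _ h0H]) (by rwa [hdegH _ (hcH (mem_cyc.2 ⟨q, hf.lt, rfl⟩))])
  have hcp : c p = f 0 := by rw [hcf, hp]
  have hcq : c q' = f q := by rw [hcf, hq']
  obtain ⟨μ, hμ⟩ := exists_isVCO hk hG (hfH.conn_sdiff_ear hk3 hH.1)
  rw [← hear] at hμ
  have hvco : IsVCO k G H (Set.range c :: μ) := .pendantCycle hc hμ
  -- the value splits along the components
  have hbr : branch k A f u v = branch k H f u v ∪ A \ H := by
    unfold branch
    ext x
    have h1 : insert u (cyc k f \ {v}) ⊆ H := Set.insert_subset (hcH huc)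
      (Set.sdiff_subset.trans hcH)
    constructor
    · rintro ⟨hx, hxn⟩
      by_cases hxH : x ∈ H
      · exact .inl ⟨hxH, hxn⟩
      · exact .inr ⟨hx, hxH⟩
    · rintro (⟨hx, hxn⟩ | ⟨hx, hxH⟩)
      · exact ⟨hH.2.1 hx, hxn⟩
      · exact ⟨hx, fun h => hxH (h1 h)⟩
  have hbH : ∀ u v, branch k H f u v ⊆ H := fun u v => branch_subset.trans Set.sdiff_subset
  have hSb : CycleHitRec k G (branch k A f u v) S := by
    refine CycleHitRec.of_core hk hG ?_
    rwa [hf.core_branch huv]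
  have hcl1 : ClosedIn G (branch k A f u v) (branch k H f u v) := by
    rw [hbr]
    refine ⟨Set.subset_union_left, fun a ha b hb hab => hb.resolve_right fun hb' => ?_⟩
    exact hb'.2 (hH.2.2 a (hbH u v ha) b hb'.1 hab)
  have hcl2 : ClosedIn G (branch k A f u v) (A \ H) := by
    rw [hbr]
    refine ⟨Set.subset_union_right, fun a ha b hb hab => hb.resolve_left fun hb' => ?_⟩
    exact ha.2 (hH.2.2 b (hbH u v hb') a ha.1 hab.symm)
  have hS1 := hSb.restrict hk3 hcl1
  have hS2 := hSb.restrict hk3 hcl2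
  have hSeq : S = S ∩ branch k H f u v ∪ S ∩ (A \ H) := by
    rw [← Set.inter_union_distrib_left, ← hbr, Set.inter_eq_left.2 hSb.subset]
  suffices hmain : CycleHitRec k G H ({u} ∪ S ∩ branch k H f u v) by
    have := hH.2.union_value hmain hS2
    rwa [Set.union_assoc, ← hSeq] at this
  by_cases hq0 : q = 0
  · subst hq0
    obtain ⟨rfl, rfl⟩ : u = f 0 ∧ v = f 0 := by rcases huv with h | h <;> exact h
    obtain rfl : p = q' := Fin.ext (by omega)
    have e : branch k H f (f 0) (f 0) = H \ Set.range c := by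
      unfold branch
      rw [hr, Set.insert_sdiff_singleton, Set.insert_eq_of_mem huc]
    rw [e] at hS1 ⊢
    have := CycleHitRec.oneAttachment hvco hc hS1
    rwa [hcp] at this
  have hpq : p ≠ q' := fun e => hq0 (by rw [← hq', ← e, hp])
  have hne : f 0 ≠ f q := fun e => hq0 (hf.indCyc.inj hf.lt (by omega) e.symm)
  have huvne : u ≠ v := by
    rcases huv with ⟨rfl, rfl⟩ | ⟨rfl, rfl⟩
    · exact hne
    · exact hne.symm
  -- a value of the other branch
  obtain ⟨T, hT⟩ := hex (branch k H f v u) ⟨(hbH v u).trans hH.2.1, fun h =>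
    ((branch_subset (h (hH.2.1 (hcH hvc)))).2 rfl)⟩
  have hle : ({u} ∪ S ∩ branch k H f u v).ncard ≤ ({v} ∪ T).ncard := by
    by_contra hgt
    have hTH : Hits G H ({v} ∪ T) := hfH.hits_insert (q := q) (u := v) (v := u)
      (by unfold Ends at *; tauto) (hT.isOpt hk3).1
    have h1 := hlt _ (by
      have := Hits.union_of_no_adj (G := G) (A := H) (B := A \ H)
        (fun a ha b hb hab => hb.2 (hH.2.2 a ha b hb.1 hab)) hTH (hS2.isOpt hk3).1
      rwa [Set.union_sdiff_cancel hH.2.1] at this)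
    have h2 := Set.ncard_union_le ({v} ∪ T) (S ∩ (A \ H))
    have h3 := Set.ncard_insert_le u (S ∩ branch k H f u v)
    rw [← Set.singleton_union] at h3
    have h4 : S.ncard = (S ∩ branch k H f u v).ncard + (S ∩ (A \ H)).ncard := by
      conv_lhs => rw [hSeq]
      refine Set.ncard_union_eq ?_ (Set.toFinite _) (Set.toFinite _)
      exact Set.disjoint_left.2 fun x hx hx' => hx'.2.2 (hbH u v hx.2)
    omega
  have e : ∀ u v, u ≠ v → u ∈ cyc k f → branch k H f u v = H \ (Set.range c \ {v}) := by
    intro u v huv hu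
    unfold branch
    rw [hr, Set.insert_eq_of_mem]
    exact ⟨hu, huv⟩
  rw [e u v huvne huc] at hS1 hle ⊢
  rw [e v u huvne.symm hvc] at hT
  rcases huv with ⟨rfl, rfl⟩ | ⟨rfl, rfl⟩
  · rw [← hcp, ← hcq] at *
    exact .twoAttachmentsLeft hvco hpq hc hS1 hT hle
  · rw [← hcp, ← hcq] at *
    exact .twoAttachmentsRight hvco hpq hc hT hS1 hle

/-- At a pendant cycle, deleting one of the attachment vertices makes the smallest transversals
smaller. -/
lemma NiceCyc.exists_ends_lt (hk : 3 ≤ k) {A : Set V} {f : ℕ → V} {q : ℕ}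
    (hf : NiceCyc G k A f q) {S : V → Set V} (hS : ∀ u, IsOpt G (A \ {u}) (S u)) :
    ∃ u v, Ends f q u v ∧ ∀ T, Hits G A T → (S u).ncard < T.ncard := by
  have key : ∀ u v, Ends f q u v → (S u).ncard ≤ (S v).ncard →
      ∀ T, Hits G A T → (S u).ncard < T.ncard := by
    intro u v huv hle T hT
    obtain ⟨T', hT', hle', hmem⟩ := hf.exchange hk hT
    have hw : ∀ w ∈ T', (S w).ncard < T'.ncard := fun w hw =>
      ((hS w).2 _ (hT'.sdiff_singleton subset_rfl)).trans_lt
          (Set.ncard_sdiff_singleton_lt_of_mem hw)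
    have hmem' : u ∈ T' ∨ v ∈ T' := by rcases huv with ⟨rfl, rfl⟩ | ⟨rfl, rfl⟩ <;> tauto
    rcases hmem' with h | h
    · have := hw u h; omega
    · have := hw v h; omega
  rcases le_total (S (f 0)).ncard (S (f q)).ncard with h | h
  · exact ⟨_, _, .inl ⟨rfl, rfl⟩, key _ _ (.inl ⟨rfl, rfl⟩) h⟩
  · exact ⟨_, _, .inr ⟨rfl, rfl⟩, key _ _ (.inr ⟨rfl, rfl⟩) h⟩

lemma isOpt_core_iff {A S : Set V} (hS : CycleHitRec k G (core G A) S) (hk : 5 ≤ k)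
    (hG : IsSC k G) : IsOpt G A S := (hS.of_core hk hG).isOpt (by omega)

/-- The recursion has a value on every induced subgraph. -/
theorem exists_cycleHitRec (hk : 5 ≤ k) (hG : IsSC k G) (A : Set V) :
    ∃ S, CycleHitRec k G A S := by
  induction hn : A.ncard using Nat.strong_induction_on generalizing A with
  | _ N ih =>
  subst hn
  have ih' : ∀ A' ⊂ A, ∃ T, CycleHitRec k G A' T := fun A' h =>
    ih _ (Set.ncard_lt_ncard h (Set.toFinite _)) A' rfl
  suffices h : ∃ S, CycleHitRec k G (core G A) S by
    obtain ⟨S, hS⟩ := h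
    exact ⟨S, hS.of_core hk hG⟩
  rcases (core G A).eq_empty_or_nonempty with he | hne
  · rw [he]; exact ⟨∅, .empty⟩
  have hZ := minDegTwo_core (G := G) A
  have hsub := core_subset (G := G) A
  have hexu : ∀ u ∈ core G A, ∃ S, CycleHitRec k G (core G (core G A \ {u})) S := by
    intro u hu
    refine ih' _ ⟨(core_subset _).trans (Set.sdiff_subset.trans hsub), fun h => ?_⟩
    exact (core_subset _ (h (hsub hu))).2 rfl
  obtain ⟨f, q, hf, hdeg⟩ := exists_niceCyc hk hG hZ hne
  have h0 : f 0 ∈ core G A := hf.subset (mem_cyc.2 ⟨0, by omega, rfl⟩)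
  rcases hdeg with hdeg | ⟨h03, hq3⟩
  · obtain ⟨S, hS⟩ := hexu _ h0
    exact ⟨_, hf.value_of_isolated hk hG hdeg (by omega) hS⟩
  · have hex : ∀ u, ∃ S, u ∈ core G A → CycleHitRec k G (core G (core G A \ {u})) S := by
      intro u
      by_cases hu : u ∈ core G A
      · obtain ⟨S, hS⟩ := hexu u hu
        exact ⟨S, fun _ => hS⟩
      · exact ⟨∅, fun h => absurd h hu⟩
    choose S hS using hex
    have hopt : ∀ u, ∃ S', IsOpt G (core G A \ {u}) S' ∧ (u ∈ core G A → S' = S u) := by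
      intro u
      by_cases hu : u ∈ core G A
      · exact ⟨S u, isOpt_core_iff (hS u hu) hk hG, fun _ => rfl⟩
      · have hfin : {n | ∃ T, Hits G (core G A \ {u}) T ∧ T.ncard = n}.Nonempty :=
          ⟨_, Set.univ, hits_iff.2 fun B hB _ => Set.subset_empty_iff.1 (by simpa using hB), rfl⟩
        obtain ⟨T, hT, hTn⟩ := Nat.sInf_mem hfin
        exact ⟨T, ⟨hT, fun T' hT' => hTn ▸ Nat.sInf_le ⟨T', hT', rfl⟩⟩, fun h => absurd h hu⟩
    choose S' hS' hSS using hopt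
    obtain ⟨u, v, huv, hlt⟩ := hf.exists_ends_lt (by omega) hS'
    have hu : u ∈ core G A := hf.subset (huv.mem_cyc hf.lt).1
    rw [hSS u hu] at hlt
    exact ⟨_, hf.value_insert hk hG h03 hq3 huv
      (fun A' h => ih' A' (h.trans_subset hsub)) (hS u hu) hlt⟩

end Orderings

/-! ### Parity of the cycle length -/

section Transversals
variable {V : Type*} {G : SimpleGraph V} {k : ℕ} [Finite V]

lemma degIn_le_one_iff {A : Set V} {v : V} : degIn G A v ≤ 1 ↔
    ∀ x ∈ A, ∀ y ∈ A, G.Adj v x → G.Adj v y → x = y := by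
  rw [← not_iff_not, not_le, Nat.lt_iff_add_one_le, two_le_degIn_iff]
  constructor
  · rintro ⟨x, hx, y, hy, hxy, h1, h2⟩ h
    exact hxy (h x hx y hy h1 h2)
  · intro h
    push Not at h
    obtain ⟨x, hx, y, hy, h1, h2, hxy⟩ := h
    exact ⟨x, hx, y, hy, hxy, h1, h2⟩

/-- When the cycle length is even, every induced subgraph has a proper two-colouring: a vertex of
degree at most one, or the ear of a pendant cycle, is coloured last, the colours on the cycle being
given by the parity of the position. -/
lemma exists_twoColoring (hk : 5 ≤ k) (hG : IsSC k G) (he : Even k) (A : Set V) :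
    ∃ χ : V → Bool, ∀ a ∈ A, ∀ b ∈ A, G.Adj a b → χ a ≠ χ b := by
  classical
  induction hn : A.ncard using Nat.strong_induction_on generalizing A with
  | _ n ih =>
  subst hn
  by_cases hlow : ∃ x ∈ A, degIn G A x ≤ 1
  · obtain ⟨x, hx, hd⟩ := hlow
    rw [degIn_le_one_iff] at hd
    obtain ⟨χ, hχ⟩ := ih _ (Set.ncard_sdiff_singleton_lt_of_mem hx (Set.toFinite _)) (A \ {x}) rfl
    obtain ⟨c, hc⟩ : ∃ c : Bool, ∀ y ∈ A, G.Adj x y → c ≠ χ y := by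
      by_cases hy : ∃ y ∈ A, G.Adj x y
      · obtain ⟨y, hy, hxy⟩ := hy
        refine ⟨!χ y, fun z hz hxz => ?_⟩
        rw [hd z hz y hy hxz hxy]
        simp
      · push Not at hy
        exact ⟨true, fun y h1 h2 => absurd h2 (hy y h1)⟩
    refine ⟨Function.update χ x c, fun a ha b hb hab => ?_⟩
    by_cases h1 : a = x
    · subst h1
      rw [Function.update_self, Function.update_of_ne hab.ne.symm]
      exact hc b hb hab
    · by_cases h2 : b = x
      · subst h2
        rw [Function.update_self, Function.update_of_ne h1]
        exact (hc a ha hab.symm).symm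
      · rw [Function.update_of_ne h1, Function.update_of_ne h2]
        exact hχ a ⟨ha, h1⟩ b ⟨hb, h2⟩ hab
  push Not at hlow
  have hA : MinDegTwo G A := minDegTwo_iff_degIn.2 hlow
  rcases A.eq_empty_or_nonempty with rfl | hne
  · exact ⟨fun _ => true, by simp⟩
  obtain ⟨f, q, hf, -⟩ := exists_niceCyc hk hG hA hne
  obtain ⟨χ, hχ⟩ := ih _ (Set.ncard_lt_ncard (hf.sdiff_ear_ssubset (by omega)) (Set.toFinite _))
    (A \ ear k f q) rfl
  have hcol : ∀ i ≤ q, χ (f i) = (χ (f 0) ^^ decide (Odd i)) := by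
    intro i
    induction i with
    | zero => simp
    | succ i ih' =>
      intro hi
      have hq := hf.lt
      have := hχ (f i) ⟨hf.subset (mem_cyc.2 ⟨i, by omega, rfl⟩),
        hf.indCyc.notMem_ear (by omega) (by omega)⟩ (f (i + 1))
        ⟨hf.subset (mem_cyc.2 ⟨i + 1, by omega, rfl⟩), hf.indCyc.notMem_ear (by omega) (by omega)⟩
        ((hf.indCyc i (i + 1) (by omega) (by omega)).2.2 (.inl rfl))
      rw [ih' (by omega)] at this
      by_cases ho : Odd i
      · simp only [ho, Nat.odd_add_one, not_true, decide_true, decide_false] at this ⊢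
        revert this; cases χ (f 0) <;> cases χ (f (i + 1)) <;> simp
      · simp only [ho, Nat.odd_add_one, not_false_iff, decide_true, decide_false] at this ⊢
        revert this; cases χ (f 0) <;> cases χ (f (i + 1)) <;> simp
  have hcyc : ∃ c : V → Bool, ∀ i < k, c (f i) = (χ (f 0) ^^ decide (Odd i)) := by
    have hinv : ∀ x : V, ∃ b : Bool, ∀ i < k, f i = x → b = (χ (f 0) ^^ decide (Odd i)) := by
      intro x
      by_cases h : ∃ i < k, f i = x
      · obtain ⟨i, hi, rfl⟩ := h
        exact ⟨_, fun j hj e => by rw [hf.indCyc.inj hj hi e]⟩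
      · push Not at h
        exact ⟨true, fun i hi e => absurd e (h i hi)⟩
    choose c hc using hinv
    exact ⟨c, fun i hi => hc _ i hi rfl⟩
  obtain ⟨c, hc⟩ := hcyc
  have hadj : ∀ i < k, ∀ j < k, G.Adj (f i) (f j) → c (f i) ≠ c (f j) := by
    intro i hi j hj h
    wlog hij : i < j generalizing i j
    · refine (this j hj i hi h.symm ?_).symm
      rcases lt_trichotomy i j with h' | rfl | h'
      · exact absurd h' hij
      · exact absurd h (G.loopless.irrefl _)
      · exact h'
    rw [hc i hi, hc j hj]
    have hpar : ¬ (Odd i ↔ Odd j) := by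
      rcases (hf.indCyc i j hij hj).2.1 h with rfl | ⟨rfl, h'⟩
      · rw [Nat.odd_add_one]; tauto
      · subst h'
        rw [Nat.even_add_one, Nat.not_even_iff_odd] at he
        simp [he]
    intro e
    apply hpar
    revert e
    by_cases h1 : Odd i <;> by_cases h2 : Odd j <;> cases χ (f 0) <;> simp [h1, h2]
  refine ⟨fun x => if x ∈ ear k f q then c x else χ x, ?_⟩
  -- neighbours of the ear lie on the cycle, where the two colourings agree
  have hear : ∀ a ∈ ear k f q, ∀ b ∈ A, G.Adj a b → b ∈ cyc k f := by
    intro a ha b hb hab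
    obtain ⟨i, hqi, hi, rfl⟩ := mem_ear.1 ha
    exact hf.indCyc.mem_of_adj (by omega) hf.subset hi
      (hf.deg i hi (by omega) (by omega)).le hb hab
  have hval : ∀ i < k, (if f i ∈ ear k f q then c (f i) else χ (f i)) = c (f i) := by
    intro i hi
    split_ifs with h
    · rfl
    · rw [hc i hi, hcol i]
      by_contra hlt
      exact h (mem_ear.2 ⟨i, by omega, hi, rfl⟩)
  have key : ∀ a ∈ ear k f q, ∀ b ∈ A, G.Adj a b →
      (if a ∈ ear k f q then c a else χ a) ≠ (if b ∈ ear k f q then c b else χ b) := by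
    intro a ha b hb hab
    obtain ⟨j, hj, rfl⟩ := mem_cyc.1 (hear a ha b hb hab)
    obtain ⟨i, -, hi, rfl⟩ := mem_ear.1 ha
    rw [hval i hi, hval j hj]
    exact hadj i hi j hj hab
  intro a ha b hb hab
  by_cases h1 : a ∈ ear k f q
  · exact key a h1 b hb hab
  · by_cases h2 : b ∈ ear k f q
    · exact (key b h2 a ha hab.symm).symm
    · simp only [h1, h2, if_false]
      exact hχ a ⟨ha, h1⟩ b ⟨hb, h2⟩ hab

lemma isOCT_empty_of_even (hk : 5 ≤ k) (hG : IsSC k G) (he : Even k) : IsOCT G ∅ := by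
  obtain ⟨χ, hχ⟩ := exists_twoColoring hk hG he Set.univ
  exact ((Coloring.mk (fun v : (∅ᶜ : Set V) => χ v) fun {a b} h =>
    hχ a trivial b trivial h).colorable).mono (by simp)

omit [Finite V] in
lemma isECT_empty_of_odd (hG : IsSC k G) (ho : Odd k) : IsECT G ∅ := by
  intro m hm hc
  rw [hG.induce _ m hm hc]
  exact ho

lemma exists_embedding_of_not_isFVS (hG : IsSC k G) {S : Set V} (h : ¬ IsFVS G S) :
    3 ≤ k ∧ Nonempty (cycleGraph k ↪g G.induce Sᶜ) := by
  rw [isFVS_iff, ← Ne, ← Set.nonempty_iff_ne_empty] at h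
  obtain ⟨hk, f, hf, hfS⟩ := exists_cyc_of_minDegTwo hG (minDegTwo_core _) h
  exact ⟨hk, hf.nonempty_embedding_induce fun i hi =>
    core_subset _ (hfS (mem_cyc.2 ⟨i, hi, rfl⟩))⟩

lemma isFVS_iff_isOCT (hG : IsSC k G) (ho : Odd k) (S : Set V) : IsFVS G S ↔ IsOCT G S := by
  constructor
  · exact fun h => IsAcyclic.isBipartite h
  · intro h
    by_contra hS
    obtain ⟨hk, ⟨c⟩⟩ := exists_embedding_of_not_isFVS hG hS
    have h2 : (cycleGraph k).Colorable 2 := Colorable.of_hom c.toHom h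
    have h3 := h2.chromaticNumber_le
    rw [chromaticNumber_cycleGraph_of_odd k (by omega) ho] at h3
    exact absurd h3 (by decide)

lemma isFVS_iff_isECT (hG : IsSC k G) (he : Even k) (S : Set V) : IsFVS G S ↔ IsECT G S := by
  constructor
  · rintro h m hm ⟨c⟩
    exact absurd h (not_isAcyclic_of_embedding hm c)
  · intro h
    by_contra hS
    obtain ⟨hk, hc⟩ := exists_embedding_of_not_isFVS hG hS
    exact Nat.not_odd_iff_even.2 he (h k hk hc)

lemma hits_univ_iff (S : Set V) : Hits G Set.univ S ↔ IsFVS G S := by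
  rw [isFVS_iff, Hits, Set.compl_eq_univ_sdiff]

lemma CycleHitRec.isMinCard (hk : 3 ≤ k) {S : Set V} (h : CycleHitRec k G Set.univ S) :
    IsMinCard (IsFVS G) S := by
  have := h.isOpt hk
  unfold IsOpt at this
  rwa [show Hits G Set.univ = IsFVS G from funext fun S => propext (hits_univ_iff S)] at this

omit [Finite V] in
lemma isMinCard_empty {P : Set V → Prop} (h : P ∅) : IsMinCard P ∅ := ⟨h, by simp⟩

theorem transversals_correct (hk : 5 ≤ k) (hG : IsSC k G) :
    ((∃ S : Set V, OCTValue k G S) ∧ ∀ S : Set V, OCTValue k G S → IsMinCard (IsOCT G) S) ∧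
      ((∃ S : Set V, ECTValue k G S) ∧ ∀ S : Set V, ECTValue k G S → IsMinCard (IsECT G) S) ∧
      (Odd k → ∀ S : Set V, IsFVS G S ↔ IsOCT G S) ∧
      (Even k → ∀ S : Set V, IsFVS G S ↔ IsECT G S) := by
  obtain ⟨S₀, hS₀⟩ := exists_cycleHitRec hk hG Set.univ
  refine ⟨⟨?_, ?_⟩, ⟨?_, ?_⟩, isFVS_iff_isOCT hG, isFVS_iff_isECT hG⟩
  · rcases Nat.even_or_odd k with he | ho
    · exact ⟨∅, .inr ⟨he, rfl⟩⟩
    · exact ⟨S₀, .inl ⟨ho, hS₀⟩⟩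
  · rintro S (⟨ho, h⟩ | ⟨he, rfl⟩)
    · rw [← show IsFVS G = IsOCT G from funext fun S => propext (isFVS_iff_isOCT hG ho S)]
      exact h.isMinCard (by omega)
    · exact isMinCard_empty (isOCT_empty_of_even hk hG he)
  · rcases Nat.even_or_odd k with he | ho
    · exact ⟨S₀, .inl ⟨he, hS₀⟩⟩
    · exact ⟨∅, .inr ⟨ho, rfl⟩⟩
  · rintro S (⟨he, h⟩ | ⟨ho, rfl⟩)
    · rw [← show IsFVS G = IsECT G from funext fun S => propext (isFVS_iff_isECT hG he S)]
      exact h.isMinCard (by omega)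
    · exact isMinCard_empty (isECT_empty_of_odd hG ho)

end Transversals

/-! ### Elimination orders of width two -/

section Elimination
variable {V : Type*}

/-- The graph in which the neighbours of `w` have been joined to each other. -/
def fill (L : SimpleGraph V) (w : V) : SimpleGraph V where
  Adj x y := x ≠ y ∧ (L.Adj x y ∨ (L.Adj x w ∧ L.Adj w y))
  symm := ⟨fun _ _ h => ⟨h.1.symm, h.2.imp (fun h => h.symm) fun h => ⟨h.2.symm, h.1.symm⟩⟩⟩
  loopless := ⟨fun _ h => h.1 rfl⟩

lemma fill_adj {L : SimpleGraph V} {w x y : V} :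
    (fill L w).Adj x y ↔ x ≠ y ∧ (L.Adj x y ∨ (L.Adj x w ∧ L.Adj w y)) := Iff.rfl

/-- `w` has at most two neighbours in `W`. -/
def Low (L : SimpleGraph V) (W : Set V) (w : V) : Prop :=
  ∃ p q, ∀ b ∈ W, L.Adj w b → b = p ∨ b = q

/-- The set `W` can be exhausted by repeatedly eliminating a vertex with at most two neighbours,
the neighbours of an eliminated vertex being joined. (So `L` has treewidth at most two on `W`.) -/
inductive Good : Set V → SimpleGraph V → Prop
  | empty (L : SimpleGraph V) : Good ∅ L
  | step {W : Set V} {L : SimpleGraph V} {w : V} (hw : w ∈ W) (hl : Low L W w)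
      (h : Good (W \ {w}) (fill L w)) : Good W L

lemma Low.anti {L L' : SimpleGraph V} {W : Set V} {w : V} (h : Low L W w) (hw : w ∈ W)
    (hL : ∀ a ∈ W, ∀ b ∈ W, L'.Adj a b → L.Adj a b) : Low L' W w := by
  obtain ⟨p, q, h⟩ := h
  exact ⟨p, q, fun b hb hab => h b hb (hL w hw b hb hab)⟩

lemma Good.anti {L L' : SimpleGraph V} {W : Set V} (h : Good W L)
    (hL : ∀ a ∈ W, ∀ b ∈ W, L'.Adj a b → L.Adj a b) : Good W L' := by
  induction h generalizing L' with
  | empty L => exact .empty _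
  | @step W L w hw hl h ih =>
    refine .step hw (hl.anti hw hL) (ih fun a ha b hb hab => ⟨hab.1, ?_⟩)
    rcases hab.2 with h | ⟨h1, h2⟩
    · exact .inl (hL a ha.1 b hb.1 h)
    · exact .inr ⟨hL a ha.1 w hw h1, hL w hw b hb.1 h2⟩

lemma good_congr {L L' : SimpleGraph V} {W : Set V}
    (hL : ∀ a ∈ W, ∀ b ∈ W, L'.Adj a b ↔ L.Adj a b) : Good W L ↔ Good W L' :=
  ⟨fun h => h.anti fun a ha b hb => (hL a ha b hb).1,
    fun h => h.anti fun a ha b hb => (hL a ha b hb).2⟩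

lemma Low.fill {L : SimpleGraph V} {W : Set V} {v w : V} (hv : Low L W v) (hw : Low L W w)
    (hvW : v ∈ W) (hwW : w ∈ W) : Low (fill L v) (W \ {v}) w := by
  classical
  obtain ⟨p, q, hp⟩ := hw
  obtain ⟨r, s, hr⟩ := hv
  by_cases h : L.Adj w v
  · have h1 := hp v hvW h
    have h2 := hr w hwW h.symm
    refine ⟨if v = p then q else p, if w = r then s else r, ?_⟩
    rintro b ⟨hb, hbv⟩ ⟨hwb, h3 | ⟨-, h3⟩⟩
    · have := hp b hb h3
      simp only [Set.mem_singleton_iff] at hbv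
      grind
    · have := hr b hb h3
      grind
  · refine ⟨p, q, ?_⟩
    rintro b ⟨hb, -⟩ ⟨-, h3 | ⟨h3, -⟩⟩
    · exact hp b hb h3
    · exact absurd h3 h

/-- Any vertex with at most two neighbours can be eliminated first. -/
lemma Good.eliminate {L : SimpleGraph V} {W : Set V} (h : Good W L) {w : V} (hw : w ∈ W)
    (hl : Low L W w) : Good (W \ {w}) (fill L w) := by
  induction h generalizing w with
  | empty L => exact absurd hw (Set.notMem_empty _)
  | @step W L v hv hlv h ih =>
    by_cases hvw : v = w
    · subst hvw; exact h
    have h1 := ih ⟨hw, Ne.symm hvw⟩ (hlv.fill hl hv hw)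
    refine .step ⟨hv, hvw⟩ (hl.fill hlv hw hv) ?_
    have he : (W \ {w}) \ {v} = (W \ {v}) \ {w} := by
      rw [sdiff_sdiff_comm]
    rw [he]
    refine h1.anti fun a ha b hb hab => ?_
    have ha1 : a ≠ v := ha.1.2
    have ha2 : a ≠ w := ha.2
    have hb1 : b ≠ v := hb.1.2
    have hb2 : b ≠ w := hb.2
    simp only [fill_adj] at hab ⊢
    have := L.adj_comm v w
    tauto

lemma good_iff_eliminate {L : SimpleGraph V} {W : Set V} {w : V} (hw : w ∈ W) (hl : Low L W w) :
    Good W L ↔ Good (W \ {w}) (fill L w) :=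
  ⟨fun h => h.eliminate hw hl, fun h => .step hw hl h⟩

/-- Eliminating the inner vertices of a path whose inner vertices have degree two amounts to
replacing the path by an edge. -/
lemma good_iff_path {L : SimpleGraph V} {A : Set V} {y : ℕ → V} {m : ℕ} (h01 : L.Adj (y 0) (y 1))
    (hinj : ∀ i, 1 ≤ i → i < m → ∀ j ≤ m, y i = y j → i = j)
    (hA : ∀ i, 1 ≤ i → i < m → y i ∈ A)
    (hadj : ∀ i, 1 ≤ i → i < m → ∀ b ∈ A, L.Adj (y i) b ↔ b = y (i - 1) ∨ b = y (i + 1))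
    {j : ℕ} (hj : j < m) :
    Good A L ↔ Good (A \ (y '' {i | 1 ≤ i ∧ i ≤ j})) (L ⊔ edge (y 0) (y (j + 1))) := by
  induction j with
  | zero =>
    have : {i : ℕ | 1 ≤ i ∧ i ≤ 0} = ∅ := by ext; simp; omega
    rw [this, Set.image_empty, Set.sdiff_empty, zero_add]
    refine good_congr fun a _ b _ => ?_
    rw [sup_adj, edge_adj]
    constructor
    · rintro (h | ⟨⟨rfl, rfl⟩ | ⟨rfl, rfl⟩, -⟩)
      · exact h
      · exact h01
      · exact h01.symm
    · exact .inl
  | succ j ih =>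
    rw [ih (by omega)]
    set W := A \ (y '' {i | 1 ≤ i ∧ i ≤ j}) with hW
    have hw : y (j + 1) ∈ W := by
      refine ⟨hA _ (by omega) hj, ?_⟩
      rintro ⟨i, ⟨hi1, hij⟩, he⟩
      have := hinj i hi1 (by omega) (j + 1) (by omega) he
      omega
    have h0 : y (j + 1) ≠ y 0 := fun e => by
      have := hinj (j + 1) (by omega) hj 0 (by omega) e
      omega
    have h2 : y (j + 1) ≠ y (j + 2) := fun e => by
      have := hinj (j + 1) (by omega) hj (j + 2) (by omega) e
      omega
    have hnb : ∀ b ∈ W, (L ⊔ edge (y 0) (y (j + 1))).Adj (y (j + 1)) b ↔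
        b = y 0 ∨ b = y (j + 2) := by
      intro b hb
      rw [sup_adj, edge_adj, hadj (j + 1) (by omega) hj b hb.1]
      constructor
      · rintro ((rfl | rfl) | ⟨⟨h, -⟩ | ⟨-, rfl⟩, -⟩)
        · by_cases hj0 : j = 0
          · left; simp [hj0]
          · exact absurd ⟨j, ⟨by omega, le_rfl⟩, by simp⟩ hb.2
        · exact .inr rfl
        · exact absurd h h0
        · exact .inl rfl
      · rintro (rfl | rfl)
        · exact .inr ⟨.inr ⟨rfl, rfl⟩, h0⟩
        · exact .inl (.inr rfl)
    rw [good_iff_eliminate hw ⟨_, _, fun b hb h => (hnb b hb).1 h⟩]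
    have hset : W \ {y (j + 1)} = A \ (y '' {i | 1 ≤ i ∧ i ≤ j + 1}) := by
      rw [hW, Set.sdiff_sdiff]
      congr 1
      ext x
      simp only [Set.mem_union, Set.mem_image, Set.mem_ofPred_eq, Set.mem_singleton_iff]
      constructor
      · rintro (⟨i, hi, rfl⟩ | rfl)
        · exact ⟨i, ⟨hi.1, by omega⟩, rfl⟩
        · exact ⟨j + 1, by omega, rfl⟩
      · rintro ⟨i, hi, rfl⟩
        by_cases h : i = j + 1
        · exact .inr (by rw [h])
        · exact .inl ⟨i, ⟨hi.1, by omega⟩, rfl⟩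
    rw [← hset]
    refine good_congr fun a ha b hb => ?_
    have hna : a ≠ y (j + 1) := ha.2
    have hnb' : b ≠ y (j + 1) := hb.2
    rw [fill_adj, (L ⊔ edge (y 0) (y (j + 1))).adj_comm a (y (j + 1)), hnb a ha.1, hnb b hb.1]
    simp only [sup_adj, edge_adj]
    constructor
    · rintro (h | ⟨h, hab⟩)
      · exact ⟨h.ne, .inl (.inl h)⟩
      · exact ⟨hab, .inr (by tauto)⟩
    · rintro ⟨hab, (h | ⟨h, -⟩) | h⟩
      · exact .inl h
      · tauto
      · refine .inr ⟨?_, hab⟩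
        rcases h with ⟨rfl | rfl, rfl | rfl⟩
        · exact absurd rfl hab
        · exact .inl ⟨rfl, rfl⟩
        · exact .inr ⟨rfl, rfl⟩
        · exact absurd rfl hab

variable {G : SimpleGraph V} {k : ℕ} [Finite V]

lemma low_of_degIn_le_one {A : Set V} {v : V} (h : degIn G A v ≤ 1) : Low G A v := by
  rw [degIn_le_one_iff] at h
  by_cases hx : ∃ x ∈ A, G.Adj v x
  · obtain ⟨x, hx, hvx⟩ := hx
    exact ⟨x, x, fun b hb hvb => .inl (h b hb x hx hvb hvx)⟩
  · push Not at hx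
    exact ⟨v, v, fun b hb hvb => absurd hvb (hx b hb)⟩

lemma NiceCyc.adj_iff {A : Set V} {f : ℕ → V} {q : ℕ} (hf : NiceCyc G k A f q)
    {i : ℕ} (hi0 : 1 ≤ i) (hi : i + 1 < k) (hiq : i ≠ q) {b : V} (hb : b ∈ A) :
    G.Adj (f i) b ↔ b = f (i - 1) ∨ b = f (i + 1) := by
  have h1 : G.Adj (f i) (f (i - 1)) :=
    ((hf.indCyc (i - 1) i (by omega) (by omega)).2.2 (.inl (by omega))).symm
  have h2 : G.Adj (f i) (f (i + 1)) := (hf.indCyc i (i + 1) (by omega) (by omega)).2.2 (.inl rfl)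
  constructor
  · intro h
    refine eq_or_eq_of_degIn_le_two (hf.deg i (by omega) (by omega) hiq).le
      (hf.subset (mem_cyc.2 ⟨i - 1, by omega, rfl⟩)) (hf.subset (mem_cyc.2 ⟨i + 1, by omega, rfl⟩))
      (fun e => ?_) h1 h2 hb h
    have := hf.indCyc.inj (by omega) (by omega) e
    omega
  · rintro (rfl | rfl)
    · exact h1
    · exact h2

lemma NiceCyc.adj_last_iff (hk : 3 ≤ k) {A : Set V} {f : ℕ → V} {q : ℕ} (hf : NiceCyc G k A f q)
    (hq : q + 1 < k) {b : V} (hb : b ∈ A) :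
    G.Adj (f (k - 1)) b ↔ b = f (k - 2) ∨ b = f 0 := by
  have h1 : G.Adj (f (k - 1)) (f (k - 2)) :=
    ((hf.indCyc (k - 2) (k - 1) (by omega) (by omega)).2.2 (.inl (by omega))).symm
  have h2 : G.Adj (f (k - 1)) (f 0) :=
    ((hf.indCyc 0 (k - 1) (by omega) (by omega)).2.2 (.inr ⟨rfl, by omega⟩)).symm
  constructor
  · intro h
    refine eq_or_eq_of_degIn_le_two (hf.deg (k - 1) (by omega) (by omega) (by omega)).le
      (hf.subset (mem_cyc.2 ⟨k - 2, by omega, rfl⟩)) (hf.subset (mem_cyc.2 ⟨0, by omega, rfl⟩))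
      (fun e => ?_) h1 h2 hb h
    have := hf.indCyc.inj (by omega) (by omega) e
    omega
  · rintro (rfl | rfl)
    · exact h1
    · exact h2

/-- The ear of a pendant cycle can be eliminated first: it acts as an edge between the attachment
vertices, and so does the rest of the cycle. -/
lemma NiceCyc.good (hk : 5 ≤ k) {A : Set V} {f : ℕ → V} {q : ℕ} (hf : NiceCyc G k A f q)
    (h : Good (A \ ear k f q) G) : Good A G := by
  have hq : q + 2 < k := by
    rcases hf.kind with h | h | ⟨-, h⟩ <;> omega
  -- the ear, as the interior of a path from `f q` to `f 0`
  have key := good_iff_path (L := G) (A := A) (y := fun i => if q + i = k then f 0 else f (q + i))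
    (m := k - q) (by
      simp only [show q + 0 ≠ k by omega, show q + 1 ≠ k by omega, if_false]
      exact (hf.indCyc q (q + 1) (by omega) (by omega)).2.2 (.inl rfl))
    (by
      intro i hi1 hi j hj he
      have hi' : (if q + i = k then f 0 else f (q + i)) = f (q + i) := if_neg (by omega)
      simp only [hi'] at he
      split_ifs at he with h
      · have := hf.indCyc.inj (by omega) (by omega) he; omega
      · have := hf.indCyc.inj (by omega) (by omega) he; omega)
    (by
      intro i hi1 hi
      simp only [show q + i ≠ k by omega, if_false]
      exact hf.subset (mem_cyc.2 ⟨_, by omega, rfl⟩))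
    (by
      intro i hi1 hi b hb
      simp only [show q + i ≠ k by omega, show q + (i - 1) ≠ k by omega, if_false]
      by_cases hl : q + (i + 1) = k
      · rw [if_pos hl, show q + i = k - 1 by omega, show q + (i - 1) = k - 2 by omega]
        exact hf.adj_last_iff (by omega) (by omega) hb
      · rw [if_neg hl, hf.adj_iff (i := q + i) (by omega) (by omega) (by omega) hb,
          show q + i - 1 = q + (i - 1) by omega, ← add_assoc])
    (j := k - q - 1) (by omega)
  rw [key]
  have he : (fun i => if q + i = k then f 0 else f (q + i)) '' {i | 1 ≤ i ∧ i ≤ k - q - 1} =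
      ear k f q := by
    ext x
    rw [mem_ear]
    constructor
    · rintro ⟨i, ⟨h1, h2⟩, rfl⟩
      exact ⟨q + i, by omega, by omega, (if_neg (by omega)).symm⟩
    · rintro ⟨i, h1, h2, rfl⟩
      refine ⟨i - q, ⟨by omega, by omega⟩, ?_⟩
      simp only [show q + (i - q) = i by omega, show i ≠ k by omega, if_false]
  rw [he]
  simp only [show q + (k - q - 1 + 1) = k by omega, show q ≠ k by omega, if_true, if_false,
    add_zero]
  rw [edge_comm]
  -- the other arc, as a path from `f 0` to `f q`
  by_cases hq2 : q < 2
  · refine h.anti fun a ha b hb hab => ?_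
    rw [sup_adj, edge_adj] at hab
    rcases hab with hab | ⟨hab, hne⟩
    · exact hab
    · have h01 := (hf.indCyc 0 1 (by omega) (by omega)).2.2 (.inl rfl)
      obtain rfl | rfl : q = 0 ∨ q = 1 := by omega
      · rcases hab with ⟨rfl, rfl⟩ | ⟨rfl, rfl⟩ <;> exact absurd rfl hne
      · rcases hab with ⟨rfl, rfl⟩ | ⟨rfl, rfl⟩
        · exact h01
        · exact h01.symm
  · have hpath : ∀ L : SimpleGraph V, G ≤ L → (∀ i, 1 ≤ i → i < q → ∀ b, L.Adj (f i) b → G.Adj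
      (f i) b) →
        (Good (A \ ear k f q) L ↔
          Good ((A \ ear k f q) \ (f '' {i | 1 ≤ i ∧ i ≤ q - 1})) (L ⊔ edge (f 0) (f q))) := by
      intro L hGL hL
      have := good_iff_path (L := L) (A := A \ ear k f q) (y := f) (m := q)
        (hGL ((hf.indCyc 0 1 (by omega) (by omega)).2.2 (.inl rfl)))
        (fun i hi1 hi j hj he => hf.indCyc.inj (by omega) (by omega) he)
        (fun i hi1 hi => ⟨hf.subset (mem_cyc.2 ⟨_, by omega, rfl⟩),
          hf.indCyc.notMem_ear (by omega) (by omega)⟩)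
        (fun i hi1 hi b hb => by
          rw [← hf.adj_iff (i := i) (by omega) (by omega) (by omega) hb.1]
          exact ⟨hL i hi1 hi b, fun h => hGL h⟩)
        (j := q - 1) (by omega)
      rwa [show q - 1 + 1 = q by omega] at this
    rw [hpath _ le_sup_left]
    · rw [sup_assoc, sup_idem]
      exact (hpath G le_rfl fun _ _ _ _ h => h).1 h
    · intro i hi1 hi b hab
      rw [sup_adj, edge_adj] at hab
      rcases hab with hab | ⟨⟨e, -⟩ | ⟨e, -⟩, -⟩
      · exact hab
      · have := hf.indCyc.inj (by omega) (by omega) e; omega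
      · have := hf.indCyc.inj (by omega) (by omega) e; omega

/-- Graphs in the class have treewidth at most two. -/
theorem good_of_isSC (hk : 5 ≤ k) (hG : IsSC k G) (A : Set V) : Good A G := by
  induction hn : A.ncard using Nat.strong_induction_on generalizing A with
  | _ n ih =>
  subst hn
  by_cases hlow : ∃ x ∈ A, degIn G A x ≤ 1
  · obtain ⟨x, hx, hd⟩ := hlow
    refine .step hx (low_of_degIn_le_one hd) ((ih _
      (Set.ncard_sdiff_singleton_lt_of_mem hx (Set.toFinite _)) (A \ {x}) rfl).anti ?_)
    rw [degIn_le_one_iff] at hd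
    rintro a ha b hb ⟨hab, h | ⟨h1, h2⟩⟩
    · exact h
    · exact absurd (hd a ha.1 b hb.1 h1.symm h2) hab
  push Not at hlow
  rcases A.eq_empty_or_nonempty with rfl | hne
  · exact .empty _
  obtain ⟨f, q, hf, -⟩ := exists_niceCyc hk hG (minDegTwo_iff_degIn.2 hlow) hne
  exact hf.good hk (ih _ (Set.ncard_lt_ncard (hf.sdiff_ear_ssubset (by omega)) (Set.toFinite _)) _
    rfl)

end Elimination

/-! ### Forests under local changes -/

section Forests
variable {V : Type*}

/-- `F'` together with new edges from `w` to `P`, in place of its old edges at `w`. -/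
def attach (F : SimpleGraph V) (w : V) (P : Set V) : SimpleGraph V where
  Adj x y := (x ≠ w ∧ y ≠ w ∧ F.Adj x y) ∨ (x = w ∧ y ≠ w ∧ y ∈ P) ∨ (y = w ∧ x ≠ w ∧ x ∈ P)
  symm := ⟨fun _ _ h => by
    rcases h with ⟨h1, h2, h3⟩ | h | h
    · exact .inl ⟨h2, h1, h3.symm⟩
    · exact .inr (.inr h)
    · exact .inr (.inl h)⟩
  loopless := ⟨fun _ h => by
    rcases h with ⟨_, _, h⟩ | ⟨h, h', _⟩ | ⟨h, h', _⟩
    · exact F.loopless.irrefl _ h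
    · exact h' h
    · exact h' h⟩

lemma attach_adj_of_ne {F : SimpleGraph V} {w x y : V} {P : Set V} (hx : x ≠ w) (hy : y ≠ w) :
    (attach F w P).Adj x y ↔ F.Adj x y := by
  simp [attach, hx, hy]

lemma attach_adj_left {F : SimpleGraph V} {w y : V} {P : Set V} (hy : y ≠ w) :
    (attach F w P).Adj w y ↔ y ∈ P := by
  simp [attach, hy]

lemma MinDegTwo.congr {F F' : SimpleGraph V} {B : Set V} (hB : MinDegTwo F B)
    (h : ∀ x ∈ B, ∀ y ∈ B, F.Adj x y → F'.Adj x y) : MinDegTwo F' B := by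
  intro v hv
  obtain ⟨x, hx, y, hy, hxy, h1, h2⟩ := hB v hv
  exact ⟨x, hx, y, hy, hxy, h v hv x hx h1, h v hv y hy h2⟩

/-- A vertex with at most one edge does not close a cycle. -/
lemma core_attach_subsingleton {F : SimpleGraph V} {A A' P : Set V} {w : V}
    (hP : P.Subsingleton) (hA : A \ {w} ⊆ A') (h : core F A' = ∅) : core (attach F w P) A = ∅ := by
  rw [core_eq_empty_iff] at h ⊢
  intro B hBA hB
  have hw : w ∉ B := by
    intro hw
    obtain ⟨x, hx, y, hy, hxy, h1, h2⟩ := hB w hw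
    rw [attach_adj_left h1.ne.symm] at h1
    rw [attach_adj_left h2.ne.symm] at h2
    exact hxy (hP h1 h2)
  refine h B (fun x hx => hA ⟨hBA hx, fun e => hw (e ▸ hx)⟩) (hB.congr fun x hx y hy hxy => ?_)
  rwa [attach_adj_of_ne (ne_of_mem_of_not_mem hx hw) (ne_of_mem_of_not_mem hy hw)] at hxy

/-- Subdividing an edge of a forest gives a forest. -/
lemma core_subdivide {F : SimpleGraph V} {A A' : Set V} {w p q : V} (hpq : F.Adj p q)
    (hA : A \ {w} ⊆ A') (h : core F A' = ∅) (hpw : p ≠ w) (hqw : q ≠ w) :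
    core (attach (F.deleteEdges {s(p, q)}) w {p, q}) A = ∅ := by
  rw [core_eq_empty_iff] at h ⊢
  intro B hBA hB
  by_cases hw : w ∈ B
  · have hpB : p ∈ B ∧ q ∈ B := by
      obtain ⟨x, hx, y, hy, hxy, h1, h2⟩ := hB w hw
      rw [attach_adj_left h1.ne.symm] at h1
      rw [attach_adj_left h2.ne.symm] at h2
      rcases h1 with rfl | rfl <;> rcases h2 with rfl | rfl <;> tauto
    have hsub : B \ {w} = ∅ := by
      refine h _ (fun x hx => hA ⟨hBA hx.1, hx.2⟩) ?_
      -- a neighbour of `v` in the subdivision, with `w` replaced by the other end of the edge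
      have hnb : ∀ v ∈ B \ {w}, ∀ x ∈ B, (attach (F.deleteEdges {s(p, q)}) w {p, q}).Adj v x →
          ∃ x' ∈ B \ {w}, F.Adj v x' ∧ ((x ≠ w ∧ x' = x ∧ s(v, x) ≠ s(p, q)) ∨
            (x = w ∧ s(v, x') = s(p, q))) := by
        rintro v ⟨hv, hvw⟩ x hx hvx
        by_cases hxw : x = w
        · subst hxw
          rw [SimpleGraph.adj_comm, attach_adj_left hvw] at hvx
          rcases hvx with rfl | rfl
          · exact ⟨q, ⟨hpB.2, hqw⟩, hpq, .inr ⟨rfl, rfl⟩⟩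
          · exact ⟨p, ⟨hpB.1, hpw⟩, hpq.symm, .inr ⟨rfl, Sym2.eq_swap⟩⟩
        · rw [attach_adj_of_ne hvw hxw, deleteEdges_adj] at hvx
          exact ⟨x, ⟨hx, hxw⟩, hvx.1, .inl ⟨hxw, rfl, by simpa using hvx.2⟩⟩
      rintro v hv
      obtain ⟨x, hx, y, hy, hxy, h1, h2⟩ := hB v hv.1
      obtain ⟨x', hx', hvx, hx2⟩ := hnb v hv x hx h1
      obtain ⟨y', hy', hvy, hy2⟩ := hnb v hv y hy h2
      refine ⟨x', hx', y', hy', ?_, hvx, hvy⟩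
      rintro rfl
      rcases hx2 with ⟨-, h3, h4⟩ | ⟨h3, h4⟩ <;> rcases hy2 with ⟨-, h5, h6⟩ | ⟨h5, h6⟩
      · exact hxy (h3 ▸ h5)
      · exact h4 (h3 ▸ h6)
      · exact h6 (h5 ▸ h4)
      · exact hxy (h3.trans h5.symm)
    exact absurd (show p ∈ B \ {w} from ⟨hpB.1, hpw⟩) (by rw [hsub]; exact Set.notMem_empty _)
  · refine h B (fun x hx => hA ⟨hBA hx, fun e => hw (e ▸ hx)⟩) (hB.congr fun x hx y hy hxy => ?_)
    rw [attach_adj_of_ne (ne_of_mem_of_not_mem hx hw) (ne_of_mem_of_not_mem hy hw)] at hxy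
    exact (deleteEdges_le _) hxy

/-- Replacing a path of length two in a forest by an edge gives a forest. -/
lemma core_sup_edge {F : SimpleGraph V} {A A' : Set V} {w p q : V} (hp : F.Adj w p)
    (hq : F.Adj w q) (hpq : p ≠ q) (hA : insert w A' ⊆ A) (hw : w ∉ A') (h : core F A = ∅) :
    core (F ⊔ edge p q) A' = ∅ := by
  rw [core_eq_empty_iff] at h ⊢
  intro B hBA hB
  have hwB : w ∉ B := fun h => hw (hBA h)
  by_cases hpqB : p ∈ B ∧ q ∈ B
  · have : insert w B = ∅ := by
      refine h _ ((Set.insert_subset_insert hBA).trans hA) ?_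
      rintro v (rfl | hv)
      · exact ⟨p, .inr hpqB.1, q, .inr hpqB.2, hpq, hp, hq⟩
      · have hnb : ∀ x ∈ B, (F ⊔ edge p q).Adj v x → ∃ x' ∈ insert w B, F.Adj v x' ∧
            (x' = x ∨ (x' = w ∧ s(v, x) = s(p, q))) := by
          intro x hx hvx
          rw [sup_adj, edge_adj] at hvx
          rcases hvx with hvx | ⟨⟨rfl, rfl⟩ | ⟨rfl, rfl⟩, -⟩
          · exact ⟨x, .inr hx, hvx, .inl rfl⟩
          · exact ⟨w, .inl rfl, hp.symm, .inr ⟨rfl, rfl⟩⟩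
          · exact ⟨w, .inl rfl, hq.symm, .inr ⟨rfl, Sym2.eq_swap⟩⟩
        obtain ⟨x, hx, y, hy, hxy, h1, h2⟩ := hB v hv
        obtain ⟨x', hx', hvx, hx2⟩ := hnb x hx h1
        obtain ⟨y', hy', hvy, hy2⟩ := hnb y hy h2
        refine ⟨x', hx', y', hy', ?_, hvx, hvy⟩
        rintro rfl
        rcases hx2 with rfl | ⟨rfl, h4⟩ <;> rcases hy2 with h5 | ⟨h5, h6⟩
        · exact hxy h5
        · exact hwB (h5 ▸ hx)
        · exact hwB (h5 ▸ hy)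
        · exact hxy (Sym2.congr_right.1 (h4.trans h6.symm))
    exact absurd (Set.mem_insert w B) (by rw [this]; exact Set.notMem_empty _)
  · refine h B (hBA.trans ((Set.subset_insert _ _).trans hA)) (hB.congr fun x hx y hy hxy => ?_)
    rw [sup_adj, edge_adj] at hxy
    rcases hxy with hxy | ⟨⟨rfl, rfl⟩ | ⟨rfl, rfl⟩, -⟩
    · exact hxy
    · exact absurd ⟨hx, hy⟩ hpqB
    · exact absurd ⟨hy, hx⟩ hpqB

end Forests

/-! ### Smallest transversals by eliminating vertices -/

section Tables
variable {V : Type*}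

/-- Cost tables for vertex pairs. For `a ≠ b`, the cost of the pair is `C a b` if both vertices are
kept and connected, `D a b` if both are kept and not connected, `M a b` if only `a` is deleted and
`E a b` if both are deleted. The diagonal entries `D a a` and `E a a` are the costs of keeping and
of deleting `a`. -/
structure Tab (V : Type*) where
  C : V → V → ℕ
  D : V → V → ℕ
  M : V → V → ℕ
  E : V → V → ℕ

/-- Costs do not depend on the order of a pair. (In `M a b`, the order says which vertex is
deleted.) -/
structure Tab.Symm (T : Tab V) : Prop where
  C : ∀ a b, T.C a b = T.C b a
  D : ∀ a b, T.D a b = T.D b a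
  E : ∀ a b, T.E a b = T.E b a

open Classical in
/-- The cost of the vertex `a` when `X` is deleted. -/
noncomputable def Tab.un (T : Tab V) (X : Set V) (a : V) : ℕ := if a ∈ X then T.E a a else T.D a a

open Classical in
/-- The cost of the pair `a`, `b` when `X` is deleted and the kept pairs in `F` are connected. -/
noncomputable def Tab.pc (T : Tab V) (X : Set V) (F : SimpleGraph V) (a b : V) : ℕ :=
  if a ∈ X then (if b ∈ X then T.E a b else T.M a b)
  else if b ∈ X then T.M b a else if F.Adj a b then T.C a b else T.D a b

/-- Twice the total cost of a configuration on `W`. -/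
noncomputable def Tab.wt [DecidableEq V] (T : Tab V) (W : Finset V) (X : Set V)
    (F : SimpleGraph V) : ℕ :=
  ∑ a ∈ W, (2 * T.un X a + ∑ b ∈ W.erase a, T.pc X F a b)

lemma Tab.Symm.pc_comm {T : Tab V} (h : T.Symm) (X : Set V) (F : SimpleGraph V) (a b : V) :
    T.pc X F a b = T.pc X F b a := by
  unfold Tab.pc
  rw [h.C a b, h.D a b, h.E a b, F.adj_comm]
  by_cases ha : a ∈ X <;> by_cases hb : b ∈ X <;> simp [ha, hb]

variable [DecidableEq V]

lemma Tab.Symm.wt_erase {T : Tab V} (h : T.Symm) {W : Finset V} {w : V} (hw : w ∈ W) (X : Set V)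
    (F : SimpleGraph V) : T.wt W X F =
      T.wt (W.erase w) X F + 2 * (T.un X w + ∑ b ∈ W.erase w, T.pc X F w b) := by
  unfold Tab.wt
  rw [← Finset.add_sum_erase _ _ hw]
  have : ∀ a ∈ W.erase w, 2 * T.un X a + ∑ b ∈ W.erase a, T.pc X F a b =
      (2 * T.un X a + ∑ b ∈ (W.erase w).erase a, T.pc X F a b) + T.pc X F w a := by
    intro a ha
    have hwa : w ∈ W.erase a := Finset.mem_erase.2 ⟨(Finset.ne_of_mem_erase ha).symm, hw⟩
    rw [← Finset.add_sum_erase _ _ hwa, Finset.erase_right_comm, h.pc_comm X F w a]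
    ring
  rw [Finset.sum_congr rfl this, Finset.sum_add_distrib]
  ring

lemma Tab.wt_congr {T T' : Tab V} {W : Finset V} {X X' : Set V} {F F' : SimpleGraph V}
    (h1 : ∀ a ∈ W, T.un X a = T'.un X' a)
    (h2 : ∀ a ∈ W, ∀ b ∈ W, a ≠ b → T.pc X F a b = T'.pc X' F' a b) :
    T.wt W X F = T'.wt W X' F' := by
  unfold Tab.wt
  refine Finset.sum_congr rfl fun a ha => ?_
  rw [h1 a ha]
  congr 1
  refine Finset.sum_congr rfl fun b hb => h2 a ha b (Finset.mem_of_mem_erase hb)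
    (Finset.ne_of_mem_erase hb).symm

lemma Tab.Symm.two_mul_pc_le {T : Tab V} (h : T.Symm) {W : Finset V} {a b : V} (ha : a ∈ W)
    (hb : b ∈ W) (hab : a ≠ b) (X : Set V) (F : SimpleGraph V) : 2 * T.pc X F a b ≤ T.wt W X F := by
  rw [h.wt_erase ha]
  have : T.pc X F a b ≤ ∑ b ∈ W.erase a, T.pc X F a b :=
    Finset.single_le_sum (f := fun b => T.pc X F a b) (fun _ _ => Nat.zero_le _)
      (Finset.mem_erase.2 ⟨hab.symm, hb⟩)
  omega

open Classical in
/-- The tables after the elimination of `w`, whose neighbours are updated so as to account for the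
cheapest choice at `w`. Diagonal entries are updated when `w` has one neighbour (`one`). For two
neighbours `a`, `b` that are kept, the choice is to delete `w`, or to keep it and to connect it to
at most one of them; connecting it to both amounts to connecting `a` and `b`, which is the second
alternative in `C`. -/
noncomputable def Tab.step (T : Tab V) (L : SimpleGraph V) (w : V) (one : Prop) : Tab V where
  C a b := if a ≠ b ∧ L.Adj w a ∧ L.Adj w b then
      min (T.C a b + min (T.E w w + (T.M w a + T.M w b))
          (T.D w w + min (T.D w a + T.D w b) (min (T.C w a + T.D w b) (T.D w a + T.C w b))))
        (T.D a b + (T.D w w + (T.C w a + T.C w b)))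
    else T.C a b
  D a b := if a ≠ b ∧ L.Adj w a ∧ L.Adj w b then
      T.D a b + min (T.E w w + (T.M w a + T.M w b))
          (T.D w w + min (T.D w a + T.D w b) (min (T.C w a + T.D w b) (T.D w a + T.C w b)))
    else if a = b ∧ L.Adj w a ∧ one then
      T.D a b + min (T.E w w + T.M w a) (T.D w w + min (T.C w a) (T.D w a))
    else T.D a b
  M a b := if a ≠ b ∧ L.Adj w a ∧ L.Adj w b then
      T.M a b + min (T.E w w + (T.E w a + T.M w b))
        (T.D w w + (T.M a w + min (T.C w b) (T.D w b)))
    else T.M a b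
  E a b := if a ≠ b ∧ L.Adj w a ∧ L.Adj w b then
      T.E a b + min (T.E w w + (T.E w a + T.E w b)) (T.D w w + (T.M a w + T.M b w))
    else if a = b ∧ L.Adj w a ∧ one then
      T.E a b + min (T.E w w + T.E w a) (T.D w w + T.M a w)
    else T.E a b

lemma Tab.Symm.step {T : Tab V} (h : T.Symm) (L : SimpleGraph V) (w : V) (one : Prop) :
    (T.step L w one).Symm := by
  refine ⟨fun a b => ?_, fun a b => ?_, fun a b => ?_⟩
  all_goals
    by_cases hab : a = b
    · subst hab; rfl
    have e1 := h.C a b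
    have e2 := h.D a b
    have e3 := h.E a b
    have e4 : min (T.C w a + T.D w b) (T.D w a + T.C w b) =
        min (T.C w b + T.D w a) (T.D w b + T.C w a) := by
      rw [min_comm, add_comm (T.D w a), add_comm (T.C w a)]
    by_cases hc : a ≠ b ∧ L.Adj w a ∧ L.Adj w b
    · have hc' : b ≠ a ∧ L.Adj w b ∧ L.Adj w a := ⟨hc.1.symm, hc.2.2, hc.2.1⟩
      simp only [Tab.step, if_pos hc, if_pos hc']
      try rw [e1]
      try rw [e2]
      try rw [e3]
      try rw [e4]
      try rw [add_comm (T.M w a)]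
      try rw [add_comm (T.M a w)]
      try rw [add_comm (T.E w a)]
      try rw [add_comm (T.D w a) (T.D w b)]
      try rw [add_comm (T.C w a) (T.C w b)]
    · have hc' : ¬ (b ≠ a ∧ L.Adj w b ∧ L.Adj w a) := fun h => hc ⟨h.1.symm, h.2.2, h.2.1⟩
      simp only [Tab.step, if_neg hc, if_neg hc', hab, Ne.symm hab, false_and, if_false]
      assumption

/-- Pairs in `W` not joined in `L` cost nothing, unless they are to be connected, which is
prohibitive: `n` bounds the size of the transversals considered. -/
structure Tab.Loc (T : Tab V) (W : Finset V) (L : SimpleGraph V) (n : ℕ) : Prop where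
  symm : T.Symm
  free : ∀ a ∈ W, ∀ b ∈ W, a ≠ b → ¬ L.Adj a b →
    T.D a b = 0 ∧ T.M a b = 0 ∧ T.E a b = 0 ∧ n < T.C a b

/-- Some configuration on `W` in which the kept connected pairs form a forest has cost at most
`m - c`. -/
def Tab.Feas (T : Tab V) (W : Finset V) (c m : ℕ) : Prop :=
  ∃ (X : Set V) (F : SimpleGraph V), core F (↑W \ X) = ∅ ∧ T.wt W X F + 2 * c ≤ 2 * m

omit [DecidableEq V] in
lemma Tab.Loc.pc_eq_zero {T : Tab V} {W : Finset V} {L : SimpleGraph V} {n : ℕ}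
    (h : T.Loc W L n) {a b : V} (ha : a ∈ W) (hb : b ∈ W) (hab : a ≠ b) (hL : ¬ L.Adj a b)
    {X : Set V} {F : SimpleGraph V} (hF : F.Adj a b → a ∈ X ∨ b ∈ X) : T.pc X F a b = 0 := by
  have h1 := h.free a ha b hb hab hL
  have h2 := h.free b hb a ha hab.symm fun h => hL h.symm
  unfold Tab.pc
  by_cases haX : a ∈ X <;> by_cases hbX : b ∈ X <;> simp [haX, hbX, h1, h2]
  intro hF'
  exact absurd (hF hF') (by tauto)

/-- In a configuration of small cost, no unlinked pair is connected. -/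
lemma Tab.Loc.mem_of_adj {T : Tab V} {W : Finset V} {L : SimpleGraph V} {n : ℕ}
    (h : T.Loc W L n) {a b : V} (ha : a ∈ W) (hb : b ∈ W) (hab : a ≠ b) (hL : ¬ L.Adj a b)
    {X : Set V} {F : SimpleGraph V} (hwt : T.wt W X F ≤ 2 * n) (hF : F.Adj a b) :
    a ∈ X ∨ b ∈ X := by
  by_contra! hX
  have h1 := h.free a ha b hb hab hL
  have h2 := h.symm.two_mul_pc_le ha hb hab X F
  unfold Tab.pc at h2
  simp only [hX.1, hX.2, hF, if_true, if_false] at h2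
  omega

lemma Tab.wt_update_pair {T T' : Tab V} (h : T.Symm) (h' : T'.Symm) {W : Finset V} {p q : V}
    (hp : p ∈ W) (hq : q ∈ W) (hpq : p ≠ q) {X X' : Set V} {F F' : SimpleGraph V}
    (hun : ∀ a ∈ W, T.un X a = T'.un X' a)
    (hpc : ∀ a ∈ W, ∀ b ∈ W, a ≠ b → s(a, b) ≠ s(p, q) → T.pc X F a b = T'.pc X' F' a b) :
    T'.wt W X' F' + 2 * T.pc X F p q = T.wt W X F + 2 * T'.pc X' F' p q := by
  have hqp : q ∈ W.erase p := Finset.mem_erase.2 ⟨hpq.symm, hq⟩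
  rw [h.wt_erase hp, h'.wt_erase hp, ← Finset.add_sum_erase _ _ hqp,
    ← Finset.add_sum_erase _ _ hqp, hun p hp]
  have h1 : T.wt (W.erase p) X F = T'.wt (W.erase p) X' F' := by
    refine Tab.wt_congr (fun a ha => hun a (Finset.mem_of_mem_erase ha)) fun a ha b hb hab =>
      hpc a (Finset.mem_of_mem_erase ha) b (Finset.mem_of_mem_erase hb) hab fun e => ?_
    have h1 := Finset.ne_of_mem_erase ha
    have h2 := Finset.ne_of_mem_erase hb
    rcases Sym2.eq_iff.1 e with ⟨e1, -⟩ | ⟨-, e2⟩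
    · exact h1 e1
    · exact h2 e2
  have h2 : ∑ b ∈ (W.erase p).erase q, T.pc X F p b =
      ∑ b ∈ (W.erase p).erase q, T'.pc X' F' p b := by
    refine Finset.sum_congr rfl fun b hb => ?_
    have hbq := Finset.ne_of_mem_erase hb
    have hbp := Finset.ne_of_mem_erase (Finset.mem_of_mem_erase hb)
    refine hpc p hp b (Finset.mem_of_mem_erase (Finset.mem_of_mem_erase hb)) hbp.symm fun e => ?_
    rcases Sym2.eq_iff.1 e with ⟨-, e1⟩ | ⟨-, e2⟩
    · exact hbq e1
    · exact hbp e2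
  rw [h1, h2]
  ring

/-- The cost of the vertex `w` and of its pairs when its neighbours are among `p` and `q`. -/
lemma Tab.Loc.wt_pair {T : Tab V} {W : Finset V} {L : SimpleGraph V} {n : ℕ}
    (h : T.Loc W L n) {w p q : V} (hw : w ∈ W) (hp : p ∈ W.erase w) (hq : q ∈ W.erase w)
    (hpq : p ≠ q) (hL : ∀ b ∈ W, L.Adj w b → b = p ∨ b = q) {X : Set V} {F : SimpleGraph V}
    (hF : ∀ b ∈ W, b ≠ w → ¬ L.Adj w b → F.Adj w b → w ∈ X ∨ b ∈ X) :
    T.wt W X F = T.wt (W.erase w) X F + 2 * (T.un X w + (T.pc X F w p + T.pc X F w q)) := by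
  rw [h.symm.wt_erase hw, ← Finset.add_sum_erase _ _ hp,
    ← Finset.add_sum_erase _ _ (Finset.mem_erase.2 ⟨hpq.symm, hq⟩), Finset.sum_eq_zero, add_zero]
  intro b hb
  have hbq := Finset.ne_of_mem_erase hb
  have hb := Finset.mem_of_mem_erase hb
  have hbp := Finset.ne_of_mem_erase hb
  have hb := Finset.mem_of_mem_erase hb
  have hbw := Finset.ne_of_mem_erase hb
  have hbW := Finset.mem_of_mem_erase hb
  have hwb : ¬ L.Adj w b := fun h => by rcases hL b hbW h with e | e <;> contradiction
  exact h.pc_eq_zero hw hbW hbw.symm hwb (hF b hbW hbw hwb)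

set_option maxHeartbeats 4000000 in
/-- Elimination of a vertex with two neighbours. A configuration on the smaller set is extended by a
cheapest choice at `w`; conversely, `w` is removed, and its neighbours become connected if they
have been connected through `w`. -/
lemma Tab.Loc.feas_step_pair {T : Tab V} {W : Finset V} {L : SimpleGraph V} {n : ℕ}
    (h : T.Loc W L n) {w p q : V} (hw : w ∈ W) (hp : p ∈ W.erase w) (hq : q ∈ W.erase w)
    (hpq : p ≠ q) (hwp : L.Adj w p) (hwq : L.Adj w q)
    (hL : ∀ b ∈ W, L.Adj w b → b = p ∨ b = q) {c m : ℕ} (hm : m ≤ n) :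
    T.Feas W c m ↔ (T.step L w False).Feas (W.erase w) c m := by
  classical
  have hpw := Finset.ne_of_mem_erase hp
  have hqw := Finset.ne_of_mem_erase hq
  have hpW := Finset.mem_of_mem_erase hp
  have hqW := Finset.mem_of_mem_erase hq
  have hsy := h.symm
  have hsy' := hsy.step L w False
  have hun : ∀ (X X' : Set V) (a : V), (a ∈ X ↔ a ∈ X') → T.un X a =
      (T.step L w False).un X' a := by
    intro X X' a ha
    simp [Tab.un, Tab.step, ha]
  have hpc : ∀ (X X' : Set V) (F F' : SimpleGraph V), ∀ a ∈ W.erase w, ∀ b ∈ W.erase w, a ≠ b →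
      s(a, b) ≠ s(p, q) → (a ∈ X ↔ a ∈ X') → (b ∈ X ↔ b ∈ X') → (F.Adj a b ↔ F'.Adj a b) →
      T.pc X F a b = (T.step L w False).pc X' F' a b := by
    intro X X' F F' a ha b hb hab hne h1 h2 h3
    have hn : ¬ (L.Adj w a ∧ L.Adj w b) := by
      rintro ⟨h4, h5⟩
      have h4 := hL a (Finset.mem_of_mem_erase ha) h4
      have h5 := hL b (Finset.mem_of_mem_erase hb) h5
      rcases h4 with rfl | rfl <;> rcases h5 with rfl | rfl
      · exact hab rfl
      · exact hne rfl
      · exact hne Sym2.eq_swap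
      · exact hab rfl
    have hn' : ¬ (L.Adj w b ∧ L.Adj w a) := fun h => hn h.symm
    simp [Tab.pc, Tab.step, hn, hn', hab, hab.symm, h1, h2, h3]
  have e1 := hsy.C w p
  have e2 := hsy.C w q
  have e3 := hsy.D w p
  have e4 := hsy.D w q
  have e5 := hsy.E w p
  have e6 := hsy.E w q
  have hqp : q ≠ p := hpq.symm
  have sC : (T.step L w False).C p q = _ := if_pos ⟨hpq, hwp, hwq⟩
  have sD : (T.step L w False).D p q = _ := if_pos ⟨hpq, hwp, hwq⟩
  have sE : (T.step L w False).E p q = _ := if_pos ⟨hpq, hwp, hwq⟩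
  have sM : (T.step L w False).M p q = _ := if_pos ⟨hpq, hwp, hwq⟩
  have sM' : (T.step L w False).M q p = _ := if_pos ⟨hqp, hwq, hwp⟩
  constructor
  · rintro ⟨X, F, hF, hwt⟩
    have hex : ∀ F' : SimpleGraph V, core F' (↑(W.erase w) \ X) = ∅ →
        (∀ a ∈ W.erase w, ∀ b ∈ W.erase w, s(a, b) ≠ s(p, q) → (F.Adj a b ↔ F'.Adj a b)) →
        (T.step L w False).pc X F' p q ≤
          T.pc X F p q + (T.un X w + (T.pc X F w p + T.pc X F w q)) →
        (T.step L w False).Feas (W.erase w) c m := by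
      intro F' hF' hag hle
      refine ⟨X, F', hF', ?_⟩
      have k1 := h.wt_pair hw hp hq hpq hL (X := X) (F := F) fun b hb hbw hwb hFb =>
        h.mem_of_adj hw hb hbw.symm hwb (by omega) hFb
      have k2 := Tab.wt_update_pair hsy hsy' hp hq hpq (X := X) (X' := X) (F := F) (F' := F')
        (fun a _ => hun X X a Iff.rfl) fun a ha b hb hab hne =>
          hpc X X F F' a ha b hb hab hne Iff.rfl Iff.rfl (hag a ha b hb hne)
      omega
    have hsub : (↑(W.erase w) : Set V) \ X ⊆ ↑W \ X := Set.sdiff_subset_sdiff_left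
      (Finset.coe_subset.2 (Finset.erase_subset _ _))
    by_cases hcc : (w ∉ X ∧ p ∉ X ∧ q ∉ X) ∧ F.Adj w p ∧ F.Adj w q
    · obtain ⟨⟨hwX, hpX, hqX⟩, hFp, hFq⟩ := hcc
      have hFpq : ¬ F.Adj p q := by
        intro hFpq
        have hmd : MinDegTwo F {w, p, q} := by
          rintro v (rfl | rfl | rfl)
          · exact ⟨p, by simp, q, by simp, hpq, hFp, hFq⟩
          · exact ⟨w, by simp, q, by simp, hqw.symm, hFp.symm, hFpq⟩
          · exact ⟨w, by simp, p, by simp, hpw.symm, hFq.symm, hFpq.symm⟩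
        have := core_eq_empty_iff.1 hF {w, p, q} (by
          rintro v (rfl | rfl | rfl)
          · exact ⟨hw, hwX⟩
          · exact ⟨hpW, hpX⟩
          · exact ⟨hqW, hqX⟩) hmd
        exact absurd (show w ∈ ({w, p, q} : Set V) by simp) (by rw [this]; simp)
      refine hex (F ⊔ edge p q) (core_sup_edge hFp hFq hpq (A := ↑W \ X) ?_ (by simp) hF) ?_ ?_
      · exact Set.insert_subset ⟨hw, hwX⟩ hsub
      · intro a ha b hb hne
        rw [sup_adj, edge_adj]
        constructor
        · exact .inl
        · rintro (h | ⟨h, -⟩)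
          · exact h
          · exact absurd (Sym2.eq_iff.2 (by tauto)) hne
      · have hpq' : (F ⊔ edge p q).Adj p q := by rw [sup_adj, edge_adj]; simp [hpq]
        simp only [Tab.pc, Tab.un, hwX, hpX, hqX, hFp, hFq, hFpq, hpq', if_true, if_false, sC]
        clear sC sD sE sM sM'
        omega
    · refine hex F (Set.subset_empty_iff.1 (hF ▸ core_mono hsub)) (fun _ _ _ _ _ => Iff.rfl) ?_
      by_cases hwX : w ∈ X <;> by_cases hpX : p ∈ X <;> by_cases hqX : q ∈ X <;>
        by_cases hFp : F.Adj w p <;> by_cases hFq : F.Adj w q <;> by_cases hFpq : F.Adj p q <;>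
        simp only [Tab.pc, Tab.un, hwX, hpX, hqX, hFp, hFq, hFpq, if_true, if_false, sC, sD, sE,
          sM, sM', not_true, not_false_iff, and_self, and_true, and_false]
          at hcc ⊢ <;>
        (clear sC sD sE sM sM'; omega)
  · rintro ⟨X, F, hF, hwt⟩
    have hnw : ∀ a ∈ W.erase w, a ≠ w := fun a ha => Finset.ne_of_mem_erase ha
    have hex : ∀ (X' : Set V) (F' : SimpleGraph V), (∀ a, a ≠ w → (a ∈ X' ↔ a ∈ X)) →
        core F' (↑W \ X') = ∅ →
        (∀ a ∈ W.erase w, ∀ b ∈ W.erase w, s(a, b) ≠ s(p, q) → (F'.Adj a b ↔ F.Adj a b)) →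
        (∀ b ∈ W, b ≠ p → b ≠ q → ¬ F'.Adj w b) →
        T.pc X' F' p q + (T.un X' w + (T.pc X' F' w p + T.pc X' F' w q)) ≤
          (T.step L w False).pc X F p q → T.Feas W c m := by
      intro X' F' hX' hF' hag hFw hle
      refine ⟨X', F', hF', ?_⟩
      have k1 := h.wt_pair hw hp hq hpq hL (X := X') (F := F') fun b hb hbw hwb hFb =>
        absurd hFb (hFw b hb (fun e => hwb (e ▸ hwp)) (fun e => hwb (e ▸ hwq)))
      have k2 := Tab.wt_update_pair hsy hsy' hp hq hpq (X := X') (X' := X) (F := F') (F' := F)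
        (fun a ha => hun X' X a (hX' a (hnw a ha))) fun a ha b hb hab hne =>
          hpc X' X F' F a ha b hb hab hne (hX' a (hnw a ha)) (hX' b (hnw b hb)) (hag a ha b hb hne)
      omega
    -- `w` is deleted, or kept with at most one edge
    have hone : ∀ (X' : Set V) (P : Set V), P ⊆ {p, q} → P.Subsingleton →
        (∀ a, a ≠ w → (a ∈ X' ↔ a ∈ X)) →
        T.pc X' (attach F w P) p q + (T.un X' w + (T.pc X' (attach F w P) w p +
          T.pc X' (attach F w P) w q)) ≤ (T.step L w False).pc X F p q → T.Feas W c m := by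
      intro X' P hP hPs hX' hle
      refine hex X' (attach F w P) hX' (core_attach_subsingleton hPs ?_ hF) ?_ ?_ hle
      · rintro x ⟨⟨hx, hxX⟩, hxw⟩
        exact ⟨Finset.mem_coe.2 (Finset.mem_erase.2 ⟨hxw, hx⟩), fun h => hxX ((hX' x hxw).2 h)⟩
      · intro a ha b hb _
        exact attach_adj_of_ne (hnw a ha) (hnw b hb)
      · intro b hb hbp hbq hadj
        rw [attach_adj_left hadj.ne.symm] at hadj
        rcases hP hadj with e | e
        · exact hbp e
        · exact hbq e
    have hcc : (p ∉ X ∧ q ∉ X ∧ F.Adj p q ∧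
        T.D p q + (T.D w w + (T.C w p + T.C w q)) ≤ (T.step L w False).C p q) → T.Feas W c m := by
      rintro ⟨hpX, hqX, hFpq, hle⟩
      have hX' : ∀ a, a ≠ w → (a ∈ X \ {w} ↔ a ∈ X) := fun a ha => by simp [ha]
      refine hex (X \ {w}) (attach (F.deleteEdges {s(p, q)}) w {p, q}) hX'
        (core_subdivide hFpq ?_ hF hpw hqw) ?_ ?_ ?_
      · rintro x ⟨⟨hx, hxX⟩, hxw⟩
        exact ⟨Finset.mem_coe.2 (Finset.mem_erase.2 ⟨hxw, hx⟩), fun h => hxX ((hX' x hxw).2 h)⟩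
      · intro a ha b hb hne
        rw [attach_adj_of_ne (hnw a ha) (hnw b hb), deleteEdges_adj]
        exact ⟨fun h => h.1, fun h => ⟨h, by simpa using hne⟩⟩
      · intro b hb hbp hbq hadj
        rw [attach_adj_left hadj.ne.symm] at hadj
        rcases hadj with e | e
        · exact hbp e
        · exact hbq e
      · have a1 : (attach (F.deleteEdges {s(p, q)}) w {p, q}).Adj w p :=
          (attach_adj_left hpw).2 (by simp)
        have a2 : (attach (F.deleteEdges {s(p, q)}) w {p, q}).Adj w q :=
          (attach_adj_left hqw).2 (by simp)
        have a3 : ¬ (attach (F.deleteEdges {s(p, q)}) w {p, q}).Adj p q := by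
          rw [attach_adj_of_ne hpw hqw, deleteEdges_adj]; simp
        simp only [Tab.pc, Tab.un, Set.mem_sdiff, hpX, hqX, a1, a2, a3, hFpq, Set.mem_singleton_iff,
          not_true, and_false, false_and, if_true, if_false]
        exact hle
    have b1 : ∀ P : Set V, (attach F w P).Adj w p ↔ p ∈ P := fun P => attach_adj_left hpw
    have b2 : ∀ P : Set V, (attach F w P).Adj w q ↔ q ∈ P := fun P => attach_adj_left hqw
    have b3 : ∀ P : Set V, (attach F w P).Adj p q ↔ F.Adj p q := fun P => attach_adj_of_ne hpw hqw
    -- the four ways to attach `w` with at most one edge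
    have o0 := hone (insert w X) ∅ (by simp) (by simp) (fun a ha => by simp [ha])
    have o1 := hone (X \ {w}) ∅ (by simp) (by simp) (fun a ha => by simp [ha])
    have o2 := hone (X \ {w}) {p} (by simp) (by simp) (fun a ha => by simp [ha])
    have o3 := hone (X \ {w}) {q} (by simp) (by simp) (fun a ha => by simp [ha])
    by_cases hpX : p ∈ X <;> by_cases hqX : q ∈ X <;> by_cases hFpq : F.Adj p q <;>
      simp only [Tab.pc, Tab.un, Set.mem_sdiff, Set.mem_insert_iff, Set.mem_singleton_iff, hpX, hqX,
        hFpq, b1, b2, b3, hpw, hqw, hpq, hqp, true_or, or_true, not_true, not_false_iff, and_false,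
        and_true, false_and, true_and, if_true, if_false, Set.mem_empty_iff_false, sC, sD, sE, sM,
        sM', and_self, false_or] at o0 o1 o2 o3 hcc <;>
      clear hone hex hun hpc sC sD sE sM sM' <;>
      (by_contra hcon
       have o0' := fun h => hcon (o0 h)
       have o1' := fun h => hcon (o1 h)
       have o2' := fun h => hcon (o2 h)
       have o3' := fun h => hcon (o3 h)
       have hcc' := fun h => hcon (hcc h)
       clear o0 o1 o2 o3 hcc hwt hcon
       simp only [imp_false, not_le, not_false_iff] at o0' o1' o2' o3' hcc'
       omega)

end Tables

/-! ### The elimination procedure -/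

section Eliminations
variable {V : Type*} [DecidableEq V]

/-- Elimination of a vertex with one neighbour. -/
lemma Tab.Loc.feas_step_single {T : Tab V} {W : Finset V} {L : SimpleGraph V} {n : ℕ}
    (h : T.Loc W L n) {w p : V} (hw : w ∈ W) (hp : p ∈ W.erase w) (hwp : L.Adj w p)
    (hL : ∀ b ∈ W, L.Adj w b → b = p) {c m : ℕ} (hm : m ≤ n) :
    T.Feas W c m ↔ (T.step L w True).Feas (W.erase w) c m := by
  classical
  have hpw := Finset.ne_of_mem_erase hp
  have hpW := Finset.mem_of_mem_erase hp
  have hsy := h.symm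
  have hsy' := hsy.step L w True
  have hnw : ∀ a ∈ W.erase w, a ≠ w := fun a ha => Finset.ne_of_mem_erase ha
  have e1 := hsy.C w p
  have e3 := hsy.D w p
  have e5 := hsy.E w p
  have sD : (T.step L w True).D p p =
      T.D p p + min (T.E w w + T.M w p) (T.D w w + min (T.C w p) (T.D w p)) := by
    simp [Tab.step, hwp]
  have sE : (T.step L w True).E p p =
      T.E p p + min (T.E w w + T.E w p) (T.D w w + T.M p w) := by
    simp [Tab.step, hwp]
  -- only the cost of the vertex `p` changes
  have hupd : ∀ (X X' : Set V) (F F' : SimpleGraph V), (∀ a, a ≠ w → (a ∈ X ↔ a ∈ X')) →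
      (∀ a ∈ W.erase w, ∀ b ∈ W.erase w, F.Adj a b ↔ F'.Adj a b) →
      (T.step L w True).wt (W.erase w) X' F' + 2 * T.un X p =
        T.wt (W.erase w) X F + 2 * (T.step L w True).un X' p := by
    intro X X' F F' hX hF
    have hpc : ∀ a ∈ W.erase w, ∀ b ∈ W.erase w, a ≠ b →
        T.pc X F a b = (T.step L w True).pc X' F' a b := by
      intro a ha b hb hab
      have hn : ¬ (L.Adj w a ∧ L.Adj w b) := by
        rintro ⟨h4, h5⟩
        exact hab ((hL a (Finset.mem_of_mem_erase ha) h4).trans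
          (hL b (Finset.mem_of_mem_erase hb) h5).symm)
      have hn' : ¬ (L.Adj w b ∧ L.Adj w a) := fun h => hn h.symm
      simp [Tab.pc, Tab.step, hn, hn', hab, hX a (hnw a ha), hX b (hnw b hb), hF a ha b hb]
    have hun : ∀ a ∈ (W.erase w).erase p, T.un X a = (T.step L w True).un X' a := by
      intro a ha
      have hap := Finset.ne_of_mem_erase ha
      have ha := Finset.mem_of_mem_erase ha
      have hwa : ¬ L.Adj w a := fun h => hap (hL a (Finset.mem_of_mem_erase ha) h)
      simp [Tab.un, Tab.step, hwa, hX a (hnw a ha)]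
    rw [hsy.wt_erase hp, hsy'.wt_erase hp, Tab.wt_congr hun fun a ha b hb =>
      hpc a (Finset.mem_of_mem_erase ha) b (Finset.mem_of_mem_erase hb),
      Finset.sum_congr rfl fun b hb => hpc p hp b (Finset.mem_of_mem_erase hb)
        (Finset.ne_of_mem_erase hb).symm]
    ring
  have hwt : ∀ (X : Set V) (F : SimpleGraph V),
      (∀ b ∈ W, b ≠ w → ¬ L.Adj w b → F.Adj w b → w ∈ X ∨ b ∈ X) →
      T.wt W X F = T.wt (W.erase w) X F + 2 * (T.un X w + T.pc X F w p) := by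
    intro X F hF
    rw [hsy.wt_erase hw, ← Finset.add_sum_erase _ _ hp, Finset.sum_eq_zero, add_zero]
    intro b hb
    have hbp := Finset.ne_of_mem_erase hb
    have hb := Finset.mem_of_mem_erase hb
    have hbw := Finset.ne_of_mem_erase hb
    have hbW := Finset.mem_of_mem_erase hb
    have hwb : ¬ L.Adj w b := fun h => hbp (hL b hbW h)
    exact h.pc_eq_zero hw hbW hbw.symm hwb (hF b hbW hbw hwb)
  constructor
  · rintro ⟨X, F, hF, hle⟩
    refine ⟨X, F, Set.subset_empty_iff.1 (hF ▸ core_mono (Set.sdiff_subset_sdiff_left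
      (Finset.coe_subset.2 (Finset.erase_subset _ _)))), ?_⟩
    have k1 := hwt X F fun b hb hbw hwb hFb => h.mem_of_adj hw hb hbw.symm hwb (by omega) hFb
    have k2 := hupd X X F F (fun _ _ => Iff.rfl) fun _ _ _ _ => Iff.rfl
    have k3 : (T.step L w True).un X p ≤ T.un X p + (T.un X w + T.pc X F w p) := by
      by_cases hwX : w ∈ X <;> by_cases hpX : p ∈ X <;> by_cases hFp : F.Adj w p <;>
        simp only [Tab.pc, Tab.un, hwX, hpX, hFp, if_true, if_false, sD, sE] <;>
        (clear sD sE; omega)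
    omega
  · rintro ⟨X, F, hF, hle⟩
    have hone : ∀ (X' P : Set V), P ⊆ {p} → (∀ a, a ≠ w → (a ∈ X' ↔ a ∈ X)) →
        T.un X' p + (T.un X' w + T.pc X' (attach F w P) w p) ≤ (T.step L w True).un X p →
        T.Feas W c m := by
      intro X' P hP hX' hun
      refine ⟨X', attach F w P,
        core_attach_subsingleton (Set.subsingleton_singleton.anti hP) ?_ hF, ?_⟩
      · rintro x ⟨⟨hx, hxX⟩, hxw⟩
        exact ⟨Finset.mem_coe.2 (Finset.mem_erase.2 ⟨hxw, hx⟩), fun h => hxX ((hX' x hxw).2 h)⟩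
      · have k1 := hwt X' (attach F w P) fun b hb hbw hwb hFb => by
          rw [attach_adj_left hbw] at hFb
          rw [hP hFb] at hwb
          exact absurd hwp hwb
        have k2 := hupd X' X (attach F w P) F hX' fun a ha b hb =>
          attach_adj_of_ne (hnw a ha) (hnw b hb)
        omega
    have b1 : ∀ P : Set V, (attach F w P).Adj w p ↔ p ∈ P := fun P => attach_adj_left hpw
    have o0 := hone (insert w X) ∅ (by simp) (fun a ha => by simp [ha])
    have o1 := hone (X \ {w}) ∅ (by simp) (fun a ha => by simp [ha])
    have o2 := hone (X \ {w}) {p} (by simp) (fun a ha => by simp [ha])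
    by_cases hpX : p ∈ X <;>
      simp only [Tab.pc, Tab.un, Set.mem_sdiff, Set.mem_insert_iff, Set.mem_singleton_iff, hpX, b1,
        hpw, true_or, or_true, not_true, not_false_iff, and_false, and_true, if_true, if_false,
        Set.mem_empty_iff_false, or_false, sD, sE, and_self] at o0 o1 o2 <;>
      clear hone hupd hwt sD sE <;>
      (by_contra hcon
       have o0' := fun h => hcon (o0 h)
       have o1' := fun h => hcon (o1 h)
       have o2' := fun h => hcon (o2 h)
       simp only [imp_false, not_le] at o0' o1' o2'
       clear o0 o1 o2 hle hcon
       omega)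

/-- Elimination of an isolated vertex. -/
lemma Tab.Loc.feas_step_isolated {T : Tab V} {W : Finset V} {L : SimpleGraph V} {n : ℕ}
    (h : T.Loc W L n) {w : V} (hw : w ∈ W) (hL : ∀ b ∈ W, ¬ L.Adj w b) {c m : ℕ} (hm : m ≤ n) :
    T.Feas W c m ↔
      (T.step L w False).Feas (W.erase w) (c + min (T.D w w) (T.E w w)) m := by
  classical
  have hsy := h.symm
  have hnw : ∀ a ∈ W.erase w, a ≠ w := fun a ha => Finset.ne_of_mem_erase ha
  have hupd : ∀ (X X' : Set V) (F F' : SimpleGraph V), (∀ a, a ≠ w → (a ∈ X ↔ a ∈ X')) →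
      (∀ a ∈ W.erase w, ∀ b ∈ W.erase w, F.Adj a b ↔ F'.Adj a b) →
      (T.step L w False).wt (W.erase w) X' F' = T.wt (W.erase w) X F := by
    intro X X' F F' hX hF
    refine Tab.wt_congr (fun a ha => ?_) (fun a ha b hb hab => ?_)
    · simp [Tab.un, Tab.step, hX a (hnw a ha)]
    · have hna := hL a (Finset.mem_of_mem_erase ha)
      have hnb := hL b (Finset.mem_of_mem_erase hb)
      simp [Tab.pc, Tab.step, hna, hnb, hX a (hnw a ha), hX b (hnw b hb), hF a ha b hb]
  have hwt : ∀ (X : Set V) (F : SimpleGraph V),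
      (∀ b ∈ W, b ≠ w → F.Adj w b → w ∈ X ∨ b ∈ X) →
      T.wt W X F = T.wt (W.erase w) X F + 2 * T.un X w := by
    intro X F hF
    rw [hsy.wt_erase hw, Finset.sum_eq_zero, add_zero]
    intro b hb
    have hbw := Finset.ne_of_mem_erase hb
    have hbW := Finset.mem_of_mem_erase hb
    exact h.pc_eq_zero hw hbW hbw.symm (hL b hbW) (hF b hbW hbw)
  constructor
  · rintro ⟨X, F, hF, hle⟩
    refine ⟨X, F, Set.subset_empty_iff.1 (hF ▸ core_mono (Set.sdiff_subset_sdiff_left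
      (Finset.coe_subset.2 (Finset.erase_subset _ _)))), ?_⟩
    have k1 := hwt X F fun b hb hbw hFb => h.mem_of_adj hw hb hbw.symm (hL b hb) (by omega) hFb
    have k2 := hupd X X F F (fun _ _ => Iff.rfl) fun _ _ _ _ => Iff.rfl
    have k3 : min (T.D w w) (T.E w w) ≤ T.un X w := by
      unfold Tab.un
      split_ifs <;> simp
    omega
  · rintro ⟨X, F, hF, hle⟩
    have hone : ∀ X' : Set V, (∀ a, a ≠ w → (a ∈ X' ↔ a ∈ X)) →
        T.un X' w ≤ min (T.D w w) (T.E w w) → T.Feas W c m := by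
      intro X' hX' hun
      refine ⟨X', attach F w ∅, core_attach_subsingleton Set.subsingleton_empty ?_ hF, ?_⟩
      · rintro x ⟨⟨hx, hxX⟩, hxw⟩
        exact ⟨Finset.mem_coe.2 (Finset.mem_erase.2 ⟨hxw, hx⟩), fun h => hxX ((hX' x hxw).2 h)⟩
      · have k1 := hwt X' (attach F w ∅) fun b hb hbw hFb => by
          rw [attach_adj_left hbw] at hFb
          exact absurd hFb (Set.notMem_empty _)
        have k2 := hupd X' X (attach F w ∅) F hX' fun a ha b hb =>
          attach_adj_of_ne (hnw a ha) (hnw b hb)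
        omega
    rcases min_choice (T.D w w) (T.E w w) with hmin | hmin
    · refine hone (X \ {w}) (fun a ha => by simp [ha]) ?_
      simp [Tab.un, hmin]
    · refine hone (insert w X) (fun a ha => by simp [ha]) ?_
      simp [Tab.un, hmin]

lemma Tab.Loc.step {T : Tab V} {W : Finset V} {L : SimpleGraph V} {n : ℕ}
    (h : T.Loc W L n) (w : V) (one : Prop) : (T.step L w one).Loc (W.erase w) (fill L w) n := by
  classical
  refine ⟨h.symm.step L w one, fun a ha b hb hab hL => ?_⟩
  rw [fill_adj] at hL
  have h1 : ¬ L.Adj a b := fun h => hL ⟨hab, .inl h⟩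
  have h2 : ¬ (L.Adj w a ∧ L.Adj w b) := fun h => hL ⟨hab, .inr ⟨h.1.symm, h.2⟩⟩
  have := h.free a (Finset.mem_of_mem_erase ha) b (Finset.mem_of_mem_erase hb) hab h1
  simpa [Tab.step, hab, h2] using this

/-- The state of the elimination: the remaining vertices, the pairs with nontrivial cost, the cost
tables and the cost of the eliminated part. -/
structure Elim (V : Type*) where
  W : Finset V
  L : SimpleGraph V
  T : Tab V
  c : ℕ

open Classical in
/-- Elimination of `w`. -/
noncomputable def Elim.next (s : Elim V) (w : V) : Elim V where
  W := s.W.erase w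
  L := fill s.L w
  T := s.T.step s.L w (degIn s.L s.W w = 1)
  c := if degIn s.L s.W w = 0 then s.c + min (s.T.D w w) (s.T.E w w) else s.c

open Classical in
/-- The initial state: deleting a vertex costs one, and the connected pairs have to be the edges of
`G` between kept vertices, every violation costing more than `n`. -/
noncomputable def Elim.init (G : SimpleGraph V) (B : Finset V) (n : ℕ) : Elim V where
  W := B
  L := G
  T := { C := fun a b => if G.Adj a b then 0 else n + 1
         D := fun a b => if G.Adj a b then n + 1 else 0
         M := fun _ _ => 0
         E := fun a b => if a = b then 1 else 0 }
  c := 0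

/-- The invariant of the elimination: the smallest cost of a configuration is the smallest size of a
transversal of `B`. -/
structure Elim.Inv (G : SimpleGraph V) (B : Finset V) (n : ℕ) (s : Elim V) : Prop where
  loc : s.T.Loc s.W s.L n
  good : Good (s.W : Set V) s.L
  feas : ∀ m ≤ n, (∃ S, Hits G B S ∧ S.ncard ≤ m) ↔ s.T.Feas s.W s.c m

variable [Finite V] {G : SimpleGraph V} {B : Finset V} {n : ℕ} {s : Elim V}

omit [DecidableEq V] in
lemma degIn_eq_zero_iff {A : Set V} {v : V} : degIn G A v = 0 ↔ ∀ b ∈ A, ¬ G.Adj v b := by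
  rw [degIn, Set.ncard_eq_zero (Set.toFinite _), Set.eq_empty_iff_forall_notMem]
  exact ⟨fun h b hb hvb => h b ⟨hb, hvb⟩, fun h b hb => h b hb.1 hb.2⟩

omit [DecidableEq V] in
lemma degIn_le_two_of_low {L : SimpleGraph V} {W : Set V} {w : V} (h : Low L W w) :
    degIn L W w ≤ 2 := by
  obtain ⟨p, q, h⟩ := h
  calc degIn L W w ≤ ({p, q} : Set V).ncard :=
        Set.ncard_le_ncard (fun b hb => h b hb.1 hb.2) (Set.toFinite _)
    _ ≤ 2 := (Set.ncard_insert_le _ _).trans (by rw [Set.ncard_singleton])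

omit [DecidableEq V] [Finite V] in
lemma Good.exists_low {L : SimpleGraph V} {W : Set V} (h : Good W L) (hne : W.Nonempty) :
    ∃ w ∈ W, Low L W w := by
  induction h with
  | empty L => exact absurd hne Set.not_nonempty_empty
  | @step W L w hw hl h ih => exact ⟨w, hw, hl⟩

/-- Elimination of a vertex with at most two neighbours preserves the invariant. -/
theorem Elim.Inv.next (h : s.Inv G B n) {w : V} (hw : w ∈ s.W) (hd : degIn s.L s.W w ≤ 2) :
    (s.next w).Inv G B n := by
  have hcoe : ((s.W.erase w : Finset V) : Set V) = (s.W : Set V) \ {w} := Finset.coe_erase _ _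
  have hlow : Low s.L s.W w := by
    by_cases h2 : degIn s.L s.W w ≤ 1
    · exact low_of_degIn_le_one h2
    · obtain ⟨x, hx, y, hy, hxy, h1, h2⟩ := two_le_degIn_iff.1 (by omega : 2 ≤ degIn s.L s.W w)
      exact ⟨x, y, fun b hb hwb => eq_or_eq_of_degIn_le_two hd hx hy hxy h1 h2 hb hwb⟩
  refine ⟨h.loc.step w _, ?_, fun m hm => (h.feas m hm).trans ?_⟩
  · change Good ((s.W.erase w : Finset V) : Set V) _
    rw [hcoe]
    exact h.good.eliminate hw hlow
  · change _ ↔ (s.T.step s.L w (degIn s.L s.W w = 1)).Feas (s.W.erase w) _ m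
    simp only [Elim.next]
    by_cases h0 : degIn s.L s.W w = 0
    · simp only [h0, if_true, show ((0 : ℕ) = 1) = False by simp]
      exact h.loc.feas_step_isolated hw (degIn_eq_zero_iff.1 h0) hm
    · rw [if_neg h0]
      by_cases h1 : degIn s.L s.W w = 1
      · simp only [h1]
        obtain ⟨p, hp, hwp, hu⟩ := exists_adj_of_degIn_eq_one h1
        exact h.loc.feas_step_single hw (Finset.mem_erase.2 ⟨hwp.ne.symm, hp⟩) hwp hu hm
      · simp only [h1]
        obtain ⟨x, hx, y, hy, hxy, hwx, hwy⟩ :=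
          two_le_degIn_iff.1 (by omega : 2 ≤ degIn s.L s.W w)
        exact h.loc.feas_step_pair hw (Finset.mem_erase.2 ⟨hwx.ne.symm, hx⟩)
          (Finset.mem_erase.2 ⟨hwy.ne.symm, hy⟩) hxy hwx hwy
          (fun b hb hwb => eq_or_eq_of_degIn_le_two hd hx hy hxy hwx hwy hb hwb) hm

lemma Elim.Inv.exists_low (h : s.Inv G B n) (hne : s.W.Nonempty) :
    ∃ w ∈ s.W, degIn s.L s.W w ≤ 2 := by
  obtain ⟨w, hw, hl⟩ := h.good.exists_low hne
  exact ⟨w, hw, degIn_le_two_of_low hl⟩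

omit [Finite V] [DecidableEq V] in
lemma core_congr {G F : SimpleGraph V} {A : Set V} (h : ∀ a ∈ A, ∀ b ∈ A, G.Adj a b ↔ F.Adj a b) :
    core G A = core F A :=
  Set.Subset.antisymm
    (((minDegTwo_core A).congr fun x hx y hy => (h x (core_subset _ hx) y
        (core_subset _ hy)).1).subset_core
      (core_subset A))
    (((minDegTwo_core A).congr fun x hx y hy => (h x (core_subset _ hx) y
        (core_subset _ hy)).2).subset_core
      (core_subset A))

theorem Elim.Inv.init (hB : Good (B : Set V) G) : (Elim.init G B n).Inv G B n := by
  classical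
  have hsy : (Elim.init G B n).T.Symm := by
    refine ⟨fun a b => ?_, fun a b => ?_, fun a b => ?_⟩
    · simp [Elim.init, G.adj_comm]
    · simp [Elim.init, G.adj_comm]
    · simp [Elim.init, eq_comm]
  refine ⟨⟨hsy, fun a _ b _ hab hL => ?_⟩, hB, fun m hm => ⟨?_, ?_⟩⟩
  · change ¬ G.Adj a b at hL
    simp [Elim.init, hL, hab]
  · rintro ⟨S, hS, hcard⟩
    refine ⟨S, G, hS, ?_⟩
    have : (Elim.init G B n).T.wt B S G = 2 * (S ∩ ↑B).ncard := by
      have h1 : ∀ a ∈ B, (2 * (Elim.init G B n).T.un S a +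
          ∑ b ∈ B.erase a, (Elim.init G B n).T.pc S G a b) = 2 * if a ∈ S then 1 else 0 := by
        intro a _
        rw [Finset.sum_eq_zero, add_zero]
        · simp [Tab.un, Elim.init]
        · intro b hb
          have := (Finset.ne_of_mem_erase hb).symm
          by_cases hab : G.Adj a b <;> simp [Tab.pc, Elim.init, this, hab]
      unfold Tab.wt
      rw [Finset.sum_congr rfl h1, ← Finset.mul_sum, Finset.sum_boole, Nat.cast_id,
        ← Set.ncard_coe_finset]
      congr 2
      ext x
      simp [and_comm]
    change (Elim.init G B n).T.wt B S G + 2 * 0 ≤ _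
    rw [this]
    have := Set.ncard_le_ncard (Set.inter_subset_left : S ∩ ↑B ⊆ S) (Set.toFinite _)
    omega
  · rintro ⟨X, F, hF, hwt⟩
    change (Elim.init G B n).T.wt B X F + 2 * 0 ≤ _ at hwt
    refine ⟨X ∩ ↑B, ?_, ?_⟩
    · have hset : (B : Set V) \ (X ∩ ↑B) = ↑B \ X := by ext x; simp
      rw [Hits, hset, ← hF]
      refine core_congr fun a ha b hb => ?_
      by_cases hab : a = b
      · subst hab; simp
      have h1 := (hsy.two_mul_pc_le ha.1 hb.1 hab X F).trans (by simpa using hwt)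
      by_cases hG : G.Adj a b <;> by_cases hFab : F.Adj a b <;>
        simp [Tab.pc, Elim.init, ha.2, hb.2, hG, hFab] at h1 ⊢ <;> omega
    · have h1 : ∑ a ∈ B, 2 * (if a ∈ X then 1 else 0) ≤ (Elim.init G B n).T.wt B X F := by
        refine Finset.sum_le_sum fun a _ => ?_
        have : (Elim.init G B n).T.un X a = if a ∈ X then 1 else 0 := by simp [Tab.un, Elim.init]
        rw [this]
        omega
      rw [← Finset.mul_sum, Finset.sum_boole, Nat.cast_id, ← Set.ncard_coe_finset] at h1
      have h2 : (X ∩ ↑B : Set V) = ↑(B.filter (· ∈ X)) := by ext x; simp [and_comm]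
      rw [h2]
      omega

omit [Finite V] in
/-- When everything is eliminated, the accumulated cost is the size of the smallest
transversals. -/
theorem Elim.Inv.final (h : s.Inv G B n) (hW : s.W = ∅) (hn : B.card ≤ n) {S : Set V}
    (hS : IsOpt G B S) : S.ncard = s.c := by
  have hfeas : ∀ m ≤ n, (∃ S, Hits G B S ∧ S.ncard ≤ m) ↔ s.c ≤ m := by
    intro m hm
    rw [h.feas m hm, hW]
    constructor
    · rintro ⟨X, F, -, hle⟩; omega
    · intro hc
      refine ⟨∅, ⊥, ?_, ?_⟩
      · exact Set.subset_empty_iff.1 ((core_subset _).trans (by simp))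
      · simp [Tab.wt, hc]
  have hSn : S.ncard ≤ n := by
    refine (hS.2 (B : Set V) ?_).trans ((Set.ncard_coe_finset B).le.trans hn)
    rw [Hits, Set.sdiff_self]
    exact Set.subset_empty_iff.1 (core_subset _)
  have h1 := (hfeas _ hSn).1 ⟨S, hS.1, le_rfl⟩
  obtain ⟨T, hT, hTc⟩ := (hfeas s.c (h1.trans hSn)).2 le_rfl
  have := hS.2 T hT
  omega

end Eliminations

/-! ### Programs over arrays on the random access machine -/

section Machine

/-- The program `P` leads from `σ` to `τ` in at most `T` steps. -/
def RAMProg.RunsIn (P : RAMProg) (σ τ : RAMState) (T : ℕ) : Prop := ∃ t ≤ T, P.Runs σ τ t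

lemma RAMProg.RunsIn.mono {P : RAMProg} {σ τ : RAMState} {T T' : ℕ} (h : P.RunsIn σ τ T)
    (hT : T ≤ T') : P.RunsIn σ τ T' := by
  obtain ⟨t, ht, h⟩ := h
  exact ⟨t, ht.trans hT, h⟩

lemma RAMProg.RunsIn.seq {P Q : RAMProg} {σ τ υ : RAMState} {S T : ℕ} (h : P.RunsIn σ τ S)
    (h' : Q.RunsIn τ υ T) : (RAMProg.seq P Q).RunsIn σ υ (S + T) := by
  obtain ⟨s, hs, h⟩ := h
  obtain ⟨t, ht, h'⟩ := h'
  exact ⟨s + t, by omega, .seq h h'⟩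

lemma runsIn_const (σ : RAMState) (r x : ℕ) : (RAMProg.const r x).RunsIn σ (σ.setReg r x) 1 :=
  ⟨1, le_rfl, .const σ r x⟩

lemma runsIn_add (σ : RAMState) (r a b : ℕ) :
    (RAMProg.add r a b).RunsIn σ (σ.setReg r (σ.reg a + σ.reg b)) 1 := ⟨1, le_rfl, .add σ r a b⟩

lemma runsIn_sub (σ : RAMState) (r a b : ℕ) :
    (RAMProg.sub r a b).RunsIn σ (σ.setReg r (σ.reg a - σ.reg b)) 1 := ⟨1, le_rfl, .sub σ r a b⟩

lemma runsIn_load (σ : RAMState) (r a : ℕ) :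
    (RAMProg.load r a).RunsIn σ (σ.setReg r (σ.mem (σ.reg a))) 1 := ⟨1, le_rfl, .load σ r a⟩

lemma runsIn_store (σ : RAMState) (a r : ℕ) :
    (RAMProg.store a r).RunsIn σ (σ.setMem (σ.reg a) (σ.reg r)) 1 := ⟨1, le_rfl, .store σ a r⟩

/-- A loop whose body counts the register `r` down. -/
lemma runsIn_loop {r : ℕ} {P : RAMProg} {T : ℕ} (I : ℕ → RAMState → Prop) (m : ℕ)
    (hstep : ∀ i < m, ∀ σ, I (i + 1) σ → σ.reg r = i + 1 →
      ∃ τ, P.RunsIn σ τ T ∧ I i τ ∧ τ.reg r = i)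
    (σ : RAMState) (hI : I m σ) (hr : σ.reg r = m) :
    ∃ τ, (RAMProg.loop r P).RunsIn σ τ (m * (T + 1) + 1) ∧ I 0 τ ∧ τ.reg r = 0 := by
  induction m generalizing σ with
  | zero => exact ⟨σ, ⟨1, by omega, .loopDone hr⟩, hI, hr⟩
  | succ m ih =>
    obtain ⟨τ, ⟨s, hs, h1⟩, hIτ, hrτ⟩ := hstep m (by omega) σ hI hr
    obtain ⟨υ, ⟨t, ht, h2⟩, hIυ, hrυ⟩ := ih (fun i hi => hstep i (by omega)) τ hIτ hrτ
    refine ⟨υ, ⟨s + t + 1, ?_, .loopStep (by omega) h1 h2⟩, hIυ, hrυ⟩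
    rw [Nat.add_mul, Nat.one_mul]
    omega

/-- The register of the variable `v`. -/
def vr (v : ℕ) : ℕ := 2 * v + 2

/-- The `d`-th register for temporary values. -/
def tr (d : ℕ) : ℕ := 2 * d + 3

/-- From `σ` to `τ`, only temporary registers from `d` on have changed. -/
def Frame (d : ℕ) (σ τ : RAMState) : Prop :=
  τ.mem = σ.mem ∧ ∀ r, (∀ i, d ≤ i → r ≠ tr i) → τ.reg r = σ.reg r

lemma Frame.refl (d : ℕ) (σ : RAMState) : Frame d σ σ := ⟨rfl, fun _ _ => rfl⟩

lemma Frame.trans {d : ℕ} {σ τ υ : RAMState} (h : Frame d σ τ) (h' : Frame d τ υ) : Frame d σ υ :=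
  ⟨h'.1.trans h.1, fun r hr => (h'.2 r hr).trans (h.2 r hr)⟩

lemma Frame.mono {d e : ℕ} {σ τ : RAMState} (h : Frame e σ τ) (hd : d ≤ e) : Frame d σ τ :=
  ⟨h.1, fun r hr => h.2 r fun i hi => hr i (hd.trans hi)⟩

lemma Frame.setReg {d e : ℕ} {σ τ : RAMState} (h : Frame d σ τ) (hd : d ≤ e) (x : ℕ) :
    Frame d σ (τ.setReg (tr e) x) := by
  refine ⟨h.1, fun r hr => ?_⟩
  rw [← h.2 r hr]
  exact Function.update_of_ne (hr e hd) _ _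

lemma Frame.reg_zero {d : ℕ} {σ τ : RAMState} (h : Frame d σ τ) : τ.reg 0 = σ.reg 0 :=
  h.2 0 fun i _ => by unfold tr; omega

lemma Frame.reg_one {d : ℕ} {σ τ : RAMState} (h : Frame d σ τ) : τ.reg 1 = σ.reg 1 :=
  h.2 1 fun i _ => by unfold tr; omega

lemma Frame.reg_vr {d : ℕ} {σ τ : RAMState} (h : Frame d σ τ) (v : ℕ) : τ.reg (vr v) = σ.reg
    (vr v) :=
  h.2 _ fun i _ => by unfold vr tr; omega

lemma Frame.reg_tr {d e : ℕ} {σ τ : RAMState} (h : Frame d σ τ) (he : e < d) :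
    τ.reg (tr e) = σ.reg (tr e) :=
  h.2 _ fun i _ => by unfold tr; omega

lemma reg_setReg (σ : RAMState) (r x s : ℕ) :
    (σ.setReg r x).reg s = if s = r then x else σ.reg s := by
  simp [RAMState.setReg, Function.update_apply]

lemma mem_setReg (σ : RAMState) (r x : ℕ) : (σ.setReg r x).mem = σ.mem := rfl

/-- Multiplication of the temporary register `d + 1` by the content of register `0`, by repeated
addition. -/
def mulProg (d : ℕ) : RAMProg :=
  .seq (.const (tr d) 0) (.seq (.add (tr (d + 2)) 0 (tr d)) (.seq (.const (tr (d + 3)) 1)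
    (.loop (tr (d + 2)) (.seq (.add (tr d) (tr d) (tr (d + 1)))
      (.sub (tr (d + 2)) (tr (d + 2)) (tr (d + 3)))))))

lemma runsIn_mulProg (d : ℕ) (σ : RAMState) : ∃ τ, (mulProg d).RunsIn σ τ (3 * σ.reg 0 + 4) ∧
    Frame d σ τ ∧ τ.reg (tr d) = σ.reg (tr (d + 1)) * σ.reg 0 := by
  set N := σ.reg 0 with hN
  set x := σ.reg (tr (d + 1)) with hx
  set σ₁ := σ.setReg (tr d) 0 with hσ₁
  set σ₂ := σ₁.setReg (tr (d + 2)) (σ₁.reg 0 + σ₁.reg (tr d)) with hσ₂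
  set σ₃ := σ₂.setReg (tr (d + 3)) 1 with hσ₃
  have hF : Frame d σ σ₃ := (((Frame.refl d σ).setReg le_rfl _).setReg (by omega) _).setReg
    (by omega) _
  have key := runsIn_loop (r := tr (d + 2)) (P := .seq (.add (tr d) (tr d) (tr (d + 1)))
    (.sub (tr (d + 2)) (tr (d + 2)) (tr (d + 3)))) (T := 2)
    (fun i τ => Frame d σ τ ∧ τ.reg (tr d) + x * i = x * N ∧ τ.reg (tr (d + 1)) = x ∧
      τ.reg (tr (d + 3)) = 1) N ?_ σ₃ ?_ ?_
  · obtain ⟨τ, h1, ⟨h2, h3, -, -⟩, -⟩ := key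
    refine ⟨τ, ?_, h2, by simpa using h3⟩
    refine RAMProg.RunsIn.mono ((runsIn_const _ _ _).seq ((runsIn_add _ _ _ _).seq
      ((runsIn_const _ _ _).seq h1))) ?_
    omega
  · rintro i hi τ ⟨h1, h2, h3, h4⟩ h5
    refine ⟨_, (runsIn_add _ _ _ _).seq (runsIn_sub _ _ _ _), ⟨(h1.setReg le_rfl _).setReg
      (by omega) _, ?_, ?_, ?_⟩, ?_⟩
    · rw [Nat.mul_add] at h2
      rw [reg_setReg, if_neg (by unfold tr; omega), reg_setReg, if_pos rfl, h3]
      omega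
    · simp only [reg_setReg, tr] at h3 ⊢
      simpa using h3
    · simp only [reg_setReg, tr] at h4 ⊢
      simpa using h4
    · simp only [reg_setReg, tr] at h4 h5 ⊢
      simp [h4, h5]
  · refine ⟨hF, ?_, ?_, ?_⟩ <;> simp [hσ₃, hσ₂, hσ₁, reg_setReg, tr, hx]
  · simp [hσ₃, hσ₂, hσ₁, reg_setReg, tr, hN]

/-- The address of the entry `(a, b)` of the array of size `N` at place `q`. -/
def addr (N q a b : ℕ) : ℕ := (q * N + a) * N + b

lemma addr_inj {N q a b q' a' b' : ℕ} (ha : a < N) (hb : b < N) (ha' : a' < N) (hb' : b' < N)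
    (h : addr N q a b = addr N q' a' b') : q = q' ∧ a = a' ∧ b = b' := by
  have aux : ∀ {x x' y y' : ℕ}, y < N → y' < N → x * N + y = x' * N + y' → x = x' ∧ y = y' := by
    intro x x' y y' hy hy' h
    have h1 : (x * N + y) / N = x := by
      rw [Nat.mul_comm, Nat.mul_add_div (by omega), Nat.div_eq_of_lt hy, Nat.add_zero]
    have h2 : (x' * N + y') / N = x' := by
      rw [Nat.mul_comm, Nat.mul_add_div (by omega), Nat.div_eq_of_lt hy', Nat.add_zero]
    have h3 : x = x' := by rw [← h1, h, h2]
    subst h3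
    exact ⟨rfl, by omega⟩
  obtain ⟨h1, h2⟩ := aux hb hb' h
  obtain ⟨h3, h4⟩ := aux ha ha' h1
  exact ⟨h3, h4, h2⟩

/-- Computation of an address from the variables `v` and `w`. -/
def addrProg (q v w d : ℕ) : RAMProg :=
  .seq (.const (tr (d + 1)) q) (.seq (mulProg d) (.seq (.add (tr (d + 1)) (tr d) (vr v))
    (.seq (mulProg d) (.add (tr d) (tr d) (vr w)))))

lemma runsIn_addrProg (q v w d : ℕ) (σ : RAMState) :
    ∃ τ, (addrProg q v w d).RunsIn σ τ (6 * σ.reg 0 + 11) ∧ Frame d σ τ ∧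
      τ.reg (tr d) = addr (σ.reg 0) q (σ.reg (vr v)) (σ.reg (vr w)) := by
  have hF1 : Frame d σ (σ.setReg (tr (d + 1)) q) := (Frame.refl d σ).setReg (by omega) _
  obtain ⟨τ₁, h1, h2, h3⟩ := runsIn_mulProg d (σ.setReg (tr (d + 1)) q)
  have hF2 := hF1.trans h2
  have hF3 : Frame d σ (τ₁.setReg (tr (d + 1)) (τ₁.reg (tr d) + τ₁.reg (vr v))) :=
    hF2.setReg (by omega) _
  obtain ⟨τ₂, h4, h5, h6⟩ := runsIn_mulProg d
    (τ₁.setReg (tr (d + 1)) (τ₁.reg (tr d) + τ₁.reg (vr v)))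
  have hF4 := hF3.trans h5
  refine ⟨_, RAMProg.RunsIn.mono ((runsIn_const _ _ _).seq (h1.seq ((runsIn_add _ _ _ _).seq
    (h4.seq (runsIn_add _ _ _ _))))) ?_, hF4.setReg le_rfl _, ?_⟩
  · rw [hF1.reg_zero, hF3.reg_zero]; omega
  · rw [reg_setReg, if_pos rfl, h6, hF4.reg_vr, hF3.reg_zero, reg_setReg, if_pos rfl, h3,
      hF1.reg_zero, hF2.reg_vr, reg_setReg, if_pos rfl]
    rfl

lemma exists_copyProg (d r : ℕ) (hr : r ≠ tr d) : ∃ P : RAMProg, ∀ σ : RAMState,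
    ∃ τ, P.RunsIn σ τ 2 ∧ Frame d σ τ ∧ τ.reg (tr d) = σ.reg r := by
  refine ⟨.seq (.const (tr d) 0) (.add (tr d) (tr d) r), fun σ => ?_⟩
  set σ₁ := σ.setReg (tr d) 0 with hσ₁
  refine ⟨_, (runsIn_const _ _ _).seq (runsIn_add _ _ _ _),
    ((Frame.refl d σ).setReg le_rfl _).setReg le_rfl _, ?_⟩
  simp [reg_setReg, hr]

/-- Expressions over square arrays. The variables range over the indices of the arrays. -/
inductive Ex where
  | lit (x : ℕ)
  | size
  | par
  | var (v : ℕ)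
  | add (a b : Ex)
  | sub (a b : Ex)
  | rd (j v w : ℕ)
  | ite (c a b : Ex)
  | sum (v : ℕ) (e : Ex)

/-- The value of an expression: `N` is the size of the arrays `A`, `K` a parameter, `ρ` gives the
values of the variables. -/
def Ex.eval (N K : ℕ) (A : ℕ → ℕ → ℕ → ℕ) : Ex → (ℕ → ℕ) → ℕ
  | .lit x, _ => x
  | .size, _ => N
  | .par, _ => K
  | .var v, ρ => ρ v
  | .add a b, ρ => a.eval N K A ρ + b.eval N K A ρ
  | .sub a b, ρ => a.eval N K A ρ - b.eval N K A ρ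
  | .rd j v w, ρ => A j (ρ v) (ρ w)
  | .ite c a b, ρ => if c.eval N K A ρ ≠ 0 then a.eval N K A ρ else b.eval N K A ρ
  | .sum v e, ρ => ∑ i ∈ Finset.range N, e.eval N K A (Function.update ρ v i)

/-- The place of array `j` in memory: the place `1` is reserved for intermediate results. -/
def place (j : ℕ) : ℕ := if j = 0 then 0 else j + 1

lemma place_ne_one (j : ℕ) : place j ≠ 1 := by
  unfold place; split_ifs <;> omega

lemma place_inj {i j : ℕ} (h : place i = place j) : i = j := by
  unfold place at h; split_ifs at h <;> omega

/-- The memory holds the arrays `A`. -/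
def MemRep (N : ℕ) (A : ℕ → ℕ → ℕ → ℕ) (mem : ℕ → ℕ) : Prop :=
  ∀ j, ∀ a < N, ∀ b < N, mem (addr N (place j) a b) = A j a b

/-- The registers hold the size, the parameter and the values of the variables. -/
structure RegRep (N K : ℕ) (ρ : ℕ → ℕ) (σ : RAMState) : Prop where
  size : σ.reg 0 = N
  par : σ.reg 1 = K
  var : ∀ v, σ.reg (vr v) = ρ v

lemma RegRep.frame {N K d : ℕ} {ρ : ℕ → ℕ} {σ τ : RAMState} (h : RegRep N K ρ σ)
    (hF : Frame d σ τ) : RegRep N K ρ τ :=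
  ⟨hF.reg_zero.trans h.size, hF.reg_one.trans h.par, fun v => (hF.reg_vr v).trans (h.var v)⟩

lemma RegRep.setVar {N K : ℕ} {ρ : ℕ → ℕ} {σ : RAMState} (h : RegRep N K ρ σ) (v x : ℕ) :
    RegRep N K (Function.update ρ v x) (σ.setReg (vr v) x) := by
  refine ⟨?_, ?_, fun w => ?_⟩
  · rw [reg_setReg, if_neg (by unfold vr; omega), h.size]
  · rw [reg_setReg, if_neg (by unfold vr; omega), h.par]
  · rw [reg_setReg, Function.update_apply]
    by_cases hw : w = v
    · rw [if_pos hw, if_pos (by rw [hw])]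
    · rw [if_neg hw, if_neg (by unfold vr; omega), h.var]

/-- Every expression can be evaluated in polynomial time. Temporary registers below `d` are kept. -/
theorem Ex.realize (e : Ex) : ∀ d : ℕ, ∃ (P : RAMProg) (p : Polynomial ℕ),
    ∀ (N K : ℕ) (A : ℕ → ℕ → ℕ → ℕ) (ρ : ℕ → ℕ) (σ : RAMState), (∀ v, ρ v < N) →
      RegRep N K ρ σ → MemRep N A σ.mem →
      ∃ τ, P.RunsIn σ τ (p.eval N) ∧ Frame d σ τ ∧ τ.reg (tr d) = e.eval N K A ρ := by
  induction e with
  | lit x =>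
    intro d
    refine ⟨.const (tr d) x, 1, fun N K A ρ σ hρ hR hM => ⟨σ.setReg (tr d) x, ?_,
        (Frame.refl d σ).setReg le_rfl _, ?_⟩⟩
    · rw [Polynomial.eval_one]; exact runsIn_const _ _ _
    · rw [reg_setReg, if_pos rfl]; rfl
  | size =>
    intro d
    obtain ⟨P, hP⟩ := exists_copyProg d 0 (by unfold tr; omega)
    refine ⟨P, 2, fun N K A ρ σ hρ hR hM => ?_⟩
    simpa [hR.size, Ex.eval] using hP σ
  | par =>
    intro d
    obtain ⟨P, hP⟩ := exists_copyProg d 1 (by unfold tr; omega)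
    refine ⟨P, 2, fun N K A ρ σ hρ hR hM => ?_⟩
    simpa [hR.par, Ex.eval] using hP σ
  | var v =>
    intro d
    obtain ⟨P, hP⟩ := exists_copyProg d (vr v) (by unfold tr vr; omega)
    refine ⟨P, 2, fun N K A ρ σ hρ hR hM => ?_⟩
    simpa [hR.var, Ex.eval] using hP σ
  | add a b iha ihb =>
    intro d
    obtain ⟨P, p, hP⟩ := iha d
    obtain ⟨Q, q, hQ⟩ := ihb (d + 1)
    refine ⟨.seq P (.seq Q (.add (tr d) (tr d) (tr (d + 1)))), p + (q + 1),
      fun N K A ρ σ hρ hR hM => ?_⟩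
    obtain ⟨τ, h1, h2, h3⟩ := hP N K A ρ σ hρ hR hM
    obtain ⟨υ, h4, h5, h6⟩ := hQ N K A ρ τ hρ (hR.frame h2) (by rwa [h2.1])
    refine ⟨_, RAMProg.RunsIn.mono (h1.seq (h4.seq (runsIn_add _ _ _ _))) ?_,
      (h2.trans (h5.mono (by omega))).setReg le_rfl _, ?_⟩
    · simp
    · rw [reg_setReg, if_pos rfl, h6, h5.reg_tr (by omega), h3]; rfl
  | sub a b iha ihb =>
    intro d
    obtain ⟨P, p, hP⟩ := iha d
    obtain ⟨Q, q, hQ⟩ := ihb (d + 1)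
    refine ⟨.seq P (.seq Q (.sub (tr d) (tr d) (tr (d + 1)))), p + (q + 1),
      fun N K A ρ σ hρ hR hM => ?_⟩
    obtain ⟨τ, h1, h2, h3⟩ := hP N K A ρ σ hρ hR hM
    obtain ⟨υ, h4, h5, h6⟩ := hQ N K A ρ τ hρ (hR.frame h2) (by rwa [h2.1])
    refine ⟨_, RAMProg.RunsIn.mono (h1.seq (h4.seq (runsIn_sub _ _ _ _))) ?_,
      (h2.trans (h5.mono (by omega))).setReg le_rfl _, ?_⟩
    · simp
    · rw [reg_setReg, if_pos rfl, h6, h5.reg_tr (by omega), h3]; rfl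
  | rd j v w =>
    intro d
    refine ⟨.seq (addrProg (place j) v w d) (.load (tr d) (tr d)), 6 * Polynomial.X + 12,
      fun N K A ρ σ hρ hR hM => ?_⟩
    obtain ⟨τ, h1, h2, h3⟩ := runsIn_addrProg (place j) v w d σ
    refine ⟨_, RAMProg.RunsIn.mono (h1.seq (runsIn_load _ _ _)) ?_, h2.setReg le_rfl _, ?_⟩
    · simp [hR.size]
    · rw [reg_setReg, if_pos rfl, h3, h2.1, hR.size, hR.var, hR.var, hM j _ (hρ v) _ (hρ w)]; rfl
  | ite c a b ihc iha ihb =>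
    intro d
    obtain ⟨P, p, hP⟩ := ihc d
    obtain ⟨Q, q, hQ⟩ := iha d
    obtain ⟨R, r, hR'⟩ := ihb d
    refine ⟨.seq P (.ite (tr d) Q R), p + (q + r + 1), fun N K A ρ σ hρ hR hM => ?_⟩
    obtain ⟨τ, h1, h2, h3⟩ := hP N K A ρ σ hρ hR hM
    simp only [Polynomial.eval_add, Polynomial.eval_one]
    by_cases hc : c.eval N K A ρ = 0
    · obtain ⟨υ, ⟨t, ht, h4⟩, h5, h6⟩ := hR' N K A ρ τ hρ (hR.frame h2) (by rwa [h2.1])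
      refine ⟨υ, h1.seq ⟨t + 1, by omega, .iteFalse (by rw [h3, hc]) h4⟩, h2.trans h5, ?_⟩
      simp only [h6, Ex.eval, hc, ne_eq, not_true, if_false]
    · obtain ⟨υ, ⟨t, ht, h4⟩, h5, h6⟩ := hQ N K A ρ τ hρ (hR.frame h2) (by rwa [h2.1])
      refine ⟨υ, h1.seq ⟨t + 1, by omega, .iteTrue (by rwa [h3]) h4⟩, h2.trans h5, ?_⟩
      simp only [h6, Ex.eval, ne_eq, hc, not_false_iff, if_true]
  | sum v e ih =>
    intro d
    obtain ⟨P, p, hP⟩ := ih (d + 2)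
    -- the sum is in register `d`, the old value of the variable in register `d + 1`
    refine ⟨.seq (.const (tr d) 0) (.seq (.add (tr (d + 1)) (vr v) (tr d))
      (.seq (.add (vr v) 0 (tr d)) (.seq (.loop (vr v) (.seq (.const (tr (d + 2)) 1)
        (.seq (.sub (vr v) (vr v) (tr (d + 2))) (.seq P (.add (tr d) (tr d) (tr (d + 2)))))))
          (.add (vr v) (tr (d + 1)) (vr v))))), Polynomial.X * (p + 4) + 5,
      fun N K A ρ σ hρ hR hM => ?_⟩
    have hvt : ∀ v d, vr v ≠ tr d := fun v d => by unfold vr tr; omega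
    have htv : ∀ v d, tr d ≠ vr v := fun v d => (hvt v d).symm
    have htt : ∀ d e, d ≠ e → tr d ≠ tr e := fun d e h => by unfold tr; omega
    set σ₁ := σ.setReg (tr d) 0 with hσ₁
    set σ₂ := σ₁.setReg (tr (d + 1)) (σ₁.reg (vr v) + σ₁.reg (tr d)) with hσ₂
    set σ₃ := σ₂.setReg (vr v) (σ₂.reg 0 + σ₂.reg (tr d)) with hσ₃
    have hF2 : Frame d σ σ₂ := ((Frame.refl d σ).setReg le_rfl _).setReg (by omega) _
    have h2d : σ₂.reg (tr d) = 0 := by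
      simp [hσ₂, hσ₁, reg_setReg, htt d (d + 1) (by omega)]
    have h2d1 : σ₂.reg (tr (d + 1)) = ρ v := by
      simp [hσ₂, hσ₁, reg_setReg, hvt, hR.var]
    have hR3 : RegRep N K (Function.update ρ v N) σ₃ := by
      rw [hσ₃, h2d, (hR.frame hF2).size, Nat.add_zero]
      exact (hR.frame hF2).setVar v N
    have key := runsIn_loop (r := vr v) (P := .seq (.const (tr (d + 2)) 1)
        (.seq (.sub (vr v) (vr v) (tr (d + 2))) (.seq P (.add (tr d) (tr d) (tr (d + 2))))))
      (T := p.eval N + 3)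
      (fun i τ => RegRep N K (Function.update ρ v i) τ ∧ τ.mem = σ.mem ∧
        (∀ e < d, τ.reg (tr e) = σ.reg (tr e)) ∧ τ.reg (tr (d + 1)) = ρ v ∧
        τ.reg (tr d) = ∑ l ∈ Finset.Ico i N, e.eval N K A (Function.update ρ v l)) N ?_ σ₃ ?_ ?_
    · obtain ⟨τ, h1, ⟨h2, h3, h4, h5, h6⟩, h7⟩ := key
      have hR' := h2.setVar v (τ.reg (tr (d + 1)) + τ.reg (vr v))
      rw [Function.update_idem] at hR'
      refine ⟨_, RAMProg.RunsIn.mono ((runsIn_const _ _ _).seq ((runsIn_add _ _ _ _).seq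
        ((runsIn_add _ _ _ _).seq (h1.seq (runsIn_add _ _ _ _))))) ?_, ⟨h3, ?_⟩, ?_⟩
      · simp; ring_nf; omega
      · intro r hr
        have hcase : r = 0 ∨ r = 1 ∨ (∃ w, r = vr w) ∨ ∃ e < d, r = tr e := by
          by_cases h0 : r = 0
          · exact .inl h0
          by_cases h1 : r = 1
          · exact .inr (.inl h1)
          rcases Nat.even_or_odd' r with ⟨c, hc | hc⟩
          · exact .inr (.inr (.inl ⟨c - 1, by unfold vr; omega⟩))
          · refine .inr (.inr (.inr ⟨c - 1, ?_, by unfold tr; omega⟩))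
            by_contra hlt
            exact hr (c - 1) (by omega) (by unfold tr; omega)
        rcases hcase with rfl | rfl | ⟨w, rfl⟩ | ⟨e, he, rfl⟩
        · rw [hR'.size, hR.size]
        · rw [hR'.par, hR.par]
        · rw [hR'.var, hR.var, h5, h7, Nat.add_zero, Function.update_eq_self]
        · rw [reg_setReg, if_neg (htv _ _), h4 e he]
      · rw [reg_setReg, if_neg (htv _ _), h6]
        simp [Ex.eval]
    · rintro i hi τ ⟨h1, h2, h3, h4, h5⟩ h6
      set τ₁ := τ.setReg (tr (d + 2)) 1 with hτ₁
      have hFτ : Frame (d + 2) τ τ₁ := (Frame.refl _ τ).setReg le_rfl _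
      have hv1 : τ₁.reg (vr v) - τ₁.reg (tr (d + 2)) = i := by
        rw [hFτ.reg_vr, h6, hτ₁, reg_setReg, if_pos rfl]; rfl
      have hR2 : RegRep N K (Function.update ρ v i)
          (τ₁.setReg (vr v) (τ₁.reg (vr v) - τ₁.reg (tr (d + 2)))) := by
        rw [hv1]
        have := (h1.frame hFτ).setVar v i
        rwa [Function.update_idem] at this
      have hρ' : ∀ w, Function.update ρ v i w < N := by
        intro w
        rw [Function.update_apply]
        split_ifs
        · exact hi
        · exact hρ w
      obtain ⟨υ, g1, g2, g3⟩ := hP N K A (Function.update ρ v i) _ hρ' hR2 (by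
        rw [mem_setReg, hFτ.1, h2]; exact hM)
      have hF' : Frame d (τ₁.setReg (vr v) (τ₁.reg (vr v) - τ₁.reg (tr (d + 2))))
          (υ.setReg (tr d) (υ.reg (tr d) + υ.reg (tr (d + 2)))) :=
        (g2.mono (by omega)).setReg le_rfl _
      have hRv := hR2.frame hF'
      refine ⟨_, RAMProg.RunsIn.mono ((runsIn_const _ _ _).seq ((runsIn_sub _ _ _ _).seq
        (g1.seq (runsIn_add _ _ _ _)))) (by omega), ⟨hRv, ?_, ?_, ?_, ?_⟩, ?_⟩
      · rw [hF'.1, mem_setReg, hFτ.1, h2]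
      · intro e he
        rw [hF'.reg_tr he, reg_setReg, if_neg (htv _ _), hFτ.reg_tr (by omega), h3 e he]
      · rw [reg_setReg, if_neg (htt _ _ (by omega)), g2.reg_tr (by omega), reg_setReg,
          if_neg (htv _ _), hFτ.reg_tr (by omega), h4]
      · rw [reg_setReg, if_pos rfl, g3, g2.reg_tr (by omega), reg_setReg,
          if_neg (htv _ _), hFτ.reg_tr (by omega), h5, Finset.sum_eq_sum_Ico_succ_bot hi,
              Nat.add_comm]
      · rw [hRv.var, Function.update_self]
    · refine ⟨hR3, hF2.1, fun e he => ?_, ?_, ?_⟩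
      · rw [hσ₃, reg_setReg, if_neg (htv _ _), hF2.reg_tr he]
      · rw [hσ₃, reg_setReg, if_neg (htv _ _), h2d1]
      · rw [hσ₃, reg_setReg, if_neg (htv _ _), h2d]; simp
    · rw [hR3.var, Function.update_self]

end Machine

/-! ### Commands on arrays -/

section Commands

/-- The assignment of `a` and `b` to the variables `0` and `1`. -/
def env (a b : ℕ) : ℕ → ℕ := fun v => if v = 0 then a else if v = 1 then b else 0

lemma env_zero : env 0 0 = fun _ => 0 := by
  funext v; unfold env; split_ifs <;> rfl

lemma update_env_zero (a b x : ℕ) : Function.update (env a b) 0 x = env x b := by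
  funext v
  by_cases h : v = 0 <;> simp [env, h]

lemma update_env_one (a b x : ℕ) : Function.update (env a b) 1 x = env a x := by
  funext v
  by_cases h : v = 1 <;> simp [env, h]

lemma env_lt {N a b : ℕ} (ha : a < N) (hb : b < N) (v : ℕ) : env a b v < N := by
  unfold env; split_ifs <;> omega

/-- For all `a` and `b`, write the value computed by `P` to the entry `(a, b)` of the array at place
`q`. -/
def passProg (q d : ℕ) (P : RAMProg) : RAMProg :=
  .seq (.const (tr d) 0) (.seq (.add (vr 0) 0 (tr d)) (.loop (vr 0)
    (.seq (.const (tr d) 1) (.seq (.sub (vr 0) (vr 0) (tr d))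
      (.seq (.const (tr d) 0) (.seq (.add (vr 1) 0 (tr d)) (.loop (vr 1)
        (.seq (.const (tr d) 1) (.seq (.sub (vr 1) (vr 1) (tr d))
          (.seq P (.seq (addrProg q 0 1 (d + 1)) (.store (tr (d + 1)) (tr d)))))))))))))

/-- The registers outside the temporary ones from `d` on. -/
structure Outer (N K d : ℕ) (ρ : ℕ → ℕ) (σ τ : RAMState) : Prop where
  rep : RegRep N K ρ τ
  tmp : ∀ e < d, τ.reg (tr e) = σ.reg (tr e)

lemma Outer.frame {N K d : ℕ} {ρ : ℕ → ℕ} {σ τ υ : RAMState} (h : Outer N K d ρ σ τ)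
    (hF : Frame d τ υ) : Outer N K d ρ σ υ :=
  ⟨h.rep.frame hF, fun e he => (hF.reg_tr he).trans (h.tmp e he)⟩

lemma Outer.setVar {N K d : ℕ} {ρ : ℕ → ℕ} {σ τ : RAMState} (h : Outer N K d ρ σ τ) (v x : ℕ) :
    Outer N K d (Function.update ρ v x) σ (τ.setReg (vr v) x) :=
  ⟨h.rep.setVar v x, fun e he => by
    rw [reg_setReg, if_neg (by unfold tr vr; omega), h.tmp e he]⟩

lemma Outer.setTmp {N K d : ℕ} {ρ : ℕ → ℕ} {σ τ : RAMState} (h : Outer N K d ρ σ τ) (x : ℕ) :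
    Outer N K d ρ σ (τ.setReg (tr d) x) :=
  h.frame ((Frame.refl d τ).setReg le_rfl x)

lemma runsIn_pass {N K q d T : ℕ} {P : RAMProg} {M : (ℕ → ℕ) → Prop} {val : ℕ → ℕ → ℕ}
    (hM : ∀ mem a b x, a < N → b < N → M mem → M (Function.update mem (addr N q a b) x))
    (hP : ∀ a < N, ∀ b < N, ∀ σ, RegRep N K (env a b) σ → M σ.mem →
      ∃ τ, P.RunsIn σ τ T ∧ Frame d σ τ ∧ τ.reg (tr d) = val a b)
    (σ : RAMState) (hσ : RegRep N K (fun _ => 0) σ) (hσM : M σ.mem) :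
    ∃ τ, (passProg q d P).RunsIn σ τ (N * (N * (T + (6 * N + 15)) + 6) + 3) ∧
      Outer N K d (fun _ => 0) σ τ ∧ M τ.mem ∧
      ∀ a < N, ∀ b < N, τ.mem (addr N q a b) = val a b := by
  have htv : ∀ v d, tr d ≠ vr v := fun v d => by unfold vr tr; omega
  have hvt : ∀ v d, vr v ≠ tr d := fun v d => (htv v d).symm
  -- one entry
  have hcell : ∀ i < N, ∀ l < N, ∀ τ, Outer N K d (env i (l + 1)) σ τ ∧ M τ.mem ∧
      (∀ a < N, i < a → ∀ b < N, τ.mem (addr N q a b) = val a b) ∧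
      (∀ b < N, l + 1 ≤ b → τ.mem (addr N q i b) = val i b) →
      ∃ υ, (RAMProg.seq (.const (tr d) 1) (.seq (.sub (vr 1) (vr 1) (tr d))
          (.seq P (.seq (addrProg q 0 1 (d + 1)) (.store (tr (d + 1)) (tr d)))))).RunsIn τ υ
            (T + (6 * N + 14)) ∧
        Outer N K d (env i l) σ υ ∧ M υ.mem ∧
        (∀ a < N, i < a → ∀ b < N, υ.mem (addr N q a b) = val a b) ∧
        (∀ b < N, l ≤ b → υ.mem (addr N q i b) = val i b) := by
    rintro i hi l hl τ ⟨h1, h2, h3, h4⟩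
    have hdec : (τ.setReg (tr d) 1).reg (vr 1) - (τ.setReg (tr d) 1).reg (tr d) = l := by
      rw [(h1.setTmp 1).rep.var, reg_setReg, if_pos rfl]; rfl
    have g1 := (h1.setTmp 1).setVar 1
      ((τ.setReg (tr d) 1).reg (vr 1) - (τ.setReg (tr d) 1).reg (tr d))
    have g1' := g1
    rw [hdec, update_env_one] at g1'
    rw [← hdec] at g1'
    set τ₁ := (τ.setReg (tr d) 1).setReg (vr 1)
      ((τ.setReg (tr d) 1).reg (vr 1) - (τ.setReg (tr d) 1).reg (tr d)) with hτ₁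
    rw [hdec] at g1'
    have hmem : τ₁.mem = τ.mem := rfl
    obtain ⟨τ₂, r1, F1, v1⟩ := hP i hi l hl τ₁ g1'.rep (by rwa [hmem])
    obtain ⟨τ₃, r2, F2, v2⟩ := runsIn_addrProg q 0 1 (d + 1) τ₂
    have g2 := g1'.frame F1
    have g3 := g2.frame (F2.mono (Nat.le_succ d))
    rw [g2.rep.size, g2.rep.var, g2.rep.var] at v2
    have v2' : τ₃.reg (tr (d + 1)) = addr N q i l := v2
    have v1' : τ₃.reg (tr d) = val i l := by rw [F2.reg_tr (by omega), v1]
    have hmem3 : τ₃.mem = τ.mem := by rw [F2.1, F1.1, hmem]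
    refine ⟨τ₃.setMem (τ₃.reg (tr (d + 1))) (τ₃.reg (tr d)), RAMProg.RunsIn.mono
      ((runsIn_const _ _ _).seq ((runsIn_sub _ _ _ _).seq (r1.seq (r2.seq
          (runsIn_store _ _ _))))) ?_,
      ⟨⟨g3.rep.size, g3.rep.par, g3.rep.var⟩, g3.tmp⟩, ?_, ?_, ?_⟩
    · rw [g2.rep.size]; omega
    · rw [v2', v1']
      exact hM _ _ _ _ hi hl (by rwa [hmem3])
    · intro a ha hia b hb
      rw [v2', RAMState.setMem]
      simp only
      rw [Function.update_of_ne, hmem3, h3 a ha hia b hb]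
      intro e
      have := (addr_inj ha hb hi hl e).2.1
      omega
    · intro b hb hlb
      rw [v2', v1', RAMState.setMem]
      simp only
      by_cases hbl : b = l
      · rw [hbl, Function.update_self]
      · rw [Function.update_of_ne, hmem3, h4 b hb (by omega)]
        intro e
        exact hbl (addr_inj hi hb hi hl e).2.2
  -- one row
  have hrow : ∀ i < N, ∀ τ, (Outer N K d (env (i + 1) 0) σ τ ∧ M τ.mem ∧
      (∀ a < N, i + 1 ≤ a → ∀ b < N, τ.mem (addr N q a b) = val a b)) →
      ∃ υ, (RAMProg.seq (.const (tr d) 1) (.seq (.sub (vr 0) (vr 0) (tr d))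
      (.seq (.const (tr d) 0) (.seq (.add (vr 1) 0 (tr d)) (.loop (vr 1)
        (.seq (.const (tr d) 1) (.seq (.sub (vr 1) (vr 1) (tr d))
          (.seq P (.seq (addrProg q 0 1 (d + 1)) (.store (tr (d + 1)) (tr d))))))))))).RunsIn τ υ
            (N * (T + (6 * N + 15)) + 5) ∧
        (Outer N K d (env i 0) σ υ ∧ M υ.mem ∧
        (∀ a < N, i ≤ a → ∀ b < N, υ.mem (addr N q a b) = val a b)) := by
    rintro i hi τ ⟨h1, h2, h3⟩
    have hdec : (τ.setReg (tr d) 1).reg (vr 0) - (τ.setReg (tr d) 1).reg (tr d) = i := by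
      rw [(h1.setTmp 1).rep.var, reg_setReg, if_pos rfl]; rfl
    have g1 : Outer N K d (env i 0) σ ((τ.setReg (tr d) 1).setReg (vr 0) i) := by
      have := (h1.setTmp 1).setVar 0 i
      rwa [update_env_zero] at this
    have g2 := g1.setTmp 0
    have hN : (((τ.setReg (tr d) 1).setReg (vr 0) i).setReg (tr d) 0).reg 0 +
        (((τ.setReg (tr d) 1).setReg (vr 0) i).setReg (tr d) 0).reg (tr d) = N := by
      rw [g2.rep.size, reg_setReg, if_pos rfl, Nat.add_zero]
    have g3 : Outer N K d (env i N) σ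
        ((((τ.setReg (tr d) 1).setReg (vr 0) i).setReg (tr d) 0).setReg (vr 1) N) := by
      have := g2.setVar 1 N
      rwa [update_env_one] at this
    obtain ⟨υ, r1, ⟨g4, g5, g6, g7⟩, -⟩ := runsIn_loop (r := vr 1) (T := T + (6 * N + 14))
      (fun l τ => Outer N K d (env i l) σ τ ∧ M τ.mem ∧
        (∀ a < N, i < a → ∀ b < N, τ.mem (addr N q a b) = val a b) ∧
        (∀ b < N, l ≤ b → τ.mem (addr N q i b) = val i b)) N
      (fun l hl τ hτ _ => by
        obtain ⟨υ, r, hυ⟩ := hcell i hi l hl τ hτ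
        exact ⟨υ, r, hυ, hυ.1.rep.var 1⟩)
      _ ⟨g3, h2, fun a ha hia => h3 a ha hia, fun b hb hNb => by omega⟩ (g3.rep.var 1)
    have r0 := (runsIn_const τ (tr d) 1).seq ((runsIn_sub (τ.setReg (tr d) 1) (vr 0) (vr 0)
        (tr d)).seq
      ((runsIn_const _ (tr d) 0).seq ((runsIn_add _ (vr 1) 0 (tr d)).seq (by
        rw [hdec, hN]; exact r1))))
    refine ⟨υ, r0.mono (by rw [show T + (6 * N + 14) + 1 = T + (6 * N + 15) by omega]; omega), g4,
        g5,
      fun a ha hia b hb => ?_⟩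
    rcases Nat.lt_or_eq_of_le hia with h | rfl
    · exact g6 a ha h b hb
    · exact g7 b hb (Nat.zero_le _)
  have hO : Outer N K d (env 0 0) σ σ := ⟨by rw [env_zero]; exact hσ, fun _ _ => rfl⟩
  have g2 := hO.setTmp 0
  have hN : (σ.setReg (tr d) 0).reg 0 + (σ.setReg (tr d) 0).reg (tr d) = N := by
    rw [g2.rep.size, reg_setReg, if_pos rfl, Nat.add_zero]
  have g3 : Outer N K d (env N 0) σ ((σ.setReg (tr d) 0).setReg (vr 0) N) := by
    have := g2.setVar 0 N
    rwa [update_env_zero] at this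
  obtain ⟨υ, r1, ⟨g4, g5, g6⟩, -⟩ := runsIn_loop (r := vr 0) (T := N * (T + (6 * N + 15)) + 5)
    (fun i τ => Outer N K d (env i 0) σ τ ∧ M τ.mem ∧
      (∀ a < N, i ≤ a → ∀ b < N, τ.mem (addr N q a b) = val a b)) N
    (fun i hi τ hτ _ => by
      obtain ⟨υ, r, hυ⟩ := hrow i hi τ hτ
      exact ⟨υ, r, hυ, hυ.1.rep.var 0⟩)
    _ ⟨g3, hσM, fun a ha hNa => by omega⟩ (g3.rep.var 0)
  have r0 := (runsIn_const σ (tr d) 0).seq ((runsIn_add _ (vr 0) 0 (tr d)).seq (by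
        rw [hN]; exact r1))
  refine ⟨υ, r0.mono (by
    rw [show N * (T + (6 * N + 15)) + 5 + 1 = N * (T + (6 * N + 15)) + 6 by omega]; omega), ?_, g5,
        fun a ha b hb => g6 a ha (Nat.zero_le _) b hb⟩
  rwa [env_zero] at g4

/-- Programs over arrays: simultaneous assignment of all entries of an array (the variables `0` and
`1` stand for row and column), composition, and repetition as many times as the arrays have
rows. -/
inductive Cmd where
  | set (j : ℕ) (e : Ex)
  | seq (c d : Cmd)
  | rep (c : Cmd)

/-- The arrays after the execution of a program. -/
def Cmd.run (N K : ℕ) : Cmd → (ℕ → ℕ → ℕ → ℕ) → (ℕ → ℕ → ℕ → ℕ)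
  | .set j e, A => Function.update A j fun a b => e.eval N K A (env a b)
  | .seq c d, A => d.run N K (c.run N K A)
  | .rep c, A => (c.run N K)^[N] A

lemma memRep_update {N q : ℕ} {A : ℕ → ℕ → ℕ → ℕ} {mem : ℕ → ℕ} (h : MemRep N A mem)
    (hq : ∀ j, place j ≠ q) {a b : ℕ} (ha : a < N) (hb : b < N) (x : ℕ) :
    MemRep N A (Function.update mem (addr N q a b) x) := by
  intro j a' ha' b' hb'
  rw [Function.update_of_ne, h j a' ha' b' hb']
  intro e
  exact hq j (addr_inj ha' hb' ha hb e).1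

/-- Every program over arrays runs in polynomial time. -/
theorem Cmd.realize (c : Cmd) : ∀ d : ℕ, ∃ (P : RAMProg) (p : Polynomial ℕ),
    ∀ (N K : ℕ) (A : ℕ → ℕ → ℕ → ℕ) (σ : RAMState),
      RegRep N K (fun _ => 0) σ → MemRep N A σ.mem →
      ∃ τ, P.RunsIn σ τ (p.eval N) ∧ Outer N K d (fun _ => 0) σ τ ∧
        MemRep N (c.run N K A) τ.mem := by
  induction c with
  | set j e =>
    intro d
    obtain ⟨P, p, hP⟩ := e.realize d
    refine ⟨.seq (passProg 1 d P) (passProg (place j) d (.seq (addrProg 1 0 1 d) (.load (tr d)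
        (tr d)))),
      (Polynomial.X * (Polynomial.X * (p + (6 * Polynomial.X + 15)) + 6) + 3) +
      (Polynomial.X * (Polynomial.X * ((6 * Polynomial.X + 12) + (6 * Polynomial.X + 15)) + 6) + 3),
      fun N K A σ hσ hM => ?_⟩
    -- the values are collected at the place `1` and then copied
    obtain ⟨τ, r1, o1, m1, v1⟩ := runsIn_pass (q := 1) (M := MemRep N A)
      (val := fun a b => e.eval N K A (env a b)) (T := p.eval N)
      (fun mem a b x ha hb h => memRep_update h place_ne_one ha hb x)
      (fun a ha b hb σ hσ hM => hP N K A (env a b) σ (env_lt ha hb) hσ hM) σ hσ hM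
    obtain ⟨υ, r2, o2, ⟨m2, m3⟩, v2⟩ := runsIn_pass (K := K) (q := place j) (d := d)
      (P := .seq (addrProg 1 0 1 d) (.load (tr d) (tr d)))
      (M := fun mem => (∀ i, i ≠ j → ∀ a < N, ∀ b < N, mem (addr N (place i) a b) = A i a b) ∧
        ∀ a < N, ∀ b < N, mem (addr N 1 a b) = e.eval N K A (env a b))
      (val := fun a b => e.eval N K A (env a b)) (T := 6 * N + 12)
      (by
        rintro mem a b x ha hb ⟨h1, h2⟩
        refine ⟨fun i hi a' ha' b' hb' => ?_, fun a' ha' b' hb' => ?_⟩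
        · rw [Function.update_of_ne, h1 i hi a' ha' b' hb']
          exact fun e => hi (place_inj (addr_inj ha' hb' ha hb e).1)
        · rw [Function.update_of_ne, h2 a' ha' b' hb']
          exact fun e => place_ne_one j (addr_inj ha' hb' ha hb e).1.symm)
      (by
        rintro a ha b hb σ hσ ⟨-, h2⟩
        obtain ⟨τ, h3, h4, h5⟩ := runsIn_addrProg 1 0 1 d σ
        refine ⟨_, RAMProg.RunsIn.mono (h3.seq (runsIn_load _ _ _)) ?_, h4.setReg le_rfl _, ?_⟩
        · rw [hσ.size]
        · rw [reg_setReg, if_pos rfl, h5, h4.1, hσ.size, hσ.var, hσ.var]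
          exact h2 a ha b hb)
      τ o1.rep ⟨fun i _ => m1 i, v1⟩
    refine ⟨υ, (r1.seq r2).mono (by simp), ⟨o2.rep, fun e he => (o2.tmp e he).trans (o1.tmp e he)⟩,
      fun i a ha b hb => ?_⟩
    rw [Cmd.run, Function.update_apply]
    split_ifs with hi
    · rw [hi]; exact v2 a ha b hb
    · exact m2 i hi a ha b hb
  | seq c₁ c₂ ih₁ ih₂ =>
    intro d
    obtain ⟨P, p, hP⟩ := ih₁ d
    obtain ⟨Q, q, hQ⟩ := ih₂ d
    refine ⟨.seq P Q, p + q, fun N K A σ hσ hM => ?_⟩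
    obtain ⟨τ, r1, o1, m1⟩ := hP N K A σ hσ hM
    obtain ⟨υ, r2, o2, m2⟩ := hQ N K _ τ o1.rep m1
    exact ⟨υ, (r1.seq r2).mono (by simp),
      ⟨o2.rep, fun e he => (o2.tmp e he).trans (o1.tmp e he)⟩, m2⟩
  | rep c ih =>
    intro d
    obtain ⟨P, p, hP⟩ := ih (d + 1)
    refine ⟨.seq (.const (tr d) 0) (.seq (.add (tr d) (tr d) 0) (.loop (tr d) (.seq P
      (.seq (.const (tr (d + 1)) 1) (.sub (tr d) (tr d) (tr (d + 1))))))),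
      Polynomial.X * (p + 3) + 3, fun N K A σ hσ hM => ?_⟩
    have htt : ∀ d e, d ≠ e → tr d ≠ tr e := fun d e h => by unfold tr; omega
    have g1 := (Outer.mk hσ (fun _ _ => rfl) : Outer N K d (fun _ => 0) σ σ).setTmp 0
    have hN : (σ.setReg (tr d) 0).reg (tr d) + (σ.setReg (tr d) 0).reg 0 = N := by
      rw [g1.rep.size, reg_setReg, if_pos rfl, Nat.zero_add]
    obtain ⟨υ, r1, ⟨o1, m1⟩, -⟩ := runsIn_loop (r := tr d) (T := p.eval N + 2) (P := .seq P
      (.seq (.const (tr (d + 1)) 1) (.sub (tr d) (tr d) (tr (d + 1)))))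
      (fun i τ => Outer N K d (fun _ => 0) σ τ ∧ MemRep N ((c.run N K)^[N - i] A) τ.mem) N
      (by
        rintro i hi τ ⟨o1, m1⟩ hr
        obtain ⟨υ, r2, o2, m2⟩ := hP N K _ τ o1.rep m1
        have o3 : Outer N K d (fun _ => 0) σ υ :=
          ⟨o2.rep, fun e he => (o2.tmp e (by omega)).trans (o1.tmp e he)⟩
        refine ⟨_, r2.seq ((runsIn_const _ _ _).seq (runsIn_sub _ _ _ _)),
          ⟨o3.frame (((Frame.refl d υ).setReg (by omega) _).setReg le_rfl _), ?_⟩, ?_⟩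
        · rw [mem_setReg, mem_setReg, show N - i = (N - (i + 1)) + 1 by omega,
            Function.iterate_succ_apply']
          exact m2
        · rw [reg_setReg, if_pos rfl, reg_setReg, if_neg (htt _ _ (by omega)), reg_setReg,
            if_pos rfl,
            o2.tmp d (by omega), hr]
          rfl)
      ((σ.setReg (tr d) 0).setReg (tr d) N) ⟨g1.setTmp N, by simpa [mem_setReg] using hM⟩
      (by rw [reg_setReg, if_pos rfl])
    have r0 := (runsIn_const σ (tr d) 0).seq ((runsIn_add _ (tr d) (tr d) 0).seq (by
        rw [hN]; exact r1))
    refine ⟨υ, r0.mono ?_, o1, by simpa [Cmd.run] using m1⟩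
    rw [show p.eval N + 2 + 1 = p.eval N + 3 by omega]
    simp
    omega

open Classical in
/-- The arrays at the beginning: array `0` is the adjacency matrix. -/
noncomputable def inputArrays {n : ℕ} (G : SimpleGraph (Fin n)) : ℕ → ℕ → ℕ → ℕ := fun j a b =>
  if j = 0 ∧ ∃ (ha : a < n) (hb : b < n), G.Adj ⟨a, ha⟩ ⟨b, hb⟩ then 1 else 0

lemma memRep_inputState (k : ℕ) {n : ℕ} (G : SimpleGraph (Fin n)) :
    MemRep n (inputArrays G) (inputState k G).mem := by
  intro j a ha b hb
  unfold inputState inputArrays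
  have hiff : (∃ i l : Fin n, addr n (place j) a b = i.val * n + l.val ∧ G.Adj i l) ↔
      (j = 0 ∧ ∃ (ha : a < n) (hb : b < n), G.Adj ⟨a, ha⟩ ⟨b, hb⟩) := by
    constructor
    · rintro ⟨i, l, he, hG⟩
      have he' : addr n (place j) a b = addr n (place 0) i l := by
        rw [he]; simp [addr, place]
      obtain ⟨h1, rfl, rfl⟩ := addr_inj ha hb i.2 l.2 he'
      exact ⟨place_inj h1, i.2, l.2, hG⟩
    · rintro ⟨rfl, ha, hb, hG⟩
      exact ⟨⟨a, ha⟩, ⟨b, hb⟩, by simp [addr, place], hG⟩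
  by_cases h : j = 0 ∧ ∃ (ha : a < n) (hb : b < n), G.Adj ⟨a, ha⟩ ⟨b, hb⟩
  · rw [if_pos h]; exact if_pos (hiff.2 h)
  · rw [if_neg h]; exact if_neg fun h' => h (hiff.1 h')

/-- A program over arrays gives a polynomial time algorithm. The output is row `0` of array `0`. -/
theorem polyTimeOnSC_of_cmd (c : Cmd)
    {Q : (k n : ℕ) → SimpleGraph (Fin n) → Set (Fin n) → Prop}
    (h : ∀ (k n : ℕ) (G : SimpleGraph (Fin n)), 5 ≤ k → 0 < n → IsSC k G →
      Q k n G {v | c.run n k (inputArrays G) 0 0 v ≠ 0}) : PolyTimeOnSC Q := by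
  obtain ⟨P, p, hP⟩ := c.realize 0
  refine ⟨P, p, fun k n G hk hG hsc => ?_⟩
  have hn : 0 < n := by
    obtain ⟨v⟩ := hG.nonempty
    exact v.pos
  obtain ⟨τ, ⟨t, ht, hr⟩, -, hm⟩ := hP n k (inputArrays G) (inputState k G)
    ⟨rfl, rfl, fun v => by
      have h0 : vr v ≠ 0 := by unfold vr; omega
      have h1 : vr v ≠ 1 := by unfold vr; omega
      simp [inputState, h0, h1]⟩ (memRep_inputState k G)
  refine ⟨τ, t, hr, ht, ?_⟩
  have : outputSet n τ = {v : Fin n | c.run n k (inputArrays G) 0 0 v ≠ 0} := by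
    ext v
    have := hm 0 0 hn v v.2
    simp only [addr, place, if_true, Nat.zero_mul, Nat.zero_add] at this
    simp only [outputSet, Set.mem_ofPred_eq, this]
  rw [this]
  exact h k n G hk hn hsc

end Commands

/-! ### Recognizing the vertices to be deleted -/

/-- The vertices of degree two in the subgraph induced on `A`. -/
def degTwo {V : Type*} (G : SimpleGraph V) (A : Set V) : Set V := {x | x ∈ A ∧ degIn G A x = 2}

/-- The vertices that can be reached from `u` by at most `d` steps to vertices of `A`. -/
def reach {V : Type*} (G : SimpleGraph V) (A : Set V) (u : V) : ℕ → Set V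
  | 0 => {u}
  | d + 1 => reach G A u d ∪ {b | b ∈ A ∧ ∃ x ∈ reach G A u d, G.Adj x b}

/-- The local test for `u` and `v` to be the attachment vertices of a pendant cycle of the subgraph
induced on `A`: the vertices of degree two, together with `u` and `v`, contain a cycle through `u`
and `v`. For `u = v` there is one attachment vertex (or none, if the cycle is a component). For
`u ≠ v` neither vertex is allowed to close a cycle alone, and `u`, `v` have to be adjacent, or at
distance at least `k / 2`, which makes them antipodal. -/
def Attached {V : Type*} (k : ℕ) (G : SimpleGraph V) (A : Set V) (u v : V) : Prop :=
  (u = v ∧ u ∈ core G (degTwo G A ∪ {u})) ∨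
  (u ≠ v ∧ u ∉ degTwo G A ∧ v ∉ degTwo G A ∧ u ∈ core G (degTwo G A ∪ {u, v}) ∧
    u ∉ core G (degTwo G A ∪ {u}) ∧ v ∉ core G (degTwo G A ∪ {v}) ∧
    (G.Adj u v ∨ ∀ d, v ∈ reach G A u d → k ≤ 2 * d))

/-- Deleting `u` lowers the minimum size of a set hitting all cycles in `A`. -/
def Drops {V : Type*} (G : SimpleGraph V) (A : Set V) (u : V) : Prop :=
  ∀ S T, IsOpt G (A \ {u}) S → IsOpt G A T → S.ncard < T.ncard

section Attachments

variable {V : Type*} {G : SimpleGraph V} {k : ℕ} {A : Set V} {f : ℕ → V} {u v : V}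

lemma degTwo_subset : degTwo G A ⊆ A := fun _ hx => hx.1

lemma mem_reach_cyc (hf : IndCyc G k f) (hfA : cyc k f ⊆ A) (i : ℕ) (hi : i < k) :
    f i ∈ reach G A (f 0) i := by
  induction i with
  | zero => rfl
  | succ i ih =>
    exact .inr ⟨hfA (mem_cyc.2 ⟨_, hi, rfl⟩), f i, ih (by omega),
      (hf.adj_iff (by omega) hi).2 (by omega)⟩

lemma mem_reach_cyc_sub (hk : 3 ≤ k) (hf : IndCyc G k f) (hfA : cyc k f ⊆ A) (i : ℕ) (h0 : 1 ≤ i)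
    (hi : i < k) : f (k - i) ∈ reach G A (f 0) i := by
  induction i with
  | zero => omega
  | succ i ih =>
    refine .inr ⟨hfA (mem_cyc.2 ⟨_, by omega, rfl⟩), ?_⟩
    rcases Nat.eq_zero_or_pos i with rfl | hi'
    · exact ⟨f 0, rfl, (hf.adj_iff (by omega) (by omega)).2 (by omega)⟩
    · exact ⟨f (k - i), ih hi' (by omega), (hf.adj_iff (by omega) (by omega)).2 (by omega)⟩

/-- The vertices reached in `d` steps lie on a walk with at most `d + 1` vertices. -/
lemma exists_conn_of_mem_reach [Finite V] (hu : u ∈ A) {d : ℕ} {b : V} (h : b ∈ reach G A u d) :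
    ∃ X, Conn G X ∧ X ⊆ A ∧ u ∈ X ∧ b ∈ X ∧ X.ncard ≤ d + 1 := by
  induction d generalizing b with
  | zero =>
    obtain rfl : b = u := h
    exact ⟨{b}, conn_singleton b, by simpa using hu, rfl, rfl, by simp⟩
  | succ d ih =>
    rcases h with h | ⟨hb, x, hx, hxb⟩
    · obtain ⟨X, h1, h2, h3, h4, h5⟩ := ih h
      exact ⟨X, h1, h2, h3, h4, by omega⟩
    · obtain ⟨X, h1, h2, h3, h4, h5⟩ := ih hx
      exact ⟨insert b X, h1.insert_of_adj h4 hxb.symm, Set.insert_subset hb h2, .inr h3, .inl rfl,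
        (Set.ncard_insert_le _ _).trans (by omega)⟩

lemma exists_rotate {x : V} (hf : IndCyc G k f) (hx : x ∈ cyc k f) :
    ∃ g, IndCyc G k g ∧ cyc k g = cyc k f ∧ g 0 = x := by
  obtain ⟨r, hr, rfl⟩ := mem_cyc.1 hx
  exact ⟨rot k f r, hf.rotate hr, cyc_rotate f hr, by simp [rot, hr]⟩

variable [Finite V]

/-- A set of minimum degree two keeps this property when a set of minimum degree two is removed all
of whose vertices have degree two in the whole graph. -/
lemma MinDegTwo.sdiff_of_degTwo {B C : Set V} (hB : MinDegTwo G B) (hBA : B ⊆ A)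
    (hC : MinDegTwo G C) (hCA : C ⊆ degTwo G A) : MinDegTwo G (B \ C) := by
  intro w hw
  obtain ⟨x, hx, y, hy, hxy, h1, h2⟩ := hB w hw.1
  have key : ∀ z ∈ B, G.Adj w z → z ∈ B \ C := fun z hz hwz =>
    ⟨hz, fun hzC => hw.2 (hC.mem_of_adj (hCA.trans degTwo_subset) hzC (hCA hzC).2.le
      (hBA hw.1) hwz.symm)⟩
  exact ⟨x, key x hx h1, y, key y hy h2, hxy, h1, h2⟩

lemma exists_niceCyc_of_mem_core (hk : 5 ≤ k) (hG : IsSC k G) (hu : u ∈ A)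
    (h : u ∈ core G (degTwo G A ∪ {u})) : ∃ f, NiceCyc G k A f 0 ∧ f 0 = u := by
  have hsub : degTwo G A ∪ {u} ⊆ A := Set.union_subset degTwo_subset (by simpa using hu)
  have hM := (minDegTwo_core (G := G) (degTwo G A ∪ {u})).sdiff_of_degTwo
    ((core_subset _).trans hsub) (minDegTwo_core (degTwo G A \ {u}))
    ((core_subset _).trans Set.sdiff_subset)
  obtain ⟨-, f, hf, hfB⟩ := exists_cyc_of_minDegTwo hG hM
    ⟨u, h, fun h' => (core_subset _ h').2 rfl⟩
  have huf : u ∈ cyc k f := by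
    by_contra hn
    have hmem : f 0 ∈ cyc k f := mem_cyc.2 ⟨0, by omega, rfl⟩
    refine (hfB hmem).2 ((hf.minDegTwo (by omega)).subset_core (fun x hx => ?_) hmem)
    have hxu : x ≠ u := fun e => hn (e ▸ hx)
    exact ⟨(core_subset _ (hfB hx).1).resolve_right hxu, hxu⟩
  obtain ⟨g, hg, hgf, rfl⟩ := exists_rotate hf huf
  rw [← hgf] at hfB
  refine ⟨g, ⟨hg, (hfB.trans Set.sdiff_subset).trans ((core_subset _).trans hsub), by omega,
    .inl rfl, fun i hi h0 _ => ?_⟩, rfl⟩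
  rcases core_subset _ (hfB (mem_cyc.2 ⟨i, hi, rfl⟩)).1 with h' | h'
  · exact h'.2
  · exact absurd (hg.inj hi (by omega) h') h0

lemma exists_niceCyc_of_attached (hk : 5 ≤ k) (hG : IsSC k G) (hu : u ∈ A) (hv : v ∈ A)
    (h : Attached k G A u v) : ∃ f q, NiceCyc G k A f q ∧ Ends f q u v := by
  rcases h with ⟨rfl, h⟩ | ⟨huv, -, -, h, h1, h2, h3⟩
  · obtain ⟨f, hf, rfl⟩ := exists_niceCyc_of_mem_core hk hG hu h
    exact ⟨f, 0, hf, .inl ⟨rfl, rfl⟩⟩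
  have hsub : degTwo G A ∪ {u, v} ⊆ A :=
    Set.union_subset degTwo_subset (Set.insert_subset hu (by simpa using hv))
  have hM := (minDegTwo_core (G := G) (degTwo G A ∪ {u, v})).sdiff_of_degTwo
    ((core_subset _).trans hsub) (minDegTwo_core (degTwo G A)) (core_subset _)
  obtain ⟨-, f, hf, hfB⟩ := exists_cyc_of_minDegTwo hG hM
    ⟨u, h, fun h' => h1 (core_mono Set.subset_union_left h')⟩
  have hfM := hf.minDegTwo (by omega : 3 ≤ k)
  have hmem : f 0 ∈ cyc k f := mem_cyc.2 ⟨0, by omega, rfl⟩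
  have hcase : ∀ x ∈ cyc k f, x ∈ degTwo G A ∨ x = u ∨ x = v := fun x hx =>
    core_subset (degTwo G A ∪ {u, v}) (hfB hx).1
  have hD : ¬ cyc k f ⊆ degTwo G A := fun h' => (hfB hmem).2 (hfM.subset_core h' hmem)
  -- If the cycle contained only one of `u` and `v`, this vertex alone would pass the test.
  have huf : u ∈ cyc k f := by
    by_contra hn
    have hle : cyc k f ⊆ degTwo G A ∪ {v} := fun x hx =>
      (hcase x hx).imp_right fun e => e.resolve_left fun e => hn (e ▸ hx)
    refine hD fun x hx => (hle hx).resolve_right fun e => h2 ?_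
    obtain rfl : x = v := e
    exact hfM.subset_core hle hx
  have hvf : v ∈ cyc k f := by
    by_contra hn
    have hle : cyc k f ⊆ degTwo G A ∪ {u} := fun x hx =>
      (hcase x hx).imp_right fun e => e.resolve_right fun e => hn (e ▸ hx)
    exact h1 (hfM.subset_core hle huf)
  obtain ⟨g, hg, hgf, rfl⟩ := exists_rotate hf huf
  rw [← hgf] at hvf hcase hfB
  have hgA : cyc k g ⊆ A := (hfB.trans Set.sdiff_subset).trans ((core_subset _).trans hsub)
  obtain ⟨m, hm, rfl⟩ := mem_cyc.1 hvf
  have hm0 : m ≠ 0 := by rintro rfl; exact huv rfl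
  have hdeg : ∀ i < k, i ≠ 0 → i ≠ m → degIn G A (g i) = 2 := fun i hi hi0 him => by
    rcases hcase _ (mem_cyc.2 ⟨i, hi, rfl⟩) with h' | h' | h'
    · exact h'.2
    · exact absurd (hg.inj hi (by omega) h') hi0
    · exact absurd (hg.inj hi hm h') him
  rcases h3 with h3 | h3
  · have : m = 1 ∨ m + 1 = k := by
      have := (hg.adj_iff (by omega) hm).1 h3; omega
    rcases this with rfl | hmk
    · exact ⟨g, 1, ⟨hg, hgA, hm, .inr (.inl rfl), hdeg⟩, .inl ⟨rfl, rfl⟩⟩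
    · refine ⟨rot k g m, 1, ⟨hg.rotate hm, by rwa [cyc_rotate g hm], by omega, .inr (.inl rfl),
        fun i hi hi0 hi1 => ?_⟩, .inr ⟨?_, ?_⟩⟩
      · simp only [rot, if_neg (by omega : ¬ i + m < k)]
        exact hdeg _ (by omega) (by omega) (by omega)
      · simp only [rot, if_neg (by omega : ¬ 1 + m < k)]
        congr 1; omega
      · simp [rot, hm]
  · have e1 := h3 m (mem_reach_cyc hg hgA m hm)
    have e2 := h3 (k - m) (by
      simpa [Nat.sub_sub_self hm.le] using
        mem_reach_cyc_sub (by omega) hg hgA (k - m) (by omega) (by omega))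
    exact ⟨g, m, ⟨hg, hgA, hm, .inr (.inr ⟨⟨m, by omega⟩, by omega⟩), hdeg⟩, .inl ⟨rfl, rfl⟩⟩

/-- A vertex that passes the test and whose deletion lowers the optimum may be put into a value of
the recursion. -/
theorem CycleHitRec.of_attached (hk : 5 ≤ k) (hG : IsSC k G) (hA : MinDegTwo G A) (hu : u ∈ A)
    (hv : v ∈ A) (h : Attached k G A u v) (hd : Drops G A u) {S : Set V}
    (hS : CycleHitRec k G (core G (A \ {u})) S) : CycleHitRec k G A ({u} ∪ S) := by
  obtain ⟨f, q, hf, he⟩ := exists_niceCyc_of_attached hk hG hu hv h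
  have hdeg : ∀ x ∈ A, 2 ≤ degIn G A x := minDegTwo_iff_degIn.1 hA
  have hdD : ∀ x ∈ A, x ∉ degTwo G A → 3 ≤ degIn G A x := fun x hx hn => by
    have h1 := hdeg x hx
    have h2 : degIn G A x ≠ 2 := fun e => hn ⟨hx, e⟩
    omega
  have hlt : ∀ T, Hits G A T → S.ncard < T.ncard := fun T hT => by
    obtain ⟨T', hT'⟩ := exists_cycleHitRec hk hG A
    have hT'o := hT'.isOpt (by omega)
    exact (hd S T' (isOpt_core_iff hS hk hG) hT'o).trans_le (hT'o.2 T hT)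
  have key : 3 ≤ degIn G A u → 3 ≤ degIn G A v → CycleHitRec k G A ({u} ∪ S) := fun h1 h2 => by
    have h0q : 3 ≤ degIn G A (f 0) ∧ 3 ≤ degIn G A (f q) := by
      rcases he with ⟨e1, e2⟩ | ⟨e1, e2⟩
      · rw [← e1, ← e2]; exact ⟨h1, h2⟩
      · rw [← e1, ← e2]; exact ⟨h2, h1⟩
    exact hf.value_insert hk hG h0q.1 h0q.2 he
      (fun A' _ => exists_cycleHitRec hk hG A') hS hlt
  rcases h with ⟨rfl, h⟩ | ⟨huv, h1, h2, -⟩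
  · by_cases hu2 : u ∈ degTwo G A
    · obtain ⟨f, hf, rfl⟩ := exists_niceCyc_of_mem_core hk hG hu h
      refine hf.value_of_isolated hk hG (fun i hi => ?_) (by omega) hS
      rcases eq_or_ne i 0 with rfl | h0
      · exact hu2.2
      · exact hf.deg i hi h0 h0
    · exact key (hdD u hu hu2) (hdD u hu hu2)
  · exact key (hdD u hu h1) (hdD v hv h2)

/-- The attachment vertices of a pendant cycle at antipodal positions are at distance `k / 2`. -/
lemma NiceCyc.le_of_mem_reach (hk : 5 ≤ k) (hG : IsSC k G) (he : Even k)
    (hf : NiceCyc G k A f (k / 2)) {d : ℕ} (h : f (k / 2) ∈ reach G A (f 0) d) : k ≤ 2 * d := by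
  have hm := Nat.even_iff.1 he
  obtain ⟨X, hX, hXA, h0, hq, hc⟩ :=
    exists_conn_of_mem_reach (hf.subset (mem_cyc.2 ⟨0, by omega, rfl⟩)) h
  obtain ⟨t, y, hy, hyX, hyU, hyW⟩ := hX.exists_indPath (U := {f 0}) (W := {f (k / 2)})
    ⟨_, h0, rfl⟩ ⟨_, hq, rfl⟩
  have hyA : ∀ i ≤ t, y i ∈ A := fun i hi => hXA (hyX i hi)
  have hy0 : y 0 = f 0 := (hyU 0 (by omega)).2 rfl
  have hyt : y t = f (k / 2) := (hyW t le_rfl).2 rfl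
  have htd : t ≤ d := by
    have h1 : (cyc (t + 1) y).ncard = t + 1 := by
      rw [cyc, Set.InjOn.ncard_image]
      · rw [show {i | i < t + 1} = (Finset.range (t + 1) : Set ℕ) by ext; simp,
          Set.ncard_coe_finset, Finset.card_range]
      · intro i hi j hj hij
        rcases lt_trichotomy i j with h | h | h
        · exact absurd hij (hy i j h hj).1
        · exact h
        · exact absurd hij.symm (hy j i h hi).1
    have h2 : cyc (t + 1) y ⊆ X := fun x hx => by
      obtain ⟨i, hi, rfl⟩ := mem_cyc.1 hx
      exact hyX i (by omega)
    have := Set.ncard_le_ncard h2 (Set.toFinite _)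
    omega
  suffices k / 2 ≤ t by omega
  have hadj : ∀ i, i + 1 ≤ t → G.Adj (y i) (y (i + 1)) := fun i hi =>
    (hy i (i + 1) (by omega) (by omega)).2.2 rfl
  -- Away from its ends, the path cannot enter or leave the cycle.
  have hin : ∀ i, 0 < i → i < t → ∀ w ∈ A, y i ∈ cyc k f → G.Adj (y i) w → w ∈ cyc k f := by
    intro i hi0 hit w hw hyi hadj
    obtain ⟨j, hj, hje⟩ := mem_cyc.1 hyi
    have hj0 : j ≠ 0 := fun e => by
      have := (hyU i (by omega)).1 (by rw [← hje, e]; rfl); omega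
    have hjq : j ≠ k / 2 := fun e => by
      have := (hyW i (by omega)).1 (by rw [← hje, e]; rfl); omega
    rw [← hje] at hadj
    exact hf.indCyc.mem_of_adj (by omega) hf.subset hj (hf.deg j hj hj0 hjq).le hw hadj
  by_cases hall : ∀ i ≤ t, y i ∈ cyc k f
  · have hidx : ∀ i ≤ t, ∀ j < k, f j = y i → min j (k - j) ≤ i := by
      intro i
      induction i with
      | zero =>
        intro _ j hj hje
        have := hf.indCyc.inj hj (by omega : 0 < k) (hje.trans hy0)
        omega
      | succ i ih =>
        intro hi j hj hje
        obtain ⟨l, hl, hle⟩ := mem_cyc.1 (hall i (by omega))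
        have h1 := ih (by omega) l hl hle
        have h2 := hadj i hi
        rw [← hle, ← hje, hf.indCyc.adj_iff hl hj] at h2
        omega
    have := hidx t le_rfl (k / 2) (by omega) hyt.symm
    omega
  · push Not at hall
    obtain ⟨i, hit, hi⟩ := hall
    have hi0 : i ≠ 0 := fun e => hi (by rw [e, hy0]; exact mem_cyc.2 ⟨0, by omega, rfl⟩)
    have hit' : i ≠ t := fun e => hi (by rw [e, hyt]; exact mem_cyc.2 ⟨k / 2, by omega, rfl⟩)
    have hout : ∀ j, 0 < j → j < t → y j ∉ cyc k f := by
      intro j hj0 hjt hj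
      rcases le_total j i with hji | hji
      · refine hi ?_
        clear hi
        induction i, hji using Nat.le_induction with
        | base => exact hj
        | succ n hn ih =>
          exact hin n (by omega) (by omega) _ (hyA _ (by omega))
            (ih (by omega) (by omega) (by omega)) (hadj n (by omega))
      · have : ∀ m, m + i ≤ j → y (j - m) ∈ cyc k f := by
          intro m
          induction m with
          | zero => exact fun _ => hj
          | succ m ih =>
            intro hm'
            refine hin (j - m) (by omega) (by omega) _ (hyA _ (by omega)) (ih (by omega)) ?_
            have := hadj (j - (m + 1)) (by omega)
            rw [show j - (m + 1) + 1 = j - m by omega] at this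
            exact this.symm
        have h' := this (j - i) (by omega)
        rw [show j - (j - i) = i by omega] at h'
        exact hi h'
    have hlen := link_length (n := t - 1) (p := k / 2) (q := 0) (δ := k / 2) hG hf.indCyc
      (y := fun i => y (i + 1)) ((hy.tail).mono (by omega)) (by omega)
      (fun i hi => hout _ (by omega) (by omega)) (by omega) (by omega) (by omega) (by omega)
      (by omega) (by
        intro i hi j _ l hl _
        have hne : ∀ l < k, l ≠ 0 → l ≠ k / 2 → ¬ G.Adj (y (i + 1)) (f l) := fun l hl h0 h1 h2 =>
          hout (i + 1) (by omega) (by omega) (hf.indCyc.mem_of_adj (by omega) hf.subset hl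
            (hf.deg l hl h0 h1).le (hyA _ (by omega)) h2.symm)
        rcases eq_or_ne l 0 with rfl | hl0
        · have := (hy 0 (i + 1) (by omega) (by omega)).2
          rw [← hy0, G.adj_comm, this]; omega
        · rcases eq_or_ne l (k / 2) with hlq | hlq
          · have := (hy (i + 1) t (by omega) (by omega)).2
            rw [hlq, ← hyt, this]; omega
          · exact ⟨fun h' => absurd h' (hne l hl hl0 hlq), by omega⟩)
    omega

/-- In a nonempty set of minimum degree two, the test succeeds for some pair of vertices. -/
theorem exists_attached (hk : 5 ≤ k) (hG : IsSC k G) (hA : MinDegTwo G A) (hne : A.Nonempty) :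
    ∃ u ∈ A, ∃ v ∈ A, Attached k G A u v ∧ Drops G A u := by
  choose S hS using fun u => exists_cycleHitRec hk hG (A \ {u})
  have hSo : ∀ u, IsOpt G (A \ {u}) (S u) := fun u => (hS u).isOpt (by omega)
  have hdrop : ∀ u, (∀ T, Hits G A T → (S u).ncard < T.ncard) → Drops G A u :=
    fun u hu S' T hS' hT => (hS'.2 _ (hSo u).1).trans_lt (hu T hT.1)
  obtain ⟨f, q, hf, hor⟩ := exists_niceCyc hk hG hA hne
  obtain ⟨u, v, he, hlt⟩ := hf.exists_ends_lt (by omega) hSo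
  have hd := hdrop u hlt
  obtain ⟨huc, hvc⟩ := he.mem_cyc hf.lt
  have hu := hf.subset huc
  have hv := hf.subset hvc
  have hfM := hf.indCyc.minDegTwo (by omega : 3 ≤ k)
  have hcase : ∀ x ∈ cyc k f, x ∈ degTwo G A ∨ x = u ∨ x = v := fun x hx => by
    obtain ⟨i, hi, rfl⟩ := mem_cyc.1 hx
    by_cases h0 : i = 0
    · subst h0; rcases he with ⟨e, -⟩ | ⟨-, e⟩ <;> simp [e]
    by_cases h1 : i = q
    · subst h1; rcases he with ⟨-, e⟩ | ⟨e, -⟩ <;> simp [e]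
    exact .inl ⟨hf.subset hx, hf.deg i hi h0 h1⟩
  by_cases huE : u ∈ core G (degTwo G A ∪ {u})
  · exact ⟨u, hu, u, hu, .inl ⟨rfl, huE⟩, hd⟩
  have huv : u ≠ v := by
    rintro rfl
    exact huE (hfM.subset_core (fun x hx => (hcase x hx).imp_right fun e => e.elim id id) huc)
  by_cases hvE : v ∈ core G (degTwo G A ∪ {v})
  · obtain ⟨g, hg, rfl⟩ := exists_niceCyc_of_mem_core hk hG hv hvE
    obtain ⟨a, b, hab, hlt'⟩ := hg.exists_ends_lt (by omega) hSo
    obtain rfl : a = g 0 := by rcases hab with ⟨e, -⟩ | ⟨e, -⟩ <;> exact e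
    exact ⟨g 0, hv, g 0, hv, .inl ⟨rfl, hvE⟩, hdrop _ hlt'⟩
  have h3 : 3 ≤ degIn G A (f 0) ∧ 3 ≤ degIn G A (f q) := by
    refine hor.resolve_left fun hall => huE (hfM.subset_core (fun x hx => ?_) huc)
    obtain ⟨i, hi, rfl⟩ := mem_cyc.1 hx
    exact .inl ⟨hf.subset hx, hall i hi⟩
  have hnot : u ∉ degTwo G A ∧ v ∉ degTwo G A := by
    refine ⟨fun h => ?_, fun h => ?_⟩ <;> have := h.2 <;> rcases he with ⟨e1, e2⟩ | ⟨e1, e2⟩ <;>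
      simp only [e1, e2] at this <;> omega
  refine ⟨u, hu, v, hv, .inr ⟨huv, hnot.1, hnot.2, hfM.subset_core hcase huc, huE, hvE, ?_⟩, hd⟩
  rcases hf.kind with rfl | rfl | ⟨hev, rfl⟩
  · rcases he with ⟨e1, e2⟩ | ⟨e1, e2⟩ <;> exact absurd (e1.trans e2.symm) huv
  · have := (hf.indCyc.adj_iff (by omega : 0 < k) (by omega : 1 < k)).2 (by omega)
    rcases he with ⟨rfl, rfl⟩ | ⟨rfl, rfl⟩
    · exact .inl this
    · exact .inl this.symm
  · have hm := Nat.even_iff.1 hev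
    have hk2 : k / 2 < k := by omega
    refine .inr fun d hd' => ?_
    rcases he with ⟨rfl, rfl⟩ | ⟨rfl, rfl⟩
    · exact hf.le_of_mem_reach hk hG hev hd'
    · have e0 : rot k f (k / 2) 0 = f (k / 2) := by simp [rot, hk2]
      have e1 : rot k f (k / 2) (k / 2) = f 0 := by
        simp only [rot, if_neg (by omega : ¬ k / 2 + k / 2 < k)]
        congr 1; omega
      have hg : NiceCyc G k A (rot k f (k / 2)) (k / 2) :=
        ⟨hf.indCyc.rotate hk2, by rw [cyc_rotate f hk2]; exact hf.subset, hk2, .inr (.inr ⟨hev,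
            rfl⟩),
          fun i hi h0 h1 => by
            by_cases hik : i + k / 2 < k
            · simp only [rot, if_pos hik]; exact hf.deg _ hik (by omega) (by omega)
            · simp only [rot, if_neg hik]; exact hf.deg _ (by omega) (by omega) (by omega)⟩
      exact hg.le_of_mem_reach hk hG hev (by rwa [e0, e1])

end Attachments

/-! ### Programs for vertex sets -/

section Toolkit

/-- The expression `e` is nonzero, i.e. true. -/
def Ex.Holds (N K : ℕ) (A : ℕ → ℕ → ℕ → ℕ) (e : Ex) (ρ : ℕ → ℕ) : Prop := e.eval N K A ρ ≠ 0

/-- Conjunction. -/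
def Ex.conj (a b : Ex) : Ex := .ite a b (.lit 0)

/-- Disjunction. -/
def Ex.disj (a b : Ex) : Ex := .ite a (.lit 1) b

/-- Negation. -/
def Ex.neg (a : Ex) : Ex := .ite a (.lit 0) (.lit 1)

/-- `a < b`, as truncated subtraction `b - a`. -/
def Ex.lt (a b : Ex) : Ex := .sub b a

/-- Equality. -/
def Ex.eq (a b : Ex) : Ex := .neg (.disj (.lt a b) (.lt b a))

/-- `e` is true for some value of the variable `v`. -/
def Ex.exi (v : ℕ) (e : Ex) : Ex := .sum v e

/-- The minimum, by truncated subtraction. -/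
def Ex.min (a b : Ex) : Ex := .sub a (.sub a b)

/-- The number of values of the variable `v` for which `e` is true. -/
def Ex.count (v : ℕ) (e : Ex) : Ex := .sum v (.ite e (.lit 1) (.lit 0))

/-- The value of the variable `v` belongs to the set given by the diagonal of the array `j`. -/
def Ex.mem (v j : ℕ) : Ex := .rd j v v

variable {N K : ℕ} {A : ℕ → ℕ → ℕ → ℕ} {ρ : ℕ → ℕ} {a b : Ex}

lemma Ex.holds_conj : (Ex.conj a b).Holds N K A ρ ↔ a.Holds N K A ρ ∧ b.Holds N K A ρ := by
  simp only [Ex.conj, Ex.Holds, Ex.eval]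
  split_ifs with h <;> simp [h]

lemma Ex.holds_disj : (Ex.disj a b).Holds N K A ρ ↔ a.Holds N K A ρ ∨ b.Holds N K A ρ := by
  simp only [Ex.disj, Ex.Holds, Ex.eval]
  split_ifs with h <;> simp [h]

lemma Ex.holds_neg : (Ex.neg a).Holds N K A ρ ↔ ¬ a.Holds N K A ρ := by
  simp only [Ex.neg, Ex.Holds, Ex.eval]
  split_ifs with h <;> simp [h]

lemma Ex.holds_lt : (Ex.lt a b).Holds N K A ρ ↔ a.eval N K A ρ < b.eval N K A ρ := by
  simp only [Ex.lt, Ex.Holds, Ex.eval]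
  omega

lemma Ex.holds_eq : (Ex.eq a b).Holds N K A ρ ↔ a.eval N K A ρ = b.eval N K A ρ := by
  simp only [Ex.eq, Ex.holds_neg, Ex.holds_disj, Ex.holds_lt]
  omega

lemma Ex.holds_exi {v : ℕ} :
    (Ex.exi v a).Holds N K A ρ ↔ ∃ i : Fin N, a.Holds N K A (Function.update ρ v i) := by
  simp only [Ex.exi, Ex.Holds, Ex.eval, ne_eq, Finset.sum_eq_zero_iff, Finset.mem_range, not_forall]
  exact ⟨fun ⟨i, hi, h⟩ => ⟨⟨i, hi⟩, h⟩, fun ⟨i, h⟩ => ⟨i, i.2, h⟩⟩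

lemma Ex.holds_mem {v j : ℕ} : (Ex.mem v j).Holds N K A ρ ↔ A j (ρ v) (ρ v) ≠ 0 := Iff.rfl

lemma Ex.holds_rd {j v w : ℕ} : (Ex.rd j v w).Holds N K A ρ ↔ A j (ρ v) (ρ w) ≠ 0 := Iff.rfl

lemma Ex.eval_min : (Ex.min a b).eval N K A ρ = Min.min (a.eval N K A ρ) (b.eval N K A ρ) := by
  simp only [Ex.min, Ex.eval]
  omega

lemma Ex.eval_ite {c : Ex} [Decidable (c.Holds N K A ρ)] : (Ex.ite c a b).eval N K A ρ =
    if c.Holds N K A ρ then a.eval N K A ρ else b.eval N K A ρ := by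
  simp only [Ex.eval, Ex.Holds]
  congr

lemma Ex.eval_count {v : ℕ} {X : Set (Fin N)}
    (h : ∀ i : Fin N, a.Holds N K A (Function.update ρ v i) ↔ i ∈ X) :
    (Ex.count v a).eval N K A ρ = X.ncard := by
  classical
  simp only [Ex.count, Ex.eval]
  rw [Finset.sum_range, Set.ncard_eq_toFinset_card', Finset.card_eq_sum_ones, ← Finset.sum_filter]
  refine Finset.sum_congr ?_ fun _ _ => rfl
  ext i
  simpa [Ex.Holds] using h i

@[simp] lemma env_apply_zero (x y : ℕ) : env x y 0 = x := rfl

@[simp] lemma env_apply_one (x y : ℕ) : env x y 1 = y := rfl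

@[simp] lemma update_two_zero (x : ℕ) : Function.update ρ 2 x 0 = ρ 0 := rfl

@[simp] lemma update_two_one (x : ℕ) : Function.update ρ 2 x 1 = ρ 1 := rfl

@[simp] lemma update_three_two (x : ℕ) : Function.update ρ 3 x 2 = ρ 2 := rfl

/-- The diagonal of `T` is the indicator of `X`. -/
def IsSet {n : ℕ} (T : ℕ → ℕ → ℕ) (X : Set (Fin n)) : Prop := ∀ a : Fin n, T a a ≠ 0 ↔ a ∈ X

/-- `T` is the adjacency matrix of `G`. -/
def IsAdj {n : ℕ} (T : ℕ → ℕ → ℕ) (G : SimpleGraph (Fin n)) : Prop :=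
  ∀ a b : Fin n, T a b ≠ 0 ↔ G.Adj a b

/-- The diagonal of `T` has the constant value `x`. -/
def IsNum (n : ℕ) (T : ℕ → ℕ → ℕ) (x : ℕ) : Prop := ∀ a : Fin n, T a a = x

/-- The arrays to which a program writes. -/
def Cmd.Writes : Cmd → ℕ → Prop
  | .set j _, i => i = j
  | .seq c d, i => c.Writes i ∨ d.Writes i
  | .rep c, i => c.Writes i

lemma Cmd.run_eq_of_not_writes {c : Cmd} {i : ℕ} (h : ¬ c.Writes i) (A : ℕ → ℕ → ℕ → ℕ) :
    c.run N K A i = A i := by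
  induction c generalizing A with
  | set j e => exact Function.update_of_ne h _ _
  | seq c d ihc ihd =>
    simp only [Cmd.Writes, not_or] at h
    exact (ihd h.2 _).trans (ihc h.1 _)
  | rep c ih =>
    simp only [Cmd.run]
    generalize N = m at *
    have : ∀ m', (c.run m K)^[m'] A i = A i := fun m' => by
      induction m' with
      | zero => rfl
      | succ m' ih' => rw [Function.iterate_succ_apply', ih h, ih']
    exact this m

lemma Cmd.run_set (j : ℕ) (e : Ex) (x y : ℕ) :
    (Cmd.set j e).run N K A j x y = e.eval N K A (env x y) := by
  simp [Cmd.run]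

lemma Cmd.run_seq (c d : Cmd) : (Cmd.seq c d).run N K A = d.run N K (c.run N K A) := rfl

lemma isSet_set {n : ℕ} {X : Set (Fin n)} {j : ℕ} {e : Ex}
    (h : ∀ x : Fin n, e.Holds n K A (env x x) ↔ x ∈ X) : IsSet ((Cmd.set j e).run n K A j) X :=
  fun x => by rw [Cmd.run_set]; exact h x

end Toolkit

section Cores

variable {V : Type*} {G : SimpleGraph V}

/-- The vertices of `X` with at least two neighbours in `X`. -/
def strip (G : SimpleGraph V) (X : Set V) : Set V := {a | a ∈ X ∧ 2 ≤ degIn G X a}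

lemma strip_subset (X : Set V) : strip G X ⊆ X := fun _ h => h.1

variable [Finite V]

lemma core_strip (X : Set V) : core G (strip G X) = core G X := by
  refine Set.Subset.antisymm (core_mono (strip_subset X)) ?_
  refine (minDegTwo_core X).subset_core fun x hx => ⟨core_subset X hx, ?_⟩
  exact (minDegTwo_iff_degIn.1 (minDegTwo_core X) x hx).trans (degIn_mono (core_subset X) x)

lemma iterate_strip (m : ℕ) (X : Set V) (h : X.ncard ≤ m) : (strip G)^[m] X = core G X := by
  induction m generalizing X with
  | zero =>
    obtain rfl := (Set.ncard_eq_zero (Set.toFinite X)).1 (by omega)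
    exact (Set.subset_empty_iff.1 (core_subset ∅)).symm
  | succ m ih =>
    rw [Function.iterate_succ_apply]
    by_cases he : strip G X = X
    · rw [he, Function.iterate_fixed he]
      have : MinDegTwo G X := minDegTwo_iff_degIn.2 fun v hv => (he.symm ▸ hv : v ∈ strip G X).2
      rw [this.core_eq]
    · have := Set.ncard_lt_ncard ((strip_subset (G := G) X).ssubset_of_ne he) (Set.toFinite X)
      rw [ih _ (by omega), core_strip]

end Cores

section SetPrograms

variable {n K : ℕ} {A : ℕ → ℕ → ℕ → ℕ} {G : SimpleGraph (Fin n)} {X : Set (Fin n)}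

/-- The number of neighbours, in the set in array `j`, of the vertex in variable `0`. -/
def Ex.deg (j : ℕ) : Ex := .count 2 (.conj (.mem 2 j) (.rd 0 0 2))

lemma Ex.eval_deg {j : ℕ} (hA : IsAdj (A 0) G) (hX : IsSet (A j) X) (x : Fin n) (y : ℕ) :
    (Ex.deg j).eval n K A (env x y) = degIn G X x := by
  refine Ex.eval_count fun i => ?_
  simp only [Ex.holds_conj, Ex.holds_mem, Ex.holds_rd, Function.update_self,
    update_two_zero, env_apply_zero, hX i, hA x i, Set.mem_ofPred_eq]

/-- Replaces the set in array `j` by its core: vertices with less than two neighbours are removed as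
often as there are vertices. -/
def coreCmd (j : ℕ) : Cmd := .rep (.set j (.conj (.mem 0 j) (.lt (.lit 1) (.deg j))))

theorem isSet_coreCmd {j : ℕ} (hj : j ≠ 0) (hA : IsAdj (A 0) G) (hX : IsSet (A j) X) :
    IsSet ((coreCmd j).run n K A j) (core G X) := by
  have key : ∀ m : ℕ, IsAdj (((Cmd.set j (.conj (.mem 0 j) (.lt (.lit 1)
      (.deg j)))).run n K)^[m] A 0) G
      ∧ IsSet (((Cmd.set j (.conj (.mem 0 j) (.lt (.lit 1) (.deg j)))).run n K)^[m] A j)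
        ((strip G)^[m] X) := by
    intro m
    induction m with
    | zero => exact ⟨hA, hX⟩
    | succ m ih =>
      rw [Function.iterate_succ_apply', Function.iterate_succ_apply']
      refine ⟨?_, isSet_set fun x => ?_⟩
      · rw [Cmd.run_eq_of_not_writes (i := 0) (by simpa [Cmd.Writes] using hj.symm)]
        exact ih.1
      · rw [Ex.holds_conj, Ex.holds_lt, Ex.eval_deg ih.1 ih.2, Ex.holds_mem, env_apply_zero,
          ih.2 x]
        rfl
  rw [← iterate_strip n X ((Set.ncard_le_card X).trans (by simp))]
  exact (key n).2

/-- One step of a breadth-first search in the set in array `1`: array `9` holds the set of the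
vertices reached, and array `10` the number of steps so far in which a vertex had not been
reached. -/
def reachStep : Cmd :=
  .seq (.set 10 (.add (.rd 10 0 0) (.ite (.mem 0 9) (.lit 0) (.lit 1))))
    (.set 9 (.disj (.mem 0 9) (.conj (.mem 0 1) (.exi 2 (.conj (.mem 2 9) (.rd 0 2 0))))))

open Classical in
lemma iterate_reachStep {u : Fin n} (hA : IsAdj (A 0) G) (hX : IsSet (A 1) X)
    (h9 : IsSet (A 9) {u}) (h10 : IsNum n (A 10) 0) (m : ℕ) :
    IsSet ((reachStep.run n K)^[m] A 9) (reach G X u m) ∧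
      ∀ x : Fin n, (reachStep.run n K)^[m] A 10 x x =
        ∑ d ∈ Finset.range m, if x ∈ reach G X u d then 0 else 1 := by
  have hfr : ∀ i, ¬ reachStep.Writes i → ∀ m, (reachStep.run n K)^[m] A i = A i := fun i hi m => by
    induction m with
    | zero => rfl
    | succ m ih => rw [Function.iterate_succ_apply', Cmd.run_eq_of_not_writes hi, ih]
  induction m with
  | zero => exact ⟨h9, fun x => by simpa using h10 x⟩
  | succ m ih =>
    rw [Function.iterate_succ_apply']
    set B := (reachStep.run n K)^[m] A with hB
    have h0 : B 0 = A 0 := hfr 0 (by simp [reachStep, Cmd.Writes]) m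
    have h1 : B 1 = A 1 := hfr 1 (by simp [reachStep, Cmd.Writes]) m
    rw [← h0] at hA
    rw [← h1] at hX
    constructor
    · refine isSet_set fun x => ?_
      set B' := (Cmd.set 10 (.add (.rd 10 0 0) (.ite (.mem 0 9) (.lit 0) (.lit 1)))).run n K B
      have e0 : B' 0 = B 0 := Cmd.run_eq_of_not_writes (by simp [Cmd.Writes]) B
      have e1 : B' 1 = B 1 := Cmd.run_eq_of_not_writes (by simp [Cmd.Writes]) B
      have e9 : B' 9 = B 9 := Cmd.run_eq_of_not_writes (by simp [Cmd.Writes]) B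
      simp only [Ex.holds_conj, Ex.holds_disj, Ex.holds_exi, Ex.holds_mem, Ex.holds_rd, e0, e1, e9,
        Function.update_self,
        update_two_zero, env_apply_zero, ih.1 _, hX _, hA _ _]
      rfl
    · intro x
      rw [reachStep, Cmd.run_seq, Cmd.run_eq_of_not_writes (i := 10) (by simp [Cmd.Writes]),
          Cmd.run_set,
        Finset.sum_range_succ, ← ih.2 x]
      simp only [Ex.eval, env_apply_zero]
      congr 1
      by_cases hx : x ∈ reach G X u m
      · rw [if_pos hx]; exact if_pos ((ih.1 x).2 hx)
      · rw [if_neg hx]; exact if_neg fun h => hx ((ih.1 x).1 h)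

lemma reach_mono {V : Type*} {G : SimpleGraph V} {X : Set V} {u : V} : Monotone (reach G X u) :=
  monotone_nat_of_le_succ fun _ => Set.subset_union_left

open Classical in
/-- The distance from `u` to `x` is the number of `d` such that `x` is not reached in `d` steps. -/
lemma le_two_mul_sum_iff {V : Type*} {G : SimpleGraph V} {X : Set V} {u x : V} {k m : ℕ}
    (hk : k ≤ m) : k ≤ 2 * (∑ d ∈ Finset.range m, if x ∈ reach G X u d then 0 else 1) ↔
      ∀ d, x ∈ reach G X u d → k ≤ 2 * d := by
  constructor
  · intro h d hd
    refine h.trans (Nat.mul_le_mul_left 2 ?_)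
    calc (∑ e ∈ Finset.range m, if x ∈ reach G X u e then 0 else 1)
        ≤ ∑ e ∈ Finset.range m, if e < d then 1 else 0 := Finset.sum_le_sum fun e _ => by
          by_cases he : e < d
          · simp only [if_pos he]; split_ifs <;> omega
          · rw [if_pos (reach_mono (not_lt.1 he) hd)]; omega
      _ = ((Finset.range m).filter (· < d)).card := (Finset.card_filter _ _).symm
      _ ≤ (Finset.range d).card := Finset.card_le_card fun e he => by
          simpa using (Finset.mem_filter.1 he).2
      _ = d := Finset.card_range d
  · intro h
    have : (k + 1) / 2 ≤ ∑ d ∈ Finset.range m, if x ∈ reach G X u d then 0 else 1 := by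
      calc (k + 1) / 2 = ∑ d ∈ Finset.range ((k + 1) / 2), 1 := by simp
        _ = ∑ d ∈ Finset.range ((k + 1) / 2), if x ∈ reach G X u d then 0 else 1 :=
          Finset.sum_congr rfl fun d hd => by
            rw [if_neg]
            intro hx
            have := h d hx
            have := Finset.mem_range.1 hd
            omega
        _ ≤ _ := Finset.sum_le_sum_of_subset (Finset.range_subset_range.2 (by omega))
    omega

end SetPrograms

/-! ### The elimination procedure as a program

Array `11` holds the set of the remaining vertices, array `12` the links, the arrays `13` to `16`
the tables `C`, `D`, `M`, `E`, array `17` the cost of the eliminated part, array `18` the numbers of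
neighbours, array `19` the set consisting of the vertex to be eliminated, and the arrays `20` to
`24` the new tables and links. In the expressions for the new entries, the variables `0` and `1` are
row and column, and the variable `2` is the vertex to be eliminated. -/

section Elimination

/-- The value of `e` when the variable `2` is the vertex selected for elimination. -/
def Ex.pick (e : Ex) : Ex := .sum 2 (.ite (.mem 2 19) e (.lit 0))

/-- The vertex `v` is present and has at most two neighbours. -/
def Ex.low (v : ℕ) : Ex := .conj (.mem v 11) (.lt (.rd 18 v v) (.lit 3))

/-- The variables `0` and `1` are different neighbours of the variable `2`. -/
def Ex.pair : Ex := .conj (.neg (.eq (.var 0) (.var 1))) (.conj (.rd 12 2 0) (.rd 12 2 1))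

/-- The variables `0` and `1` are equal and the only neighbour of the variable `2`. -/
def Ex.only : Ex := .conj (.eq (.var 0) (.var 1)) (.conj (.rd 12 2 0) (.eq (.rd 18 2 2) (.lit 1)))

/-- The new entries of the table `C`. -/
def Ex.stepC : Ex :=
  .ite .pair
    (.min
      (.add (.rd 13 0 1) (.min (.add (.rd 16 2 2) (.add (.rd 15 2 0) (.rd 15 2 1)))
        (.add (.rd 14 2 2) (.min (.add (.rd 14 2 0) (.rd 14 2 1))
          (.min (.add (.rd 13 2 0) (.rd 14 2 1)) (.add (.rd 14 2 0) (.rd 13 2 1)))))))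
      (.add (.rd 14 0 1) (.add (.rd 14 2 2) (.add (.rd 13 2 0) (.rd 13 2 1)))))
    (.rd 13 0 1)

/-- The new entries of the table `D`. -/
def Ex.stepD : Ex :=
  .ite .pair
    (.add (.rd 14 0 1) (.min (.add (.rd 16 2 2) (.add (.rd 15 2 0) (.rd 15 2 1)))
      (.add (.rd 14 2 2) (.min (.add (.rd 14 2 0) (.rd 14 2 1))
        (.min (.add (.rd 13 2 0) (.rd 14 2 1)) (.add (.rd 14 2 0) (.rd 13 2 1)))))))
    (.ite .only
      (.add (.rd 14 0 1) (.min (.add (.rd 16 2 2) (.rd 15 2 0))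
        (.add (.rd 14 2 2) (.min (.rd 13 2 0) (.rd 14 2 0)))))
      (.rd 14 0 1))

/-- The new entries of the table `M`. -/
def Ex.stepM : Ex :=
  .ite .pair
    (.add (.rd 15 0 1) (.min (.add (.rd 16 2 2) (.add (.rd 16 2 0) (.rd 15 2 1)))
      (.add (.rd 14 2 2) (.add (.rd 15 0 2) (.min (.rd 13 2 1) (.rd 14 2 1))))))
    (.rd 15 0 1)

/-- The new entries of the table `E`. -/
def Ex.stepE : Ex :=
  .ite .pair
    (.add (.rd 16 0 1) (.min (.add (.rd 16 2 2) (.add (.rd 16 2 0) (.rd 16 2 1)))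
      (.add (.rd 14 2 2) (.add (.rd 15 0 2) (.rd 15 1 2)))))
    (.ite .only
      (.add (.rd 16 0 1) (.min (.add (.rd 16 2 2) (.rd 16 2 0)) (.add (.rd 14 2 2) (.rd 15 0 2))))
      (.rd 16 0 1))

/-- The variables `0` and `1` are linked after the elimination. -/
def Ex.stepL : Ex :=
  .conj (.neg (.eq (.var 0) (.var 1))) (.disj (.rd 12 0 1) (.conj (.rd 12 0 2) (.rd 12 2 1)))

/-- Selects the first vertex with at most two neighbours. -/
def selectCmd : Cmd :=
  .seq (.set 18 (.count 2 (.conj (.mem 2 11) (.rd 12 0 2))))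
    (.set 19 (.conj (.low 0) (.neg (.exi 2 (.conj (.low 2) (.lt (.var 2) (.var 0)))))))

/-- Adds the cost of the selected vertex, if it has no neighbours, to the number in array `17`. -/
def costCmd : Cmd :=
  .set 17 (.add (.rd 17 0 0) (.pick (.ite (.rd 18 2 2) (.lit 0) (.min (.rd 14 2 2) (.rd 16 2 2)))))

/-- Updates tables and links. -/
def tablesCmd : Cmd :=
  .seq (.set 20 (.pick .stepC)) (.seq (.set 21 (.pick .stepD)) (.seq (.set 22 (.pick .stepM))
    (.seq (.set 23 (.pick .stepE)) (.seq (.set 24 (.pick .stepL)) (.seq (.set 13 (.rd 20 0 1))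
      (.seq (.set 14 (.rd 21 0 1)) (.seq (.set 15 (.rd 22 0 1)) (.seq (.set 16 (.rd 23 0 1))
        (.set 12 (.rd 24 0 1))))))))))

/-- Eliminates a vertex with at most two neighbours, if there are vertices left. -/
def elimCmd : Cmd :=
  .seq selectCmd (.seq costCmd (.seq tablesCmd (.set 11 (.conj (.mem 0 11) (.neg (.mem 0 19))))))

/-- Prepares the elimination of the set in array `11`. -/
def elimInitCmd : Cmd :=
  .seq (.set 12 (.rd 0 0 1)) (.seq (.set 13 (.ite (.rd 0 0 1) (.lit 0) (.add .size (.lit 1))))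
    (.seq (.set 14 (.ite (.rd 0 0 1) (.add .size (.lit 1)) (.lit 0))) (.seq (.set 15 (.lit 0))
      (.seq (.set 16 (.ite (.eq (.var 0) (.var 1)) (.lit 1) (.lit 0))) (.set 17 (.lit 0))))))

/-- Computes the minimum size of a set hitting all cycles in the set in array
`11`. -/
def tauCmd : Cmd := .seq elimInitCmd (.rep elimCmd)

variable {n K : ℕ} {A : ℕ → ℕ → ℕ → ℕ} {G : SimpleGraph (Fin n)} {s : Elim (Fin n)} {w : Fin n}

/-- The arrays represent the links and the tables of `s`. -/
structure TabRep (A : ℕ → ℕ → ℕ → ℕ) (s : Elim (Fin n)) : Prop where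
  adj : IsAdj (A 12) s.L
  C : ∀ a b : Fin n, A 13 a b = s.T.C a b
  D : ∀ a b : Fin n, A 14 a b = s.T.D a b
  M : ∀ a b : Fin n, A 15 a b = s.T.M a b
  E : ∀ a b : Fin n, A 16 a b = s.T.E a b

/-- The arrays represent `s`. Links and tables do not matter when all vertices are eliminated. -/
structure ElimRep (A : ℕ → ℕ → ℕ → ℕ) (s : Elim (Fin n)) : Prop where
  W : IsSet (A 11) (s.W : Set (Fin n))
  c : IsNum n (A 17) s.c
  tab : s.W.Nonempty → TabRep A s

/-- The arrays represent the links and the tables of `s`, and `w` is the selected vertex. -/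
structure Ready (A : ℕ → ℕ → ℕ → ℕ) (s : Elim (Fin n)) (w : Fin n) : Prop extends TabRep A s where
  sel : IsSet (A 19) {w}
  deg : A 18 w w = degIn s.L s.W w

lemma Ready.run (h : Ready A s w) {c : Cmd} (hc : ∀ i, 12 ≤ i → i ≤ 19 → i ≠ 17 → ¬ c.Writes i) :
    Ready (c.run n K A) s w := by
  have e : ∀ i, 12 ≤ i → i ≤ 19 → i ≠ 17 → c.run n K A i = A i := fun i h1 h2 h3 =>
    Cmd.run_eq_of_not_writes (hc i h1 h2 h3) A
  constructor
  · constructor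
    · rw [e 12 (by omega) (by omega) (by omega)]; exact h.adj
    · rw [e 13 (by omega) (by omega) (by omega)]; exact h.C
    · rw [e 14 (by omega) (by omega) (by omega)]; exact h.D
    · rw [e 15 (by omega) (by omega) (by omega)]; exact h.M
    · rw [e 16 (by omega) (by omega) (by omega)]; exact h.E
  · rw [e 19 (by omega) (by omega) (by omega)]; exact h.sel
  · rw [e 18 (by omega) (by omega) (by omega)]; exact h.deg

lemma Ex.eval_pick (h : IsSet (A 19) {w}) (e : Ex) (ρ : ℕ → ℕ) :
    (Ex.pick e).eval n K A ρ = e.eval n K A (Function.update ρ 2 w) := by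
  simp only [Ex.pick, Ex.eval]
  rw [Finset.sum_range, Finset.sum_eq_single w]
  · exact if_pos ((h w).2 rfl)
  · exact fun i _ hi => if_neg fun h' => hi ((h i).1 h')
  · exact fun h => absurd (Finset.mem_univ w) h

lemma Ex.eval_pick_of_empty (h : IsSet (n := n) (A 19) ∅) (e : Ex) (ρ : ℕ → ℕ) :
    (Ex.pick e).eval n K A ρ = 0 := by
  simp only [Ex.pick, Ex.eval]
  rw [Finset.sum_range]
  exact Finset.sum_eq_zero fun i _ => if_neg fun h' => (h i).1 h'

lemma Ready.holds_pair (h : Ready A s w) (a b : Fin n) :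
    Ex.pair.Holds n K A (Function.update (env a b) 2 w) ↔ a ≠ b ∧ s.L.Adj w a ∧ s.L.Adj w b := by
  simp only [Ex.pair, Ex.holds_conj, Ex.holds_neg, Ex.holds_eq, Ex.holds_rd, Ex.eval,
    Function.update_self, update_two_zero, update_two_one, env_apply_zero, env_apply_one,
    h.adj _ _, ne_eq, Fin.val_inj]

lemma Ready.holds_only (h : Ready A s w) (a b : Fin n) :
    Ex.only.Holds n K A (Function.update (env a b) 2 w) ↔
      a = b ∧ s.L.Adj w a ∧ degIn s.L s.W w = 1 := by
  simp only [Ex.only, Ex.holds_conj, Ex.holds_eq, Ex.holds_rd, Ex.eval,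
    Function.update_self, update_two_zero, update_two_one, env_apply_zero, env_apply_one,
    h.adj _ _, Fin.val_inj, h.deg]

open Classical in
lemma Ready.eval_step (h : Ready A s w) (a b : Fin n) :
    (Ex.pick .stepC).eval n K A (env a b) = (s.next w).T.C a b ∧
    (Ex.pick .stepD).eval n K A (env a b) = (s.next w).T.D a b ∧
    (Ex.pick .stepM).eval n K A (env a b) = (s.next w).T.M a b ∧
    (Ex.pick .stepE).eval n K A (env a b) = (s.next w).T.E a b ∧
    ((Ex.pick .stepL).eval n K A (env a b) ≠ 0 ↔ (s.next w).L.Adj a b) := by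
  simp only [Ex.eval_pick h.sel]
  refine ⟨?_, ?_, ?_, ?_, ?_⟩
  · simp only [Ex.stepC, Ex.eval_ite, h.holds_pair]
    simp only [Ex.eval, Function.update_self, update_two_zero, update_two_one, env_apply_zero,
      env_apply_one, h.C, h.D, h.M, h.E, Elim.next, Tab.step, Ex.eval_min]
  · simp only [Ex.stepD, Ex.eval_ite, h.holds_pair, h.holds_only]
    simp only [Ex.eval, Function.update_self, update_two_zero, update_two_one, env_apply_zero,
      env_apply_one, h.C, h.D, h.M, h.E, Elim.next, Tab.step, Ex.eval_min]
    split_ifs <;> rfl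
  · simp only [Ex.stepM, Ex.eval_ite, h.holds_pair]
    simp only [Ex.eval, Function.update_self, update_two_zero, update_two_one, env_apply_zero,
      env_apply_one, h.C, h.D, h.M, h.E, Elim.next, Tab.step, Ex.eval_min]
  · simp only [Ex.stepE, Ex.eval_ite, h.holds_pair, h.holds_only]
    simp only [Ex.eval, Function.update_self, update_two_zero, update_two_one, env_apply_zero,
      env_apply_one, h.D, h.M, h.E, Elim.next, Tab.step, Ex.eval_min]
    split_ifs <;> rfl
  · change Ex.Holds n K A Ex.stepL _ ↔ _
    simp only [Ex.stepL, Ex.holds_conj, Ex.holds_disj, Ex.holds_neg, Ex.holds_eq, Ex.holds_rd,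
      Ex.eval, Function.update_self, update_two_zero, update_two_one, env_apply_zero,
      env_apply_one, h.adj _ _, Fin.val_inj, Elim.next, fill_adj, ne_eq]

lemma Ready.run_tablesCmd (h : Ready A s w) : TabRep (tablesCmd.run n K A) (s.next w) := by
  set A₁ := (Cmd.set 20 (.pick .stepC)).run n K A with h₁
  set A₂ := (Cmd.set 21 (.pick .stepD)).run n K A₁ with h₂
  set A₃ := (Cmd.set 22 (.pick .stepM)).run n K A₂ with h₃
  set A₄ := (Cmd.set 23 (.pick .stepE)).run n K A₃ with h₄
  set A₅ := (Cmd.set 24 (.pick .stepL)).run n K A₄ with h₅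
  have r₁ : Ready A₁ s w := h.run fun i _ _ _ => by simp only [Cmd.Writes]; omega
  have r₂ : Ready A₂ s w := r₁.run fun i _ _ _ => by simp only [Cmd.Writes]; omega
  have r₃ : Ready A₃ s w := r₂.run fun i _ _ _ => by simp only [Cmd.Writes]; omega
  have r₄ : Ready A₄ s w := r₃.run fun i _ _ _ => by simp only [Cmd.Writes]; omega
  have e : ∀ a b : ℕ, A₅ 20 a b = (Ex.pick .stepC).eval n K A (env a b) ∧
      A₅ 21 a b = (Ex.pick .stepD).eval n K A₁ (env a b) ∧
      A₅ 22 a b = (Ex.pick .stepM).eval n K A₂ (env a b) ∧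
      A₅ 23 a b = (Ex.pick .stepE).eval n K A₃ (env a b) ∧
      A₅ 24 a b = (Ex.pick .stepL).eval n K A₄ (env a b) := fun a b => ⟨rfl, rfl, rfl, rfl, rfl⟩
  have e' : ∀ a b : ℕ, tablesCmd.run n K A 13 a b = A₅ 20 a b ∧
      tablesCmd.run n K A 14 a b = A₅ 21 a b ∧ tablesCmd.run n K A 15 a b = A₅ 22 a b ∧
      tablesCmd.run n K A 16 a b = A₅ 23 a b ∧ tablesCmd.run n K A 12 a b = A₅ 24 a b :=
    fun a b => ⟨rfl, rfl, rfl, rfl, rfl⟩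
  constructor
  · intro a b
    rw [(e' a b).2.2.2.2, (e a b).2.2.2.2]
    exact (r₄.eval_step a b).2.2.2.2
  · intro a b
    rw [(e' a b).1, (e a b).1]
    exact (h.eval_step a b).1
  · intro a b
    rw [(e' a b).2.1, (e a b).2.1]
    exact (r₁.eval_step a b).2.1
  · intro a b
    rw [(e' a b).2.2.1, (e a b).2.2.1]
    exact (r₂.eval_step a b).2.2.1
  · intro a b
    rw [(e' a b).2.2.2.1, (e a b).2.2.2.1]
    exact (r₃.eval_step a b).2.2.2.1

/-- The vertex selected is one with at most two neighbours, if there is any vertex left. -/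
lemma ElimRep.select (h : ElimRep A s) (hl : s.W.Nonempty → ∃ w ∈ s.W, degIn s.L s.W w ≤ 2) :
    (s.W = ∅ ∧ IsSet (n := n) (selectCmd.run n K A 19) ∅) ∨
      ∃ w ∈ s.W, degIn s.L s.W w ≤ 2 ∧ Ready (selectCmd.run n K A) s w := by
  set A₁ := (Cmd.set 18 (.count 2 (.conj (.mem 2 11) (.rd 12 0 2)))).run n K A with h₁
  have hW : IsSet (A₁ 11) (s.W : Set (Fin n)) := h.W
  have hrun : selectCmd.run n K A = (Cmd.set 19 (.conj (.low 0)
    (.neg (.exi 2 (.conj (.low 2) (.lt (.var 2) (.var 0))))))).run n K A₁ := rfl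
  rcases s.W.eq_empty_or_nonempty with he | hne
  · refine .inl ⟨he, ?_⟩
    rw [hrun]
    refine isSet_set fun x => ?_
    simp only [Ex.holds_conj, Ex.low, Ex.holds_mem, env_apply_zero, hW x, he, Finset.coe_empty,
      Set.mem_empty_iff_false, false_and]
  · have ht := h.tab hne
    have hdeg : ∀ x : Fin n, A₁ 18 x x = degIn s.L s.W x := fun x => by
      rw [h₁, Cmd.run_set]
      refine Ex.eval_count fun i => ?_
      simp only [Ex.holds_conj, Ex.holds_mem, Ex.holds_rd, Function.update_self, update_two_zero,
        env_apply_zero, h.W i, ht.adj x i, Set.mem_ofPred_eq]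
    have hlow0 : ∀ (x y : Fin n), (Ex.low 0).Holds n K A₁ (env x y) ↔
        x ∈ s.W ∧ degIn s.L s.W x < 3 := fun x y => by
      simp only [Ex.low, Ex.holds_conj, Ex.holds_mem, Ex.holds_lt, Ex.eval, env_apply_zero, hW x,
        hdeg x, Finset.mem_coe]
    have hlow2 : ∀ (x : Fin n) (ρ : ℕ → ℕ), (Ex.low 2).Holds n K A₁ (Function.update ρ 2 x) ↔
        x ∈ s.W ∧ degIn s.L s.W x < 3 := fun x ρ => by
      simp only [Ex.low, Ex.holds_conj, Ex.holds_mem, Ex.holds_lt, Ex.eval, Function.update_self,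
        hW x, hdeg x, Finset.mem_coe]
    classical
    obtain ⟨w₀, hw₀, hd₀⟩ := hl hne
    obtain ⟨w, hw, hmin⟩ := Finset.exists_min_image (s.W.filter fun x => degIn s.L s.W x < 3) id
      ⟨w₀, Finset.mem_filter.2 ⟨hw₀, by omega⟩⟩
    rw [Finset.mem_filter] at hw
    refine .inr ⟨w, hw.1, by omega, ?_⟩
    constructor
    · exact ⟨ht.adj, ht.C, ht.D, ht.M, ht.E⟩
    · rw [hrun]
      refine isSet_set fun x => ?_
      simp only [Ex.holds_conj, Ex.holds_neg, Ex.holds_exi, Ex.holds_lt, hlow0, hlow2, Ex.eval,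
        Function.update_self, update_two_zero, env_apply_zero, Fin.val_fin_lt, not_exists, not_and,
        Set.mem_singleton_iff]
      constructor
      · rintro ⟨hx, hx'⟩
        refine le_antisymm (not_lt.1 (hx' w ⟨hw.1, hw.2⟩)) ?_
        exact hmin x (Finset.mem_filter.2 hx)
      · rintro rfl
        exact ⟨hw, fun i hi => not_lt.2 (hmin i (Finset.mem_filter.2 hi))⟩
    · exact hdeg w

/-- One step of the elimination. -/
lemma ElimRep.run_elimCmd {B : Finset (Fin n)} {m : ℕ} (h : ElimRep A s) (hI : s.Inv G B m) :
    ∃ s' : Elim (Fin n), s'.Inv G B m ∧ ElimRep (elimCmd.run n K A) s' ∧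
      s'.W.card ≤ s.W.card - 1 := by
  set A₁ := selectCmd.run n K A with h₁
  set A₂ := costCmd.run n K A₁ with h₂
  set A₃ := tablesCmd.run n K A₂ with h₃
  set e := Ex.conj (.mem 0 11) (.neg (.mem 0 19))
  have hrun : elimCmd.run n K A = (Cmd.set 11 e).run n K A₃ := rfl
  have e11 : A₃ 11 = A 11 := by
    rw [h₃, Cmd.run_eq_of_not_writes (by simp [tablesCmd, Cmd.Writes]), h₂,
      Cmd.run_eq_of_not_writes (by simp [costCmd, Cmd.Writes]), h₁,
      Cmd.run_eq_of_not_writes (by simp [selectCmd, Cmd.Writes])]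
  have e19 : A₃ 19 = A₁ 19 := by
    rw [h₃, Cmd.run_eq_of_not_writes (by simp [tablesCmd, Cmd.Writes]), h₂,
      Cmd.run_eq_of_not_writes (by simp [costCmd, Cmd.Writes])]
  have e17 : elimCmd.run n K A 17 = A₂ 17 := by
    rw [hrun, Cmd.run_eq_of_not_writes (by simp [Cmd.Writes]), h₃,
      Cmd.run_eq_of_not_writes (by simp [tablesCmd, Cmd.Writes])]
  have e17' : A₁ 17 = A 17 := by
    rw [h₁, Cmd.run_eq_of_not_writes (by simp [selectCmd, Cmd.Writes])]
  have hsel := h.select (K := K) hI.exists_low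
  rw [← h₁] at hsel
  rcases hsel with ⟨he, hs⟩ | ⟨w, hw, hd, hr⟩
  · refine ⟨s, hI, ⟨?_, ?_, fun hne => absurd hne (by simp [he])⟩, by simp [he]⟩
    · rw [hrun]
      refine isSet_set fun x => ?_
      simp only [e, Ex.holds_conj, Ex.holds_mem, env_apply_zero, e11, h.W x, he, Finset.coe_empty,
        Set.mem_empty_iff_false, false_and]
    · intro x
      rw [e17, h₂, costCmd, Cmd.run_set]
      simp only [Ex.eval, Ex.eval_pick_of_empty hs, env_apply_zero, e17', h.c x, add_zero]
  · refine ⟨s.next w, hI.next hw hd, ⟨?_, ?_, fun _ => ?_⟩, ?_⟩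
    · rw [hrun]
      refine isSet_set fun x => ?_
      simp only [e, Ex.holds_conj, Ex.holds_neg, Ex.holds_mem, env_apply_zero, e11, e19, h.W x,
        hr.sel x, Set.mem_singleton_iff, Elim.next, Finset.coe_erase, Set.mem_sdiff]
    · intro x
      rw [e17, h₂, costCmd, Cmd.run_set]
      simp only [Ex.eval, Ex.eval_pick hr.sel, Ex.eval_min, env_apply_zero, e17', h.c x,
        Function.update_self, hr.deg, hr.D, hr.E, Elim.next]
      by_cases h0 : degIn s.L s.W w = 0 <;> simp [h0]
    · have h2 : Ready A₂ s w := hr.run fun i _ _ _ => by simp only [costCmd, Cmd.Writes]; omega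
      have h3 := h2.run_tablesCmd (K := K)
      have e12 : ∀ i, i ≠ 11 → elimCmd.run n K A i = A₃ i := fun i hi => by
        rw [hrun, Cmd.run_eq_of_not_writes (by simpa [Cmd.Writes] using hi)]
      constructor
      · rw [e12 12 (by omega)]; exact h3.adj
      · rw [e12 13 (by omega)]; exact h3.C
      · rw [e12 14 (by omega)]; exact h3.D
      · rw [e12 15 (by omega)]; exact h3.M
      · rw [e12 16 (by omega)]; exact h3.E
    · simp [Elim.next, Finset.card_erase_of_mem hw]

/-- The program computes the minimum size of a set hitting all cycles. -/
theorem isNum_tauCmd {X : Set (Fin n)} (hA : IsAdj (A 0) G) (hX : IsSet (A 11) X)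
    (hgood : Good X G) {S : Set (Fin n)} (hS : IsOpt G X S) :
    IsNum n (tauCmd.run n K A 17) S.ncard := by
  classical
  obtain ⟨B, rfl⟩ : ∃ B : Finset (Fin n), (B : Set (Fin n)) = X := ⟨X.toFinset, by simp⟩
  have h0 : ElimRep (elimInitCmd.run n K A) (Elim.init G B n) := by
    refine ⟨hX, fun a => rfl, fun _ => ⟨?_, fun a b => ?_, fun a b => ?_, fun a b => rfl,
      fun a b => ?_⟩⟩
    · exact hA
    · change (Ex.ite (.rd 0 0 1) (.lit 0) (.add .size (.lit 1))).eval n K A (env a b) = _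
      simp only [Ex.eval, env_apply_zero, env_apply_one, hA a b, Elim.init]
    · change (Ex.ite (.rd 0 0 1) (.add .size (.lit 1)) (.lit 0)).eval n K A (env a b) = _
      simp only [Ex.eval, env_apply_zero, env_apply_one, hA a b, Elim.init]
    · change (Ex.ite (.eq (.var 0) (.var 1)) (.lit 1) (.lit 0)).eval n K _ (env a b) = _
      rw [Ex.eval_ite]
      simp only [Ex.holds_eq, Ex.eval, env_apply_zero, env_apply_one, Fin.val_inj, Elim.init]
  have key : ∀ m : ℕ, ∃ s' : Elim (Fin n), s'.Inv G B n ∧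
      ElimRep ((elimCmd.run n K)^[m] (elimInitCmd.run n K A)) s' ∧ s'.W.card ≤ B.card - m := by
    intro m
    induction m with
    | zero => exact ⟨_, Elim.Inv.init hgood, h0, by simp [Elim.init]⟩
    | succ m ih =>
      obtain ⟨s, hI, hR, hc⟩ := ih
      obtain ⟨s', hI', hR', hc'⟩ := hR.run_elimCmd (K := K) hI
      rw [Function.iterate_succ_apply']
      exact ⟨s', hI', hR', by omega⟩
  obtain ⟨s', hI, hR, hc⟩ := key n
  have hBn : B.card ≤ n := by simpa using B.card_le_univ
  have hW : s'.W = ∅ := Finset.card_eq_zero.1 (by omega)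
  rw [hI.final hW hBn hS]
  exact hR.c

end Elimination

/-! ### The test as a program

Array `1` holds the set `A` of the remaining vertices, the arrays `3` and `4` hold the current pair
`u`, `v`, array `5` the vertices of degree two, the arrays `6` to `8` the cores for `u` and `v`, for
`u`, and for `v`, array `10` the distances from `u`, the arrays `25` and `17` the smallest sizes of
transversals before and after the deletion of `u`, and array `26` the result. -/

section Test

/-- The vertex `v` is the number stored in the array `j`. -/
def Ex.is (v j : ℕ) : Ex := .eq (.var v) (.rd j v v)

/-- Computes the vertices of degree two and the cores of this set together with `u` and `v`. -/
def attachCmd : Cmd :=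
  .seq (.set 5 (.conj (.mem 0 1) (.eq (.deg 1) (.lit 2))))
    (.seq (.seq (.set 6 (.disj (.mem 0 5) (.disj (.is 0 3) (.is 0 4)))) (coreCmd 6))
      (.seq (.seq (.set 7 (.disj (.mem 0 5) (.is 0 3))) (coreCmd 7))
        (.seq (.set 8 (.disj (.mem 0 5) (.is 0 4))) (coreCmd 8))))

/-- Computes the distances from `u`. -/
def distCmd : Cmd := .seq (.set 9 (.is 0 3)) (.seq (.set 10 (.lit 0)) (.rep reachStep))

/-- Computes the smallest sizes of sets hitting all cycles, before and after the deletion of `u`. -/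
def dropCmd : Cmd :=
  .seq (.set 11 (.mem 0 1)) (.seq tauCmd (.seq (.set 25 (.rd 17 0 0))
    (.seq (.set 11 (.conj (.mem 0 1) (.neg (.is 0 3)))) tauCmd)))

/-- The result of the test, given the preceding computations, when the variables `2` and `3` are `u`
and `v`. -/
def Ex.test : Ex :=
  .conj (.mem 2 1) (.conj (.mem 3 1) (.conj
    (.disj (.conj (.eq (.var 2) (.var 3)) (.mem 2 7))
      (.conj (.neg (.eq (.var 2) (.var 3))) (.conj (.neg (.mem 2 5)) (.conj (.neg (.mem 3 5))
        (.conj (.mem 2 6) (.conj (.neg (.mem 2 7)) (.conj (.neg (.mem 3 8))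
          (.disj (.rd 0 2 3) (.neg (.lt (.add (.rd 10 3 3) (.rd 10 3 3)) .par))))))))))
    (.lt (.rd 17 2 2) (.rd 25 2 2))))

/-- Tests whether `u` may be put into a value of the recursion, as an attachment vertex of a pendant
cycle with attachment vertices `u` and `v`. -/
def testCmd : Cmd :=
  .seq attachCmd (.seq distCmd (.seq dropCmd
    (.set 26 (.exi 2 (.exi 3 (.conj (.is 2 3) (.conj (.is 3 4) .test)))))))

variable {n k : ℕ} {A : ℕ → ℕ → ℕ → ℕ} {G : SimpleGraph (Fin n)} {X : Set (Fin n)} {u v : Fin n}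

lemma Ex.holds_is {j i : ℕ} {ρ : ℕ → ℕ} {x : Fin n} (h : IsNum n (A j) u) (hx : ρ i = x) :
    (Ex.is i j).Holds n k A ρ ↔ x = u := by
  simp only [Ex.is, Ex.holds_eq, Ex.eval, hx, h x, Fin.val_inj]

lemma isSet_seq_coreCmd {j : ℕ} {e : Ex} {Y : Set (Fin n)} (hj : j ≠ 0) (hA : IsAdj (A 0) G)
    (h : ∀ x : Fin n, e.Holds n k A (env x x) ↔ x ∈ Y) :
    IsSet ((Cmd.seq (.set j e) (coreCmd j)).run n k A j) (core G Y) := by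
  rw [Cmd.run_seq]
  refine isSet_coreCmd hj ?_ (isSet_set h)
  rwa [Cmd.run_eq_of_not_writes (by simpa [Cmd.Writes] using hj.symm)]

lemma run_attachCmd (hA : IsAdj (A 0) G) (hX : IsSet (A 1) X) (hu : IsNum n (A 3) u)
    (hv : IsNum n (A 4) v) :
    IsSet (attachCmd.run n k A 5) (degTwo G X) ∧
      IsSet (attachCmd.run n k A 6) (core G (degTwo G X ∪ {u, v})) ∧
      IsSet (attachCmd.run n k A 7) (core G (degTwo G X ∪ {u})) ∧
      IsSet (attachCmd.run n k A 8) (core G (degTwo G X ∪ {v})) := by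
  set A₁ := (Cmd.set 5 (.conj (.mem 0 1) (.eq (.deg 1) (.lit 2)))).run n k A with h₁
  set A₂ := (Cmd.seq (.set 6 (.disj (.mem 0 5) (.disj (.is 0 3) (.is 0 4)))) (coreCmd 6)).run n k A₁
    with h₂
  set A₃ := (Cmd.seq (.set 7 (.disj (.mem 0 5) (.is 0 3))) (coreCmd 7)).run n k A₂ with h₃
  set A₄ := (Cmd.seq (.set 8 (.disj (.mem 0 5) (.is 0 4))) (coreCmd 8)).run n k A₃ with h₄
  have hrun : attachCmd.run n k A = A₄ := rfl
  have e₁ : ∀ i, i ≠ 5 → A₁ i = A i := fun i hi =>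
    Cmd.run_eq_of_not_writes (by simpa [Cmd.Writes] using hi) A
  have e₂ : ∀ i, i ≠ 6 → A₂ i = A₁ i := fun i hi =>
    Cmd.run_eq_of_not_writes (by simpa [Cmd.Writes, coreCmd] using hi) A₁
  have e₃ : ∀ i, i ≠ 7 → A₃ i = A₂ i := fun i hi =>
    Cmd.run_eq_of_not_writes (by simpa [Cmd.Writes, coreCmd] using hi) A₂
  have e₄ : ∀ i, i ≠ 8 → A₄ i = A₃ i := fun i hi =>
    Cmd.run_eq_of_not_writes (by simpa [Cmd.Writes, coreCmd] using hi) A₃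
  have f₁ : ∀ i ≤ 4, A₁ i = A i := fun i hi => e₁ i (by omega)
  have f₂ : ∀ i ≤ 4, A₂ i = A i := fun i hi => (e₂ i (by omega)).trans (f₁ i hi)
  have f₃ : ∀ i ≤ 4, A₃ i = A i := fun i hi => (e₃ i (by omega)).trans (f₂ i hi)
  have h5 : IsSet (A₁ 5) (degTwo G X) := isSet_set fun x => by
    simp only [Ex.holds_conj, Ex.holds_eq, Ex.holds_mem, Ex.eval_deg hA hX, Ex.eval,
      env_apply_zero, hX x]
    rfl
  have h52 : IsSet (A₂ 5) (degTwo G X) := by rwa [e₂ 5 (by omega)]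
  have h53 : IsSet (A₃ 5) (degTwo G X) := by rwa [e₃ 5 (by omega)]
  rw [hrun]
  refine ⟨?_, ?_, ?_, ?_⟩
  · rwa [e₄ 5 (by omega)]
  · rw [e₄ 6 (by omega), e₃ 6 (by omega)]
    refine isSet_seq_coreCmd (by omega) (by rwa [f₁ 0 (by omega)]) fun x => ?_
    rw [Ex.holds_disj, Ex.holds_disj, Ex.holds_mem,
      Ex.holds_is (x := x) (u := u) (by rwa [f₁ 3 (by omega)]) rfl,
      Ex.holds_is (x := x) (u := v) (by rwa [f₁ 4 (by omega)]) rfl, env_apply_zero, h5 x]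
    rfl
  · rw [e₄ 7 (by omega)]
    refine isSet_seq_coreCmd (by omega) (by rwa [f₂ 0 (by omega)]) fun x => ?_
    rw [Ex.holds_disj, Ex.holds_mem,
      Ex.holds_is (x := x) (u := u) (by rwa [f₂ 3 (by omega)]) rfl, env_apply_zero, h52 x]
    rfl
  · refine isSet_seq_coreCmd (by omega) (by rwa [f₃ 0 (by omega)]) fun x => ?_
    rw [Ex.holds_disj, Ex.holds_mem,
      Ex.holds_is (x := x) (u := v) (by rwa [f₃ 4 (by omega)]) rfl, env_apply_zero, h53 x]
    rfl

open Classical in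
lemma run_distCmd (hA : IsAdj (A 0) G) (hX : IsSet (A 1) X) (hu : IsNum n (A 3) u) (x : Fin n) :
    distCmd.run n k A 10 x x = ∑ d ∈ Finset.range n, if x ∈ reach G X u d then 0 else 1 := by
  set A₁ := (Cmd.set 9 (.is 0 3)).run n k A with h₁
  set A₂ := (Cmd.set 10 (.lit 0)).run n k A₁ with h₂
  have hrun : distCmd.run n k A = (reachStep.run n k)^[n] A₂ := rfl
  have e : ∀ i, i ≠ 10 → A₂ i = A₁ i := fun i hi =>
    Cmd.run_eq_of_not_writes (by simpa [Cmd.Writes] using hi) A₁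
  have e' : ∀ i, i ≠ 9 → A₁ i = A i := fun i hi =>
    Cmd.run_eq_of_not_writes (by simpa [Cmd.Writes] using hi) A
  rw [hrun]
  refine (iterate_reachStep (X := X) ?_ ?_ ?_ ?_ n).2 x
  · rwa [e 0 (by omega), e' 0 (by omega)]
  · rwa [e 1 (by omega), e' 1 (by omega)]
  · rw [e 9 (by omega)]
    exact isSet_set fun x => Ex.holds_is hu rfl
  · intro x
    rw [h₂, Cmd.run_set]
    rfl

lemma run_dropCmd (hk : 5 ≤ k) (hG : IsSC k G) (hA : IsAdj (A 0) G) (hX : IsSet (A 1) X)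
    (hu : IsNum n (A 3) u) (x : Fin n) :
    dropCmd.run n k A 17 x x < dropCmd.run n k A 25 x x ↔ Drops G X u := by
  set A₁ := (Cmd.set 11 (.mem 0 1)).run n k A with h₁
  set A₂ := tauCmd.run n k A₁ with h₂
  set A₃ := (Cmd.set 25 (.rd 17 0 0)).run n k A₂ with h₃
  set A₄ := (Cmd.set 11 (.conj (.mem 0 1) (.neg (.is 0 3)))).run n k A₃ with h₄
  have hrun : dropCmd.run n k A = tauCmd.run n k A₄ := rfl
  have w : ∀ i ≤ 25, i ≤ 10 ∨ i = 25 → ¬ tauCmd.Writes i := fun i h h' => by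
    simp only [tauCmd, elimInitCmd, elimCmd, selectCmd, costCmd, tablesCmd, Cmd.Writes]
    omega
  have e₃ : ∀ i ≤ 10, A₃ i = A i := fun i hi => by
    rw [h₃, Cmd.run_eq_of_not_writes (by simp only [Cmd.Writes]; omega), h₂,
      Cmd.run_eq_of_not_writes (w i (by omega) (by omega)), h₁,
      Cmd.run_eq_of_not_writes (by simp only [Cmd.Writes]; omega)]
  obtain ⟨S, hS⟩ := exists_cycleHitRec hk hG (X \ {u})
  obtain ⟨T, hT⟩ := exists_cycleHitRec hk hG X
  have hSo := hS.isOpt (by omega)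
  have hTo := hT.isOpt (by omega)
  have hT' : IsNum n (A₂ 17) T.ncard := by
    refine isNum_tauCmd (X := X) ?_ (isSet_set fun x => ?_) (good_of_isSC hk hG X) hTo
    · rwa [Cmd.run_eq_of_not_writes (by simp [Cmd.Writes])]
    · rw [Ex.holds_mem, env_apply_zero, hX x]
  have hS' : IsNum n (tauCmd.run n k A₄ 17) S.ncard := by
    refine isNum_tauCmd (X := X \ {u}) ?_ (isSet_set fun x => ?_) (good_of_isSC hk hG _) hSo
    · rwa [Cmd.run_eq_of_not_writes (by simp [Cmd.Writes]), e₃ 0 (by omega)]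
    · rw [Ex.holds_conj, Ex.holds_neg, Ex.holds_mem,
        Ex.holds_is (x := x) (u := u) (by rwa [e₃ 3 (by omega)]) rfl, env_apply_zero,
        e₃ 1 (by omega), hX x]
      rfl
  have h25 : tauCmd.run n k A₄ 25 x x = T.ncard := by
    rw [Cmd.run_eq_of_not_writes (w 25 (by omega) (by omega)), h₄,
      Cmd.run_eq_of_not_writes (by simp [Cmd.Writes]), h₃, Cmd.run_set]
    exact hT' x
  rw [hrun, hS' x, h25]
  exact ⟨fun h S' T' hS₁ hT₁ => (hS₁.2 _ hSo.1).trans_lt (h.trans_le (hTo.2 _ hT₁.1)),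
    fun h => h S T hSo hTo⟩

theorem run_testCmd (hk : 5 ≤ k) (hG : IsSC k G) (hA : IsAdj (A 0) G) (hX : IsSet (A 1) X)
    (hM : MinDegTwo G X) (hu : IsNum n (A 3) u) (hv : IsNum n (A 4) v) (x : Fin n) :
    testCmd.run n k A 26 x x ≠ 0 ↔ u ∈ X ∧ v ∈ X ∧ Attached k G X u v ∧ Drops G X u := by
  set A₁ := attachCmd.run n k A with h₁
  set A₂ := distCmd.run n k A₁ with h₂
  set A₃ := dropCmd.run n k A₂ with h₃
  have hrun : testCmd.run n k A =
    (Cmd.set 26 (.exi 2 (.exi 3 (.conj (.is 2 3) (.conj (.is 3 4) .test))))).run n k A₃ := rfl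
  have e₁ : ∀ i ≤ 4, A₁ i = A i := fun i hi =>
    Cmd.run_eq_of_not_writes (by simp only [attachCmd, coreCmd, Cmd.Writes]; omega) A
  have e₂ : ∀ i ≤ 8, A₂ i = A₁ i := fun i hi =>
    Cmd.run_eq_of_not_writes (by simp only [distCmd, reachStep, Cmd.Writes]; omega) A₁
  have e₃ : ∀ i ≤ 10, A₃ i = A₂ i := fun i hi =>
    Cmd.run_eq_of_not_writes (by
      simp only [dropCmd, tauCmd, elimInitCmd, elimCmd, selectCmd, costCmd, tablesCmd, Cmd.Writes]
      omega) A₂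
  have f₂ : ∀ i ≤ 4, A₂ i = A i := fun i hi => (e₂ i (by omega)).trans (e₁ i hi)
  have f₃ : ∀ i ≤ 4, A₃ i = A i := fun i hi => (e₃ i (by omega)).trans (f₂ i hi)
  have g₃ : ∀ i ≤ 8, A₃ i = A₁ i := fun i hi => (e₃ i (by omega)).trans (e₂ i hi)
  obtain ⟨h5, h6, h7, h8⟩ := run_attachCmd (k := k) hA hX hu hv
  rw [← h₁, ← g₃ _ (by omega)] at h5 h6 h7 h8
  rw [hrun, Cmd.run_set]
  change Ex.Holds n k A₃ _ _ ↔ _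
  have hu3 : IsNum n (A₃ 3) u := by rwa [f₃ 3 (by omega)]
  have hv3 : IsNum n (A₃ 4) v := by rwa [f₃ 4 (by omega)]
  have hA3 : IsAdj (A₃ 0) G := by rwa [f₃ 0 (by omega)]
  have hX3 : IsSet (A₃ 1) X := by rwa [f₃ 1 (by omega)]
  have hd : A₃ 17 u u < A₃ 25 u u ↔ Drops G X u :=
    run_dropCmd hk hG (by rwa [f₂ 0 (by omega)]) (by rwa [f₂ 1 (by omega)])
      (by rwa [f₂ 3 (by omega)]) u
  -- If `u` is a vertex of `X`, there is a cycle, and so `k` is at most the number of steps.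
  have hdist : u ∈ X → (¬ A₃ 10 v v + A₃ 10 v v < k ↔ ∀ d, v ∈ reach G X u d → k ≤ 2 * d) := by
    classical
    intro huX
    obtain ⟨-, f, hf, -⟩ := exists_cyc_of_minDegTwo hG hM ⟨u, huX⟩
    have hkn : k ≤ n := by
      rw [← cyc_ncard hf]
      exact (Set.ncard_le_card _).trans (by simp)
    rw [← le_two_mul_sum_iff hkn, e₃ 10 (by omega), h₂, run_distCmd (X := X) (u := u)
      (by rwa [e₁ 0 (by omega)]) (by rwa [e₁ 1 (by omega)]) (by rwa [e₁ 3 (by omega)])]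
    omega
  have his2 : ∀ i j : Fin n, (Ex.is 2 3).Holds n k A₃
      (Function.update (Function.update (env x x) 2 i) 3 j) ↔ i = u := fun i j =>
    Ex.holds_is hu3 rfl
  have his3 : ∀ i j : Fin n, (Ex.is 3 4).Holds n k A₃
      (Function.update (Function.update (env x x) 2 i) 3 j) ↔ j = v := fun i j =>
    Ex.holds_is hv3 rfl
  simp only [Ex.holds_exi, Ex.holds_conj, his2, his3, exists_and_left, exists_eq_left]
  simp only [Ex.test, Ex.holds_conj, Ex.holds_disj, Ex.holds_neg, Ex.holds_mem, Ex.holds_lt,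
    Ex.holds_eq, Ex.holds_rd, Ex.eval, Function.update_self, update_three_two, Fin.val_inj, hX3 _,
    h5 _, h6 _, h7 _, h8 _, hA3 _ _, hd]
  refine and_congr_right fun huX => ?_
  rw [hdist huX]
  rfl

end Test

/-! ### The algorithm -/

section Algorithm

/-- The number in the array `j`, increased by one modulo the number of vertices. -/
def Ex.next (j : ℕ) : Ex :=
  .ite (.lt (.add (.rd j 0 0) (.lit 1)) .size) (.add (.rd j 0 0) (.lit 1)) (.lit 0)

/-- If the current pair of vertices passes the test, its first vertex is moved from the set in array
`1` to the set in array `2`, and the former set is reduced to its core. Then the second vertex is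
advanced. -/
def pairCmd : Cmd :=
  .seq testCmd (.seq (.set 2 (.disj (.mem 0 2) (.conj (.mem 0 26) (.is 0 3))))
    (.seq (.seq (.set 1 (.conj (.mem 0 1) (.neg (.conj (.mem 0 26) (.is 0 3))))) (coreCmd 1))
      (.set 4 (.next 4))))

/-- Runs through all pairs with a given first vertex, which is then advanced. -/
def rowCmd : Cmd := .seq (.rep pairCmd) (.set 3 (.next 3))

/-- Computes a value of the recursion in array `2`: all pairs are run through as many times as there
are vertices. -/
def hitCmd : Cmd := .seq (.seq (.set 1 (.lit 1)) (coreCmd 1)) (.rep (.rep rowCmd))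

/-- A relation preserved by every step of an iteration that shrinks a set, and is active in every
step in which a condition holds, is preserved by the iteration; if the set does not shrink at all,
the condition has never held. -/
lemma exists_subset_iterate {V σ : Type*} {f : σ → σ} {I : ℕ → Set V → σ → Prop}
    {P : ℕ → Set V → Prop} {n : ℕ}
    (h : ∀ i < n, ∀ X s, I i X s → ∃ Y ⊆ X, I (i + 1) Y (f s) ∧ (Y = X → ¬ P i X)) {X : Set V}
    {s : σ} (h0 : I 0 X s) (i : ℕ) (hi : i ≤ n) :
    ∃ Y ⊆ X, I i Y (f^[i] s) ∧ (Y = X → ∀ j < i, ¬ P j X) := by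
  induction i with
  | zero => exact ⟨X, subset_rfl, h0, fun _ j hj => by omega⟩
  | succ i ih =>
    obtain ⟨Y, hYX, hY, hP⟩ := ih (by omega)
    obtain ⟨Z, hZY, hZ, hQ⟩ := h i (by omega) Y _ hY
    rw [Function.iterate_succ_apply']
    refine ⟨Z, hZY.trans hYX, hZ, fun hZX j hj => ?_⟩
    have hYX' : Y = X := hYX.antisymm (hZX ▸ hZY)
    rcases Nat.lt_succ_iff_lt_or_eq.1 hj with hj | rfl
    · exact hP hYX' j hj
    · rw [← hYX']
      exact hQ (hZX.trans hYX'.symm)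

variable {n k : ℕ} {A : ℕ → ℕ → ℕ → ℕ} {G : SimpleGraph (Fin n)} {X : Set (Fin n)}

/-- Array `1` holds the rest `X` of the graph, and every value of the recursion on `X` is completed
by the set in array `2` to a value of the recursion on the whole graph. -/
structure HitInv (k : ℕ) (G : SimpleGraph (Fin n)) (A : ℕ → ℕ → ℕ → ℕ) (X : Set (Fin n)) :
    Prop where
  adj : IsAdj (A 0) G
  set : IsSet (A 1) X
  minDegTwo : MinDegTwo G X
  value : ∃ S, IsSet (A 2) S ∧ ∀ T, CycleHitRec k G X T → CycleHitRec k G Set.univ (S ∪ T)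

/-- The test for the pair `u`, `v`. -/
def Passes (k : ℕ) (G : SimpleGraph (Fin n)) (X : Set (Fin n)) (u v : Fin n) : Prop :=
  u ∈ X ∧ v ∈ X ∧ Attached k G X u v ∧ Drops G X u

lemma isNum_next {j i : ℕ} (h : IsNum n (A j) i) :
    IsNum n ((Cmd.set j (.next j)).run n k A j) (if i + 1 < n then i + 1 else 0) := fun x => by
  classical
  rw [Cmd.run_set, Ex.next, Ex.eval_ite]
  simp only [Ex.holds_lt, Ex.eval, env_apply_zero, h x]

lemma HitInv.run_pairCmd (hk : 5 ≤ k) (hG : IsSC k G) (h : HitInv k G A X) {u v : Fin n}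
    (hu : IsNum n (A 3) u) (hv : IsNum n (A 4) v) :
    ∃ Y ⊆ X, (HitInv k G (pairCmd.run n k A) Y ∧ IsNum n (pairCmd.run n k A 3) u ∧
      IsNum n (pairCmd.run n k A 4) (if v.val + 1 < n then v.val + 1 else 0)) ∧
      (Y = X → ¬ Passes k G X u v) := by
  have htest := run_testCmd hk hG h.adj h.set h.minDegTwo hu hv
  set A₁ := testCmd.run n k A with h₁
  set e₂ := Ex.disj (.mem 0 2) (.conj (.mem 0 26) (.is 0 3)) with he₂
  set e₃ := Ex.conj (.mem 0 1) (.neg (.conj (.mem 0 26) (.is 0 3))) with he₃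
  set A₂ := (Cmd.set 2 e₂).run n k A₁ with h₂
  set A₃ := (Cmd.seq (.set 1 e₃) (coreCmd 1)).run n k A₂ with h₃
  have hrun : pairCmd.run n k A = (Cmd.set 4 (.next 4)).run n k A₃ := rfl
  have f₁ : ∀ i ≤ 4, A₁ i = A i := fun i hi =>
    Cmd.run_eq_of_not_writes (by
      simp only [testCmd, attachCmd, coreCmd, distCmd, reachStep, dropCmd, tauCmd, elimInitCmd,
        elimCmd, selectCmd, costCmd, tablesCmd, Cmd.Writes]
      omega) A
  have f₂ : ∀ i, i ≠ 2 → A₂ i = A₁ i := fun i hi =>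
    Cmd.run_eq_of_not_writes (by simpa [Cmd.Writes] using hi) A₁
  have f₃ : ∀ i, i ≠ 1 → A₃ i = A₂ i := fun i hi =>
    Cmd.run_eq_of_not_writes (by simpa [Cmd.Writes, coreCmd] using hi) A₂
  have f₄ : ∀ i, i ≠ 4 → pairCmd.run n k A i = A₃ i := fun i hi => by
    rw [hrun, Cmd.run_eq_of_not_writes (by simpa [Cmd.Writes] using hi)]
  obtain ⟨S, hS, hval⟩ := h.value
  have his : ∀ x : Fin n, ∀ B : ℕ → ℕ → ℕ → ℕ, B 3 = A 3 →
      ((Ex.is 0 3).Holds n k B (env x x) ↔ x = u) := fun x B hB =>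
    Ex.holds_is (by rwa [hB]) rfl
  have h3 : IsNum n (pairCmd.run n k A 3) u := by
    rwa [f₄ 3 (by omega), f₃ 3 (by omega), f₂ 3 (by omega), f₁ 3 (by omega)]
  have h4 : IsNum n (pairCmd.run n k A 4) (if v.val + 1 < n then v.val + 1 else 0) := by
    rw [hrun]
    refine isNum_next ?_
    rwa [f₃ 4 (by omega), f₂ 4 (by omega), f₁ 4 (by omega)]
  have hadj2 : IsAdj (A₂ 0) G := by
    rw [f₂ 0 (by omega), f₁ 0 (by omega)]
    exact h.adj
  have hadj : IsAdj (pairCmd.run n k A 0) G := by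
    rwa [f₄ 0 (by omega), f₃ 0 (by omega)]
  have hholds₂ : ∀ x : Fin n, e₂.Holds n k A₁ (env x x) ↔ x ∈ S ∨ (Passes k G X u v ∧ x = u) :=
    fun x => by
      rw [he₂, Ex.holds_disj, Ex.holds_conj, Ex.holds_mem, Ex.holds_mem, his x A₁ (f₁ 3 (by omega)),
        env_apply_zero, f₁ 2 (by omega), hS x, htest x]
      rfl
  have hholds₃ : ∀ x : Fin n, e₃.Holds n k A₂ (env x x) ↔ x ∈ X ∧ ¬ (Passes k G X u v ∧ x = u) :=
    fun x => by
      rw [he₃, Ex.holds_conj, Ex.holds_neg, Ex.holds_conj, Ex.holds_mem, Ex.holds_mem,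
        his x A₂ ((f₂ 3 (by omega)).trans (f₁ 3 (by omega))), env_apply_zero, f₂ 1 (by omega),
        f₂ 26 (by omega), f₁ 1 (by omega), h.set x, htest x]
      rfl
  by_cases hp : Passes k G X u v
  · refine ⟨core G (X \ {u}), (core_subset _).trans Set.sdiff_subset, ⟨⟨hadj, ?_, minDegTwo_core _,
      {u} ∪ S, ?_, fun T hT => ?_⟩, h3, h4⟩, fun he _ => ?_⟩
    · rw [f₄ 1 (by omega)]
      refine isSet_seq_coreCmd (by omega) hadj2 fun x => ?_
      rw [hholds₃ x, and_iff_right hp]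
      rfl
    · rw [f₄ 2 (by omega), f₃ 2 (by omega)]
      refine isSet_set fun x => ?_
      rw [hholds₂ x, and_iff_right hp, or_comm]
      rfl
    · rw [Set.union_comm {u} S, Set.union_assoc]
      exact hval _ (hT.of_attached hk hG h.minDegTwo hp.1 hp.2.1 hp.2.2.1 hp.2.2.2)
    · exact (core_subset _ (he.symm ▸ hp.1 : u ∈ core G (X \ {u}))).2 rfl
  · refine ⟨X, subset_rfl, ⟨⟨hadj, ?_, h.minDegTwo, S, ?_, hval⟩, h3, h4⟩, fun _ => hp⟩
    · rw [f₄ 1 (by omega), ← h.minDegTwo.core_eq]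
      refine isSet_seq_coreCmd (by omega) hadj2 fun x => ?_
      rw [hholds₃ x]
      simp [hp]
    · rw [f₄ 2 (by omega), f₃ 2 (by omega)]
      refine isSet_set fun x => ?_
      rw [hholds₂ x]
      simp [hp]

lemma HitInv.run_rowCmd (hk : 5 ≤ k) (hG : IsSC k G) (h : HitInv k G A X) {u : Fin n}
    (hu : IsNum n (A 3) u) (hv : IsNum n (A 4) 0) :
    ∃ Y ⊆ X, (HitInv k G (rowCmd.run n k A) Y ∧
      IsNum n (rowCmd.run n k A 3) (if u.val + 1 < n then u.val + 1 else 0) ∧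
      IsNum n (rowCmd.run n k A 4) 0) ∧ (Y = X → ∀ v, ¬ Passes k G X u v) := by
  obtain ⟨Y, hYX, ⟨h1, h2, h3⟩, hP⟩ := exists_subset_iterate (f := pairCmd.run n k) (X := X)
      (s := A)
    (I := fun i X A => HitInv k G A X ∧ IsNum n (A 3) u ∧ IsNum n (A 4) (if i < n then i else 0))
    (P := fun j X => ∃ hj : j < n, Passes k G X u ⟨j, hj⟩) (n := n) (by
      rintro i hi X A ⟨h, hu, hv⟩
      rw [if_pos hi] at hv
      obtain ⟨Y, hYX, hY, hP⟩ := h.run_pairCmd hk hG hu (v := ⟨i, hi⟩) hv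
      exact ⟨Y, hYX, hY, fun he ⟨_, h'⟩ => hP he h'⟩) ⟨h, hu, by simpa using hv⟩ n le_rfl
  have hrun : rowCmd.run n k A = (Cmd.set 3 (.next 3)).run n k ((pairCmd.run n k)^[n] A) := rfl
  have f : ∀ i, i ≠ 3 → rowCmd.run n k A i = (pairCmd.run n k)^[n] A i := fun i hi => by
    rw [hrun, Cmd.run_eq_of_not_writes (by simpa [Cmd.Writes] using hi)]
  refine ⟨Y, hYX, ⟨⟨?_, ?_, h1.minDegTwo, ?_⟩, ?_, ?_⟩, fun he v hv => hP he v v.2 ⟨v.2, hv⟩⟩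
  · rw [f 0 (by omega)]; exact h1.adj
  · rw [f 1 (by omega)]; exact h1.set
  · rw [f 2 (by omega)]; exact h1.value
  · rw [hrun]; exact isNum_next h2
  · rw [f 4 (by omega)]; simpa using h3

/-- Running through all pairs of vertices shrinks the rest of the graph, unless it is empty. -/
lemma HitInv.run_round (hk : 5 ≤ k) (hG : IsSC k G) (h : HitInv k G A X)
    (hu : IsNum n (A 3) 0) (hv : IsNum n (A 4) 0) :
    ∃ Y, (HitInv k G ((Cmd.rep rowCmd).run n k A) Y ∧ IsNum n ((Cmd.rep rowCmd).run n k A 3) 0 ∧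
      IsNum n ((Cmd.rep rowCmd).run n k A 4) 0) ∧ Y.ncard ≤ X.ncard - 1 := by
  obtain ⟨Y, hYX, ⟨h1, h2, h3⟩, hP⟩ := exists_subset_iterate (f := rowCmd.run n k) (X := X) (s := A)
    (I := fun i X A => HitInv k G A X ∧ IsNum n (A 3) (if i < n then i else 0) ∧ IsNum n (A 4) 0)
    (P := fun j X => ∃ hj : j < n, ∃ v, Passes k G X ⟨j, hj⟩ v) (n := n) (by
      rintro i hi X A ⟨h, hu, hv⟩
      rw [if_pos hi] at hu
      obtain ⟨Y, hYX, hY, hP⟩ := h.run_rowCmd hk hG (u := ⟨i, hi⟩) hu hv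
      exact ⟨Y, hYX, hY, fun he ⟨_, v, h'⟩ => hP he v h'⟩) ⟨h, by simpa using hu, hv⟩ n le_rfl
  rw [if_neg (lt_irrefl n)] at h2
  refine ⟨Y, ⟨h1, h2, h3⟩, ?_⟩
  by_cases he : Y = X
  · have hX : X = ∅ := by
      by_contra hne
      obtain ⟨u, hu, v, hv, ha, hd⟩ :=
        exists_attached hk hG h.minDegTwo (Set.nonempty_iff_ne_empty.2 hne)
      exact hP he u u.2 ⟨u.2, v, hu, hv, ha, hd⟩
    simp [he, hX]
  · have := Set.ncard_lt_ncard (hYX.ssubset_of_ne he) (Set.toFinite X)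
    omega

/-- The program computes a value of the recursion. -/
theorem exists_isSet_hitCmd (hk : 5 ≤ k) (hG : IsSC k G) (hA : IsAdj (A 0) G)
    (h0 : ∀ i, i ≠ 0 → ∀ a b, A i a b = 0) :
    ∃ S, IsSet (hitCmd.run n k A 2) S ∧ CycleHitRec k G Set.univ S := by
  set A₁ := (Cmd.seq (.set 1 (.lit 1)) (coreCmd 1)).run n k A with h₁
  have hrun : hitCmd.run n k A = ((Cmd.rep rowCmd).run n k)^[n] A₁ := rfl
  have f : ∀ i, i ≠ 1 → A₁ i = A i := fun i hi =>
    Cmd.run_eq_of_not_writes (by simpa [Cmd.Writes, coreCmd] using hi) A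
  have hinit : HitInv k G A₁ (core G Set.univ) := by
    refine ⟨by rwa [f 0 (by omega)], ?_, minDegTwo_core _, ∅, fun x => ?_, fun T hT => ?_⟩
    · exact isSet_seq_coreCmd (by omega) hA fun x => by simp [Ex.Holds, Ex.eval]
    · simp [f 2 (by omega), h0 2 (by omega)]
    · rw [Set.empty_union]
      exact hT.of_core hk hG
  have key : ∀ m : ℕ, ∃ Y, (HitInv k G (((Cmd.rep rowCmd).run n k)^[m] A₁) Y ∧
      IsNum n (((Cmd.rep rowCmd).run n k)^[m] A₁ 3) 0 ∧
      IsNum n (((Cmd.rep rowCmd).run n k)^[m] A₁ 4) 0) ∧ Y.ncard ≤ n - m := by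
    intro m
    induction m with
    | zero =>
      refine ⟨_, ⟨hinit, fun x => ?_, fun x => ?_⟩, (Set.ncard_le_card _).trans (by simp)⟩
      · rw [Function.iterate_zero_apply, f 3 (by omega), h0 3 (by omega)]
      · rw [Function.iterate_zero_apply, f 4 (by omega), h0 4 (by omega)]
    | succ m ih =>
      obtain ⟨Y, ⟨h1, h2, h3⟩, hc⟩ := ih
      obtain ⟨Z, hZ, hc'⟩ := h1.run_round hk hG h2 h3
      rw [Function.iterate_succ_apply']
      exact ⟨Z, hZ, by omega⟩
  obtain ⟨Y, ⟨hY, -, -⟩, hc⟩ := key n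
  obtain rfl : Y = ∅ := (Set.ncard_eq_zero (Set.toFinite Y)).1 (by omega)
  obtain ⟨S, hS, hval⟩ := hY.value
  exact ⟨S, hS, by simpa using hval ∅ .empty⟩

/-- The parameter is twice a number less than the size of the arrays. For `k` at most the number of
vertices, this says that `k` is even. -/
def Ex.even : Ex := .exi 2 (.eq (.add (.var 2) (.var 2)) .par)

/-- Computes a value of the recursion as output. -/
def fvsCmd : Cmd := .seq hitCmd (.set 0 (.rd 2 1 1))

/-- Computes a value of the recursion for odd `k`, and the empty set for even `k`. -/
def octCmd : Cmd := .seq hitCmd (.set 0 (.ite .even (.lit 0) (.rd 2 1 1)))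

/-- Computes a value of the recursion for even `k`, and the empty set for odd `k`. -/
def ectCmd : Cmd := .seq hitCmd (.set 0 (.ite .even (.rd 2 1 1) (.lit 0)))

/-- If `k` exceeds the number of vertices, there is no cycle. -/
lemma CycleHitRec.eq_empty_of_lt (hk : 5 ≤ k) (hG : IsSC k G) (hn : n < k) {S : Set (Fin n)}
    (h : CycleHitRec k G Set.univ S) : S = ∅ := by
  have hh : Hits G Set.univ ∅ := by
    refine hits_iff.2 fun B _ hB => ?_
    by_contra hne
    obtain ⟨-, f, hf, -⟩ := exists_cyc_of_minDegTwo hG hB (Set.nonempty_iff_ne_empty.2 hne)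
    have h1 := cyc_ncard hf
    have h2 := Set.ncard_le_card (cyc k f)
    simp at h2
    omega
  have := (h.isOpt (by omega)).2 _ hh
  exact (Set.ncard_eq_zero (Set.toFinite S)).1 (by simpa using this)

lemma Ex.holds_even {ρ : ℕ → ℕ} (h : k ≤ n) (hk : 0 < k) :
    Ex.even.Holds n k A ρ ↔ Even k := by
  simp only [Ex.even, Ex.holds_exi, Ex.holds_eq, Ex.eval, Function.update_self]
  constructor
  · rintro ⟨i, hi⟩
    exact ⟨i, hi.symm⟩
  · rintro ⟨m, hm⟩
    exact ⟨⟨m, by omega⟩, hm.symm⟩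

open Classical in
lemma exists_run_hitCmd (hk : 5 ≤ k) (hG : IsSC k G) :
    ∃ S, CycleHitRec k G Set.univ S ∧ {v : Fin n | fvsCmd.run n k (inputArrays G) 0 0 v ≠ 0} = S ∧
      {v : Fin n | octCmd.run n k (inputArrays G) 0 0 v ≠ 0} = (if Even k then ∅ else S) ∧
      {v : Fin n | ectCmd.run n k (inputArrays G) 0 0 v ≠ 0} = if Even k then S else ∅ := by
  obtain ⟨S, hS, hval⟩ := exists_isSet_hitCmd (A := inputArrays G) hk hG
    (fun a b => by simp [inputArrays]) (fun i hi a b => by simp [inputArrays, hi])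
  refine ⟨S, hval, ?_, ?_, ?_⟩
  · ext v
    rw [Set.mem_ofPred_eq, fvsCmd, Cmd.run_seq, Cmd.run_set]
    exact hS v
  all_goals
    ext v
    rw [Set.mem_ofPred_eq]
    simp only [octCmd, ectCmd, Cmd.run_seq, Cmd.run_set, Ex.eval_ite]
    have hv : (Ex.rd 2 1 1).eval n k (hitCmd.run n k (inputArrays G)) (env 0 v) ≠ 0 ↔ v ∈ S := hS v
    by_cases hkn : k ≤ n
    · simp only [Ex.holds_even hkn (by omega)]
      split_ifs
      all_goals first | exact hv | simp [Ex.eval]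
    · obtain rfl := hval.eq_empty_of_lt hk hG (by omega)
      simp only [ite_self, Set.mem_empty_iff_false, iff_false, not_not] at hv ⊢
      split_ifs
      all_goals first | exact hv | rfl

end Algorithm

theorem mainTheorem2 :
    (∀ (V : Type*) [Finite V] (k : ℕ) (G : SimpleGraph V), 5 ≤ k → G.Connected → IsSC k G →
      ((∃ S : Set V, OCTValue k G S) ∧
        ∀ S : Set V, OCTValue k G S → IsMinCard (IsOCT G) S) ∧
      ((∃ S : Set V, ECTValue k G S) ∧
        ∀ S : Set V, ECTValue k G S → IsMinCard (IsECT G) S) ∧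
      (Odd k → ∀ S : Set V, IsFVS G S ↔ IsOCT G S) ∧
      (Even k → ∀ S : Set V, IsFVS G S ↔ IsECT G S)) ∧
    PolyTimeOnSC (fun k _ G S => OCTValue k G S) ∧
    PolyTimeOnSC (fun k _ G S => ECTValue k G S) ∧
    PolyTimeOnSC (fun _ _ G S => IsMinCard (IsFVS G) S) := by
  refine ⟨fun V _ k G hk _ hG => transversals_correct hk hG,
    polyTimeOnSC_of_cmd octCmd fun k n G hk _ hG => ?_,
    polyTimeOnSC_of_cmd ectCmd fun k n G hk _ hG => ?_,
    polyTimeOnSC_of_cmd fvsCmd fun k n G hk _ hG => ?_⟩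
  all_goals obtain ⟨S, hS, hf, ho, he⟩ := exists_run_hitCmd hk hG
  · rw [ho]
    rcases Nat.even_or_odd k with hk' | hk'
    · exact .inr ⟨hk', if_pos hk'⟩
    · rw [if_neg (Nat.not_even_iff_odd.2 hk')]
      exact .inl ⟨hk', hS⟩
  · rw [he]
    rcases Nat.even_or_odd k with hk' | hk'
    · rw [if_pos hk']
      exact .inl ⟨hk', hS⟩
    · exact .inr ⟨hk', if_neg (Nat.not_even_iff_odd.2 hk')⟩
  · rw [hf]
    exact hS.isMinCard (by omega)
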